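/- Let $X$ be a non-empty finite set. A homogeneous relation $H$ on $X$ assigns to every $x\in X$ an equivalence relation $H_x$ on $X\setminus\{x\}$; write $H(x|yz)$ for $H_x(y,z)$. A set $U\subseteq X$ is a umodule of $H$ if $H(u|xx')\iff H(u'|xx')$ for all $u,u'\in U$ and $x,x'\in X\setminus U$. The relation $H$ is self-complemented if the complement of every umodule is a umodule, and its local congruence is the maximum over $x\in X$ of the number of classes of $H_x$. If $H$ is self-complemented, let $\mathcal B$ be the family of all bipartitions $\{U,X\setminus U\}$ of $X$ into two non-empty umodules. Two bipartitions $\{A,A'\}$, $\{B,B'\}$ overlap if $A\cap B$, $A\cap B'$, $A'\cap B$, $A'\cap B'$ are all non-empty; a member of $\mathcal B$ is strong if it overlaps no member of $\mathcal B$. The umodular decomposition tree of $H$ is the unrooted tree $T$ whose nodes of degree at most one are labelled bijectively by $X$ and whose edges $e$ correspond bijectively to the strong members of $\mathcal B$, the two parts being the label sets of the two components of $T-e$. Moreover its nodes are typed prime, complete or circular, with a circular ordering of the neighbours of the circular nodes, in such a way that $\mathcal B$ consists exactly of the bipartitions $\{\bigcup_{i\in I}X_i,\ X\setminus\bigcup_{i\in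 I}X_i\}$, where $N$ is a node, $X_1,\dots,X_k$ are the label sets of the components of $T-N$ (in the circular order if $N$ is circular), and $I\subseteq\{1,\dots,k\}$ is a singleton, or any non-empty proper subset if $N$ is complete, or any non-empty proper circular interval if $N$ is circular. (At a node of degree at most $3$ several types may satisfy this condition; any of them is accepted.) The model of computation is a word RAM with additions, truncated subtractions, multiplications, comparisons, conditional jumps and indirect addressing at unit cost, and with words of $O(\log |X|)$ bits (at least constant size). **(1)** There is an algorithm that computes, in $O(|X|^2)$ time, the umodular decomposition tree (with node types and circular orderings) of any self-complemented homogeneous relation $H$ on $X$ of local congruence at most $2$. Here $X=\{0,\dots,n-1\}$ with $n\ge 1$, and $H$ is given by an $n\times n$ table whose row $x$ names, for every $y\ne x$, the class of $y$ in $H_x$ by an integer in $\{0,\dots,n\}$; the tree is output by the adjacency lists of its nodes, in circular order, and the node types. **(2)** There is an algorithm that computes, in $O(|X|^2)$ time, the bijoin decomposition tree of any tournament on $X$ given by its arc matrix, that is, the umodular decomposition tree of its standard homogeneous relation, where $H(x|uv)$ holds if and only if the pairs $(x,u)$ and $(x,v)$ have the same arc status and the pairs $(u,x)$ and $(v,x)$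 have the same arc status. -/

import Mathlib

/-! ### Homogeneous relations and umodules -/

/-- A homogeneous relation on `X`: an equivalence relation `H x` on `X \ {x}` for every `x`. -/
def HomogeneousRelation (X : Type*) : Type _ := ∀ x : X, Setoid {y : X // y ≠ x}

namespace HomogeneousRelation

variable {X : Type*}

/-- `H(x|yz)`, a relation over the reflectless triples (`x ≠ y` and `x ≠ z`). -/
def Holds (H : HomogeneousRelation X) (x y z : X) : Prop :=
  ∃ (hy : y ≠ x) (hz : z ≠ x), (H x).r ⟨y, hy⟩ ⟨z, hz⟩

/-- `U` is a umodule of `H`. -/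
def IsUmodule (H : HomogeneousRelation X) (U : Set X) : Prop :=
  ∀ u ∈ U, ∀ u' ∈ U, ∀ x ∉ U, ∀ x' ∉ U, (H.Holds u x x' ↔ H.Holds u' x x')

/-- The family of all umodules of `H`. -/
def umodules (H : HomogeneousRelation X) : Set (Set X) := {U | H.IsUmodule U}

/-- The number of equivalence classes of `H x`. -/
noncomputable def congruence (H : HomogeneousRelation X) (x : X) : ℕ := Nat.card (Quotient (H x))

/-- The maximum of the congruences of the elements of `X`. -/
noncomputable def localCongruence [Fintype X] (H : HomogeneousRelation X) : ℕ :=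
  Finset.univ.sup H.congruence

/-- The umodule family of `H` is closed under complementation. -/
def SelfComplemented (H : HomogeneousRelation X) : Prop := ∀ A ∈ H.umodules, Aᶜ ∈ H.umodules

/-- The standard homogeneous relation of the 2-structure with ground set `X` and colouring `C`. -/
def standard (C : X → X → ℕ) : HomogeneousRelation X := fun x =>
  { r := fun u v => C x u = C x v ∧ C u x = C v x
    iseqv :=
      { refl := fun _ => ⟨rfl, rfl⟩
        symm := fun h => ⟨h.1.symm, h.2.symm⟩
        trans := fun h k => ⟨h.1.trans k.1, h.2.trans k.2⟩ } }

/-- The table `C` presents `H`: row `x` of `C` gives every `y ≠ x` the name of its class in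
`H x`. The diagonal entries are irrelevant. -/
def PresentedBy (H : HomogeneousRelation X) (C : X → X → ℕ) : Prop :=
  ∀ x y z : X, y ≠ x → z ≠ x → (H.Holds x y z ↔ C x y = C x z)

end HomogeneousRelation

/-- `A` is the arc matrix of a tournament: no loops, and exactly one arc between any two distinct
vertices. -/
def IsTournament {X : Type*} (A : X → X → Bool) : Prop :=
  (∀ x, A x x = false) ∧ ∀ x y, x ≠ y → A x y = !(A y x)

/-- The 2-structure colouring of a digraph: colour `1` for arcs, colour `0` for non-arcs. -/
def arcColour {X : Type*} (A : X → X → Bool) (x y : X) : ℕ := (A x y).toNat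

/-- The bijoins of a tournament (or graph) are the umodules of its standard relation. -/
def bijoins {X : Type*} (A : X → X → Bool) : Set (Set X) :=
  (HomogeneousRelation.standard (arcColour A)).umodules

/-! ### Families of bipartitions and their decomposition trees

A self-complemented family `F` of subsets is seen as the family of the bipartitions `{A, Aᶜ}` with
`A ∈ F` and both parts non-empty. -/

section Trees

variable {X V : Type*}

/-- `{A, Aᶜ}` is a bipartition of the family `F`. -/
def IsPart (F : Set (Set X)) (A : Set X) : Prop := A ∈ F ∧ A.Nonempty ∧ Aᶜ.Nonempty

/-- The bipartitions `{A, Aᶜ}` and `{B, Bᶜ}` overlap. -/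
def BipOverlap (A B : Set X) : Prop :=
  (A ∩ B).Nonempty ∧ (A ∩ Bᶜ).Nonempty ∧ (Aᶜ ∩ B).Nonempty ∧ (Aᶜ ∩ Bᶜ).Nonempty

/-- `{A, Aᶜ}` is a strong bipartition of the family `F`. -/
def IsStrongPart (F : Set (Set X)) (A : Set X) : Prop :=
  IsPart F A ∧ ∀ B, IsPart F B → ¬ BipOverlap A B

/-- The three types of nodes. -/
inductive NodeKind
  | prime
  | complete
  | circular

/-- The leaf labels in the component of `w` of the tree `G` minus its edge `vw`; as `G` is a tree,
these are also the leaf labels in the component of `w` of `G` minus the node `v`. -/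
def branch (G : SimpleGraph V) (leaf : X → V) (v w : V) : Set X :=
  {x | (G.deleteEdges {s(v, w)}).Reachable w (leaf x)}

/-- The sets `I` of neighbours of a node for which the union of the branches towards `I` is a part
of a bipartition described by that node; `l` lists the neighbours in their circular order.
A single neighbour is allowed at every node, every non-empty proper subset at a complete node, and
every non-empty proper interval of the circular order at a circular node. -/
def Admissible (k : NodeKind) (l : List V) (I : Set V) : Prop :=
  (∃ w ∈ l, I = {w}) ∨
  (k = NodeKind.complete ∧ I.Nonempty ∧ I ⊂ {w | w ∈ l}) ∨
  (k = NodeKind.circular ∧ I.Nonempty ∧ I ⊂ {w | w ∈ l} ∧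
    ∃ (r : ℕ) (l' : List V), l' <+: l.rotate r ∧ I = {w | w ∈ l'})

/-- The graph `G` with leaf labelling `leaf`, node types `kind` and (circularly) ordered
neighbour lists `order` is the labelled decomposition tree of the self-complemented family `F`. -/
structure IsDecompositionTree (F : Set (Set X)) (G : SimpleGraph V) (leaf : X → V)
    (kind : V → NodeKind) (order : V → List V) : Prop where
  isTree : G.IsTree
  leaf_injective : Function.Injective leaf
  /-- The labelled nodes are exactly the nodes of degree at most one (degree zero occurs only in
  the one-node tree). -/
  leaf_range : ∀ v, v ∈ Set.range leaf ↔ (G.neighborSet v).Subsingleton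
  /-- The edges correspond one to one to the strong bipartitions. -/
  strong : ∀ A : Set X, IsStrongPart F A ↔ ∃ v w, G.Adj v w ∧ branch G leaf v w = A
  strong_injective : ∀ v w v' w', G.Adj v w → G.Adj v' w' →
    branch G leaf v w = branch G leaf v' w' → v = v' ∧ w = w'
  order_nodup : ∀ v, (order v).Nodup
  mem_order : ∀ v w, w ∈ order v ↔ G.Adj v w
  /-- The bipartitions of the family are exactly those described by the nodes. -/
  parts : ∀ A : Set X, IsPart F A ↔
    ∃ (v : V) (I : Set V), Admissible (kind v) (order v) I ∧ A = ⋃ w ∈ I, branch G leaf v w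

end Trees

/-! ### Word RAM programs with a step count

A program has finitely many integer variables and finitely many arrays, named by numerals in its
text. Every operation costs one step. A value can be stored only if it fits in a machine word, that
is, if it is at most the bound `W`; the run is stuck otherwise. -/

namespace WordRAM

/-- Binary operations: natural-number arithmetic and comparisons with value `0` or `1`. -/
inductive BinOp
  | add
  | sub
  | mul
  | eq
  | lt

/-- The value of an operation; subtraction is truncated at `0`. -/
def BinOp.eval : BinOp → ℕ → ℕ → ℕ
  | .add, a, b => a + b
  | .sub, a, b => a - b
  | .mul, a, b => a * b
  | .eq, a, b => if a = b then 1 else 0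
  | .lt, a, b => if a < b then 1 else 0

/-- Expressions: constants, variables, array reads and operations. -/
inductive Expr
  | lit (k : ℕ)
  | var (v : ℕ)
  | get (a : ℕ) (i : Expr)
  | bin (o : BinOp) (e f : Expr)

/-- Commands. -/
inductive Cmd
  | skip
  | assign (v : ℕ) (e : Expr)
  | put (a : ℕ) (i e : Expr)
  | seq (p q : Cmd)
  | ite (e : Expr) (p q : Cmd)
  | loop (e : Expr) (p : Cmd)

/-- The memory: the values of the variables and of the array cells. -/
@[ext]
structure State where
  var : ℕ → ℕ
  arr : ℕ → ℕ → ℕ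

/-- The value of an expression. -/
def Expr.eval (σ : State) : Expr → ℕ
  | .lit k => k
  | .var v => σ.var v
  | .get a i => σ.arr a (i.eval σ)
  | .bin o e f => o.eval (e.eval σ) (f.eval σ)

/-- The number of steps taken by the evaluation of an expression. -/
def Expr.cost : Expr → ℕ
  | .lit _ => 1
  | .var _ => 1
  | .get _ i => i.cost + 1
  | .bin _ e f => e.cost + f.cost + 1

/-- Overwrite a variable. -/
def State.setVar (σ : State) (v a : ℕ) : State :=
  { σ with var := Function.update σ.var v a }

/-- Overwrite an array cell. -/
def State.setArr (σ : State) (a i b : ℕ) : State :=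
  { σ with arr := Function.update σ.arr a (Function.update (σ.arr a) i b) }

/-- `Exec W p σ t τ`: with words bounded by `W`, the program `p` started in memory `σ` halts after
exactly `t` steps in memory `τ`. A test succeeds if its value is not `0`. -/
inductive Exec (W : ℕ) : Cmd → State → ℕ → State → Prop
  | skip (σ : State) : Exec W .skip σ 1 σ
  | assign (σ : State) (v : ℕ) (e : Expr) (hW : e.eval σ ≤ W) :
      Exec W (.assign v e) σ (e.cost + 1) (σ.setVar v (e.eval σ))
  | put (σ : State) (a : ℕ) (i e : Expr) (hW : e.eval σ ≤ W) :
      Exec W (.put a i e) σ (i.cost + e.cost + 1) (σ.setArr a (i.eval σ) (e.eval σ))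
  | seq {p q : Cmd} {σ ρ τ : State} {s t : ℕ} (hp : Exec W p σ s ρ) (hq : Exec W q ρ t τ) :
      Exec W (.seq p q) σ (s + t) τ
  | ite_true {e : Expr} {p q : Cmd} {σ τ : State} {t : ℕ} (he : e.eval σ ≠ 0)
      (hp : Exec W p σ t τ) : Exec W (.ite e p q) σ (e.cost + 1 + t) τ
  | ite_false {e : Expr} {p q : Cmd} {σ τ : State} {t : ℕ} (he : e.eval σ = 0)
      (hq : Exec W q σ t τ) : Exec W (.ite e p q) σ (e.cost + 1 + t) τ
  | loop_stop {e : Expr} {p : Cmd} {σ : State} (he : e.eval σ = 0) :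
      Exec W (.loop e p) σ (e.cost + 1) σ
  | loop_step {e : Expr} {p : Cmd} {σ ρ τ : State} {s t : ℕ} (he : e.eval σ ≠ 0)
      (hp : Exec W p σ s ρ) (hl : Exec W (.loop e p) ρ t τ) :
      Exec W (.loop e p) σ (e.cost + 1 + s + t) τ

/-- The input: variable `0` holds `n`, array `0` holds the `n × n` table `C` row by row, and
everything else is `0`. -/
def inputState (n : ℕ) (C : Fin n → Fin n → ℕ) : State where
  var := fun v => if v = 0 then n else 0
  arr := fun a i =>
    if h : a = 0 ∧ i < n * n then
      C ⟨i / n, Nat.div_lt_of_lt_mul h.2⟩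
        ⟨i % n, Nat.mod_lt i (Nat.pos_of_ne_zero fun h0 => by simp [h0] at h)⟩
    else 0

/-- Numerical code of a node type. -/
def kindCode : NodeKind → ℕ
  | .prime => 0
  | .complete => 1
  | .circular => 2

/-- The memory `σ` holds the labelled decomposition tree of the family `F` of subsets of `Fin n`.
The nodes are `0, …, m - 1`, where `m` is in variable `1`, and node `x < n` is the leaf labelled
`x`. The neighbour lists are stored one after the other in array `2`; array `1` holds the position
at which the list of each node starts, and array `3` holds the node types. -/
def OutputsTree {n : ℕ} (F : Set (Set (Fin n))) (σ : State) : Prop :=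
  ∃ (m : ℕ) (hnm : n ≤ m) (G : SimpleGraph (Fin m)) (kind : Fin m → NodeKind)
    (order : Fin m → List (Fin m)),
    IsDecompositionTree F G (Fin.castLE hnm) kind order ∧
    σ.var 1 = m ∧
    σ.arr 1 0 = 0 ∧
    (∀ v : Fin m, σ.arr 1 (v.val + 1) = σ.arr 1 v.val + (order v).length) ∧
    (∀ (v : Fin m) (i : Fin (order v).length),
      σ.arr 2 (σ.arr 1 v.val + i.val) = ((order v).get i).val) ∧
    (∀ v : Fin m, σ.arr 3 v.val = kindCode (kind v))

/-- On the table `C`, with words of at most `c * log₂ (n + 2)` bits, the program `P` outputs the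
decomposition tree of `F` after at most `c * n ^ 2` steps. -/
def ComputesTree (P : Cmd) (c : ℕ) {n : ℕ} (C : Fin n → Fin n → ℕ) (F : Set (Set (Fin n))) :
    Prop :=
  ∃ (t : ℕ) (σ : State), Exec ((n + 2) ^ c) P (inputState n C) t σ ∧ t ≤ c * n ^ 2 ∧
    OutputsTree F σ

end WordRAM

/-! Reduction to modules. Let `m = n - 1` be the last element and read every bipartition off its
part that avoids `m`. As `H u` has at most two classes, it is determined by which `x` lie in the
class of `m`. So a set `U` avoiding `m` is a umodule iff each `x` outside `U` lies in the class of
`m` for all `u` in `U` or for none. Give the pair `(u, x)` the colour `e u x`, which is 0 or 1 and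
compares "x lies in the class of m at u" with "x lies in the class of 0 at m". The second condition
does not involve `u`, so the criterion still says that outsiders see constant incoming colours on
`U` (`InHom`). If the complement is a umodule too, then `x` and `m` split `U` in the same way, and
the twist makes the outgoing colours constant as well. Hence the umodules avoiding `m` are exactly
the modules of the coloured digraph `e` on `[0, m)` (`isModuleOf_of_inHom`, `leafSet_mem_umodules`),
strong bipartitions are strong modules (`isStrongPart_leafSet`), and the wanted tree is the modular
decomposition tree hung from the leaf `m`.

Modular decomposition. Strong modules form a laminar family, and every other nonempty module is a
union of children of a strong module that is a disjoint union of two modules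
(`exists_strong_of_not_hasSplit`). In such a node all pairs from different children carry the same
two colours up to order (`degenerate_of_hasSplit`). If the two colours agree, every union of
children is a module; if not, the children are linearly ordered and the modules are the convex
unions. Adding the parent as one more neighbour, and passing to complements when it is selected,
turns these two kinds into complete and circular nodes (`exists_of_prefix_rotate`).

A good order. The algorithm computes a permutation in which all strong modules are intervals and
linear nodes are sorted (`GoodOrder`). Partition refinement repeatedly picks a pivot in a class that
is homogeneous towards the outside and splits the rest of that class until every part is homogeneous
again; no split cuts a module that avoids the pivot. A boundary `j` makes the two sides `[lo j, j)`
and `[j, hi j)` refine each other, at a cost proportional to the area of their product. These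
rectangles are disjoint, so the total is quadratic (`sum_rect_le`). The result is a hierarchy of
classes below pivots. Two siblings `v`, `w` below one pivot are joined by an arc if `v`
distinguishes `w` from the pivot (`seqArc`): a module with the pivot and `w` must then contain `v`.
Elements are ordered by strongly connected components, successors first, and each is inserted
immediately next to its pivot, on the side given by its colour. Outsiders of a strong module around
a pivot are thus inserted before its members (`ClassTree.tm_lt_of_strong`) and end up farther away.
This gives `ClassTree.pos_strong` and `ClassTree.pos_linear`.

The tree. In a good order an interval is a strong module iff it is a module and no interval that is
a module overlaps it (`GoodOrder.strongInterval_iff`). Both properties are tabulated for all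
intervals by running minima and maxima. The laminar family of strong intervals is turned into a tree
from short intervals to long ones. It has at most `2 * m + 1` nodes (`TreeInv.card_le`), so linear
time per node suffices. The first two children decide the type of a node (`TreeInv.hasSplit_iff`),
and `TreeInv.isDecompositionTree_parentGraph` verifies the output.

Tournaments. Incoming and outgoing arcs determine each other, so the standard relation has at most
two classes at each vertex, is presented by the arc matrix and is self-complemented; the same
program applies. -/

namespace WordRAM

/-! ### Hoare-style reasoning about word RAM programs -/

/-- The program `P` halts from memory `σ`, and its running time and final memory satisfy `Q`. -/
def Runs (W : ℕ) (P : Cmd) (σ : State) (Q : ℕ → State → Prop) : Prop :=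
  ∃ t τ, Exec W P σ t τ ∧ Q t τ

@[simp] theorem State.setVar_var (σ : State) (v a w : ℕ) :
    (σ.setVar v a).var w = if w = v then a else σ.var w := by
  simp [State.setVar, Function.update_apply]

@[simp] theorem State.setVar_arr (σ : State) (v a : ℕ) : (σ.setVar v a).arr = σ.arr := rfl

@[simp] theorem State.setArr_var (σ : State) (a i b : ℕ) : (σ.setArr a i b).var = σ.var := rfl

@[simp] theorem State.setArr_arr (σ : State) (a i b c : ℕ) :
    (σ.setArr a i b).arr c = if c = a then Function.update (σ.arr a) i b else σ.arr c := by
  simp only [State.setArr, Function.update_apply]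

theorem Runs.mono {W : ℕ} {P : Cmd} {σ : State} {Q Q' : ℕ → State → Prop} (h : Runs W P σ Q)
    (hQ : ∀ t τ, Q t τ → Q' t τ) : Runs W P σ Q' := by
  obtain ⟨t, τ, h1, h2⟩ := h
  exact ⟨t, τ, h1, hQ t τ h2⟩

theorem runs_skip {W : ℕ} {σ : State} {Q : ℕ → State → Prop} : Runs W .skip σ Q ↔ Q 1 σ :=
  ⟨fun ⟨_, _, h, hQ⟩ => by cases h; exact hQ, fun h => ⟨_, _, .skip σ, h⟩⟩

theorem runs_assign {W v : ℕ} {e : Expr} {σ : State} {Q : ℕ → State → Prop} :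
    Runs W (.assign v e) σ Q ↔ e.eval σ ≤ W ∧ Q (e.cost + 1) (σ.setVar v (e.eval σ)) :=
  ⟨fun ⟨_, _, h, hQ⟩ => by cases h; exact ⟨by assumption, hQ⟩,
    fun h => ⟨_, _, .assign σ v e h.1, h.2⟩⟩

theorem runs_put {W a : ℕ} {i e : Expr} {σ : State} {Q : ℕ → State → Prop} :
    Runs W (.put a i e) σ Q ↔
      e.eval σ ≤ W ∧ Q (i.cost + e.cost + 1) (σ.setArr a (i.eval σ) (e.eval σ)) :=
  ⟨fun ⟨_, _, h, hQ⟩ => by cases h; exact ⟨by assumption, hQ⟩,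
    fun h => ⟨_, _, .put σ a i e h.1, h.2⟩⟩

theorem runs_seq {W : ℕ} {p q : Cmd} {σ : State} {Q : ℕ → State → Prop} :
    Runs W (.seq p q) σ Q ↔ Runs W p σ fun s ρ => Runs W q ρ fun t τ => Q (s + t) τ :=
  ⟨fun ⟨_, _, h, hQ⟩ => by cases h with | seq hp hq => exact ⟨_, _, hp, _, _, hq, hQ⟩,
    fun ⟨_, _, hp, _, _, hq, hQ⟩ => ⟨_, _, .seq hp hq, hQ⟩⟩

theorem runs_ite {W : ℕ} {e : Expr} {p q : Cmd} {σ : State} {Q : ℕ → State → Prop} :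
    Runs W (.ite e p q) σ Q ↔
      (e.eval σ ≠ 0 → Runs W p σ fun t τ => Q (e.cost + 1 + t) τ) ∧
      (e.eval σ = 0 → Runs W q σ fun t τ => Q (e.cost + 1 + t) τ) := by
  constructor
  · rintro ⟨_, _, h, hQ⟩
    cases h with
    | ite_true he hp => exact ⟨fun _ => ⟨_, _, hp, hQ⟩, fun h => absurd h he⟩
    | ite_false he hp => exact ⟨fun h => absurd he h, fun _ => ⟨_, _, hp, hQ⟩⟩
  · rintro ⟨h1, h2⟩
    by_cases he : e.eval σ = 0
    · obtain ⟨t, τ, h, hQ⟩ := h2 he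
      exact ⟨_, _, .ite_false he h, hQ⟩
    · obtain ⟨t, τ, h, hQ⟩ := h1 he
      exact ⟨_, _, .ite_true he h, hQ⟩

/-- The variables a program may write. -/
def Cmd.writesVar : Cmd → ℕ → Bool
  | .skip, _ => false
  | .assign v _, x => v == x
  | .put _ _ _, _ => false
  | .seq p q, x => p.writesVar x || q.writesVar x
  | .ite _ p q, x => p.writesVar x || q.writesVar x
  | .loop _ p, x => p.writesVar x

/-- The arrays a program may write. -/
def Cmd.writesArr : Cmd → ℕ → Bool
  | .skip, _ => false
  | .assign _ _, _ => false
  | .put a _ _, x => a == x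
  | .seq p q, x => p.writesArr x || q.writesArr x
  | .ite _ p q, x => p.writesArr x || q.writesArr x
  | .loop _ p, x => p.writesArr x

/-- Two memories agree on everything that `P` does not write. -/
structure Frame (P : Cmd) (σ τ : State) : Prop where
  var : ∀ v, P.writesVar v = false → τ.var v = σ.var v
  arr : ∀ a, P.writesArr a = false → τ.arr a = σ.arr a

theorem Frame.refl (P : Cmd) (σ : State) : Frame P σ σ := ⟨fun _ _ => rfl, fun _ _ => rfl⟩

theorem Frame.trans {P : Cmd} {σ τ ρ : State} (h : Frame P σ τ) (k : Frame P τ ρ) : Frame P σ ρ :=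
  ⟨fun v hv => (k.var v hv).trans (h.var v hv), fun a ha => (k.arr a ha).trans (h.arr a ha)⟩

/-- What a run leaves unchanged can be read off the program text. Later side conditions such as
`hF.var 2 rfl` are therefore settled by computation. -/
theorem Exec.frame {W : ℕ} {P : Cmd} {σ τ : State} {t : ℕ} (h : Exec W P σ t τ) :
    Frame P σ τ := by
  induction h with
  | skip σ => exact Frame.refl _ _
  | assign σ v e hW =>
    refine ⟨fun x hx => ?_, fun _ _ => rfl⟩
    have : x ≠ v := fun h => by simp [Cmd.writesVar, h] at hx
    simp [State.setVar, this]
  | put σ a i e hW =>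
    refine ⟨fun _ _ => rfl, fun x hx => ?_⟩
    have : x ≠ a := fun h => by simp [Cmd.writesArr, h] at hx
    simp [State.setArr, this]
  | seq _ _ ih1 ih2 =>
    refine ⟨fun v hv => ?_, fun v hv => ?_⟩
    · simp only [Cmd.writesVar, Bool.or_eq_false_iff] at hv
      rw [ih2.var v hv.2, ih1.var v hv.1]
    · simp only [Cmd.writesArr, Bool.or_eq_false_iff] at hv
      rw [ih2.arr v hv.2, ih1.arr v hv.1]
  | ite_true _ _ ih =>
    refine ⟨fun v hv => ?_, fun v hv => ?_⟩
    · simp only [Cmd.writesVar, Bool.or_eq_false_iff] at hv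
      exact ih.var v hv.1
    · simp only [Cmd.writesArr, Bool.or_eq_false_iff] at hv
      exact ih.arr v hv.1
  | ite_false _ _ ih =>
    refine ⟨fun v hv => ?_, fun v hv => ?_⟩
    · simp only [Cmd.writesVar, Bool.or_eq_false_iff] at hv
      exact ih.var v hv.2
    · simp only [Cmd.writesArr, Bool.or_eq_false_iff] at hv
      exact ih.arr v hv.2
  | loop_stop _ => exact Frame.refl _ _
  | loop_step _ _ _ ih1 ih2 =>
    refine ⟨fun v hv => ?_, fun v hv => ?_⟩
    · rw [ih2.var v hv, ih1.var v hv]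
    · rw [ih2.arr v hv, ih1.arr v hv]

theorem Runs.frame {W : ℕ} {P : Cmd} {σ : State} {Q : ℕ → State → Prop} (h : Runs W P σ Q) :
    Runs W P σ fun t τ => Q t τ ∧ Frame P σ τ := by
  obtain ⟨t, τ, h1, h2⟩ := h
  exact ⟨t, τ, h1, h2, h1.frame⟩

/-- A loop whose invariant bounds the elapsed time and in which a measure decreases. -/
theorem runs_loop {W : ℕ} {e : Expr} {p : Cmd} (Inv : ℕ → ℕ → State → Prop)
    (hstep : ∀ k T τ, Inv k T τ → e.eval τ ≠ 0 →
      Runs W p τ fun t ρ => ∃ k' < k, Inv k' (T + (t + (e.cost + 1))) ρ)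
    {Q : ℕ → State → Prop}
    (hend : ∀ k T τ, Inv k T τ → e.eval τ = 0 → Q (T + (e.cost + 1)) τ) (k : ℕ) :
    ∀ T σ, Inv k T σ → Runs W (.loop e p) σ fun t τ => Q (T + t) τ := by
  induction k using Nat.strong_induction_on with
  | _ k ih =>
    intro T σ h
    by_cases he : e.eval σ = 0
    · exact ⟨_, _, Exec.loop_stop he, hend k T σ h he⟩
    · obtain ⟨t, ρ, h1, k', hk, h2⟩ := hstep k T σ h he
      obtain ⟨t', τ, h3, h4⟩ := ih k' hk _ ρ h2
      refine ⟨_, _, .loop_step he h1 h3, ?_⟩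
      convert h4 using 1
      ring

/-- A loop with at most `k` iterations, each of which takes at most `c` steps. -/
theorem runs_loop_const {W : ℕ} {e : Expr} {p : Cmd} {σ : State} (c : ℕ) (Inv : ℕ → State → Prop)
    (k : ℕ) (h0 : Inv k σ)
    (hstep : ∀ k τ, Inv k τ → e.eval τ ≠ 0 → Frame p σ τ →
      Runs W p τ fun t ρ => t ≤ c ∧ ∃ k' < k, Inv k' ρ) {Q : ℕ → State → Prop}
    (hend : ∀ t k' τ, t ≤ k * (c + e.cost + 1) + e.cost + 1 → Inv k' τ → e.eval τ = 0 →
      Frame p σ τ → Q t τ) :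
    Runs W (.loop e p) σ Q := by
  have := runs_loop (W := W) (e := e) (p := p) (Q := Q)
    (fun k' T τ => k' ≤ k ∧ T + k' * (c + e.cost + 1) ≤ k * (c + e.cost + 1) ∧ Inv k' τ ∧
      Frame p σ τ)
    (by
      rintro k' T τ ⟨hk', h1, h2, h3⟩ he
      refine (hstep k' τ h2 he h3).frame.mono ?_
      rintro t ρ ⟨⟨ht, k'', hk, hI⟩, hf⟩
      refine ⟨k'', hk, by omega, ?_, hI, h3.trans hf⟩
      have : (k'' + 1) * (c + e.cost + 1) ≤ k' * (c + e.cost + 1) := Nat.mul_le_mul_right _ hk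
      rw [add_mul] at this
      omega)
    (by
      rintro k' T τ ⟨_, h1, h2, h3⟩ he
      exact hend _ k' τ (by omega) h2 he h3) k 0 σ ⟨le_rfl, by omega, h0, Frame.refl _ _⟩
  simpa using this

/-- `for i = lo, …, hi - 1`. -/
def forTo (i : ℕ) (lo hi : Expr) (p : Cmd) : Cmd :=
  .seq (.assign i lo) (.loop (.bin .lt (.var i) hi)
    (.seq p (.assign i (.bin .add (.var i) (.lit 1)))))

theorem writesVar_forTo {i : ℕ} {lo hi : Expr} {p : Cmd} {v : ℕ} :
    (forTo i lo hi p).writesVar v = (i == v || (p.writesVar v || i == v)) := rfl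

theorem writesArr_forTo {i : ℕ} {lo hi : Expr} {p : Cmd} {v : ℕ} :
    (forTo i lo hi p).writesArr v = p.writesArr v := by
  simp [forTo, Cmd.writesArr]

/-- A counting loop; the invariant bounds the elapsed time. -/
theorem runs_forTo_time {W i : ℕ} {lo hi : Expr} {p : Cmd} {σ : State} (L N : ℕ)
    (Inv : ℕ → ℕ → State → Prop) (hL : lo.eval σ = L) (hLN : L ≤ N) (hNW : N ≤ W)
    (hi' : p.writesVar i = false)
    (hN : ∀ τ, Frame (forTo i lo hi p) σ τ → hi.eval τ = N)
    (h0 : Inv L 0 (σ.setVar i L))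
    (hstep : ∀ k T τ, L ≤ k → k < N → τ.var i = k → Frame (forTo i lo hi p) σ τ → Inv k T τ →
      Runs W p τ fun t ρ => Inv (k + 1) (T + t) (ρ.setVar i (k + 1)))
    {Q : ℕ → State → Prop}
    (hQ : ∀ t T τ, t ≤ T + (N - L) * (hi.cost + 7) + lo.cost + hi.cost + 4 →
      Frame (forTo i lo hi p) σ τ → τ.var i = N → Inv N T τ → Q t τ) :
    Runs W (forTo i lo hi p) σ Q := by
  rw [forTo, runs_seq, runs_assign]
  refine ⟨by omega, ?_⟩
  have hfr : ∀ ρ τ, Frame p ρ τ → Frame (forTo i lo hi p) ρ τ := fun ρ τ h =>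
    ⟨fun v hv => h.var v (by rw [writesVar_forTo] at hv; simp at hv; simp [hv]),
      fun a ha => h.arr a (by rwa [writesArr_forTo] at ha)⟩
  have hfi : ∀ ρ x, Frame (forTo i lo hi p) ρ (ρ.setVar i x) := fun ρ x =>
    ⟨fun v hv => by
      rw [writesVar_forTo] at hv
      have : v ≠ i := by rintro rfl; simp at hv
      simp [State.setVar, this], fun a ha => rfl⟩
  have := runs_loop (W := W) (e := .bin .lt (.var i) hi)
    (p := .seq p (.assign i (.bin .add (.var i) (.lit 1))))
    (Q := fun t τ => Q (lo.cost + 1 + t) τ)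
    (fun k' T τ => ∃ k T', L ≤ k ∧ k + k' = N ∧ τ.var i = k ∧ Inv k T' τ ∧
      T ≤ T' + (k - L) * (hi.cost + 7) ∧ Frame (forTo i lo hi p) σ τ)
    (by
      rintro k' T τ ⟨k, T', hk, hkN, hki, hI, hT, hF⟩ he
      have hlt : k < N := by
        simp only [Expr.eval, BinOp.eval, hN τ hF, hki] at he
        by_contra h
        simp [h] at he
      rw [runs_seq]
      refine (hstep k T' τ hk hlt hki hF hI).frame.mono ?_
      rintro t ρ ⟨h1, h2⟩
      have hρ : ρ.var i = k := by rw [h2.var i hi', hki]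
      rw [runs_assign]
      simp only [Expr.eval, BinOp.eval, Expr.cost, hρ]
      -- The measure is the number of iterations left. An iteration costs `hi.cost + 3` for the test
      -- and 4 for the increment besides the body, which explains the constant 7.
      refine ⟨by omega, N - (k + 1), by omega, k + 1, T' + t, by omega, by omega, ?_, h1, ?_, ?_⟩
      · simp [State.setVar]
      · rw [Nat.sub_add_comm hk, add_mul]
        omega
      · exact hF.trans ((hfr _ _ h2).trans (hfi _ _)))
    (by
      rintro k' T τ ⟨k, T', hk, hkN, hki, hI, hT, hF⟩ he
      have hlt : k = N := by
        simp only [Expr.eval, BinOp.eval, hN τ hF, hki] at he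
        by_contra h
        have : k < N := by omega
        simp [this] at he
      subst hlt
      refine hQ _ T' _ ?_ hF hki hI
      simp only [Expr.cost]
      omega) (N - L) 0 (σ.setVar i (lo.eval σ))
    ⟨L, 0, le_rfl, by omega, by simp [State.setVar, hL], by rw [hL]; exact h0, by simp, hfi _ _⟩
  simpa using this

/-- A counting loop whose body takes at most `c` steps. -/
theorem runs_forTo {W i : ℕ} {lo hi : Expr} {p : Cmd} {σ : State} (L N c : ℕ)
    (Inv : ℕ → State → Prop) (hL : lo.eval σ = L) (hLN : L ≤ N) (hNW : N ≤ W)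
    (hi' : p.writesVar i = false)
    (hN : ∀ τ, Frame (forTo i lo hi p) σ τ → hi.eval τ = N)
    (h0 : Inv L (σ.setVar i L))
    (hstep : ∀ k τ, L ≤ k → k < N → τ.var i = k → Frame (forTo i lo hi p) σ τ → Inv k τ →
      Runs W p τ fun t ρ => t ≤ c ∧ Inv (k + 1) (ρ.setVar i (k + 1)))
    {Q : ℕ → State → Prop}
    (hQ : ∀ t τ, t ≤ (N - L) * (c + hi.cost + 7) + lo.cost + hi.cost + 4 →
      Frame (forTo i lo hi p) σ τ → τ.var i = N → Inv N τ → Q t τ) :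
    Runs W (forTo i lo hi p) σ Q := by
  refine runs_forTo_time L N (fun k T τ => T ≤ (k - L) * c ∧ Inv k τ) hL hLN hNW hi' hN
    ⟨by simp, h0⟩ ?_ ?_
  · rintro k T τ hk hkN hki hF ⟨hT, hI⟩
    refine (hstep k τ hk hkN hki hF hI).mono ?_
    rintro t ρ ⟨ht, h⟩
    refine ⟨?_, h⟩
    rw [Nat.sub_add_comm hk, add_mul]
    omega
  · rintro t T τ ht hF hki ⟨hT, hI⟩
    refine hQ t τ ?_ hF hki hI
    have : (N - L) * (c + hi.cost + 7) = (N - L) * c + (N - L) * (hi.cost + 7) := by ring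
    omega

end WordRAM


/-! ### Modules of an edge-coloured complete digraph -/

section Modules

variable {α : Type*} {e : α → α → ℕ} {Y A B C N U : Set α}

/-- Elements outside of `U` do not distinguish the elements of `U` by the incoming colours. -/
def InHom (e : α → α → ℕ) (Y U : Set α) : Prop :=
  ∀ x ∈ Y, x ∉ U → ∀ u ∈ U, ∀ v ∈ U, e u x = e v x

/-- `U` is a module of the digraph on `Y` with colours `e`. -/
structure IsModuleOf (e : α → α → ℕ) (Y U : Set α) : Prop where
  sub : U ⊆ Y
  inHom : InHom e Y U
  outHom : ∀ x ∈ Y, x ∉ U → ∀ u ∈ U, ∀ v ∈ U, e x u = e x v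

/-- Two sets overlap. -/
def SetOverlap (A B : Set α) : Prop := (A ∩ B).Nonempty ∧ (A \ B).Nonempty ∧ (B \ A).Nonempty

/-- A nonempty module that overlaps no module. -/
structure IsStrongModule (e : α → α → ℕ) (Y U : Set α) : Prop where
  mod : IsModuleOf e Y U
  nonempty : U.Nonempty
  strong : ∀ B, IsModuleOf e Y B → ¬ SetOverlap U B

/-- All colours are compared with those of one common element `c`. -/
theorem IsModuleOf.union (hA : IsModuleOf e Y A) (hB : IsModuleOf e Y B)
    (hAB : (A ∩ B).Nonempty) : IsModuleOf e Y (A ∪ B) := by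
  obtain ⟨c, hcA, hcB⟩ := hAB
  have key1 : ∀ x ∈ Y, x ∉ A ∪ B → ∀ u ∈ A ∪ B, e u x = e c x := by
    intro x hx hn u hu
    rcases hu with hu | hu
    · exact hA.inHom x hx (fun h => hn (.inl h)) u hu c hcA
    · exact hB.inHom x hx (fun h => hn (.inr h)) u hu c hcB
  have key2 : ∀ x ∈ Y, x ∉ A ∪ B → ∀ u ∈ A ∪ B, e x u = e x c := by
    intro x hx hn u hu
    rcases hu with hu | hu
    · exact hA.outHom x hx (fun h => hn (.inl h)) u hu c hcA
    · exact hB.outHom x hx (fun h => hn (.inr h)) u hu c hcB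
  exact ⟨Set.union_subset hA.sub hB.sub,
    fun x hx hn u hu v hv => (key1 x hx hn u hu).trans (key1 x hx hn v hv).symm,
    fun x hx hn u hu v hv => (key2 x hx hn u hu).trans (key2 x hx hn v hv).symm⟩

/-- An element `x` of `A ∩ B` can be replaced by an element `y` of `B \ A`, because `B` looks
homogeneous from `A \ B`; then `A` is homogeneous towards `y`. Incoming homogeneity of the
difference thus uses outgoing homogeneity of `B`, and conversely. -/
theorem IsModuleOf.diff (hA : IsModuleOf e Y A) (hB : IsModuleOf e Y B)
    (hBA : (B \ A).Nonempty) : IsModuleOf e Y (A \ B) := by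
  obtain ⟨y, hyB, hyA⟩ := hBA
  refine ⟨fun x hx => hA.sub hx.1, fun x hx hn u hu v hv => ?_, fun x hx hn u hu v hv => ?_⟩
  · by_cases h : x ∈ A
    · have hxB : x ∈ B := by by_contra h'; exact hn ⟨h, h'⟩
      rw [hB.outHom u (hA.sub hu.1) hu.2 x hxB y hyB, hB.outHom v (hA.sub hv.1) hv.2 x hxB y hyB]
      exact hA.inHom y (hB.sub hyB) hyA u hu.1 v hv.1
    · exact hA.inHom x hx h u hu.1 v hv.1
  · by_cases h : x ∈ A
    · have hxB : x ∈ B := by by_contra h'; exact hn ⟨h, h'⟩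
      rw [hB.inHom u (hA.sub hu.1) hu.2 x hxB y hyB, hB.inHom v (hA.sub hv.1) hv.2 x hxB y hyB]
      exact hA.outHom y (hB.sub hyB) hyA u hu.1 v hv.1
    · exact hA.outHom x hx h u hu.1 v hv.1

theorem IsModuleOf.singleton {x : α} (hx : x ∈ Y) : IsModuleOf e Y {x} :=
  ⟨by simpa using hx, by rintro y - - u rfl v rfl; rfl, by rintro y - - u rfl v rfl; rfl⟩

theorem IsModuleOf.univ : IsModuleOf e Y Y :=
  ⟨subset_rfl, fun _ hx hn => absurd hx hn, fun _ hx hn => absurd hx hn⟩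

theorem IsStrongModule.nested (hA : IsStrongModule e Y A) (hB : IsModuleOf e Y B)
    (hAB : (A ∩ B).Nonempty) : A ⊆ B ∨ B ⊆ A := by
  by_contra! h
  exact hA.strong B hB ⟨hAB, Set.sdiff_nonempty.2 h.1, Set.sdiff_nonempty.2 h.2⟩

theorem IsStrongModule.singleton {x : α} (hx : x ∈ Y) : IsStrongModule e Y {x} := by
  refine ⟨.singleton hx, ⟨x, rfl⟩, ?_⟩
  rintro B - ⟨⟨y, rfl, hy⟩, ⟨z, rfl, hz⟩, -⟩
  exact hz hy

theorem IsStrongModule.univ (hY : Y.Nonempty) : IsStrongModule e Y Y := by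
  refine ⟨.univ, hY, ?_⟩
  rintro B hB ⟨-, -, ⟨x, hx, hn⟩⟩
  exact hn (hB.sub hx)

/-- `u` and `v` lie in a common strong module that is a proper subset of `N`. -/
def Together (e : α → α → ℕ) (Y N : Set α) (u v : α) : Prop :=
  ∃ C, IsStrongModule e Y C ∧ C ⊂ N ∧ u ∈ C ∧ v ∈ C

theorem Together.symm {u v : α} (h : Together e Y N u v) : Together e Y N v u := by
  obtain ⟨C, h1, h2, h3, h4⟩ := h
  exact ⟨C, h1, h2, h4, h3⟩

theorem Together.trans {u v w : α} (h : Together e Y N u v) (k : Together e Y N v w) :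
    Together e Y N u w := by
  obtain ⟨C, h1, h2, h3, h4⟩ := h
  obtain ⟨D, k1, k2, k3, k4⟩ := k
  rcases h1.nested k1.mod ⟨v, h4, k3⟩ with h | h
  · exact ⟨D, k1, k2, h h3, k4⟩
  · exact ⟨C, h1, h2, h3, h k4⟩

/-- `N` is the disjoint union of two modules. -/
def HasSplit (e : α → α → ℕ) (Y N : Set α) : Prop :=
  ∃ A, IsModuleOf e Y A ∧ IsModuleOf e Y (N \ A) ∧ A.Nonempty ∧ (N \ A).Nonempty ∧ A ⊆ N

/-- A maximal module `M` with `U ⊆ M ⊂ N` is strong: if `B` overlaps it, then `B ⊆ N`, and by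
maximality `M ∪ B = N`, so `M` and `B \ M` split `N`. -/
theorem exists_strong_of_not_hasSplit (hY : Y.Finite) (hN : IsStrongModule e Y N)
    (hs : ¬ HasSplit e Y N) (hU : IsModuleOf e Y U) (hUN : U ⊂ N) (hne : U.Nonempty) :
    ∃ C, IsStrongModule e Y C ∧ C ⊂ N ∧ U ⊆ C := by
  have hfin : {M | IsModuleOf e Y M ∧ M ⊂ N}.Finite :=
    hY.finite_subsets.subset fun M hM => hM.1.sub
  obtain ⟨M, hUM, hM⟩ := hfin.exists_le_maximal (a := U) ⟨hU, hUN⟩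
  refine ⟨M, ⟨hM.prop.1, hne.mono hUM, fun B hB ho => ?_⟩, hM.prop.2, hUM⟩
  obtain ⟨⟨c, hcM, hcB⟩, ⟨a, haM, haB⟩, ⟨b, hbB, hbM⟩⟩ := ho
  rcases hN.nested hB ⟨c, hM.prop.2.1 hcM, hcB⟩ with h | h
  · exact haB (h (hM.prop.2.1 haM))
  · by_cases hMB : M ∪ B = N
    · refine hs ⟨M, hM.prop.1, ?_, ⟨c, hcM⟩, ⟨b, h hbB, hbM⟩, hM.prop.2.1⟩
      have : N \ M = B \ M := by
        rw [← hMB]; ext x; simp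
      rw [this]
      exact hB.diff hM.prop.1 ⟨a, haM, haB⟩
    · have : M ∪ B ⊂ N := (Set.union_subset hM.prop.2.1 h).ssubset_of_ne hMB
      have h2 := hM.le_of_ge ⟨hM.prop.1.union hB ⟨c, hcM, hcB⟩, this⟩ Set.subset_union_left
      exact hbM (h2 (.inr hbB))

/-- The maximal strong proper submodule around `u`. Strong modules that meet are nested, so it
absorbs all the others. -/
theorem exists_child (hY : Y.Finite) {u : α} (hN : IsStrongModule e Y N) (hu : u ∈ N)
    (hN2 : N ≠ {u}) :
    ∃ C, IsStrongModule e Y C ∧ C ⊂ N ∧ u ∈ C ∧ ∀ v, Together e Y N u v → v ∈ C := by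
  have hfin : {M | IsStrongModule e Y M ∧ M ⊂ N ∧ u ∈ M}.Finite :=
    hY.finite_subsets.subset fun M hM => hM.1.mod.sub
  have h0 : {u} ⊂ N := (Set.singleton_subset_iff.2 hu).ssubset_of_ne hN2.symm
  obtain ⟨C, -, hC⟩ := hfin.exists_le_maximal (a := {u}) ⟨.singleton (hN.mod.sub hu), h0, rfl⟩
  refine ⟨C, hC.prop.1, hC.prop.2.1, hC.prop.2.2, ?_⟩
  rintro v ⟨D, hD, hDN, huD, hvD⟩
  rcases hC.prop.1.nested hD.mod ⟨u, hC.prop.2.2, huD⟩ with h | h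
  · exact hC.le_of_ge ⟨hD, hDN, huD⟩ h hvD
  · exact h hvD

/-- A strong module that splits is degenerate: any two of its elements that are not together in a
smaller strong module have colours `a` and `b`, in one of the two orders, and if `a ≠ b` these
orders form a linear order. -/
theorem degenerate_of_hasSplit (hN : IsStrongModule e Y N) (hs : HasSplit e Y N) :
    ∃ a b : ℕ, (∀ u ∈ N, ∀ v ∈ N, ¬ Together e Y N u v →
        (e u v = a ∧ e v u = b) ∨ (e v u = a ∧ e u v = b)) ∧
      (a ≠ b → ∀ u ∈ N, ∀ v ∈ N, ∀ w ∈ N, ¬ Together e Y N u v → ¬ Together e Y N v w →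
        e u v = a → e v u = b → e v w = a → e w v = b →
        ¬ Together e Y N u w ∧ e u w = a ∧ e w u = b) := by
  obtain ⟨A₀, hA, hA', ⟨a₀, ha₀⟩, ⟨b₀, hb₀⟩, hAN⟩ := hs
  set a := e a₀ b₀ with ha
  set b := e b₀ a₀ with hb
  let R : α → α → Prop := fun u v => e u v = a ∧ e v u = b
  -- A cut is an initial part of `N` for `R`. The classes `K u` of elements that no cut separates
  -- turn out to be the children of `N`.
  let Cut : Set α → Prop := fun A => A ⊆ N ∧ ∀ u ∈ A, ∀ v ∈ N, v ∉ A → R u v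
  have hYN := hN.mod.sub
  have hcut₀ : Cut A₀ := by
    refine ⟨hAN, fun u hu v hv hvA => ⟨?_, ?_⟩⟩
    · rw [hA.inHom v (hYN hv) hvA u hu a₀ ha₀,
        hA'.outHom a₀ (hA.sub ha₀) (fun h => h.2 ha₀) v ⟨hv, hvA⟩ b₀ hb₀]
    · rw [hA.outHom v (hYN hv) hvA u hu a₀ ha₀,
        hA'.inHom a₀ (hA.sub ha₀) (fun h => h.2 ha₀) v ⟨hv, hvA⟩ b₀ hb₀]
  have hcutmod : ∀ A, Cut A → IsModuleOf e Y A := by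
    intro A hA
    refine ⟨hA.1.trans hYN, fun x hx hn u hu v hv => ?_, fun x hx hn u hu v hv => ?_⟩
    · by_cases hxN : x ∈ N
      · rw [(hA.2 u hu x hxN hn).1, (hA.2 v hv x hxN hn).1]
      · exact hN.mod.inHom x hx hxN u (hA.1 hu) v (hA.1 hv)
    · by_cases hxN : x ∈ N
      · rw [(hA.2 u hu x hxN hn).2, (hA.2 v hv x hxN hn).2]
      · exact hN.mod.outHom x hx hxN u (hA.1 hu) v (hA.1 hv)
  let Same : α → α → Prop := fun u v => ∀ A, Cut A → (u ∈ A ↔ v ∈ A)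
  let K : α → Set α := fun u => {v | v ∈ N ∧ Same u v}
  have hsep : ∀ u ∈ N, ∀ v ∈ N, ¬ Same u v →
      ∃ A, Cut A ∧ ((u ∈ A ∧ v ∉ A) ∨ (v ∈ A ∧ u ∉ A)) := by
    intro u hu v hv h
    simp only [Same, not_forall] at h
    obtain ⟨A, h1, h2⟩ := h
    exact ⟨A, h1, by tauto⟩
  have hsepR : ∀ u ∈ N, ∀ v ∈ N, ¬ Same u v → R u v ∨ R v u := by
    intro u hu v hv h
    obtain ⟨A, h1, h2 | h2⟩ := hsep u hu v hv h
    · exact .inl (h1.2 u h2.1 v hv h2.2)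
    · exact .inr (h1.2 v h2.1 u hu h2.2)
  have hKmod : ∀ u ∈ N, IsModuleOf e Y (K u) := by
    intro u hu
    have key : ∀ x ∈ N, x ∉ K u → ∀ v ∈ K u, e v x = e u x ∧ e x v = e x u := by
      intro x hx hn v hv
      obtain ⟨A, h1, h2 | h2⟩ := hsep u hu x hx (fun h => hn ⟨hx, h⟩)
      · have h3 := h1.2 u h2.1 x hx h2.2
        have h4 := h1.2 v ((hv.2 A h1).1 h2.1) x hx h2.2
        exact ⟨h4.1.trans h3.1.symm, h4.2.trans h3.2.symm⟩
      · have h3 := h1.2 x h2.1 u hu h2.2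
        have h4 := h1.2 x h2.1 v hv.1 (fun h => h2.2 ((hv.2 A h1).2 h))
        exact ⟨h4.2.trans h3.2.symm, h4.1.trans h3.1.symm⟩
    refine ⟨fun v hv => hYN hv.1, fun x hx hn v hv w hw => ?_, fun x hx hn v hv w hw => ?_⟩
    · by_cases hxN : x ∈ N
      · rw [(key x hxN hn v hv).1, (key x hxN hn w hw).1]
      · exact hN.mod.inHom x hx hxN v hv.1 w hw.1
    · by_cases hxN : x ∈ N
      · rw [(key x hxN hn v hv).2, (key x hxN hn w hw).2]
      · exact hN.mod.outHom x hx hxN v hv.1 w hw.1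
  have hKss : ∀ u ∈ N, K u ⊂ N := by
    intro u hu
    have h0 : K u ⊆ N := fun v hv => hv.1
    refine h0.ssubset_of_ne fun h => ?_
    have h1 : a₀ ∈ K u := h ▸ hAN ha₀
    have h2 : b₀ ∈ K u := h ▸ hb₀.1
    exact hb₀.2 ((h2.2 A₀ hcut₀).1 ((h1.2 A₀ hcut₀).2 ha₀))
  have hKstrong : ∀ u ∈ N, IsStrongModule e Y (K u) := by
    intro u hu
    refine ⟨hKmod u hu, ⟨u, hu, fun _ _ => Iff.rfl⟩, ?_⟩
    rintro B hB ⟨⟨c, hcK, hcB⟩, ⟨d, hdK, hdB⟩, ⟨b', hbB, hbK⟩⟩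
    have hBN : B ⊆ N := by
      rcases hN.nested hB ⟨c, hcK.1, hcB⟩ with h | h
      · exact absurd (h hdK.1) hdB
      · exact h
    -- the smallest cut containing the class of `u`, without that class
    let L : Set α := {x | x ∈ N ∧ x ∉ K u ∧ ∀ A, Cut A → u ∈ A → x ∈ A}
    have hL1 : ∀ x ∈ L, ∀ v ∈ K u, R x v := by
      intro x hx v hv
      obtain ⟨A, h1, h2 | h2⟩ := hsep u hu x hx.1 (fun h => hx.2.1 ⟨hx.1, h⟩)
      · exact absurd (hx.2.2 A h1 h2.1) h2.2
      · exact h1.2 x h2.1 v hv.1 fun h => h2.2 ((hv.2 A h1).2 h)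
    have hL2 : ∀ y ∈ N, y ∉ L → y ∉ K u → ∀ x, x ∈ L ∨ x ∈ K u → R x y := by
      intro y hy hyL hyK x hx
      have : ∃ A, Cut A ∧ u ∈ A ∧ y ∉ A := by
        by_contra! h
        exact hyL ⟨hy, hyK, h⟩
      obtain ⟨A, h1, h2, h3⟩ := this
      refine h1.2 x ?_ y hy h3
      rcases hx with hx | hx
      · exact hx.2.2 A h1 h2
      · exact (hx.2 A h1).1 h2
    -- If a subset of `K u` precedes the rest of `K u`, then together with `L` it is a cut. It
    -- therefore cannot be nonempty and proper, as cuts do not separate `K u`.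
    have hnocut : ∀ K' : Set α, K' ⊆ K u → (∀ v ∈ K', ∀ w ∈ K u, w ∉ K' → R v w) →
        Cut (L ∪ K') := by
      intro K' hK' hR
      refine ⟨Set.union_subset (fun x hx => hx.1) (fun x hx => (hK' hx).1), ?_⟩
      intro x hx y hy hn
      have hyL : y ∉ L := fun h => hn (.inl h)
      have hyK' : y ∉ K' := fun h => hn (.inr h)
      by_cases hyK : y ∈ K u
      · rcases hx with hx | hx
        · exact hL1 x hx y hyK
        · exact hR x hx y hyK hyK'
      · exact hL2 y hy hyL hyK x (hx.imp_right fun h => hK' h)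
    have hsame : Same c d := fun A hA => ((hcK.2 A hA).symm).trans (hdK.2 A hA)
    have hcL : c ∉ L := fun h => h.2.1 hcK
    have hdL : d ∉ L := fun h => h.2.1 hdK
    -- The elements of `B ∩ K u` relate to those of `K u \ B` as `b'` does. So `B ∩ K u` comes first
    -- if `b'` is in `L` and last otherwise, and either order contradicts `hnocut`.
    by_cases hbL : b' ∈ L
    · have h1 := hnocut (K u ∩ B) Set.inter_subset_left (by
        rintro v ⟨hv, hvB⟩ w hw hwB
        have hwB : w ∉ B := fun h => hwB ⟨hw, h⟩
        have := hL1 b' hbL w hw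
        exact ⟨(hB.inHom w (hYN hw.1) hwB v hvB b' hbB).trans this.1,
          (hB.outHom w (hYN hw.1) hwB v hvB b' hbB).trans this.2⟩)
      rcases (hsame _ h1).1 (.inr ⟨hcK, hcB⟩) with h | h
      · exact hdL h
      · exact hdB h.2
    · have h1 := hnocut (K u \ B) Set.sdiff_subset (by
        rintro v ⟨hv, hvB⟩ w hw hwB
        have hwB : w ∈ B := by by_contra h; exact hwB ⟨hw, h⟩
        have := hL2 b' (hBN hbB) hbL hbK v (.inr hv)
        exact ⟨(hB.outHom v (hYN hv.1) hvB w hwB b' hbB).trans this.1,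
          (hB.inHom v (hYN hv.1) hvB w hwB b' hbB).trans this.2⟩)
      rcases (hsame _ h1).2 (.inr ⟨hdK, hdB⟩) with h | h
      · exact hcL h
      · exact h.2 hcB
  -- A proper strong module separated by a cut `A` would be comparable with both modules `A` and `N
  -- \ A`, hence contain both and equal `N`.
  have hTS : ∀ u ∈ N, ∀ v ∈ N, Together e Y N u v ↔ Same u v := by
    intro u hu v hv
    constructor
    · rintro ⟨C, hC, hCN, huC, hvC⟩ A hA
      have key : ∀ x ∈ C, ∀ y ∈ C, x ∈ A → y ∈ A := by
        intro x hx y hy hxA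
        by_contra hyA
        have h1 : A ⊆ C := by
          rcases hC.nested (hcutmod A hA) ⟨x, hx, hxA⟩ with h | h
          · exact absurd (h hy) hyA
          · exact h
        have hmod' : IsModuleOf e Y (N \ A) := by
          refine ⟨fun z hz => hYN hz.1, fun z hz hn s hs t ht => ?_, fun z hz hn s hs t ht => ?_⟩
          · by_cases hzN : z ∈ N
            · have hzA : z ∈ A := by by_contra h; exact hn ⟨hzN, h⟩
              rw [(hA.2 z hzA s hs.1 hs.2).2, (hA.2 z hzA t ht.1 ht.2).2]
            · exact hN.mod.inHom z hz hzN s hs.1 t ht.1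
          · by_cases hzN : z ∈ N
            · have hzA : z ∈ A := by by_contra h; exact hn ⟨hzN, h⟩
              rw [(hA.2 z hzA s hs.1 hs.2).1, (hA.2 z hzA t ht.1 ht.2).1]
            · exact hN.mod.outHom z hz hzN s hs.1 t ht.1
        have h2 : N \ A ⊆ C := by
          rcases hC.nested hmod' ⟨y, hy, hCN.1 hy, hyA⟩ with h | h
          · exact absurd hxA (h hx).2
          · exact h
        refine hCN.2 fun z hz => ?_
        by_cases hzA : z ∈ A
        · exact h1 hzA
        · exact h2 ⟨hz, hzA⟩
      exact ⟨key u huC v hvC, key v hvC u huC⟩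
    · intro h
      exact ⟨K u, hKstrong u hu, hKss u hu, ⟨hu, fun _ _ => Iff.rfl⟩, ⟨hv, h⟩⟩
  refine ⟨a, b, fun u hu v hv h => ?_, ?_⟩
  · rw [hTS u hu v hv] at h
    exact hsepR u hu v hv h
  · intro hab u hu v hv w hw huv hvw h1 h2 h3 h4
    rw [hTS u hu v hv] at huv
    rw [hTS v hv w hw] at hvw
    rw [hTS u hu w hw]
    -- Since `a ≠ b`, the direction of the cut between `u` and `v` is forced, and `w` lies on the
    -- side of `v`.
    obtain ⟨A, hA, ⟨huA, hvA⟩ | ⟨hvA, huA⟩⟩ := hsep u hu v hv huv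
    · have hwA : w ∉ A := fun hwA => hab (h4 ▸ (hA.2 w hwA v hv hvA).1).symm
      exact ⟨fun h => hwA ((h A hA).1 huA), hA.2 u huA w hw hwA⟩
    · exact absurd (h2 ▸ (hA.2 v hvA u hu huA).1) (Ne.symm hab)

/-- A module in no strong proper submodule of `N` contains every such submodule that it meets, so it
is a union of children. -/
theorem IsModuleOf.saturated (hU : IsModuleOf e Y U)
    (hnot : ¬ ∃ C, IsStrongModule e Y C ∧ C ⊂ N ∧ U ⊆ C) {u v : α} (hu : u ∈ U)
    (h : Together e Y N u v) : v ∈ U := by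
  obtain ⟨C, hC, hCN, huC, hvC⟩ := h
  rcases hC.nested hU ⟨u, huC, hu⟩ with h | h
  · exact h hvC
  · exact absurd ⟨C, hC, hCN, h⟩ hnot

end Modules


/-! ### Trees given by parent functions -/

section ParentTree

variable {V X : Type*} {par : V → V} {ρ : V}

/-- The graph that joins every `v ≠ ρ` to its parent. -/
def parentGraph (par : V → V) (ρ : V) : SimpleGraph V :=
  SimpleGraph.fromRel fun v w => v ≠ ρ ∧ par v = w

/-- `w` is reached from `u` by going up to parents. -/
def Below (par : V → V) (ρ w u : V) : Prop :=
  Relation.ReflTransGen (fun u p => u ≠ ρ ∧ par u = p) u w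

theorem Below.step {w u : V} (hu : u ≠ ρ) (h : Below par ρ w (par u)) : Below par ρ w u :=
  Relation.ReflTransGen.head ⟨hu, rfl⟩ h

theorem Below.eq_or {w u : V} (h : Below par ρ w u) :
    u = w ∨ (u ≠ ρ ∧ Below par ρ w (par u)) := by
  rcases Relation.ReflTransGen.cases_head h with h | ⟨c, ⟨h1, rfl⟩, h2⟩
  · exact .inl h
  · exact .inr ⟨h1, h2⟩

theorem Below.rank_le {ht : V → ℕ} (hpar : ∀ v, v ≠ ρ → ht (par v) < ht v) {w u : V}
    (h : Below par ρ w u) : ht w ≤ ht u := by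
  induction h using Relation.ReflTransGen.head_induction_on with
  | refl => exact le_rfl
  | head h _ ih =>
    obtain ⟨h1, rfl⟩ := h
    exact ih.trans (hpar _ h1).le

theorem parentGraph_adj {ht : V → ℕ} (hpar : ∀ v, v ≠ ρ → ht (par v) < ht v) {v w : V} :
    (parentGraph par ρ).Adj v w ↔ (v ≠ ρ ∧ par v = w) ∨ (w ≠ ρ ∧ par w = v) := by
  rw [parentGraph, SimpleGraph.fromRel_adj]
  refine and_iff_right_of_imp ?_
  rintro (⟨h, rfl⟩ | ⟨h, rfl⟩) heq
  · have := hpar v h; rw [← heq] at this; exact lt_irrefl _ this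
  · have := hpar w h; rw [heq] at this; exact lt_irrefl _ this

variable {ht : V → ℕ} (hpar : ∀ v, v ≠ ρ → ht (par v) < ht v)
include hpar

theorem adj_par {v : V} (hv : v ≠ ρ) : (parentGraph par ρ).Adj v (par v) :=
  (parentGraph_adj hpar).2 (.inl ⟨hv, rfl⟩)

theorem edge_ne {u w : V} (hu : u ≠ ρ) (hw : w ≠ ρ) (huw : u ≠ w) :
    s(u, par u) ≠ s(w, par w) := by
  intro h
  rcases Sym2.eq_iff.1 h with ⟨h1, -⟩ | ⟨h1, h2⟩
  · exact huw h1
  · have := hpar u hu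
    have h3 := hpar w hw
    rw [h2] at this
    rw [← h1] at h3
    exact lt_asymm this h3

/-- Only the edge above `w` changes whether a node is below `w`; all other edges join nodes on the
same side. -/
theorem below_iff_of_reachable {w : V} (hw : w ≠ ρ) {u v : V}
    (h : ((parentGraph par ρ).deleteEdges {s(w, par w)}).Reachable u v) :
    Below par ρ w u ↔ Below par ρ w v := by
  obtain ⟨p⟩ := h
  induction p with
  | nil => rfl
  | cons h _ ih =>
    refine Iff.trans ?_ ih
    rw [SimpleGraph.deleteEdges_adj, parentGraph_adj hpar] at h
    have key : ∀ u, u ≠ ρ → s(u, par u) ∉ ({s(w, par w)} : Set (Sym2 V)) →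
        (Below par ρ w u ↔ Below par ρ w (par u)) := by
      intro u hu hne
      refine ⟨fun hb => ?_, fun hb => hb.step hu⟩
      rcases hb.eq_or with rfl | h
      · exact absurd rfl hne
      · exact h.2
    rcases h with ⟨⟨h, rfl⟩ | ⟨h, rfl⟩, hne⟩
    · exact key _ h hne
    · exact (key _ h (by rwa [Sym2.eq_swap (a := par _)] at hne)).symm

theorem reachable_of_below {w : V} (hw : w ≠ ρ) {u : V} (h : Below par ρ w u) :
    ((parentGraph par ρ).deleteEdges {s(w, par w)}).Reachable w u := by
  induction h using Relation.ReflTransGen.head_induction_on with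
  | refl => rfl
  | @head a _ h _ ih =>
    obtain ⟨h1, rfl⟩ := h
    by_cases ha : a = w
    · subst ha; rfl
    · refine ih.trans (SimpleGraph.Adj.reachable ?_)
      rw [SimpleGraph.deleteEdges_adj]
      refine ⟨(adj_par hpar h1).symm, ?_⟩
      rw [Sym2.eq_swap (a := par _)]
      exact edge_ne hpar h1 hw ha

/-- The walk upwards from a node not below `w` never uses the edge above `w`; the rank `ht` makes it
end at the root. -/
theorem reachable_root {w : V} (hw : w ≠ ρ) (u : V) (h : ¬ Below par ρ w u) :
    ((parentGraph par ρ).deleteEdges {s(w, par w)}).Reachable u ρ := by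
  induction hn : ht u using Nat.strong_induction_on generalizing u with
  | _ n ih =>
    by_cases hu : u = ρ
    · subst hu; rfl
    · have h1 : ¬ Below par ρ w (par u) := fun h' => h (h'.step hu)
      refine SimpleGraph.Reachable.trans ?_ (ih _ (hn ▸ hpar u hu) _ h1 rfl)
      apply SimpleGraph.Adj.reachable
      rw [SimpleGraph.deleteEdges_adj]
      refine ⟨adj_par hpar hu, edge_ne hpar hu hw ?_⟩
      rintro rfl
      exact h Relation.ReflTransGen.refl

theorem not_below_par {w : V} (hw : w ≠ ρ) : ¬ Below par ρ w (par w) := fun h =>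
  absurd (h.rank_le hpar) (not_le.2 (hpar w hw))

/-- Every node climbs to the root, so the graph is connected. Every edge is a bridge, as its ends
differ in being below the lower one. -/
theorem parentGraph_isTree : (parentGraph par ρ).IsTree := by
  have hroot : ∀ u, (parentGraph par ρ).Reachable u ρ := by
    intro u
    induction hn : ht u using Nat.strong_induction_on generalizing u with
    | _ n ih =>
      by_cases hu : u = ρ
      · subst hu; rfl
      · exact (adj_par hpar hu).reachable.trans (ih _ (hn ▸ hpar u hu) _ rfl)
  have : Nonempty V := ⟨ρ⟩
  refine ⟨⟨fun u v => (hroot u).trans (hroot v).symm⟩, ?_⟩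
  rw [SimpleGraph.isAcyclic_iff_forall_adj_isBridge]
  have key : ∀ w, w ≠ ρ → ¬ ((parentGraph par ρ).deleteEdges {s(w, par w)}).Reachable w (par w) :=
    fun w hw h => not_below_par hpar hw
      ((below_iff_of_reachable hpar hw h).1 Relation.ReflTransGen.refl)
  intro v w h
  rw [SimpleGraph.isBridge_iff]
  rcases (parentGraph_adj hpar).1 h with ⟨h1, rfl⟩ | ⟨h1, rfl⟩
  · exact key v h1
  · rw [Sym2.eq_swap]
    exact fun h' => key w h1 h'.symm

theorem branch_child (leaf : X → V) {w : V} (hw : w ≠ ρ) :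
    branch (parentGraph par ρ) leaf (par w) w = {x | Below par ρ w (leaf x)} := by
  ext x
  simp only [branch, Set.mem_ofPred_eq]
  rw [Sym2.eq_swap]
  exact ⟨fun h => (below_iff_of_reachable hpar hw h).1 Relation.ReflTransGen.refl,
    reachable_of_below hpar hw⟩

theorem branch_par (leaf : X → V) {w : V} (hw : w ≠ ρ) :
    branch (parentGraph par ρ) leaf w (par w) = {x | Below par ρ w (leaf x)}ᶜ := by
  ext x
  simp only [branch, Set.mem_ofPred_eq, Set.mem_compl_iff]
  refine ⟨fun h h' => not_below_par hpar hw ((below_iff_of_reachable hpar hw h).2 h'), fun h =>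
    (reachable_root hpar hw _ (not_below_par hpar hw)).trans (reachable_root hpar hw _ h).symm⟩

end ParentTree


/-! ### Partition refinement: the invariant

Positions `0, …, m - 1` hold a permutation `s` of the elements. The positions `k` with `st k ≠ 0`
are the boundaries of the classes of the current partition; a boundary `j` has split the range from
`lo j` to `hi j`, and it is pending as long as `st j = 1`. -/

section Refine

/-- The set of elements at the positions `a, …, b - 1`. -/
def block (s : ℕ → ℕ) (a b : ℕ) : Set ℕ := s '' Set.Ico a b

theorem block_mono {s : ℕ → ℕ} {a b a' b' : ℕ} (ha : a' ≤ a) (hb : b ≤ b') :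
    block s a b ⊆ block s a' b' :=
  Set.image_mono (Set.Ico_subset_Ico ha hb)

theorem mem_block {s : ℕ → ℕ} {a b i : ℕ} (h1 : a ≤ i) (h2 : i < b) : s i ∈ block s a b :=
  ⟨i, ⟨h1, h2⟩, rfl⟩

theorem block_succ (s : ℕ → ℕ) (a : ℕ) : block s a (a + 1) = {s a} := by
  ext x
  constructor
  · rintro ⟨i, ⟨h1, h2⟩, rfl⟩
    rw [show i = a by omega]; rfl
  · rintro rfl
    exact mem_block le_rfl (Nat.lt_succ_self a)

theorem InHom.singleton' {e : ℕ → ℕ → ℕ} {Y : Set ℕ} {x : ℕ} : InHom e Y {x} := by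
  rintro y - - u rfl v rfl; rfl

/-- Boundary `j` still has to be used to refine the class `[a, b)` by the element `z`. -/
def OfTask (s lo hi : ℕ → ℕ) (j z a b : ℕ) : Prop :=
  (z ∈ block s (lo j) j ∧ j ≤ a ∧ b ≤ hi j) ∨ (z ∈ block s j (hi j) ∧ lo j ≤ a ∧ b ≤ j)

/-- The invariant of partition refinement. The predicate `X` lists the pivots `z` and classes
`[a, b)` of the boundary that is being processed. -/
structure RefInv (m : ℕ) (e : ℕ → ℕ → ℕ) (s st lo hi own q : ℕ → ℕ) (p : ℕ)
    (X : ℕ → ℕ → ℕ → Prop) : Prop where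
  maps : ∀ i < m, s i < m
  inj : ∀ i < m, ∀ j < m, s i = s j → i = j
  start0 : st 0 ≠ 0
  startm : st m ≠ 0
  bounds : ∀ j, 0 < j → j < m → st j ≠ 0 →
    lo j < j ∧ j < hi j ∧ hi j ≤ m ∧ st (lo j) ≠ 0 ∧ st (hi j) ≠ 0
  -- The rectangles `[lo j, j) × [j, hi j)` are disjoint; their areas bound the refinement time.
  rect : ∀ j j', 0 < j → j < m → 0 < j' → j' < m → st j ≠ 0 → st j' ≠ 0 → j ≠ j' → ∀ i k,
    lo j ≤ i → i < j → j ≤ k → k < hi j → lo j' ≤ i → i < j' → j' ≤ k → k < hi j' → False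
  -- The debt of the algorithm: a class may be inhomogeneous towards an outside element only if a
  -- pending boundary, or the one being processed, still schedules that pair.
  stable : ∀ a b, a < b → b ≤ m → st a ≠ 0 → st b ≠ 0 → (∀ k, a < k → k < b → st k = 0) →
    ∀ z < m, z ∉ block s a b → (∀ u ∈ block s a b, ∀ v ∈ block s a b, e u z = e v z) ∨
      (∃ j, 0 < j ∧ j < m ∧ st j = 1 ∧ OfTask s lo hi j z a b) ∨ X z a b
  qlt : ∀ i < m, i < q i ∧ q i ≤ m
  q0 : q 0 = m
  lam : ∀ i < m, ∀ k, i < k → k < q i → q k ≤ q i ∧ i ≤ own k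
  own_lt : ∀ i, 0 < i → i < m → own i < i ∧ i < q (own i)
  qmod : ∀ i < m, InHom e (Set.Iio m) (block s i (q i))
  qstart : ∀ i < m, i + 1 < q i → st i ≠ 0 ∧ st (q i) ≠ 0 ∧ st (i + 1) ≠ 0
  -- Refinement is never too fine: a boundary inside the class of a pivot does not cut a module of
  -- that class that avoids the pivot.
  sep : ∀ c, 0 < c → c < m → st c ≠ 0 → ∀ U, IsModuleOf e (Set.Iio m) U →
    U ⊆ block s (own c) (q (own c)) → s (own c) ∉ U →
    U ⊆ block s (own c) c ∨ U ⊆ block s c (q (own c))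
  plt : p < m
  cur : ∀ j, 0 < j → j < m → st j = 1 → p ≤ lo j ∧ hi j ≤ q p
  curOwn : ∀ i, p < i → i < q p → own i = p
  last : ∀ i < m, i + 1 < q i → i ≤ p
  pre : ∀ k ≤ p, st k ≠ 0

variable {m : ℕ} {e : ℕ → ℕ → ℕ} {s st lo hi own q : ℕ → ℕ} {p : ℕ} {X : ℕ → ℕ → ℕ → Prop}

theorem block_swap {i g : ℕ} {a b : ℕ} (ha : a ≤ i ↔ a ≤ g) (hb : b ≤ i ↔ b ≤ g) :
    block (s ∘ Equiv.swap i g) a b = block s a b := by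
  have key : ∀ k, k ∈ Set.Ico a b ↔ Equiv.swap i g k ∈ Set.Ico a b := by
    intro k
    by_cases h1 : k = i
    · subst h1; simp only [Equiv.swap_apply_left, Set.mem_Ico]; omega
    by_cases h2 : k = g
    · subst h2; simp only [Equiv.swap_apply_right, Set.mem_Ico]; omega
    rw [Equiv.swap_apply_of_ne_of_ne h1 h2]
  ext x
  constructor
  · rintro ⟨k, hk, rfl⟩
    exact ⟨_, (key k).1 hk, rfl⟩
  · rintro ⟨k, hk, rfl⟩
    refine ⟨Equiv.swap i g k, ?_, by simp⟩
    rw [key]; simpa using hk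

theorem RefInv.weaken {X' : ℕ → ℕ → ℕ → Prop} (h : RefInv m e s st lo hi own q p X)
    (hX : ∀ a b, a < b → b ≤ m → st a ≠ 0 → st b ≠ 0 → (∀ k, a < k → k < b → st k = 0) → ∀ z < m,
      X z a b → (∀ u ∈ block s a b, ∀ v ∈ block s a b, e u z = e v z) ∨ X' z a b) :
    RefInv m e s st lo hi own q p X' :=
  { h with
    stable := fun a b hab hb h1 h2 h3 z hz hzn => by
      rcases h.stable a b hab hb h1 h2 h3 z hz hzn with h' | h' | h'
      · exact .inl h'
      · exact .inr (.inl h')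
      · rcases hX a b hab hb h1 h2 h3 z hz h' with h' | h'
        · exact .inl h'
        · exact .inr (.inr h') }

theorem RefInv.own_start (h : RefInv m e s st lo hi own q p X) {c : ℕ} (h0 : 0 < c) (hc : c < m)
    : st (own c) ≠ 0 ∧ st (own c + 1) ≠ 0 ∧ st (q (own c)) ≠ 0 := by
  obtain ⟨h1, h2⟩ := h.own_lt c h0 hc
  have := h.qstart (own c) (by omega) (by omega)
  tauto

/-- No boundary lies between the two positions, so all blocks that start and end at boundaries keep
their elements. Pivots with large classes are singleton blocks and do not move. -/
theorem RefInv.swap (h : RefInv m e s st lo hi own q p X) {i g : ℕ} (hi' : i < m) (hg : g < m)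
    (hcl : ∀ k, st k ≠ 0 → (k ≤ i ↔ k ≤ g)) :
    RefInv m e (s ∘ Equiv.swap i g) st lo hi own q p X := by
  have hb : ∀ a b, st a ≠ 0 → st b ≠ 0 → block (s ∘ Equiv.swap i g) a b = block s a b :=
    fun a b ha hb => block_swap (hcl a ha) (hcl b hb)
  have hlt : ∀ k < m, Equiv.swap i g k < m := by
    intro k hk
    rw [Equiv.swap_apply_def]
    split_ifs <;> assumption
  refine { h with
    maps := fun k hk => h.maps _ (hlt k hk)
    inj := fun k hk l hl hkl =>
      (Equiv.swap i g).injective (h.inj _ (hlt k hk) _ (hlt l hl) hkl)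
    stable := ?_
    qmod := ?_
    sep := ?_ }
  · intro a b hab hbm h1 h2 h3 z hz hzn
    rw [hb a b h1 h2] at hzn ⊢
    rcases h.stable a b hab hbm h1 h2 h3 z hz hzn with h' | ⟨j, hj0, hjm, hj, h'⟩ | h'
    · exact .inl h'
    · refine .inr (.inl ⟨j, hj0, hjm, hj, ?_⟩)
      have hj' : st j ≠ 0 := by omega
      obtain ⟨-, -, -, k1, k2⟩ := h.bounds j hj0 hjm hj'
      rwa [OfTask, hb _ _ k1 hj', hb _ _ hj' k2]
    · exact .inr (.inr h')
  · intro k hk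
    by_cases hq : k + 1 < q k
    · obtain ⟨h1, h2, -⟩ := h.qstart k hk hq
      rw [hb _ _ h1 h2]
      exact h.qmod k hk
    · rw [show q k = k + 1 by have := h.qlt k hk; omega, block_succ]
      exact InHom.singleton'
  · intro c h0 hc hst U hU
    obtain ⟨h1, h2, h3⟩ := h.own_start h0 hc
    have : (s ∘ Equiv.swap i g) (own c) = s (own c) := by
      have k1 := hcl _ h1
      have k2 := hcl _ h2
      simp only [Function.comp]
      congr 1
      rw [Equiv.swap_apply_def]
      split_ifs <;> omega
    rw [hb _ _ h1 h3, hb _ _ h1 hst, hb _ _ hst h3, this]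
    exact h.sep c h0 hc hst U hU

theorem RefInv.mem_block_iff (h : RefInv m e s st lo hi own q p X) {a b i : ℕ} (hb : b ≤ m)
    (hi : i < m) : s i ∈ block s a b ↔ a ≤ i ∧ i < b := by
  refine ⟨?_, fun h => mem_block h.1 h.2⟩
  rintro ⟨k, ⟨h1, h2⟩, h3⟩
  rw [← h.inj k (by omega) i hi h3]
  exact ⟨h1, h2⟩

/-- A module inside `[a, b)` misses `z`, so its colours towards `z` agree and the new boundary does
not cut it. Debts towards elements outside `[a, b)` are inherited, and those between the two halves
are scheduled by making `g` pending. -/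
theorem RefInv.split (h : RefInv m e s st lo hi own q p X)
    (hX : ∀ z a b a' b', a ≤ a' → b' ≤ b → X z a b → X z a' b')
    {a g b z : ℕ} (hag : a < g) (hgb : g < b) (hb : b ≤ m) (hsa : st a ≠ 0) (hsb : st b ≠ 0)
    (hcl : ∀ k, a < k → k < b → st k = 0) (hpa : p ≤ a) (hbq : b ≤ q p) (hz : z < m)
    (hzn : z ∉ block s a b) (h0 : ∀ i, a ≤ i → i < g → e (s i) z = 0)
    (h1 : ∀ i, g ≤ i → i < b → e (s i) z ≠ 0) :
    RefInv m e s (Function.update st g 1) (Function.update lo g a) (Function.update hi g b)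
      own q p X := by
  have hsg : st g = 0 := hcl g hag hgb
  have hst : ∀ k, st k ≠ 0 → Function.update st g 1 k ≠ 0 := by
    intro k hk
    rw [Function.update_apply]; split_ifs <;> omega
  have hst' : ∀ k, k ≠ g → Function.update st g 1 k = st k := fun k hk => by simp [hk]
  -- The position after a pivot with a larger class is a boundary, so a class that gets split cannot
  -- start at the pivot.
  have hpa' : p < a := by
    rcases hpa.lt_or_eq with h' | rfl
    · exact h'
    · have := (h.qstart p h.plt (by omega)).2.2
      exact absurd (hcl (p + 1) (by omega) (by omega)) this
  have hqm := (h.qlt p h.plt).2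
  refine { h with
    start0 := hst _ h.start0
    startm := hst _ h.startm
    bounds := ?_
    rect := ?_
    stable := ?_
    qstart := fun i hi hq => ⟨hst _ (h.qstart i hi hq).1, hst _ (h.qstart i hi hq).2.1,
      hst _ (h.qstart i hi hq).2.2⟩
    sep := ?_
    cur := ?_
    pre := fun k hk => hst _ (h.pre k hk) }
  · intro j hj0 hjm hj
    by_cases hjg : j = g
    · subst hjg
      simp only [Function.update_self]
      exact ⟨hag, hgb, hb, hst _ hsa, hst _ hsb⟩
    · rw [hst' j hjg] at hj
      have := h.bounds j hj0 hjm hj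
      simp only [Function.update_of_ne hjg]
      exact ⟨this.1, this.2.1, this.2.2.1, hst _ this.2.2.2.1, hst _ this.2.2.2.2⟩
  -- If another rectangle meets the new one, its boundary lies strictly between `a` and `b`, where
  -- there was none.
  · intro j j' hj0 hjm hj0' hjm' hj hj' hne i k
    by_cases hjg : j = g
    · have hjg' : j' ≠ g := fun h' => hne (hjg.trans h'.symm)
      subst hjg
      rw [hst' j' hjg'] at hj'
      simp only [Function.update_self, Function.update_of_ne hjg']
      intro k1 k2 k3 k4 k5 k6 k7 k8
      exact hj' (hcl j' (by omega) (by omega))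
    · rw [hst' j hjg] at hj
      simp only [Function.update_of_ne hjg]
      by_cases hjg' : j' = g
      · subst hjg'
        simp only [Function.update_self]
        intro k1 k2 k3 k4 k5 k6 k7 k8
        exact hj (hcl j (by omega) (by omega))
      · rw [hst' j' hjg'] at hj'
        simp only [Function.update_of_ne hjg']
        exact h.rect j j' hj0 hjm hj0' hjm' hj hj' hne i k
  · intro a' b' hab' hbm' hsa' hsb' hcl' z' hz' hzn'
    have htask : ∀ j c d, st j = 1 → OfTask s lo hi j z' c d → c ≤ a' → b' ≤ d →
        OfTask s (Function.update lo g a) (Function.update hi g b) j z' a' b' := by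
      intro j c d hj ht hc hd
      have hjg : j ≠ g := by rintro rfl; omega
      simp only [OfTask, Function.update_of_ne hjg]
      rcases ht with ⟨t1, t2, t3⟩ | ⟨t1, t2, t3⟩
      · exact .inl ⟨t1, by omega, by omega⟩
      · exact .inr ⟨t1, by omega, by omega⟩
    have hold : ∀ c d, c < d → d ≤ m → st c ≠ 0 → st d ≠ 0 → (∀ k, c < k → k < d → st k = 0) →
        c ≤ a' → b' ≤ d → z' ∉ block s c d →
        (∀ u ∈ block s a' b', ∀ v ∈ block s a' b', e u z' = e v z') ∨
        (∃ j, 0 < j ∧ j < m ∧ Function.update st g 1 j = 1 ∧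
          OfTask s (Function.update lo g a) (Function.update hi g b) j z' a' b') ∨ X z' a' b' := by
      intro c d hcd hd hsc hsd hcl2 hc hd' hzn2
      rcases h.stable c d hcd hd hsc hsd hcl2 z' hz' hzn2 with h' | ⟨j, hj0, hjm, hj, h'⟩ | h'
      · exact .inl fun u hu v hv => h' u (block_mono hc hd' hu) v (block_mono hc hd' hv)
      · have hjg : j ≠ g := by rintro rfl; omega
        exact .inr (.inl ⟨j, hj0, hjm, by rw [hst' j hjg, hj], htask j c d hj h' hc hd'⟩)
      · exact .inr (.inr (hX _ _ _ _ _ hc hd' h'))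
    have hnew : OfTask s (Function.update lo g a) (Function.update hi g b) g z' a' b' →
        ∃ j, 0 < j ∧ j < m ∧ Function.update st g 1 j = 1 ∧
          OfTask s (Function.update lo g a) (Function.update hi g b) j z' a' b' :=
      fun h' => ⟨g, by omega, by omega, by simp, h'⟩
    by_cases hag' : a' = g
    · have hb'b : b' = b := by
        by_contra hne
        rcases lt_or_gt_of_ne hne with h' | h'
        · rw [hst' b' (by omega)] at hsb'
          exact hsb' (hcl b' (by omega) h')
        · exact hst b hsb (hcl' b (by omega) h')
      by_cases hz2 : z' ∈ block s a b
      · refine .inr (.inl (hnew (.inl ?_)))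
        simp only [Function.update_self]
        obtain ⟨i, ⟨hi1, hi2⟩, rfl⟩ := hz2
        refine ⟨mem_block hi1 ?_, by omega, by omega⟩
        by_contra h'
        exact hzn' (mem_block (by omega) (by omega))
      · exact hold a b (by omega) hb hsa hsb hcl (by omega) (by omega) hz2
    · rw [hst' a' hag'] at hsa'
      by_cases hbg' : b' = g
      · have ha'a : a' = a := by
          by_contra hne
          rcases lt_or_gt_of_ne hne with h' | h'
          · exact hst a hsa (hcl' a h' (by omega))
          · exact hsa' (hcl a' h' (by omega))
        by_cases hz2 : z' ∈ block s a b
        · refine .inr (.inl (hnew (.inr ?_)))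
          simp only [Function.update_self]
          obtain ⟨i, ⟨hi1, hi2⟩, rfl⟩ := hz2
          refine ⟨mem_block ?_ hi2, by omega, by omega⟩
          by_contra h'
          exact hzn' (mem_block (by omega) (by omega))
        · exact hold a b (by omega) hb hsa hsb hcl (by omega) (by omega) hz2
      · rw [hst' b' hbg'] at hsb'
        refine hold a' b' hab' hbm' hsa' hsb' (fun k hk1 hk2 => ?_) le_rfl le_rfl hzn'
        by_contra hk
        exact hst k hk (hcl' k hk1 hk2)
  · intro c hc0 hcm hc U hU hUs hUp
    by_cases hcg : c = g
    · subst hcg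
      rw [h.curOwn c (by omega) (by omega)] at hUs hUp ⊢
      -- The old boundaries at `a` and `b` place `U` before `a`, within `[a, b)`, or after `b`. Only
      -- the middle case needs the colours towards `z`.
      have ha := h.sep a (by omega) (by omega) hsa U hU
      rw [h.curOwn a (by omega) (by omega)] at ha
      rcases ha hUs hUp with h' | h'
      · exact .inl (h'.trans (block_mono le_rfl hag.le))
      · have hb' : U ⊆ block s p b ∨ U ⊆ block s b (q p) := by
          rcases hbq.lt_or_eq with h2 | rfl
          · have hb2 := h.sep b (by omega) (by omega) hsb U hU
            rw [h.curOwn b (by omega) (by omega)] at hb2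
            exact hb2 hUs hUp
          · exact .inl hUs
        rcases hb' with h2 | h2
        · have hUab : ∀ u ∈ U, ∃ i, a ≤ i ∧ i < b ∧ s i = u := by
            intro u hu
            obtain ⟨i, ⟨hi1, hi2⟩, rfl⟩ := h' hu
            exact ⟨i, hi1, ((h.mem_block_iff hb (by omega)).1 (h2 hu)).2, rfl⟩
          have hzU : z ∉ U := by
            intro hzU
            obtain ⟨i, hi1, hi2, rfl⟩ := hUab z hzU
            exact hzn (mem_block hi1 hi2)
          by_cases hex : ∃ u ∈ U, e u z = 0
          · obtain ⟨u, hu, hu0⟩ := hex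
            left
            intro v hv
            obtain ⟨i, hi1, hi2, rfl⟩ := hUab v hv
            refine mem_block (by omega) ?_
            by_contra hi3
            exact h1 i (by omega) hi2 (by rw [hU.inHom z hz hzU _ hv u hu, hu0])
          · right
            intro v hv
            obtain ⟨i, hi1, hi2, rfl⟩ := hUab v hv
            refine mem_block ?_ (by omega)
            by_contra hi3
            exact hex ⟨_, hv, h0 i hi1 (by omega)⟩
        · exact .inr (h2.trans (block_mono (by omega) le_rfl))
    · rw [hst' c hcg] at hc
      exact h.sep c hc0 hcm hc U hU hUs hUp
  · intro j hj0 hjm hj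
    by_cases hjg : j = g
    · subst hjg
      simp only [Function.update_self]
      exact ⟨hpa, hbq⟩
    · rw [hst' j hjg] at hj
      simp only [Function.update_of_ne hjg]
      exact h.cur j hj0 hjm hj

/-- The debts covered by boundary `j` are moved to the predicate of the task in progress. -/
theorem RefInv.begin_task (h : RefInv m e s st lo hi own q p fun _ _ _ => False) {j : ℕ}
    (hj : st j ≠ 0) :
    RefInv m e s (Function.update st j 2) lo hi own q p (OfTask s lo hi j) := by
  have hst : ∀ k, Function.update st j 2 k = 0 ↔ st k = 0 := by
    intro k
    rw [Function.update_apply]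
    split_ifs with h'
    · subst h'; simp [hj]
    · rfl
  have hst1 : ∀ k, Function.update st j 2 k = 1 → st k = 1 := by
    intro k
    rw [Function.update_apply]
    split_ifs with h'
    · omega
    · exact id
  refine { h with
    start0 := by rw [Ne, hst]; exact h.start0
    startm := by rw [Ne, hst]; exact h.startm
    bounds := by simpa only [Ne, hst] using h.bounds
    rect := by simpa only [Ne, hst] using h.rect
    stable := ?_
    qstart := by simpa only [Ne, hst] using h.qstart
    sep := by simpa only [Ne, hst] using h.sep
    cur := fun k hk hkm hk1 => h.cur k hk hkm (hst1 k hk1)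
    pre := by simpa only [Ne, hst] using h.pre }
  intro a b hab hb h1 h2 h3 z hz hzn
  simp only [Ne, hst] at h1 h2 h3
  rcases h.stable a b hab hb h1 h2 h3 z hz hzn with h' | ⟨k, hk0, hkm, hk1, h'⟩ | h'
  · exact .inl h'
  · by_cases hkj : k = j
    · subst hkj; exact .inr (.inr h')
    · exact .inr (.inl ⟨k, hk0, hkm, by simpa [hkj] using hk1, h'⟩)
  · exact h'.elim

/-- Without pending boundaries every class is homogeneous towards its outside, so `[p', b)` may
become the class of a pivot. The boundary after the pivot cuts no module avoiding it, and as a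
pending one it makes the pivot refine the rest. -/
theorem RefInv.choose_pivot (h : RefInv m e s st lo hi own q p fun _ _ _ => False)
    (hno : ∀ j, 0 < j → j < m → st j ≠ 1) {p' b : ℕ} (hb : b ≤ m) (hpb : p' + 1 < b)
    (hpre : ∀ k ≤ p', st k ≠ 0) (hsb : st b ≠ 0) (hcl : ∀ k, p' < k → k < b → st k = 0) :
    RefInv m e s (Function.update st (p' + 1) 1) (Function.update lo (p' + 1) p')
      (Function.update hi (p' + 1) b) (fun i => if p' < i ∧ i < b then p' else own i)
      (Function.update q p' b) p' fun _ _ _ => False := by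
  set j := p' + 1 with hj
  have hsp : st p' ≠ 0 := hpre p' le_rfl
  have hst : ∀ k, st k ≠ 0 → Function.update st j 1 k ≠ 0 := by
    intro k hk
    rw [Function.update_apply]; split_ifs <;> omega
  have hst' : ∀ k, k ≠ j → Function.update st j 1 k = st k := fun k hk => by simp [hk]
  have hsj : st j = 0 := hcl j (by omega) (by omega)
  -- Had `p'` already been a pivot with a larger class, `p' + 1` would be a boundary.
  have hqp : q p' = p' + 1 := by
    have h1 := h.qlt p' (by omega)
    by_contra h2
    exact (h.qstart p' (by omega) (by omega)).2.2 hsj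
  have hpp : p ≤ p' := by
    by_contra h'
    exact h.pre j (by omega) hsj
  have hownne : ∀ i, 0 < i → i < m → own i ≠ p' := by
    intro i hi0 hi1 h'
    have := h.own_lt i hi0 hi1
    rw [h', hqp] at this
    omega
  have hmod : ∀ z < m, z ∉ block s p' b → ∀ u ∈ block s p' b, ∀ v ∈ block s p' b, e u z = e v z := by
    intro z hz hzn
    rcases h.stable p' b (by omega) hb hsp hsb hcl z hz hzn with h' | ⟨k, hk0, hkm, hk1, -⟩ | h'
    · exact h'
    · exact absurd hk1 (hno k hk0 hkm)
    · exact h'.elim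
  have hp0 : p' ≠ 0 := by
    intro h0
    have := h.q0
    rw [h0] at hqp
    omega
  refine { h with
    start0 := hst _ h.start0
    startm := hst _ h.startm
    bounds := ?_
    rect := ?_
    stable := ?_
    qlt := ?_
    q0 := by rw [Function.update_of_ne (Ne.symm hp0)]; exact h.q0
    lam := ?_
    own_lt := ?_
    qmod := ?_
    qstart := ?_
    sep := ?_
    plt := by omega
    cur := ?_
    curOwn := ?_
    last := ?_
    pre := fun k hk => hst _ (hpre k hk) }
  · intro k hk0 hkm hk
    by_cases hkj : k = j
    · subst hkj
      simp only [Function.update_self]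
      exact ⟨by omega, by omega, hb, hst _ hsp, hst _ hsb⟩
    · rw [hst' k hkj] at hk
      have := h.bounds k hk0 hkm hk
      simp only [Function.update_of_ne hkj]
      exact ⟨this.1, this.2.1, this.2.2.1, hst _ this.2.2.2.1, hst _ this.2.2.2.2⟩
  · intro k k' hk0 hkm hk0' hkm' hk hk' hne i l
    by_cases hkj : k = j
    · have hkj' : k' ≠ j := fun h' => hne (hkj.trans h'.symm)
      subst hkj
      rw [hst' k' hkj'] at hk'
      simp only [Function.update_self, Function.update_of_ne hkj']
      intro k1 k2 k3 k4 k5 k6 k7 k8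
      exact hk' (hcl k' (by omega) (by omega))
    · rw [hst' k hkj] at hk
      simp only [Function.update_of_ne hkj]
      by_cases hkj' : k' = j
      · subst hkj'
        simp only [Function.update_self]
        intro k1 k2 k3 k4 k5 k6 k7 k8
        exact hk (hcl k (by omega) (by omega))
      · rw [hst' k' hkj'] at hk'
        simp only [Function.update_of_ne hkj']
        exact h.rect k k' hk0 hkm hk0' hkm' hk hk' hne i l
  · intro a' b' hab' hbm' hsa' hsb' hcl' z hz hzn
    by_cases haj : a' = j
    · have hb'b : b' = b := by
        by_contra hne
        rcases lt_or_gt_of_ne hne with h' | h'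
        · rw [hst' b' (by omega)] at hsb'
          exact hsb' (hcl b' (by omega) h')
        · exact hst b hsb (hcl' b (by omega) h')
      by_cases hz2 : z ∈ block s p' b
      · refine .inr (.inl ⟨j, by omega, by omega, by simp, .inl ?_⟩)
        simp only [Function.update_self]
        obtain ⟨i, ⟨hi1, hi2⟩, rfl⟩ := hz2
        refine ⟨mem_block hi1 ?_, by omega, by omega⟩
        by_contra h'
        exact hzn (mem_block (by omega) (by omega))
      · left
        intro u hu v hv
        exact hmod z hz hz2 u (block_mono (by omega) (by omega) hu) v
          (block_mono (by omega) (by omega) hv)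
    · rw [hst' a' haj] at hsa'
      by_cases hbj : b' = j
      · have : a' = p' := by
          by_contra hne
          exact hst p' hsp (hcl' p' (by omega) (by omega))
        left
        rw [this, hbj, hj, block_succ]
        rintro u rfl v rfl
        rfl
      · rw [hst' b' hbj] at hsb'
        rcases h.stable a' b' hab' hbm' hsa' hsb' (fun k hk1 hk2 => by
            by_contra hk
            exact hst k hk (hcl' k hk1 hk2)) z hz hzn with h' | ⟨k, hk0, hkm, hk1, -⟩ | h'
        · exact .inl h'
        · exact absurd hk1 (hno k hk0 hkm)
        · exact h'.elim
  · intro i hi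
    by_cases hip : i = p'
    · subst hip; simp only [Function.update_self]; omega
    · rw [Function.update_of_ne hip]; exact h.qlt i hi
  · intro i hi k hik hkq
    by_cases hip : i = p'
    · subst hip
      simp only [Function.update_self] at hkq ⊢
      rw [Function.update_of_ne (by omega), if_pos ⟨hik, hkq⟩]
      refine ⟨?_, le_rfl⟩
      have := (h.qlt k (by omega)).1
      by_contra h'
      exact (h.qstart k (by omega) (by omega)).1 (hcl k hik hkq)
    · rw [Function.update_of_ne hip] at hkq ⊢
      obtain ⟨k1, k2⟩ := h.lam i hi k hik hkq
      have hqs := h.qstart i hi (by omega)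
      constructor
      · by_cases hkp : k = p'
        · subst hkp
          simp only [Function.update_self]
          by_contra h'
          exact hqs.2.1 (hcl (q i) hkq (by omega))
        · rwa [Function.update_of_ne hkp]
      · split_ifs with hk
        · by_contra h'
          exact hqs.1 (hcl i (by omega) (by omega))
        · exact k2
  · intro i hi0 him
    split_ifs with hi'
    · simp only [Function.update_self]; exact hi'
    · rw [Function.update_of_ne (hownne i hi0 him)]
      exact h.own_lt i hi0 him
  · intro i hi
    by_cases hip : i = p'
    · subst hip
      simp only [Function.update_self]
      exact fun z hz hzn => hmod z hz hzn
    · rw [Function.update_of_ne hip]; exact h.qmod i hi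
  · intro i hi hq
    by_cases hip : i = p'
    · subst hip
      simp only [Function.update_self]
      exact ⟨hst _ hsp, hst _ hsb, by simp [hj]⟩
    · rw [Function.update_of_ne hip] at hq ⊢
      exact ⟨hst _ (h.qstart i hi hq).1, hst _ (h.qstart i hi hq).2.1,
        hst _ (h.qstart i hi hq).2.2⟩
  · intro c hc0 hcm hc U hU
    by_cases hcj : c = j
    · subst hcj
      rw [if_pos ⟨by omega, by omega⟩]
      simp only [Function.update_self]
      intro hUs hUp
      right
      intro u hu
      obtain ⟨i, ⟨hi1, hi2⟩, rfl⟩ := hUs hu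
      refine mem_block ?_ hi2
      rcases hi1.lt_or_eq with h' | rfl
      · omega
      · exact absurd hu hUp
    · rw [hst' c hcj] at hc
      have hcn : ¬ (p' < c ∧ c < b) := fun h' => hc (hcl c h'.1 h'.2)
      rw [if_neg hcn, Function.update_of_ne (hownne c hc0 hcm)]
      exact h.sep c hc0 hcm hc U hU
  · intro k hk0 hkm hk
    by_cases hkj : k = j
    · subst hkj
      simp only [Function.update_self]
      exact ⟨le_rfl, le_rfl⟩
    · rw [hst' k hkj] at hk
      exact absurd hk (hno k hk0 hkm)
  · intro i hi1 hi2
    simp only [Function.update_self] at hi2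
    rw [if_pos ⟨hi1, hi2⟩]
  · intro i hi hq
    by_cases hip : i = p'
    · omega
    · rw [Function.update_of_ne hip] at hq
      exact (h.last i hi hq).trans hpp

end Refine


/-! ### Refining a range by one element: the loop invariant -/

section RefineRange

variable {m : ℕ} {e : ℕ → ℕ → ℕ} {s st lo hi own q : ℕ → ℕ} {p : ℕ} {X : ℕ → ℕ → ℕ → Prop}

/-- The partition `s', st', lo', hi'` refines the partition `s, st, lo, hi`. -/
structure RefExt (s st lo hi s' st' lo' hi' : ℕ → ℕ) : Prop where
  keep : ∀ k, st k ≠ 0 → st' k = st k ∧ lo' k = lo k ∧ hi' k = hi k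
  new : ∀ k, st k = 0 → st' k = 0 ∨ st' k = 1
  blk : ∀ a b, st a ≠ 0 → st b ≠ 0 → block s' a b = block s a b

theorem RefExt.refl : RefExt s st lo hi s st lo hi :=
  ⟨fun _ _ => ⟨rfl, rfl, rfl⟩, fun _ h => .inl h, fun _ _ _ _ => rfl⟩

theorem RefExt.trans {s' st' lo' hi' s'' st'' lo'' hi'' : ℕ → ℕ}
    (h : RefExt s st lo hi s' st' lo' hi') (k : RefExt s' st' lo' hi' s'' st'' lo'' hi'') :
    RefExt s st lo hi s'' st'' lo'' hi'' := by
  have key : ∀ j, st j ≠ 0 → st' j ≠ 0 := fun j hj => by rw [(h.keep j hj).1]; exact hj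
  refine ⟨fun j hj => ?_, fun j hj => ?_, fun a b ha hb => ?_⟩
  · obtain ⟨h1, h2, h3⟩ := h.keep j hj
    obtain ⟨k1, k2, k3⟩ := k.keep j (key j hj)
    exact ⟨k1.trans h1, k2.trans h2, k3.trans h3⟩
  · rcases h.new j hj with h' | h'
    · exact k.new j h'
    · right; rw [(k.keep j (by omega)).1, h']
  · rw [k.blk a b (key a ha) (key b hb), h.blk a b ha hb]

/-- The invariant of the refinement of the range from `c` to `h` by the pivot `z`: the current
class starts at `a`, it does not end before `k`, and its positions below `r` are sorted by their
colour towards `z`. -/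
structure RefLoop (m : ℕ) (e : ℕ → ℕ → ℕ) (s₀ st₀ lo₀ hi₀ own q : ℕ → ℕ) (p c h z : ℕ)
    (X : ℕ → ℕ → ℕ → Prop) (k r a g : ℕ) (s st lo hi : ℕ → ℕ) : Prop where
  inv : RefInv m e s st lo hi own q p fun z' a' b' => X z' a' b' ∨ (z' = z ∧ a ≤ a' ∧ b' ≤ h)
  ext : RefExt s₀ st₀ lo₀ hi₀ s st lo hi
  out : ∀ i, ¬ (c ≤ i ∧ i < h) → s i = s₀ i
  hca : c ≤ a
  hag : a ≤ g
  hgr : g ≤ r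
  start : st a ≠ 0
  cls : ∀ j, a < j → j ≤ k → st j = 0
  zeros : ∀ i, a ≤ i → i < g → e (s i) z = 0
  ones : ∀ i, g ≤ i → i < r → e (s i) z = 1

variable {s₀ st₀ lo₀ hi₀ : ℕ → ℕ} {c h z k r a g : ℕ}

/-- In-place partitioning: an element of colour 0 is exchanged with the first element of colour 1 of
its class. -/
theorem RefLoop.swap (H : RefLoop m e s₀ st₀ lo₀ hi₀ own q p c h z X k k a g s st lo hi)
    (hkh : k < h) (hhm : h ≤ m) (h0 : e (s k) z = 0) :
    RefLoop m e s₀ st₀ lo₀ hi₀ own q p c h z X k (k + 1) a (g + 1)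
      (s ∘ Equiv.swap k g) st lo hi := by
  have hcl : ∀ j, st j ≠ 0 → (j ≤ k ↔ j ≤ g) := by
    intro j hj
    refine ⟨fun hjk => ?_, fun hjg => hjg.trans H.hgr⟩
    by_contra hjg
    exact hj (H.cls j (by have := H.hag; omega) hjk)
  have hgr := H.hgr
  have hag := H.hag
  have hca := H.hca
  refine ⟨H.inv.swap (by omega) (by omega) hcl, ?_, ?_, hca, by omega, by omega, H.start,
    H.cls, ?_, ?_⟩
  · refine H.ext.trans ⟨fun _ _ => ⟨rfl, rfl, rfl⟩, fun _ h => .inl h, fun a b ha hb => ?_⟩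
    exact block_swap (hcl a ha) (hcl b hb)
  · intro i hi
    simp only [Function.comp]
    rw [Equiv.swap_apply_of_ne_of_ne (by omega) (by omega)]
    exact H.out i hi
  · intro i h1 h2
    simp only [Function.comp]
    by_cases hig : i = g
    · subst hig; simpa using h0
    · rw [Equiv.swap_apply_of_ne_of_ne (by omega) hig]
      exact H.zeros i h1 (by omega)
  · intro i h1 h2
    simp only [Function.comp]
    by_cases hik : i = k
    · subst hik
      rw [Equiv.swap_apply_left]
      exact H.ones g le_rfl (by omega)
    · rw [Equiv.swap_apply_of_ne_of_ne hik (by omega)]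
      exact H.ones i (by omega) (by omega)

theorem RefLoop.skip (H : RefLoop m e s₀ st₀ lo₀ hi₀ own q p c h z X k k a g s st lo hi)
    (h1 : e (s k) z = 1) :
    RefLoop m e s₀ st₀ lo₀ hi₀ own q p c h z X k (k + 1) a g s st lo hi := by
  refine { H with hgr := by have := H.hgr; omega, ones := fun i hi1 hi2 => ?_ }
  by_cases hik : i = k
  · subst hik; exact h1
  · exact H.ones i hi1 (by omega)

theorem RefLoop.next (H : RefLoop m e s₀ st₀ lo₀ hi₀ own q p c h z X k (k + 1) a g s st lo hi)
    (h1 : st (k + 1) = 0) :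
    RefLoop m e s₀ st₀ lo₀ hi₀ own q p c h z X (k + 1) (k + 1) a g s st lo hi := by
  refine { H with cls := fun j hj1 hj2 => ?_ }
  by_cases hik : j = k + 1
  · subst hik; exact h1
  · exact H.cls j hj1 (by omega)

/-- The class ends and all its elements have the same colour towards `z`, so the debt for `z` on
this class is paid without a new boundary. -/
theorem RefLoop.close (H : RefLoop m e s₀ st₀ lo₀ hi₀ own q p c h z X k (k + 1) a g s st lo hi)
    (hak : a ≤ k) (h1 : st (k + 1) ≠ 0) (hg : g = a ∨ g = k + 1) :
    RefLoop m e s₀ st₀ lo₀ hi₀ own q p c h z X (k + 1) (k + 1) (k + 1) (k + 1) s st lo hi := by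
  have hca := H.hca
  refine ⟨H.inv.weaken ?_, H.ext, H.out, by omega, le_rfl, le_rfl, h1, by omega, by omega,
    by omega⟩
  rintro a' b' hab hb hsa hsb hcl z' hz' (hX | ⟨rfl, h2, h3⟩)
  · exact .inr (.inl hX)
  by_cases ha' : k + 1 ≤ a'
  · exact .inr (.inr ⟨rfl, ha', h3⟩)
  left
  have haa : a' = a := by
    by_contra hne
    exact hsa (H.cls a' (by omega) (by omega))
  subst haa
  have hbk : b' ≤ k + 1 := by
    by_contra hlt
    exact h1 (hcl (k + 1) (by omega) (by omega))
  rintro _ ⟨i, ⟨hi1, hi2⟩, rfl⟩ _ ⟨j, ⟨hj1, hj2⟩, rfl⟩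
  rcases hg with hg | hg
  · rw [H.ones i (by omega) (by omega), H.ones j (by omega) (by omega)]
  · rw [H.zeros i (by omega) (by omega), H.zeros j (by omega) (by omega)]

/-- Both colours occur, so the class is split at `g`. Each half is homogeneous towards `z`, and the
debt for `z` remains only from `k + 1` on. -/
theorem RefLoop.split (H : RefLoop m e s₀ st₀ lo₀ hi₀ own q p c h z X k (k + 1) a g s st lo hi)
    (hX : ∀ z a b a' b', a ≤ a' → b' ≤ b → X z a b → X z a' b')
    (hkh : k < h) (hhm : h ≤ m) (h1 : st (k + 1) ≠ 0) (hag : a < g) (hgk : g < k + 1)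
    (hc0 : st₀ c ≠ 0) (hh0 : st₀ h ≠ 0) (hpc : p ≤ c) (hhq : h ≤ q p) (hz : z < m)
    (hzn : z ∉ block s₀ c h) :
    RefLoop m e s₀ st₀ lo₀ hi₀ own q p c h z X (k + 1) (k + 1) (k + 1) (k + 1)
      s (Function.update st g 1) (Function.update lo g a) (Function.update hi g (k + 1)) := by
  have hca := H.hca
  have hsg : st g = 0 := H.cls g hag (by omega)
  have hst : ∀ k, st k ≠ 0 → Function.update st g 1 k ≠ 0 := by
    intro k hk
    rw [Function.update_apply]; split_ifs <;> omega
  have hzn' : z ∉ block s a (k + 1) := by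
    intro h'
    rw [← H.ext.blk c h hc0 hh0] at hzn
    exact hzn (block_mono hca (by omega) h')
  have hones : ∀ i, g ≤ i → i < k + 1 → e (s i) z ≠ 0 := fun i hi1 hi2 => by
    rw [H.ones i hi1 hi2]; omega
  have hspl := H.inv.split (a := a) (g := g) (b := k + 1) (z := z) (by
      rintro z' a1 b1 a2 b2 ha hb (h' | ⟨h', h2, h3⟩)
      · exact .inl (hX _ _ _ _ _ ha hb h')
      · exact .inr ⟨h', by omega, by omega⟩) hag hgk (by omega) H.start h1
    (fun j hj1 hj2 => H.cls j hj1 (by omega)) (by omega) (by omega) hz hzn' H.zeros hones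
  refine ⟨hspl.weaken ?_, ?_, H.out, by omega, le_rfl, le_rfl, hst _ h1, by omega, by omega,
    by omega⟩
  · rintro a' b' hab hb hsa hsb hcl z' hz' (hX | ⟨rfl, h2, h3⟩)
    · exact .inr (.inl hX)
    by_cases ha' : k + 1 ≤ a'
    · exact .inr (.inr ⟨rfl, ha', h3⟩)
    left
    have hbk : b' ≤ k + 1 := by
      by_contra hlt
      exact hst _ h1 (hcl (k + 1) (by omega) (by omega))
    have hg0 : Function.update st g 1 g ≠ 0 := by simp
    have hcase : (a' = a ∧ b' ≤ g) ∨ a' = g := by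
      by_cases hag' : a' = g
      · exact .inr hag'
      · left
        rw [Function.update_of_ne hag'] at hsa
        have haa : a' = a := by
          by_contra hne
          exact hsa (H.cls a' (by omega) (by omega))
        refine ⟨haa, ?_⟩
        by_contra hlt
        exact hg0 (hcl g (by omega) (by omega))
    rintro _ ⟨i, ⟨hi1, hi2⟩, rfl⟩ _ ⟨j, ⟨hj1, hj2⟩, rfl⟩
    rcases hcase with ⟨hg, hg'⟩ | hg
    · rw [H.zeros i (by omega) (by omega), H.zeros j (by omega) (by omega)]
    · rw [H.ones i (by omega) (by omega), H.ones j (by omega) (by omega)]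
  · refine H.ext.trans ⟨fun j hj => ?_, fun j hj => ?_, fun _ _ _ _ => rfl⟩
    · have : j ≠ g := by rintro rfl; exact hj hsg
      simp [this]
    · rw [Function.update_apply]
      split_ifs
      · exact .inr rfl
      · exact .inl hj

end RefineRange

/-! ### The programs for the refinement of ranges -/

namespace WordRAM

/-- Split the classes in the range from `c` to `h` by the element in variable `10`. -/
def refineRange (c h : Expr) : Cmd :=
  -- Arrays 4 to 8 hold the colour table, `s`, `st`, `lo` and `hi`. Variable 11 is the start of the
  -- current class, 12 the end of its elements of colour 0 seen so far, 13 the position being read.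
  .seq (.assign 11 c) (.seq (.assign 12 c) (forTo 13 c h
    (.seq
      (.ite (.get 4 (.bin .add (.bin .mul (.get 5 (.var 13)) (.var 2)) (.var 10)))
        .skip
        (.seq (.assign 14 (.get 5 (.var 12))) (.seq (.put 5 (.var 12) (.get 5 (.var 13)))
          (.seq (.put 5 (.var 13) (.var 14)) (.assign 12 (.bin .add (.var 12) (.lit 1)))))))
      (.ite (.get 6 (.bin .add (.var 13) (.lit 1)))
        (.seq
          (.ite (.bin .mul (.bin .lt (.var 11) (.var 12))
              (.bin .lt (.var 12) (.bin .add (.var 13) (.lit 1))))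
            (.seq (.put 6 (.var 12) (.lit 1)) (.seq (.put 7 (.var 12) (.var 11))
              (.put 8 (.var 12) (.bin .add (.var 13) (.lit 1)))))
            .skip)
          (.seq (.assign 11 (.bin .add (.var 13) (.lit 1)))
            (.assign 12 (.bin .add (.var 13) (.lit 1)))))
        .skip))))

/-- The memory holds the data of a partition. -/
def HoldsRef (σ : State) (s st lo hi : ℕ → ℕ) : Prop :=
  σ.arr 5 = s ∧ σ.arr 6 = st ∧ σ.arr 7 = lo ∧ σ.arr 8 = hi

theorem update_eq_swap (s : ℕ → ℕ) (g k : ℕ) :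
    Function.update (Function.update s g (s k)) k (s g) = s ∘ Equiv.swap k g := by
  funext i
  simp only [Function.comp, Function.update_apply, Equiv.swap_apply_def]
  split_ifs <;> simp_all

theorem refineRange_spec {W m : ℕ} {E s st lo hi own q : ℕ → ℕ} {p : ℕ}
    {X : ℕ → ℕ → ℕ → Prop} {c h z : ℕ} {ce he : Expr} {σ : State}
    (hW : m + 1 ≤ W) (hm : σ.var 2 = m) (hE : σ.arr 4 = E)
    (h01 : ∀ u < m, ∀ x < m, E (u * m + x) ≤ 1) (hz : σ.var 10 = z)
    (hce : ce.eval σ = c) (hce' : ce.eval (σ.setVar 11 c) = c)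
    (hce'' : ce.eval ((σ.setVar 11 c).setVar 12 c) = c)
    (hhe : ∀ τ, Frame (refineRange ce he) σ τ → he.eval τ = h)
    (hσ : HoldsRef σ s st lo hi)
    (hX : ∀ z a b a' b', a ≤ a' → b' ≤ b → X z a b → X z a' b')
    (hI : RefInv m (fun u x => E (u * m + x)) s st lo hi own q p
      fun z' a' b' => X z' a' b' ∨ (z' = z ∧ c ≤ a' ∧ b' ≤ h))
    (hch : c < h) (hhm : h ≤ m) (hc0 : st c ≠ 0) (hh0 : st h ≠ 0) (hpc : p ≤ c) (hhq : h ≤ q p)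
    (hzm : z < m) (hzn : z ∉ block s c h) :
    Runs W (refineRange ce he) σ fun t τ =>
      t ≤ (h - c) * (he.cost + 100) + 3 * ce.cost + he.cost + 20 ∧
      ∃ s' st' lo' hi', HoldsRef τ s' st' lo' hi' ∧
        RefInv m (fun u x => E (u * m + x)) s' st' lo' hi' own q p X ∧
        RefExt s st lo hi s' st' lo' hi' ∧ (∀ i, ¬ (c ≤ i ∧ i < h) → s' i = s i) := by
  rw [refineRange, runs_seq, runs_assign]
  refine ⟨by omega, ?_⟩
  rw [runs_seq, runs_assign, hce, hce']
  refine ⟨by omega, ?_⟩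
  refine runs_forTo c h 90 (fun k τ => ∃ s' st' lo' hi' a g, HoldsRef τ s' st' lo' hi' ∧
    τ.var 11 = a ∧ τ.var 12 = g ∧
    RefLoop m (fun u x => E (u * m + x)) s st lo hi own q p c h z X k k a g s' st' lo' hi')
    hce'' hch.le (by omega) rfl ?_ ?_ ?_ ?_
  · intro τ hF
    apply hhe
    constructor
    · intro v hv
      have h1 : v ≠ 11 := by rintro rfl; simp [refineRange, Cmd.writesVar] at hv
      have h2 : v ≠ 12 := by rintro rfl; simp [refineRange, Cmd.writesVar] at hv
      rw [hF.var v ?_]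
      · simp [State.setVar, h1, h2]
      · simp only [refineRange, Cmd.writesVar, Bool.or_eq_false_iff] at hv
        exact hv.2.2
    · intro v hv
      rw [hF.arr v ?_]
      · rfl
      · simp only [refineRange, Cmd.writesArr, Bool.or_eq_false_iff] at hv
        exact hv.2.2
  · refine ⟨s, st, lo, hi, c, c, hσ, by simp [State.setVar], by simp [State.setVar], ?_⟩
    exact ⟨hI, RefExt.refl, fun _ _ => rfl, le_rfl, le_rfl, le_rfl, hc0, by omega, by omega,
      by omega⟩
  · rintro k τ hck hkh hk hF ⟨s', st', lo', hi', a, g, ⟨hs, hst, hlo, hhi⟩, ha, hg, H⟩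
    have hEτ : τ.arr 4 = E := by
      rw [hF.arr 4 rfl]; exact hE
    have hmτ : τ.var 2 = m := by
      rw [hF.var 2 rfl]; exact hm
    have hzτ : τ.var 10 = z := by
      rw [hF.var 10 rfl]; exact hz
    have hak : a ≤ k := H.hag.trans H.hgr
    have hgr := H.hgr
    have hag := H.hag
    have hsk := H.inv.maps k (by omega)
    have hsg := H.inv.maps g (by omega)
    -- after the first conditional
    have key : ∀ ρ s1 g1 t, ρ.var 2 = m → ρ.var 13 = k → ρ.var 11 = a → ρ.var 12 = g1 →
        HoldsRef ρ s1 st' lo' hi' → t ≤ 40 →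
        RefLoop m (fun u x => E (u * m + x)) s st lo hi own q p c h z X k (k + 1) a g1
          s1 st' lo' hi' →
        Runs W (.ite (.get 6 (.bin .add (.var 13) (.lit 1)))
          (.seq
            (.ite (.bin .mul (.bin .lt (.var 11) (.var 12))
                (.bin .lt (.var 12) (.bin .add (.var 13) (.lit 1))))
              (.seq (.put 6 (.var 12) (.lit 1)) (.seq (.put 7 (.var 12) (.var 11))
                (.put 8 (.var 12) (.bin .add (.var 13) (.lit 1)))))
              .skip)
            (.seq (.assign 11 (.bin .add (.var 13) (.lit 1)))
              (.assign 12 (.bin .add (.var 13) (.lit 1)))))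
          .skip) ρ fun t' τ' => t + t' ≤ 90 ∧ ∃ s' st' lo' hi' a g,
            HoldsRef (τ'.setVar 13 (k + 1)) s' st' lo' hi' ∧
            (τ'.setVar 13 (k + 1)).var 11 = a ∧ (τ'.setVar 13 (k + 1)).var 12 = g ∧
            RefLoop m (fun u x => E (u * m + x)) s st lo hi own q p c h z X (k + 1) (k + 1) a g
              s' st' lo' hi' := by
      rintro ρ s1 g1 t hm1 hk1 ha1 hg1 ⟨hs1, hst1, hlo1, hhi1⟩ ht H1
      rw [runs_ite]
      simp only [Expr.eval, BinOp.eval, hk1, hst1]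
      constructor
      · intro hne
        rw [runs_seq, runs_ite]
        simp only [Expr.eval, BinOp.eval, hk1, ha1, hg1]
        constructor
        · intro hne2
          have h2 : a < g1 ∧ g1 < k + 1 := by
            by_contra h2
            apply hne2
            by_cases h3 : a < g1
            · have : ¬ g1 < k + 1 := fun h4 => h2 ⟨h3, h4⟩
              simp [this]
            · simp [h3]
          simp only [runs_seq, runs_put, runs_assign]
          simp [Expr.eval, BinOp.eval, Expr.cost, hk1, ha1, hg1]
          refine ⟨by omega, by omega, by omega, by omega, ?_⟩
          refine ⟨s1, Function.update st' g1 1, Function.update lo' g1 a,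
            Function.update hi' g1 (k + 1), ?_, ?_⟩
          · simp [HoldsRef, hs1, hst1, hlo1, hhi1]
          · exact H1.split hX hkh hhm hne h2.1 h2.2 hc0 hh0 hpc hhq hzm hzn
        · intro hne2
          have h2 : g1 = a ∨ g1 = k + 1 := by
            by_contra h2
            have h3 : a < g1 := by have := H1.hag; omega
            have h4 : g1 < k + 1 := by have := H1.hgr; omega
            simp [h3, h4] at hne2
          simp only [runs_seq, runs_skip, runs_assign]
          simp [Expr.eval, BinOp.eval, Expr.cost, hk1]
          refine ⟨by omega, by omega, ?_⟩
          refine ⟨s1, st', lo', hi', ?_, ?_⟩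
          · simp [HoldsRef, hs1, hst1, hlo1, hhi1]
          · exact H1.close hak hne h2
      · intro heq
        rw [runs_skip]
        simp only [Expr.cost]
        refine ⟨by omega, s1, st', lo', hi', a, g1, ?_, ?_, ?_, H1.next heq⟩
        · simp [HoldsRef, State.setVar, hs1, hst1, hlo1, hhi1]
        · simp [State.setVar, ha1]
        · simp [State.setVar, hg1]
    have hEk : (Expr.get 4 (.bin .add (.bin .mul (.get 5 (.var 13)) (.var 2)) (.var 10))).eval τ =
        E (s' k * m + z) := by
      simp [Expr.eval, BinOp.eval, hs, hk, hmτ, hzτ, hEτ]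
    rw [runs_seq, runs_ite, hEk]
    constructor
    · intro hne
      rw [runs_skip]
      refine key τ s' g _ hmτ hk ha hg ⟨hs, hst, hlo, hhi⟩ (by simp [Expr.cost]) (H.skip ?_)
      have := h01 (s' k) hsk z hzm
      change E (s' k * m + z) = 1
      omega
    · intro heq
      simp only [runs_seq, runs_put, runs_assign]
      simp only [Expr.eval, BinOp.eval, Expr.cost, State.setVar_var, State.setVar_arr,
        State.setArr_var, hk, hg, hs, reduceIte, Nat.reduceEqDiff]
      refine ⟨by omega, by omega, by omega, by omega, ?_⟩
      refine Runs.mono (key _ (s' ∘ Equiv.swap k g) (g + 1) 40 ?_ ?_ ?_ ?_ ?_ (by omega)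
        (H.swap hkh hhm heq)) fun t' τ' h' => ⟨by omega, h'.2⟩
      · simp [hmτ]
      · simp [hk]
      · simp [ha]
      · simp
      · refine ⟨?_, ?_, ?_, ?_⟩
        · simpa [hs] using update_eq_swap s' g k
        · simp [hst]
        · simp [hlo]
        · simp [hhi]
  · rintro t τ ht hF - ⟨s', st', lo', hi', a, g, hH, ha, hg, H⟩
    refine ⟨?_, s', st', lo', hi', hH, ?_, H.ext, H.out⟩
    · have : (h - c) * (90 + he.cost + 7) ≤ (h - c) * (he.cost + 100) :=
        Nat.mul_le_mul_left _ (by omega)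
      omega
    · have hah : a = h := by
        by_contra hne
        have h1 := H.hag.trans H.hgr
        have h2 : st' h ≠ 0 := by rw [(H.ext.keep h hh0).1]; exact hh0
        exact h2 (H.cls h (by omega) le_rfl)
      refine H.inv.weaken ?_
      rintro a' b' hab - - - - z' - (h' | ⟨-, h2, h3⟩)
      · exact .inr h'
      · omega

end WordRAM


namespace WordRAM

/-- Find the first `i` in a range with a property, and store it in `v`, or else `0`. -/
def findFirst (v i : ℕ) (lo hi c : Expr) : Cmd :=
  .seq (.assign v (.lit 0)) (forTo i lo hi
    (.ite (.bin .mul (.bin .eq (.var v) (.lit 0)) c) (.assign v (.var i)) .skip))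

/-- The value 0 means failure, so the range must start above 0. The loop runs to its end; the test
whether `v` is still 0 freezes the first hit. -/
theorem runs_findFirst {W v i : ℕ} {lo hi c : Expr} {σ : State} (L N : ℕ) (P : ℕ → Prop)
    (hvi : v ≠ i) (hL : lo.eval (σ.setVar v 0) = L) (hL0 : 0 < L) (hLN : L ≤ N) (hNW : N ≤ W)
    (hN : ∀ τ, Frame (findFirst v i lo hi c) σ τ → hi.eval τ = N)
    (hc : ∀ τ, Frame (findFirst v i lo hi c) σ τ → L ≤ τ.var i → τ.var i < N →
      (c.eval τ ≠ 0 ↔ P (τ.var i)))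
    {Q : ℕ → State → Prop}
    (hQ : ∀ t τ, t ≤ (N - L) * (c.cost + hi.cost + 20) + lo.cost + hi.cost + 10 →
      Frame (findFirst v i lo hi c) σ τ →
      (τ.var v = 0 ∧ ∀ k, L ≤ k → k < N → ¬ P k) ∨
        (L ≤ τ.var v ∧ τ.var v < N ∧ P (τ.var v) ∧ ∀ k, L ≤ k → k < τ.var v → ¬ P k) → Q t τ) :
    Runs W (findFirst v i lo hi c) σ Q := by
  have hfr : ∀ τ, Frame (forTo i lo hi (.ite (.bin .mul (.bin .eq (.var v) (.lit 0)) c)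
      (.assign v (.var i)) .skip)) (σ.setVar v 0) τ → Frame (findFirst v i lo hi c) σ τ := by
    intro τ h
    refine ⟨fun x hx => ?_, fun a ha => ?_⟩
    · have hxv : x ≠ v := by rintro rfl; simp [findFirst, Cmd.writesVar] at hx
      rw [h.var x (by simp only [findFirst, Cmd.writesVar, Bool.or_eq_false_iff] at hx; exact hx.2)]
      simp [hxv]
    · rw [h.arr a (by simp only [findFirst, Cmd.writesArr, Bool.or_eq_false_iff] at ha; exact ha.2)]
      simp
  rw [findFirst, runs_seq, runs_assign]
  refine ⟨by simp [Expr.eval], ?_⟩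
  refine runs_forTo L N (c.cost + 13) (fun k τ =>
    (τ.var v = 0 ∧ ∀ k', L ≤ k' → k' < k → ¬ P k') ∨
        (L ≤ τ.var v ∧ τ.var v < k ∧ P (τ.var v) ∧ ∀ k, L ≤ k → k < τ.var v → ¬ P k))
    hL hLN hNW (by simp [Cmd.writesVar, hvi]) (fun τ h => hN τ (hfr τ h)) ?_ ?_ ?_
  · left
    simp [hvi]
    omega
  · intro k τ hLk hkN hk hF hI
    have hc' := hc τ (hfr τ hF) (by omega) (by omega)
    rw [hk] at hc'
    rw [runs_ite, runs_assign, runs_skip]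
    have hev : (Expr.bin .mul (.bin .eq (.var v) (.lit 0)) c).eval τ ≠ 0 ↔ τ.var v = 0 ∧ P k := by
      rw [← hc']
      by_cases h0 : τ.var v = 0 <;> simp [Expr.eval, BinOp.eval, h0]
    constructor
    · intro hne
      obtain ⟨h1, h2⟩ := hev.1 hne
      simp only [Expr.eval, Expr.cost]
      refine ⟨by omega, by omega, ?_⟩
      simp only [State.setVar_var, hvi, reduceIte, hk]
      right
      refine ⟨hLk, by omega, h2, fun k' hk1 hk2 => ?_⟩
      rcases hI with hI | hI
      · exact hI.2 k' hk1 hk2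
      · omega
    · intro heq
      simp only [Expr.cost]
      refine ⟨by omega, ?_⟩
      simp only [State.setVar_var, hvi, reduceIte]
      have hn : ¬ (τ.var v = 0 ∧ P k) := fun h => hev.2 h heq
      rcases hI with hI | hI
      · left
        refine ⟨hI.1, fun k' hk1 hk2 hP => ?_⟩
        by_cases hkk : k' = k
        · subst hkk; exact hn ⟨hI.1, hP⟩
        · exact hI.2 k' hk1 (by omega) hP
      · right
        exact ⟨hI.1, by omega, hI.2.2⟩
  · intro t τ ht hF _ hI
    refine hQ _ τ ?_ (hfr τ hF) hI
    have : (N - L) * (c.cost + 13 + hi.cost + 7) = (N - L) * (c.cost + hi.cost + 20) := by ring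
    simp only [Expr.cost]
    omega

/-- Refine the range from `c` to `h` by the elements at the positions from `a` to `b`; the bounds
are variables. -/
def pivotLoop (a b c h : ℕ) : Cmd :=
  forTo 18 (.var a) (.var b) (.seq (.assign 10 (.get 5 (.var 18))) (refineRange (.var c) (.var h)))

/-- The refining positions are disjoint from the refined range, so they are never moved and the
`k`-th pivot is the original `s k`. -/
theorem pivotLoop_spec {W m : ℕ} {E s st lo hi own q : ℕ → ℕ} {p : ℕ}
    {X : ℕ → ℕ → ℕ → Prop} {a b c h : ℕ} {av bv cv hv : ℕ} {σ : State}
    (hW : m + 1 ≤ W) (hm : σ.var 2 = m) (hE : σ.arr 4 = E)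
    (h01 : ∀ u < m, ∀ x < m, E (u * m + x) ≤ 1)
    (ha : σ.var av = a) (hb : σ.var bv = b) (hc : σ.var cv = c) (hh : σ.var hv = h)
    (hav : av ≠ 18) (hbv : (pivotLoop av bv cv hv).writesVar bv = false)
    (hcv : (pivotLoop av bv cv hv).writesVar cv = false)
    (hhv : (pivotLoop av bv cv hv).writesVar hv = false)
    (hσ : HoldsRef σ s st lo hi)
    (hX : ∀ z a b a' b', a ≤ a' → b' ≤ b → X z a b → X z a' b')
    (hI : RefInv m (fun u x => E (u * m + x)) s st lo hi own q p
      fun z' a' b' => X z' a' b' ∨ (z' ∈ block s a b ∧ c ≤ a' ∧ b' ≤ h))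
    (hab : a ≤ b) (hbm : b ≤ m) (hdis : b ≤ c ∨ h ≤ a)
    (hch : c < h) (hhm : h ≤ m) (hc0 : st c ≠ 0) (hh0 : st h ≠ 0) (hpc : p ≤ c) (hhq : h ≤ q p) :
    Runs W (pivotLoop av bv cv hv) σ fun t τ =>
      t ≤ (b - a) * ((h - c) * 150) + 10 ∧
      ∃ s' st' lo' hi', HoldsRef τ s' st' lo' hi' ∧
        RefInv m (fun u x => E (u * m + x)) s' st' lo' hi' own q p X ∧
        RefExt s st lo hi s' st' lo' hi' := by
  have hcv' : cv ≠ 10 ∧ cv ≠ 11 ∧ cv ≠ 12 ∧ cv ≠ 13 ∧ cv ≠ 18 := by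
    refine ⟨?_, ?_, ?_, ?_, ?_⟩ <;> rintro rfl <;> simp [pivotLoop, forTo, refineRange, Cmd.writesVar] at hcv
  have hhv' : hv ≠ 10 ∧ hv ≠ 11 ∧ hv ≠ 12 ∧ hv ≠ 13 := by
    refine ⟨?_, ?_, ?_, ?_⟩ <;> rintro rfl <;> simp [pivotLoop, forTo, refineRange, Cmd.writesVar] at hhv
  refine runs_forTo a b ((h - c) * 101 + 40) (fun k τ => ∃ s' st' lo' hi',
    HoldsRef τ s' st' lo' hi' ∧ RefExt s st lo hi s' st' lo' hi' ∧
      (∀ i, ¬ (c ≤ i ∧ i < h) → s' i = s i) ∧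
      RefInv m (fun u x => E (u * m + x)) s' st' lo' hi' own q p
        fun z' a' b' => X z' a' b' ∨ (z' ∈ block s k b ∧ c ≤ a' ∧ b' ≤ h))
    (by simpa [Expr.eval] using ha) hab (by omega) rfl (fun τ hF => ?_) ?_ ?_ ?_
  · simp only [Expr.eval]
    rw [hF.var bv hbv, hb]
  · exact ⟨s, st, lo, hi, hσ, RefExt.refl, fun _ _ => rfl, hI⟩
  · rintro k τ hak hkb hk hF ⟨s', st', lo', hi', ⟨hs, hst, hlo, hhi⟩, hext, hout, H⟩
    have hsk : s' k = s k := hout k (by omega)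
    have hskm := H.maps k (by omega)
    rw [runs_seq, runs_assign]
    simp only [Expr.eval, hk, hs]
    refine ⟨by omega, ?_⟩
    have hst0 : ∀ j, st j ≠ 0 → st' j ≠ 0 := fun j hj => by rw [(hext.keep j hj).1]; exact hj
    refine Runs.mono (refineRange_spec (m := m) (E := E) (s := s') (st := st') (lo := lo')
      (hi := hi') (own := own) (q := q) (p := p) (c := c) (h := h) (z := s' k)
      (X := fun z' a' b' => X z' a' b' ∨ (z' ∈ block s (k + 1) b ∧ c ≤ a' ∧ b' ≤ h))
      hW ?_ ?_ h01 ?_ ?_ ?_ ?_ ?_ ?_ ?_ ?_ hch hhm (hst0 c hc0) (hst0 h hh0) hpc hhq hskm ?_) ?_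
    · simp; rw [hF.var 2 rfl, hm]
    · simp; rw [hF.arr 4 rfl, hE]
    · simp
    · simp [Expr.eval, hcv']; rw [hF.var cv hcv, hc]
    · simp [Expr.eval, hcv']; rw [hF.var cv hcv, hc]
    · simp [Expr.eval, hcv']; rw [hF.var cv hcv, hc]
    · intro ρ hρ
      simp only [Expr.eval]
      rw [hρ.var hv ?_]
      · simp [hhv']; rw [hF.var hv hhv, hh]
      · rw [pivotLoop, writesVar_forTo] at hhv
        simp only [Cmd.writesVar, Bool.or_eq_false_iff] at hhv
        exact hhv.2.1.2
    · exact ⟨hs, hst, hlo, hhi⟩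
    · rintro z a1 b1 a2 b2 h1 h2 (h' | ⟨h', h3, h4⟩)
      · exact .inl (hX _ _ _ _ _ h1 h2 h')
      · exact .inr ⟨h', by omega, by omega⟩
    · refine H.weaken ?_
      rintro a1 b1 - - - - - z hz (h' | ⟨⟨i, ⟨hi1, hi2⟩, rfl⟩, h3⟩)
      · exact .inr (.inl (.inl h'))
      · right
        by_cases hik : i = k
        · subst hik; exact .inr ⟨hsk.symm, h3⟩
        · exact .inl (.inr ⟨mem_block (by omega) hi2, h3⟩)
    · rw [H.mem_block_iff hhm (by omega)]
      omega
    · rintro t ρ ⟨ht, s1, st1, lo1, hi1, hH1, hI1, hext1, hout1⟩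
      simp only [Expr.cost] at ht ⊢
      refine ⟨?_, s1, st1, lo1, hi1, ?_, hext.trans hext1, fun i hi => ?_, hI1⟩
      · have : (h - c) * (1 + 100) = (h - c) * 101 := by ring
        omega
      · simpa [HoldsRef] using hH1
      · rw [hout1 i hi, hout i hi]
  · rintro t τ ht hF - ⟨s', st', lo', hi', hH, hext, -, hI'⟩
    refine ⟨?_, s', st', lo', hi', hH, ?_, hext⟩
    · refine ht.trans ?_
      simp only [Expr.cost]
      have : (b - a) * ((h - c) * 101 + 40 + 1 + 7) ≤ (b - a) * ((h - c) * 150) :=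
        Nat.mul_le_mul_left _ (by omega)
      omega
    · refine hI'.weaken ?_
      rintro a1 b1 - - - - - z hz (h' | ⟨⟨i, ⟨hi1, hi2⟩, rfl⟩, h3⟩)
      · exact .inr h'
      · omega

/-- Process the boundary in variable `15`. -/
def processTask : Cmd :=
  .seq (.put 6 (.var 15) (.lit 2)) (.seq (.assign 16 (.get 7 (.var 15)))
    (.seq (.assign 17 (.get 8 (.var 15)))
      (.seq (pivotLoop 16 15 15 17) (pivotLoop 15 17 16 15))))

/-- The left side refines the right one and then conversely. Both passes cost a constant times the
area of the rectangle of `j`. -/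
theorem processTask_spec {W m : ℕ} {E s st lo hi own q : ℕ → ℕ} {p j : ℕ} {σ : State}
    (hW : m + 2 ≤ W) (hm : σ.var 2 = m) (hE : σ.arr 4 = E)
    (h01 : ∀ u < m, ∀ x < m, E (u * m + x) ≤ 1)
    (hj : σ.var 15 = j) (hσ : HoldsRef σ s st lo hi)
    (hI : RefInv m (fun u x => E (u * m + x)) s st lo hi own q p fun _ _ _ => False)
    (hj0 : 0 < j) (hjm : j < m) (hj1 : st j = 1) :
    Runs W processTask σ fun t τ =>
      t ≤ (j - lo j) * (hi j - j) * 300 + 40 ∧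
      ∃ s' st' lo' hi', HoldsRef τ s' st' lo' hi' ∧
        RefInv m (fun u x => E (u * m + x)) s' st' lo' hi' own q p (fun _ _ _ => False) ∧
        RefExt s (Function.update st j 2) lo hi s' st' lo' hi' := by
  have hjne : st j ≠ 0 := by omega
  obtain ⟨b1, b2, b3, b4, b5⟩ := hI.bounds j hj0 hjm hjne
  obtain ⟨c1, c2⟩ := hI.cur j hj0 hjm hj1
  have hI1 := hI.begin_task hjne
  have hne : ∀ k, st k ≠ 0 → Function.update st j 2 k ≠ 0 := by
    intro k hk
    rw [Function.update_apply]; split_ifs <;> omega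
  obtain ⟨hs, hst, hlo, hhi⟩ := hσ
  simp only [processTask, runs_seq, runs_put, runs_assign]
  simp only [Expr.eval, Expr.cost, State.setArr_arr, State.setVar_arr, State.setArr_var,
    State.setVar_var, Nat.reduceEqDiff, reduceIte, hj, hst, hlo, hhi]
  refine ⟨by omega, by omega, by omega, ?_⟩
  refine Runs.mono (Runs.frame (pivotLoop_spec (m := m) (E := E) (s := s) (st := Function.update st j 2)
    (lo := lo) (hi := hi) (own := own) (q := q) (p := p) (a := lo j) (b := j) (c := j) (h := hi j)
    (X := fun z a b => z ∈ block s j (hi j) ∧ lo j ≤ a ∧ b ≤ j)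
    (by omega) ?_ ?_ h01 ?_ ?_ ?_ ?_ (by decide) rfl rfl rfl ?_ ?_ ?_ b1.le hjm.le (by omega) b2 b3
    (hne j hjne) (hne _ b5) (by omega) c2)) ?_
  · simp [hm]
  · simp [hE]
  · simp
  · simp [hj]
  · simp [hj]
  · simp
  · simp [HoldsRef, hs, hst, hlo, hhi]
  · rintro z a b a' b' ha hb ⟨h1, h2, h3⟩
    exact ⟨h1, by omega, by omega⟩
  · refine hI1.weaken ?_
    rintro a b - - - - - z - (h | h)
    · exact .inr (.inr h)
    · exact .inr (.inl h)
  rintro t ρ ⟨⟨ht, s', st', lo', hi', hH, hI', hext⟩, hF⟩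
  -- The first pass permutes the right side but keeps its set of elements, so the second pass still
  -- uses the scheduled pivots.
  have hblk : block s' j (hi j) = block s j (hi j) := hext.blk _ _ (hne j hjne) (hne _ b5)
  have hne' : ∀ k, st k ≠ 0 → st' k ≠ 0 := fun k hk => by
    rw [(hext.keep k (hne k hk)).1]; exact hne k hk
  refine Runs.mono (pivotLoop_spec (m := m) (E := E) (s := s') (st := st')
    (lo := lo') (hi := hi') (own := own) (q := q) (p := p) (a := j) (b := hi j) (c := lo j) (h := j)
    (X := fun _ _ _ => False)
    (by omega) ?_ ?_ h01 ?_ ?_ ?_ ?_ (by decide) rfl rfl rfl hH ?_ ?_ b2.le b3 (.inr le_rfl) b1 hjm.le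
    (hne' _ b4) (hne' j hjne) c1 (by omega)) ?_
  · rw [hF.var 2 rfl]; simp [hm]
  · rw [hF.arr 4 rfl]; simp [hE]
  · rw [hF.var 15 rfl]; simp [hj]
  · rw [hF.var 17 rfl]; simp
  · rw [hF.var 16 rfl]; simp
  · rw [hF.var 15 rfl]; simp [hj]
  · rintro z a b a' b' - - ⟨⟩
  · rwa [hblk, show (fun z' a' b' => False ∨ z' ∈ block s j (hi j) ∧ lo j ≤ a' ∧ b' ≤ j) =
      fun z' a' b' => z' ∈ block s j (hi j) ∧ lo j ≤ a' ∧ b' ≤ j by simp]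
  rintro t' τ ⟨ht', s2, st2, lo2, hi2, hH2, hI2, hext2⟩
  refine ⟨?_, s2, st2, lo2, hi2, hH2, hI2, hext.trans hext2⟩
  have k1 : (j - lo j) * ((hi j - j) * 150) = (j - lo j) * (hi j - j) * 150 := by ring
  have k2 : (hi j - j) * ((j - lo j) * 150) = (j - lo j) * (hi j - j) * 150 := by ring
  have k3 : (j - lo j) * (hi j - j) * 300 = (j - lo j) * (hi j - j) * 150 + (j - lo j) * (hi j - j) * 150 := by ring
  omega

end WordRAM


/-! ### Partition refinement as a whole and its quadratic time bound -/

namespace WordRAM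

theorem Expr.eval_eq {σ : State} {e f : Expr} :
    (Expr.bin .eq e f).eval σ ≠ 0 ↔ e.eval σ = f.eval σ := by
  simp only [Expr.eval, BinOp.eval]; split_ifs <;> simp_all

theorem Expr.eval_lt {σ : State} {e f : Expr} :
    (Expr.bin .lt e f).eval σ ≠ 0 ↔ e.eval σ < f.eval σ := by
  simp only [Expr.eval, BinOp.eval]; split_ifs <;> simp_all

theorem Expr.eval_mul {σ : State} {e f : Expr} :
    (Expr.bin .mul e f).eval σ ≠ 0 ↔ e.eval σ ≠ 0 ∧ f.eval σ ≠ 0 := by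
  simp only [Expr.eval, BinOp.eval]; simp

/-- The outcome of partition refinement: position `c > 0` belongs to the class of the pivot
`own c`, the classes of the pivot `i` fill the positions from `i + 1` to `q i`, and every boundary
separates modules. -/
structure RefSpec (m : ℕ) (e : ℕ → ℕ → ℕ) (s own q : ℕ → ℕ) : Prop where
  maps : ∀ i < m, s i < m
  inj : ∀ i < m, ∀ j < m, s i = s j → i = j
  qlt : ∀ i < m, i < q i ∧ q i ≤ m
  q0 : q 0 = m
  lam : ∀ i < m, ∀ k, i < k → k < q i → q k ≤ q i ∧ i ≤ own k
  own_lt : ∀ i, 0 < i → i < m → own i < i ∧ i < q (own i)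
  qmod : ∀ i < m, InHom e (Set.Iio m) (block s i (q i))
  sep : ∀ c, 0 < c → c < m → ∀ U, IsModuleOf e (Set.Iio m) U →
    U ⊆ block s (own c) (q (own c)) → s (own c) ∉ U →
    U ⊆ block s (own c) c ∨ U ⊆ block s c (q (own c))

/-- Open the first class with more than one position as the class of a new pivot. -/
def choosePivot : Cmd :=
  .seq (findFirst 15 19 (.lit 1) (.var 2) (.bin .eq (.get 6 (.var 19)) (.lit 0)))
    (.seq (findFirst 17 19 (.bin .add (.var 15) (.lit 1)) (.bin .add (.var 2) (.lit 1))
        (.bin .lt (.lit 0) (.get 6 (.var 19))))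
      (.seq (forTo 19 (.var 15) (.var 17) (.put 9 (.var 19) (.bin .sub (.var 15) (.lit 1))))
        (.seq (.put 7 (.var 15) (.bin .sub (.var 15) (.lit 1)))
          (.seq (.put 8 (.var 15) (.var 17)) (.put 6 (.var 15) (.lit 1))))))

/-- The first position that is no boundary is `p' + 1`, so the pivot `p'` starts the first class
with more than one position; the next boundary ends that class. -/
theorem choosePivot_spec {W m : ℕ} {e : ℕ → ℕ → ℕ} {s st lo hi own q : ℕ → ℕ} {p : ℕ} {σ : State}
    (hW : m + 2 ≤ W) (hm : σ.var 2 = m) (hσ : HoldsRef σ s st lo hi) (hown : σ.arr 9 = own)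
    (hI : RefInv m e s st lo hi own q p fun _ _ _ => False)
    (hno : ∀ j, 0 < j → j < m → st j ≠ 1) (hex : ∃ j, 0 < j ∧ j < m ∧ st j = 0) :
    Runs W choosePivot σ fun t τ => t ≤ m * 100 + 100 ∧
      ∃ p' b, 0 < p' + 1 ∧ p' + 1 < m ∧ st (p' + 1) = 0 ∧ τ.var 15 = p' + 1 ∧
        HoldsRef τ s (Function.update st (p' + 1) 1) (Function.update lo (p' + 1) p')
          (Function.update hi (p' + 1) b) ∧
        τ.arr 9 = (fun i => if p' < i ∧ i < b then p' else own i) ∧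
        RefInv m e s (Function.update st (p' + 1) 1) (Function.update lo (p' + 1) p')
          (Function.update hi (p' + 1) b) (fun i => if p' < i ∧ i < b then p' else own i)
          (Function.update q p' b) p' fun _ _ _ => False := by
  obtain ⟨j0, hj0, hjm0, hst0⟩ := hex
  obtain ⟨hs, hst, hlo, hhi⟩ := hσ
  rw [choosePivot, runs_seq]
  refine runs_findFirst 1 m (fun k => st k = 0) (by decide) rfl (by omega) (by omega) (by omega) ?_ ?_ ?_
  · intro τ hF
    simp only [Expr.eval]; rw [hF.var 2 rfl, hm]
  · intro τ hF h1 h2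
    rw [Expr.eval_eq]
    simp only [Expr.eval]
    rw [hF.arr 6 rfl, hst]
  intro t1 τ1 ht1 hF1 hr1
  have hr1 : 1 ≤ τ1.var 15 ∧ τ1.var 15 < m ∧ st (τ1.var 15) = 0 ∧
      ∀ k, 1 ≤ k → k < τ1.var 15 → st k ≠ 0 := by
    rcases hr1 with hr1 | hr1
    · exact absurd hst0 (hr1.2 j0 hj0 hjm0)
    · exact hr1
  obtain ⟨k1, k2, k3, k4⟩ := hr1
  obtain ⟨p', hp'⟩ : ∃ p', τ1.var 15 = p' + 1 := ⟨τ1.var 15 - 1, by omega⟩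
  rw [hp'] at k1 k2 k3 k4
  rw [runs_seq]
  refine runs_findFirst (p' + 2) (m + 1) (fun k => st k ≠ 0) (by decide) ?_ (by omega) (by omega)
    (by omega) ?_ ?_ ?_
  · simp [Expr.eval, BinOp.eval, hp']
  · intro τ hF
    simp only [Expr.eval, BinOp.eval]; rw [hF.var 2 rfl, hF1.var 2 rfl, hm]
  · intro τ hF h1 h2
    rw [Expr.eval_lt]
    simp only [Expr.eval]
    rw [hF.arr 6 rfl, hF1.arr 6 rfl, hst, Nat.pos_iff_ne_zero]
  intro t2 τ2 ht2 hF2 hr2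
  have hr2 : p' + 2 ≤ τ2.var 17 ∧ τ2.var 17 < m + 1 ∧ st (τ2.var 17) ≠ 0 ∧
      ∀ k, p' + 2 ≤ k → k < τ2.var 17 → ¬ st k ≠ 0 := by
    rcases hr2 with hr2 | hr2
    · exact absurd hI.startm (hr2.2 m (by omega) (by omega))
    · exact hr2
  obtain ⟨l1, l2, l3, l4⟩ := hr2
  obtain ⟨b, hb⟩ : ∃ b, τ2.var 17 = b := ⟨_, rfl⟩
  rw [hb] at l1 l2 l3 l4
  have hp2 : τ2.var 15 = p' + 1 := by rw [hF2.var 15 rfl, hp']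
  rw [runs_seq]
  refine runs_forTo (p' + 1) b 10 (fun k τ => τ.arr 9 = fun i => if p' < i ∧ i < k then p' else own i)
    (by simp [Expr.eval, hp2]) (by omega) (by omega) rfl ?_ ?_ ?_ ?_
  · intro τ hF
    simp only [Expr.eval]; rw [hF.var 17 rfl, hb]
  · simp only [State.setVar_arr]
    rw [hF2.arr 9 rfl, hF1.arr 9 rfl, hown]
    funext i
    rw [if_neg (by omega)]
  · intro k τ h1 h2 h3 hF hI9
    rw [runs_put]
    simp only [Expr.eval, BinOp.eval, Expr.cost, hF.var 15 rfl, hp2]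
    refine ⟨by omega, by omega, ?_⟩
    simp only [State.setVar_arr, State.setArr_arr, reduceIte, h3, hI9]
    funext i
    simp only [Function.update_apply]
    split_ifs <;> first | rfl | omega
  intro t3 τ3 ht3 hF3 _ h9
  simp only [runs_seq, runs_put]
  simp only [Expr.eval, Expr.cost, State.setArr_arr, State.setArr_var, Nat.reduceEqDiff, reduceIte, BinOp.eval, hF3.var 15 rfl, hF3.var 17 rfl, hb,
    hp2]
  simp only [Expr.cost] at ht1 ht2 ht3
  have q1 : p' + 1 - 1 = p' := by omega
  refine ⟨by omega, by omega, by omega, by omega, p', b, by omega, k2, k3, rfl, ?_, h9, ?_⟩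
  · simp only [HoldsRef, State.setArr_arr, Nat.reduceEqDiff, reduceIte, q1]
    rw [hF3.arr 5 rfl, hF3.arr 6 rfl, hF3.arr 7 rfl, hF3.arr 8 rfl, hF2.arr 5 rfl, hF2.arr 6 rfl,
      hF2.arr 7 rfl, hF2.arr 8 rfl, hF1.arr 5 rfl, hF1.arr 6 rfl, hF1.arr 7 rfl, hF1.arr 8 rfl,
      hs, hst, hlo, hhi]
    exact ⟨rfl, rfl, rfl, rfl⟩
  · refine hI.choose_pivot hno (by omega) (by omega) ?_ l3 ?_
    · intro k hk
      by_cases hk0 : k = 0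
      · rw [hk0]; exact hI.start0
      · exact k4 k (by omega) (by omega)
    · intro k hk1 hk2
      by_cases hkp : k = p' + 1
      · rw [hkp]; exact k3
      · exact not_not.1 (l4 k (by omega) hk2)

/-- Process a pending boundary, or else one opened by a new pivot. -/
def refineStep : Cmd :=
  .seq (findFirst 15 19 (.lit 1) (.var 2) (.bin .eq (.get 6 (.var 19)) (.lit 1)))
    (.seq (.ite (.var 15) .skip choosePivot) processTask)

/-- Partition refinement. -/
def refineAll : Cmd :=
  .seq (forTo 18 (.lit 0) (.var 2) (.put 5 (.var 18) (.var 18)))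
    -- The order of these writes matters for `m = 1`, where position 1 is the end and must not stay
    -- pending. The bound `lo 1 = 0` is the default memory value.
    (.seq (.put 6 (.lit 1) (.lit 1)) (.seq (.put 6 (.lit 0) (.lit 2))
      (.seq (.put 6 (.var 2) (.lit 2)) (.seq (.put 8 (.lit 1) (.var 2))
        (forTo 20 (.lit 1) (.var 2) refineStep)))))

/-- The processed boundaries. -/
def doneSet (m : ℕ) (st : ℕ → ℕ) : Finset ℕ := (Finset.Ico 1 m).filter fun j => st j = 2

theorem mem_doneSet {m : ℕ} {st : ℕ → ℕ} {j : ℕ} :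
    j ∈ doneSet m st ↔ 0 < j ∧ j < m ∧ st j = 2 := by
  simp [doneSet, Nat.succ_le_iff, and_assoc]

/-- The summands count the points of disjoint rectangles inside an `m × m` square. -/
theorem sum_rect_le {m : ℕ} {e : ℕ → ℕ → ℕ} {s st lo hi own q : ℕ → ℕ} {p : ℕ}
    {X : ℕ → ℕ → ℕ → Prop} (h : RefInv m e s st lo hi own q p X) :
    ∑ j ∈ doneSet m st, (j - lo j) * (hi j - j) ≤ m * m := by
  have : ∑ j ∈ doneSet m st, (j - lo j) * (hi j - j) =
      ((doneSet m st).biUnion fun j => Finset.Ico (lo j) j ×ˢ Finset.Ico j (hi j)).card := by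
    rw [Finset.card_biUnion]
    · refine Finset.sum_congr rfl fun j _ => by simp
    · intro j hj j' hj' hne
      rw [Finset.mem_coe, mem_doneSet] at hj hj'
      refine Finset.disjoint_left.2 ?_
      rintro ⟨i, k⟩ h1 h2
      simp only [Finset.mem_product, Finset.mem_Ico] at h1 h2
      exact h.rect j j' hj.1 hj.2.1 hj'.1 hj'.2.1 (by omega) (by omega) hne i k h1.1.1 h1.1.2
        h1.2.1 h1.2.2 h2.1.1 h2.1.2 h2.2.1 h2.2.2
  rw [this]
  calc _ ≤ (Finset.range m ×ˢ Finset.range m).card := by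
        refine Finset.card_le_card fun x hx => ?_
        simp only [Finset.mem_biUnion, mem_doneSet, Finset.mem_product, Finset.mem_Ico] at hx
        obtain ⟨j, hj, h1, h2⟩ := hx
        have := h.bounds j hj.1 hj.2.1 (by omega)
        simp only [Finset.mem_product, Finset.mem_range]
        omega
    _ = m * m := by simp

/-- At the start position 0 is the pivot, its class is everything, and the pending boundary 1 lets
it refine the rest. -/
theorem RefInv.init {m : ℕ} (hm : 0 < m) {e : ℕ → ℕ → ℕ} {s st lo hi own : ℕ → ℕ}
    (hs : ∀ i < m, s i = i) (hst : ∀ i, st i ≠ 0 ↔ i = 0 ∨ i = 1 ∨ i = m) (h1 : 1 < m → st 1 = 1)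
    (hlo : lo 1 = 0) (hhi : hi 1 = m) (hown : ∀ i, own i = 0) :
    RefInv m e s st lo hi own (fun i => if i = 0 then m else i + 1) 0 fun _ _ _ => False := by
  have hst1 : ∀ j, 0 < j → j < m → st j ≠ 0 → j = 1 := by
    intro j h0 hjm h
    rw [hst] at h; omega
  constructor
  · intro i hi; rw [hs i hi]; exact hi
  · intro i hi j hj h; rwa [hs i hi, hs j hj] at h
  · simp [hst]
  · simp [hst]
  · intro j h0 hj h
    have := hst1 j h0 hj h
    subst this
    rw [hlo, hhi]
    exact ⟨h0, hj, le_rfl, (hst 0).2 (by omega), (hst m).2 (by omega)⟩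
  · intro j j' h0 hj h0' hj' h h' hne
    exact absurd ((hst1 j h0 hj h).trans (hst1 j' h0' hj' h').symm) hne
  · intro a b hab hbm ha hb hcl z hz hzn
    rw [hst] at ha hb
    by_cases ha0 : a = 0
    · left
      have hb1 : b = 1 := by
        by_contra h
        exact (hst 1).2 (by simp) (hcl 1 (by omega) (by omega))
      rw [ha0, hb1, block_succ]
      rintro u rfl v rfl; rfl
    · right; left
      refine ⟨1, by omega, by omega, h1 (by omega), .inl ?_⟩
      rw [hlo, hhi]
      refine ⟨?_, by omega, by omega⟩
      by_cases hz0 : z = 0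
      · rw [hz0]; exact ⟨0, ⟨le_rfl, by omega⟩, hs 0 hm⟩
      · exfalso; apply hzn
        exact ⟨z, ⟨by omega, by omega⟩, hs z hz⟩
  · intro i hi; split_ifs <;> omega
  · simp
  · intro i hi k h1 h2
    rw [hown]
    split_ifs at h2 ⊢ <;> omega
  · intro i h0 hi
    rw [hown]
    simp only [reduceIte]; exact ⟨h0, hi⟩
  · intro i hi
    by_cases hi0 : i = 0
    · simp only [hi0, reduceIte]
      intro z hz hzn
      exfalso; apply hzn
      exact ⟨z, ⟨by omega, hz⟩, hs z hz⟩
    · simp only [hi0, reduceIte]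
      rw [block_succ]; exact InHom.singleton'
  · intro i hi h
    by_cases hi0 : i = 0
    · simp [hi0, hst]
    · simp [hi0] at h
  · intro c h0 hc hcs U _ hU hn
    have := hst1 c h0 hc hcs
    subst this
    right
    rw [hown] at hn hU ⊢
    intro u hu
    obtain ⟨i, ⟨hi1, hi2⟩, rfl⟩ := hU hu
    refine mem_block ?_ hi2
    rcases hi1.lt_or_eq with h | rfl
    · omega
    · exact absurd hu hn
  · exact hm
  · intro j h0 hj hj1
    have := hst1 j h0 hj (by omega)
    subst this
    simp [hhi]
  · intro i _ _; exact hown i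
  · intro i hi h
    by_contra hi0
    simp [show i ≠ 0 by omega] at h
  · intro k hk
    rw [hst]; omega

/-- Each of the `m - 1` rounds completes exactly one boundary. It pays linear time for searching
plus the area of the rectangle of that boundary, and the areas sum to at most `m * m`. -/
theorem refineAll_spec {W m : ℕ} {E : ℕ → ℕ} {σ : State} (hm0 : 0 < m)
    (hW : m + 2 ≤ W) (hm : σ.var 2 = m) (hE : σ.arr 4 = E)
    (h01 : ∀ u < m, ∀ x < m, E (u * m + x) ≤ 1)
    (h5 : ∀ a ∈ ({6, 7, 8, 9} : Finset ℕ), σ.arr a = fun _ => 0) :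
    Runs W refineAll σ fun t τ => t ≤ 1000 * (m * m) + 1000 ∧
      ∃ q, RefSpec m (fun u x => E (u * m + x)) (τ.arr 5) (τ.arr 9) q := by
  rw [refineAll, runs_seq]
  refine runs_forTo 0 m 10 (fun k τ => ∀ i < k, τ.arr 5 i = i) rfl (by omega) (by omega) rfl ?_ ?_
    ?_ ?_
  · intro τ hF
    simp only [Expr.eval]; rw [hF.var 2 rfl, hm]
  · simp
  · intro k τ h1 h2 h3 hF hI
    rw [runs_put]
    simp only [Expr.eval, Expr.cost, h3]
    refine ⟨by omega, by omega, ?_⟩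
    intro i hi
    simp only [State.setVar_arr, State.setArr_arr, reduceIte, Function.update_apply]
    split_ifs with h
    · exact h.symm
    · exact hI i (by omega)
  intro t0 τ0 ht0 hF0 _ hI0
  simp only [Expr.cost] at ht0
  simp only [runs_seq, runs_put]
  simp only [Expr.eval, Expr.cost, State.setArr_var, hF0.var 2 rfl, hm]
  refine ⟨by omega, by omega, by omega, by omega, ?_⟩
  refine Runs.mono (Q := fun t τ => t ≤ 950 * (m * m) + 300 ∧
    ∃ q, RefSpec m (fun u x => E (u * m + x)) (τ.arr 5) (τ.arr 9) q) ?_ ?_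
  swap
  · rintro t τ ⟨ht, h⟩
    refine ⟨?_, h⟩
    have : m ≤ m * m := Nat.le_mul_self m
    omega
  obtain ⟨ρ, hρ⟩ : ∃ ρ, ρ = ((((τ0.setArr 6 1 1).setArr 6 0 2).setArr 6 m 2).setArr 8 1 m) := ⟨_, rfl⟩
  rw [← hρ]
  have hρm : ρ.var 2 = m := by rw [hρ]; simp only [State.setArr_var]; rw [hF0.var 2 rfl, hm]
  have hρE : ρ.arr 4 = E := by
    rw [hρ]; simp only [State.setArr_arr, Nat.reduceEqDiff, reduceIte]; rw [hF0.arr 4 rfl, hE]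
  have hinit : RefInv m (fun u x => E (u * m + x)) (ρ.arr 5) (ρ.arr 6) (ρ.arr 7) (ρ.arr 8) (ρ.arr 9)
      (fun i => if i = 0 then m else i + 1) 0 fun _ _ _ => False := by
    have e6 : ρ.arr 6 = fun i => if i = m then 2 else if i = 0 then 2 else if i = 1 then 1 else 0 := by
      rw [hρ]; simp only [State.setArr_arr, Nat.reduceEqDiff, reduceIte]
      rw [hF0.arr 6 rfl, h5 6 (by simp)]
      funext i; simp only [Function.update_apply]
    refine RefInv.init hm0 ?_ ?_ ?_ ?_ ?_ ?_
    · intro i hi; rw [hρ]; simp only [State.setArr_arr, Nat.reduceEqDiff, reduceIte]; exact hI0 i hi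
    · intro i; rw [e6]; dsimp only; split_ifs <;> simp <;> omega
    · intro h; rw [e6]; simp; omega
    · rw [hρ]; simp only [State.setArr_arr, Nat.reduceEqDiff, reduceIte]
      rw [hF0.arr 7 rfl, h5 7 (by simp)]
    · rw [hρ]; simp [State.setArr_arr]
    · intro i
      rw [hρ]; simp only [State.setArr_arr, Nat.reduceEqDiff, reduceIte]
      rw [hF0.arr 9 rfl, h5 9 (by simp)]
  have hle2 : ∀ k, ρ.arr 6 k ≤ 2 := by
    intro i
    rw [hρ]; simp only [State.setArr_arr, Nat.reduceEqDiff, reduceIte]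
    rw [hF0.arr 6 rfl, h5 6 (by simp)]
    simp only [Function.update_apply]
    split_ifs <;> omega
  have hdone : (doneSet m (ρ.arr 6)) = ∅ := by
    refine Finset.eq_empty_of_forall_notMem fun j hj => ?_
    rw [mem_doneSet, hρ] at hj
    simp only [State.setArr_arr, Nat.reduceEqDiff, reduceIte] at hj
    rw [hF0.arr 6 rfl, h5 6 (by simp)] at hj
    simp only [Function.update_apply] at hj
    obtain ⟨h1, h2, h3⟩ := hj
    split_ifs at h3 <;> omega
  refine runs_forTo_time 1 m (fun k T τ => ∃ s st lo hi own q p, HoldsRef τ s st lo hi ∧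
    τ.arr 9 = own ∧ RefInv m (fun u x => E (u * m + x)) s st lo hi own q p (fun _ _ _ => False) ∧
    (∀ k, st k ≤ 2) ∧ (doneSet m st).card + 1 = k ∧
    T ≤ 300 * ∑ j ∈ doneSet m st, (j - lo j) * (hi j - j) + (k - 1) * (m * 200 + 300))
    rfl hm0 (by omega) rfl ?_ ?_ ?_ ?_
  · intro τ hF
    simp only [Expr.eval]; rw [hF.var 2 rfl, hρm]
  · refine ⟨_, _, _, _, _, _, _, ⟨rfl, rfl, rfl, rfl⟩, rfl, hinit, hle2, ?_, by simp⟩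
    simp [hdone]
  · rintro it T τ hit1 hitm hit hF ⟨s, st, lo, hi, own, q, p, hH, h9, hI, hst2, hcard, hT⟩
    rw [refineStep, runs_seq]
    have hτ2 : τ.var 2 = m := by rw [hF.var 2 rfl, hρm]
    have hτE : τ.arr 4 = E := by rw [hF.arr 4 rfl, hρE]
    refine runs_findFirst 1 m (fun k => st k = 1) (by decide) rfl (by omega) (by omega) (by omega) ?_ ?_ ?_
    · intro ρ hF
      simp only [Expr.eval]; rw [hF.var 2 rfl, hτ2]
    · intro ρ hF h1 h2
      rw [Expr.eval_eq]
      simp only [Expr.eval]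
      rw [hF.arr 6 rfl, hH.2.1]
    intro t1 τ1 ht1 hF1 hr1
    have hH1 : HoldsRef τ1 s st lo hi := by
      obtain ⟨a1, a2, a3, a4⟩ := hH
      exact ⟨by rw [hF1.arr 5 rfl, a1], by rw [hF1.arr 6 rfl, a2], by rw [hF1.arr 7 rfl, a3],
        by rw [hF1.arr 8 rfl, a4]⟩
    rw [runs_seq]
    simp only [Expr.cost] at ht1
    have key : Runs W (.ite (.var 15) .skip choosePivot) τ1 fun t ρ => t ≤ m * 100 + 110 ∧
        ∃ j lo' hi' own' q' p', 0 < j ∧ j < m ∧ st j ≠ 2 ∧ ρ.var 15 = j ∧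
          HoldsRef ρ s (Function.update st j 1) lo' hi' ∧
          ρ.arr 9 = own' ∧ (∀ i ≠ j, lo' i = lo i ∧ hi' i = hi i) ∧
          RefInv m (fun u x => E (u * m + x)) s (Function.update st j 1) lo' hi' own' q' p'
            (fun _ _ _ => False) := by
      rw [runs_ite]
      constructor
      · intro hne
        rw [runs_skip]
        simp only [Expr.eval] at hne
        simp only [Expr.cost]
        rcases hr1 with hr1 | ⟨a1, a2, a3, -⟩
        · omega
        have : Function.update st (τ1.var 15) 1 = st := by rw [← a3, Function.update_eq_self]
        refine ⟨by omega, τ1.var 15, lo, hi, own, q, p, by omega, a2, by omega, rfl, ?_, ?_, ?_, ?_⟩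
        · rw [this]; exact hH1
        · rw [hF1.arr 9 rfl, h9]
        · intro _ _; exact ⟨rfl, rfl⟩
        · rw [this]; exact hI
      · intro h0
        simp only [Expr.eval] at h0
        have hno : ∀ j, 0 < j → j < m → st j ≠ 1 := by
          rcases hr1 with hr1 | hr1
          · exact hr1.2
          · omega
        -- If no position were free, all `m - 1` inner boundaries would be processed, which the
        -- round number excludes.
        have hex : ∃ j, 0 < j ∧ j < m ∧ st j = 0 := by
          by_contra! hcon
          have : doneSet m st = Finset.Ico 1 m := by
            ext j
            rw [mem_doneSet, Finset.mem_Ico]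
            constructor
            · rintro ⟨h1, h2, -⟩; exact ⟨h1, h2⟩
            · rintro ⟨h1, h2⟩
              have := hcon j h1 h2
              have := hno j h1 h2
              have := hst2 j
              exact ⟨h1, h2, by omega⟩
          rw [this] at hcard
          simp at hcard
          omega
        refine Runs.mono (choosePivot_spec hW (by rw [hF1.var 2 rfl, hτ2]) hH1
          (by rw [hF1.arr 9 rfl, h9]) hI hno hex) ?_
        rintro t ρ ⟨ht, p', b, a1, a2, a3, a4, a5, a6, a7⟩
        simp only [Expr.cost]
        refine ⟨by omega, p' + 1, _, _, _, _, _, a1, a2, by omega, a4, a5, a6, ?_, a7⟩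
        intro i hi
        simp [hi]
    refine Runs.mono (Runs.frame key) ?_
    rintro t2 τ2 ⟨⟨ht2, j, lo1, hi1, own1, q1, p1, j0, jm, j2, hj, hH2, h92, hlh, hI2⟩, hF2⟩
    refine Runs.mono (Runs.frame (processTask_spec hW (by rw [hF2.var 2 rfl, hF1.var 2 rfl, hτ2])
      (by rw [hF2.arr 4 rfl, hF1.arr 4 rfl, hτE]) h01 hj hH2 hI2 j0 jm (by simp))) ?_
    rintro t3 τ3 ⟨⟨ht3, s', st', lo', hi', hH3, hI3, hext⟩, hF3⟩
    rw [Function.update_idem] at hext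
    have hD : doneSet m st' = insert j (doneSet m st) := by
      ext i
      simp only [Finset.mem_insert, mem_doneSet]
      by_cases hij : i = j
      · subst hij
        have := (hext.keep i (by simp)).1
        simp at this
        simp [j0, jm, this]
      · simp only [hij, false_or]
        by_cases hi0 : st i = 0
        · have := hext.new i (by simp [hij, hi0])
          constructor <;> rintro ⟨-, -, h⟩ <;> omega
        · have := (hext.keep i (by simpa [hij] using hi0)).1
          rw [Function.update_of_ne hij] at this
          rw [this]
    have hjn : j ∉ doneSet m st := by
      rw [mem_doneSet]; rintro ⟨-, -, h⟩; exact j2 h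
    refine ⟨s', st', lo', hi', own1, q1, p1, by simpa [HoldsRef] using hH3, ?_, hI3, ?_, ?_, ?_⟩
    · simp only [State.setVar_arr]; rw [hF3.arr 9 rfl, h92]
    · intro k
      by_cases hk : Function.update st j 2 k = 0
      · have := hext.new k hk; omega
      · rw [(hext.keep k hk).1, Function.update_apply]
        have := hst2 k
        split_ifs <;> omega
    · rw [hD, Finset.card_insert_of_notMem hjn]; omega
    · have hlj := hext.keep j (by simp)
      rw [hD, Finset.sum_insert hjn, hlj.2.1, hlj.2.2]
      have : ∑ x ∈ doneSet m st, (x - lo' x) * (hi' x - x) =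
          ∑ x ∈ doneSet m st, (x - lo x) * (hi x - x) := by
        refine Finset.sum_congr rfl fun x hx => ?_
        have hxj : x ≠ j := by rintro rfl; exact hjn hx
        have h1 := (mem_doneSet.1 hx).2.2
        have := hext.keep x (by rw [Function.update_of_ne hxj]; omega)
        rw [this.2.1, this.2.2, (hlh x hxj).1, (hlh x hxj).2]
      rw [this]
      have : (it + 1 - 1) * (m * 200 + 300) = (it - 1) * (m * 200 + 300) + (m * 200 + 300) := by
        rw [show it + 1 - 1 = it - 1 + 1 by omega, add_mul, one_mul]
      omega
  · rintro t T τ ht hF _ ⟨s, st, lo, hi, own, q, p, ⟨hs, -, -, -⟩, h9, hI, hst2, hcard, hT⟩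
    refine ⟨?_, q, ?_⟩
    · have h1 := sum_rect_le hI
      have h2 : (m - 1) * (m * 200 + 300) ≤ 500 * (m * m) := by
        obtain ⟨k, rfl⟩ : ∃ k, m = k + 1 := ⟨m - 1, by omega⟩
        simp only [Nat.add_sub_cancel]
        nlinarith
      have h3 : m ≤ m * m := Nat.le_mul_self m
      simp only [Expr.cost] at ht
      omega
    · rw [hs, h9]
      -- After `m - 1` rounds every inner position is a processed boundary, so `sep` holds
      -- everywhere.
      have hall : ∀ c, 0 < c → c < m → st c ≠ 0 := by
        intro c h0 hc
        have : doneSet m st = Finset.Ico 1 m :=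
          Finset.eq_of_subset_of_card_le (Finset.filter_subset _ _) (by simp; omega)
        have h : c ∈ doneSet m st := by rw [this]; simp; omega
        rw [mem_doneSet] at h
        omega
      exact ⟨hI.maps, hI.inj, hI.qlt, hI.q0, hI.lam, hI.own_lt, hI.qmod,
        fun c h0 hc => hI.sep c h0 hc (hall c h0 hc)⟩

end WordRAM


/-! ### Strongly connected components: the invariant

The vertices are `0, …, m - 1`. A vertex is new (`lev v = 0`), finished (`lev v = m + 2`), or it
lies on one of the levels `2, …, S` of the stack. Row `l` of `R` records the successors of the
vertices of level `l`, and row `1` is full. -/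

/-- A set of vertices that contains all successors of its elements. -/
def ArcClosed (m : ℕ) (arc : ℕ → ℕ → Prop) (Z : Set ℕ) : Prop :=
  ∀ v < m, ∀ w < m, v ∈ Z → arc v w → w ∈ Z

/-- An ordering of the vertices by strongly connected components, successors first. -/
structure SccSpec (m : ℕ) (arc : ℕ → ℕ → Prop) (ord rank : ℕ → ℕ) : Prop where
  lt : ∀ i < m, ord i < m
  inj : ∀ i < m, ∀ j < m, ord i = ord j → i = j
  surj : ∀ v < m, ∃ i < m, ord i = v
  mono : ∀ i j, i ≤ j → j < m → rank (ord i) ≤ rank (ord j)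
  arc_rank : ∀ v < m, ∀ w < m, arc v w → rank w ≤ rank v
  closed : ∀ v < m, ∀ w < m, rank v = rank w → ∀ Z, ArcClosed m arc Z → v ∈ Z → w ∈ Z

/-- The invariant of the path-based algorithm for strongly connected components. -/
structure SccInv (m : ℕ) (arc : ℕ → ℕ → Prop) (lev R ord rank : ℕ → ℕ) (S cnt r : ℕ) : Prop where
  -- Level 1 contains no vertex; its full row acts as a source with arcs to all vertices and starts
  -- the search everywhere.
  rows : ∀ l, 1 ≤ l → l ≤ S → ∀ w < m,
    (R (l * m + w) ≠ 0 ↔ l = 1 ∨ ∃ v < m, lev v = l ∧ arc v w)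
  levels : ∀ v < m, lev v = 0 ∨ (2 ≤ lev v ∧ lev v ≤ S) ∨ lev v = m + 2
  -- It keeps level numbers at most `m + 1`, so the mark `m + 2` for finished vertices is never used
  -- as a level.
  height : S + ((Finset.range m).filter fun v => lev v = 0).card ≤ m + 1
  done_of_zero : S = 0 → ∀ v < m, lev v = m + 2
  doneClosed : ∀ v < m, ∀ w < m, lev v = m + 2 → arc v w → lev w = m + 2
  -- Reachability along the stack, expressed through closed sets in place of paths: from a level
  -- everything on it and on higher levels is reachable.
  stack : ∀ Z, ArcClosed m arc Z → ∀ v < m, ∀ w < m, 2 ≤ lev v → lev v ≤ lev w → lev w ≤ S →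
    v ∈ Z → w ∈ Z
  ord_lt : ∀ i < cnt, ord i < m ∧ lev (ord i) = m + 2
  ord_inj : ∀ i < cnt, ∀ j < cnt, ord i = ord j → i = j
  ord_surj : ∀ v < m, lev v = m + 2 → ∃ i < cnt, ord i = v
  mono : ∀ i j, i ≤ j → j < cnt → rank (ord i) ≤ rank (ord j)
  rank_lt : ∀ v < m, lev v = m + 2 → rank v < r
  arc_rank : ∀ v < m, ∀ w < m, lev v = m + 2 → arc v w → rank w ≤ rank v
  closed : ∀ v < m, ∀ w < m, lev v = m + 2 → lev w = m + 2 → rank v = rank w →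
    ∀ Z, ArcClosed m arc Z → v ∈ Z → w ∈ Z

namespace SccInv

variable {m : ℕ} {arc : ℕ → ℕ → Prop} {lev R ord rank : ℕ → ℕ} {S cnt r : ℕ}

theorem S_le (h : SccInv m arc lev R ord rank S cnt r) : S ≤ m + 1 := by
  have := h.height; omega

theorem init (hR : ∀ w < m, R (1 * m + w) ≠ 0) (hlev : ∀ v, lev v = 0) :
    SccInv m arc lev R ord rank 1 0 0 := by
  constructor <;> try (intros; simp_all; done)
  · intro l h1 h2 w hw
    rw [show l = 1 by omega]
    simp only [true_or, iff_true]
    exact hR w hw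
  · have : ((Finset.range m).filter fun v => lev v = 0).card ≤ m :=
      (Finset.card_filter_le _ _).trans (by simp)
    omega

theorem cnt_le (h : SccInv m arc lev R ord rank S cnt r) : cnt ≤ m := by
  have := Finset.card_le_card_of_injOn (s := Finset.range cnt) (t := Finset.range m) ord
    (fun i hi => by simpa using (h.ord_lt i (by simpa using hi)).1)
    (fun i hi j hj => h.ord_inj i (by simpa using hi) j (by simpa using hj))
  simpa using this

theorem spec (h : SccInv m arc lev R ord rank 0 cnt r) : SccSpec m arc ord rank := by
  have hd := h.done_of_zero rfl
  have hcnt : cnt = m := by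
    have h1 := h.cnt_le
    have h2 : m ≤ cnt := by
      have := Finset.card_le_card_of_surjOn (s := Finset.range cnt) (t := Finset.range m) ord
        (fun v hv => by
          obtain ⟨i, hi, rfl⟩ := h.ord_surj v (by simpa using hv) (hd v (by simpa using hv))
          exact ⟨i, by simpa using hi, rfl⟩)
      simpa using this
    omega
  subst hcnt
  exact ⟨fun i hi => (h.ord_lt i hi).1, h.ord_inj, fun v hv => h.ord_surj v hv (hd v hv), h.mono,
    fun v hv w hw => h.arc_rank v hv w hw (hd v hv),
    fun v hv w hw => h.closed v hv w hw (hd v hv) (hd w hw)⟩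

/-- The new vertex is a successor of the top level, so it is reachable from all levels from 2 to the
top. -/
theorem push (h : SccInv m arc lev R ord rank S cnt r) {x : ℕ} (hS : 0 < S) (hx : x < m)
    (hx0 : lev x = 0) (hRx : R (S * m + x) ≠ 0) {R' : ℕ → ℕ}
    (hR : ∀ j < (S + 1) * m, R' j = R j)
    (hR' : ∀ w < m, R' ((S + 1) * m + w) ≠ 0 ↔ arc x w) :
    SccInv m arc (Function.update lev x (S + 1)) R' ord rank (S + 1) cnt r := by
  have hSm : S ≤ m := by
    have := h.height
    have : 0 < ((Finset.range m).filter fun v => lev v = 0).card :=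
      Finset.card_pos.2 ⟨x, by simp [hx, hx0]⟩
    omega
  have hne : ∀ v, lev v ≠ 0 → Function.update lev x (S + 1) v = lev v := by
    intro v hv
    rw [Function.update_of_ne]; rintro rfl; exact hv hx0
  have hB : ∀ v, Function.update lev x (S + 1) v = m + 2 ↔ lev v = m + 2 := by
    intro v
    by_cases hv : v = x
    · subst hv; simp; omega
    · simp [hv]
  constructor
  · intro l h1 h2 w hw
    by_cases hl : l = S + 1
    · subst hl
      rw [hR' w hw]
      constructor
      · intro ha; exact .inr ⟨x, hx, by simp, ha⟩
      · rintro (h0 | ⟨v, hv, hv', ha⟩)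
        · omega
        · by_cases hvx : v = x
          · rwa [← hvx]
          · rw [Function.update_of_ne hvx] at hv'
            have := h.levels v hv
            omega
    · have hlt : l * m + w < (S + 1) * m := by
        have : (l + 1) * m ≤ (S + 1) * m := Nat.mul_le_mul_right _ (by omega)
        rw [add_mul] at this; omega
      rw [hR _ hlt, h.rows l h1 (by omega) w hw]
      refine or_congr_right ⟨?_, ?_⟩
      · rintro ⟨v, hv, hv', ha⟩
        exact ⟨v, hv, by rw [hne v (by omega), hv'], ha⟩
      · rintro ⟨v, hv, hv', ha⟩
        refine ⟨v, hv, ?_, ha⟩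
        rw [Function.update_apply] at hv'
        split_ifs at hv' <;> omega
  · intro v hv
    by_cases hvx : v = x
    · subst hvx; simp; omega
    · rw [Function.update_of_ne hvx]
      have := h.levels v hv
      omega
  · have : ((Finset.range m).filter fun v => lev v = 0) =
        insert x ((Finset.range m).filter fun v => Function.update lev x (S + 1) v = 0) := by
      ext v
      by_cases hvx : v = x
      · subst hvx; simp [hx, hx0]
      · simp [hvx]
    have h1 := h.height
    rw [this, Finset.card_insert_of_notMem (by simp)] at h1
    omega
  · omega
  · intro v hv w hw
    rw [hB, hB]; exact h.doneClosed v hv w hw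
  · intro Z hZ v hv w hw h1 h2 h3 hvZ
    by_cases hvx : v = x
    · by_cases hwx : w = x
      · rwa [hwx, ← hvx]
      · rw [hvx, Function.update_self] at h2
        rw [Function.update_of_ne hwx] at h2 h3
        have := h.levels w hw
        omega
    · rw [Function.update_of_ne hvx] at h1 h2
      by_cases hwx : w = x
      · subst hwx
        rw [Function.update_self] at h2
        rw [h.rows S hS le_rfl w hx] at hRx
        have hvl := h.levels v hv
        rcases hRx with hRx | ⟨u, hu, hu', ha⟩
        · omega
        · exact hZ u hu w hw (h.stack Z hZ v hv u hu h1 (by omega) (by omega) hvZ) ha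
      · rw [Function.update_of_ne hwx] at h2 h3
        exact h.stack Z hZ v hv w hw h1 h2 (by have := h.levels w hw; omega) hvZ
  · intro i hi; rw [hB]; exact h.ord_lt i hi
  · exact h.ord_inj
  · intro v hv; rw [hB]; exact h.ord_surj v hv
  · exact h.mono
  · intro v hv; rw [hB]; exact h.rank_lt v hv
  · intro v hv w hw; rw [hB]; exact h.arc_rank v hv w hw
  · intro v hv w hw; rw [hB, hB]; exact h.closed v hv w hw

/-- An arc leads from the top level back to `x` on a lower level, so the levels in between lie in
one component. Only the two top levels are joined; the joined row still records `x`, so further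
merges can follow. -/
theorem merge (h : SccInv m arc lev R ord rank S cnt r) {x : ℕ} (hx : x < m)
    (hx2 : 2 ≤ lev x) (hxS : lev x < S) (hRx : R (S * m + x) ≠ 0) {lev' R' : ℕ → ℕ}
    (hlev : ∀ v < m, lev' v = if lev v = S then S - 1 else lev v)
    (hR : ∀ j < (S - 1) * m, R' j = R j)
    (hR' : ∀ w < m, R' ((S - 1) * m + w) ≠ 0 ↔ R ((S - 1) * m + w) ≠ 0 ∨ R (S * m + w) ≠ 0) :
    SccInv m arc lev' R' ord rank (S - 1) cnt r := by
  have hSm := h.S_le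
  have hB : ∀ v < m, lev' v = m + 2 ↔ lev v = m + 2 := by
    intro v hv
    rw [hlev v hv]; split_ifs <;> omega
  have h0 : ∀ v < m, lev' v = 0 ↔ lev v = 0 := by
    intro v hv
    rw [hlev v hv]; split_ifs <;> omega
  constructor
  · intro l h1 h2 w hw
    by_cases hl : l = S - 1
    · subst hl
      rw [hR' w hw, h.rows _ h1 (by omega) w hw, h.rows S (by omega) le_rfl w hw]
      constructor
      · rintro ((h | ⟨v, hv, hv', ha⟩) | (h | ⟨v, hv, hv', ha⟩))
        · exact .inl h
        · exact .inr ⟨v, hv, by rw [hlev v hv]; split_ifs <;> omega, ha⟩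
        · omega
        · exact .inr ⟨v, hv, by rw [hlev v hv, if_pos hv'], ha⟩
      · rintro (h | ⟨v, hv, hv', ha⟩)
        · exact .inl (.inl h)
        · rw [hlev v hv] at hv'
          split_ifs at hv' with hs
          · exact .inr (.inr ⟨v, hv, hs, ha⟩)
          · exact .inl (.inr ⟨v, hv, hv', ha⟩)
    · have hlt : l * m + w < (S - 1) * m := by
        have : (l + 1) * m ≤ (S - 1) * m := Nat.mul_le_mul_right _ (by omega)
        rw [add_mul] at this; omega
      rw [hR _ hlt, h.rows l h1 (by omega) w hw]
      refine or_congr_right ⟨?_, ?_⟩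
      · rintro ⟨v, hv, hv', ha⟩
        exact ⟨v, hv, by rw [hlev v hv, if_neg (by omega), hv'], ha⟩
      · rintro ⟨v, hv, hv', ha⟩
        refine ⟨v, hv, ?_, ha⟩
        rw [hlev v hv] at hv'
        split_ifs at hv' <;> omega
  · intro v hv
    rw [hlev v hv]
    have := h.levels v hv
    split_ifs <;> omega
  · have : ((Finset.range m).filter fun v => lev' v = 0) =
        ((Finset.range m).filter fun v => lev v = 0) :=
      Finset.filter_congr fun v hv => by rw [h0 v (by simpa using hv)]
    rw [this]
    have := h.height
    omega
  · omega
  · intro v hv w hw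
    rw [hB v hv, hB w hw]; exact h.doneClosed v hv w hw
  · intro Z hZ v hv w hw h1 h2 h3 hvZ
    rw [hlev v hv] at h1 h2
    rw [hlev w hw] at h2 h3
    by_cases hvS : lev v = S
    · rw [if_pos hvS] at h2
      by_cases hwS : lev w = S
      · exact h.stack Z hZ v hv w hw (by omega) (by omega) (by omega) hvZ
      · rw [if_neg hwS] at h2 h3
        rw [h.rows S (by omega) le_rfl x hx] at hRx
        rcases hRx with hRx | ⟨u, hu, hu', ha⟩
        · omega
        · have huZ := h.stack Z hZ v hv u hu (by omega) (by omega) (by omega) hvZ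
          exact h.stack Z hZ x hx w hw hx2 (by omega) (by omega) (hZ u hu x hx huZ ha)
    · rw [if_neg hvS] at h1 h2
      refine h.stack Z hZ v hv w hw h1 ?_ ?_ hvZ
      · split_ifs at h2 <;> omega
      · split_ifs at h3 <;> omega
  · intro i hi
    obtain ⟨h1, h2⟩ := h.ord_lt i hi
    exact ⟨h1, (hB _ h1).2 h2⟩
  · exact h.ord_inj
  · intro v hv; rw [hB v hv]; exact h.ord_surj v hv
  · exact h.mono
  · intro v hv; rw [hB v hv]; exact h.rank_lt v hv
  · intro v hv w hw; rw [hB v hv]; exact h.arc_rank v hv w hw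
  · intro v hv w hw; rw [hB v hv, hB w hw]; exact h.closed v hv w hw

/-- No arc leaves the top level except to finished vertices, so the level is a complete component.
It gets a rank above all earlier ones, which puts successors first. Popping the empty level 1 means
that all vertices are finished. -/
theorem pop (h : SccInv m arc lev R ord rank S cnt r) (hS : 0 < S)
    (hno : ∀ w < m, R (S * m + w) ≠ 0 → lev w = S ∨ lev w = m + 2) {lev' ord' : ℕ → ℕ} {cnt' : ℕ}
    (hlev : ∀ v < m, lev' v = if lev v = S then m + 2 else lev v)
    (hc : cnt ≤ cnt') (hold : ∀ i < cnt, ord' i = ord i)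
    (hnew : ∀ i, cnt ≤ i → i < cnt' → ord' i < m ∧ lev (ord' i) = S)
    (hinj : ∀ i j, cnt ≤ i → i < j → j < cnt' → ord' i ≠ ord' j)
    (hsurj : ∀ v < m, lev v = S → ∃ i, i < cnt' ∧ ord' i = v) :
    SccInv m arc lev' R ord' (fun v => if lev v = S then r else rank v) (S - 1) cnt' (r + 1) := by
  have hSm := h.S_le
  have hB : ∀ v < m, lev' v = m + 2 ↔ lev v = S ∨ lev v = m + 2 := by
    intro v hv
    rw [hlev v hv]; split_ifs <;> omega
  have hsame : ∀ v < m, lev v ≠ S → lev' v = lev v := fun v hv hvS => by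
    rw [hlev v hv, if_neg hvS]
  have hlvl : ∀ v < m, lev' v ≠ m + 2 → lev v = lev' v ∧ lev v ≠ S := by
    intro v hv hv'
    rw [hlev v hv] at hv' ⊢
    split_ifs at hv' ⊢ with h'
    · exact absurd rfl hv'
    · exact ⟨rfl, h'⟩
  have hr : ∀ v < m, lev v = m + 2 → (if lev v = S then r else rank v) = rank v := fun v hv hv' => by
    rw [if_neg (by omega)]
  have hmem : ∀ i < cnt', ord' i < m ∧ ((i < cnt ∧ lev (ord' i) = m + 2 ∧ ord' i = ord i) ∨
      (cnt ≤ i ∧ lev (ord' i) = S)) := by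
    intro i hi
    by_cases hic : i < cnt
    · have := h.ord_lt i hic
      rw [hold i hic]
      exact ⟨this.1, .inl ⟨hic, this.2, rfl⟩⟩
    · have := hnew i (by omega) hi
      exact ⟨this.1, .inr ⟨by omega, this.2⟩⟩
  constructor
  · intro l h1 h2 w hw
    rw [h.rows l h1 (by omega) w hw]
    refine or_congr_right ⟨?_, ?_⟩
    · rintro ⟨v, hv, hv', ha⟩
      exact ⟨v, hv, by rw [hsame v hv (by omega), hv'], ha⟩
    · rintro ⟨v, hv, hv', ha⟩
      exact ⟨v, hv, by rw [(hlvl v hv (by omega)).1, hv'], ha⟩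
  · intro v hv
    rw [hlev v hv]
    have := h.levels v hv
    split_ifs <;> omega
  · have : ((Finset.range m).filter fun v => lev' v = 0) =
        ((Finset.range m).filter fun v => lev v = 0) :=
      Finset.filter_congr fun v hv => by
        rw [hlev v (by simpa using hv)]
        by_cases hvS : lev v = S
        · simp [hvS, hS.ne']
        · simp [hvS]
    rw [this]
    have := h.height
    omega
  · intro hS0 v hv
    rw [hB v hv]
    exact hno v hv ((h.rows S hS le_rfl v hv).2 (.inl (by omega)))
  · intro v hv w hw
    rw [hB v hv, hB w hw]
    rintro (hv' | hv') ha
    · exact hno w hw ((h.rows S hS le_rfl w hw).2 (.inr ⟨v, hv, hv', ha⟩))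
    · exact .inr (h.doneClosed v hv w hw hv' ha)
  · intro Z hZ v hv w hw h1 h2 h3 hvZ
    have e1 := (hlvl v hv (by omega)).1
    have e2 := (hlvl w hw (by omega)).1
    exact h.stack Z hZ v hv w hw (by omega) (by omega) (by omega) hvZ
  · intro i hi
    obtain ⟨h1, h2⟩ := hmem i hi
    exact ⟨h1, (hB _ h1).2 (by omega)⟩
  · intro i hi j hj hij
    obtain ⟨-, h1⟩ := hmem i hi
    obtain ⟨-, h2⟩ := hmem j hj
    rcases h1 with ⟨a1, a2, a3⟩ | ⟨a1, a2⟩ <;> rcases h2 with ⟨b1, b2, b3⟩ | ⟨b1, b2⟩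
    · exact h.ord_inj i a1 j b1 (by rw [← a3, hij, b3])
    · rw [hij] at a2; omega
    · rw [hij] at a2; omega
    · by_contra hne
      rcases lt_or_gt_of_ne hne with h' | h'
      · exact hinj i j a1 h' hj hij
      · exact hinj j i b1 h' hi hij.symm
  · intro v hv
    rw [hB v hv]
    rintro (hv' | hv')
    · exact hsurj v hv hv'
    · obtain ⟨i, hi, rfl⟩ := h.ord_surj v hv hv'
      exact ⟨i, by omega, hold i hi⟩
  · intro i j hij hj
    obtain ⟨hi', h1⟩ := hmem i (by omega)
    obtain ⟨hj', h2⟩ := hmem j hj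
    rcases h2 with ⟨b1, b2, b3⟩ | ⟨b1, b2⟩
    · rcases h1 with ⟨a1, a2, a3⟩ | ⟨a1, a2⟩
      · rw [hr _ hi' a2, hr _ hj' b2, a3, b3]
        exact h.mono i j hij b1
      · omega
    · rw [if_pos b2]
      rcases h1 with ⟨a1, a2, a3⟩ | ⟨a1, a2⟩
      · rw [hr _ hi' a2]; exact (h.rank_lt _ hi' a2).le
      · rw [if_pos a2]
  · intro v hv
    rw [hB v hv]
    rintro (hv' | hv')
    · simp [hv']
    · rw [hr v hv hv']; have := h.rank_lt v hv hv'; omega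
  · intro v hv w hw
    rw [hB v hv]
    rintro (hv' | hv') ha
    · rw [if_pos hv']
      rcases hno w hw ((h.rows S hS le_rfl w hw).2 (.inr ⟨v, hv, hv', ha⟩)) with hw' | hw'
      · rw [if_pos hw']
      · rw [hr w hw hw']; exact (h.rank_lt w hw hw').le
    · rw [hr v hv hv', hr w hw (h.doneClosed v hv w hw hv' ha)]
      exact h.arc_rank v hv w hw hv' ha
  · intro v hv w hw
    rw [hB v hv, hB w hw]
    rintro (hv' | hv') (hw' | hw') hrk Z hZ hvZ
    · by_cases hS1 : S = 1
      · have := h.levels v hv; omega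
      · exact h.stack Z hZ v hv w hw (by omega) (by omega) (by omega) hvZ
    · rw [if_pos hv', hr w hw hw'] at hrk
      have := h.rank_lt w hw hw'; omega
    · rw [if_pos hw', hr v hv hv'] at hrk
      have := h.rank_lt v hv hv'; omega
    · rw [hr v hv hv', hr w hw hw'] at hrk
      exact h.closed v hv w hw hv' hw' hrk Z hZ hvZ

end SccInv


/-! ### The program for strongly connected components -/

namespace WordRAM

/-- Logical negation. -/
def Expr.not (e : Expr) : Expr := .bin .eq e (.lit 0)

theorem Expr.eval_not {σ : State} {e : Expr} : e.not.eval σ ≠ 0 ↔ ¬ e.eval σ ≠ 0 := by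
  rw [Expr.not, Expr.eval_eq]; simp [Expr.eval]

theorem Expr.eval_add {σ : State} {e f : Expr} :
    (Expr.bin .add e f).eval σ ≠ 0 ↔ e.eval σ ≠ 0 ∨ f.eval σ ≠ 0 := by
  simp only [Expr.eval, BinOp.eval]; omega

/-- The truth value of `e ≠ 0`. -/
def Expr.bool (e : Expr) : Expr := .bin .lt (.lit 0) e

theorem Expr.eval_bool {σ : State} {e : Expr} {P : Prop} [Decidable P] (h : e.eval σ ≠ 0 ↔ P) :
    e.bool.eval σ = if P then 1 else 0 := by
  by_cases hP : P
  · rw [if_pos hP]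
    simp [Expr.bool, Expr.eval, BinOp.eval, Nat.pos_of_ne_zero (h.2 hP)]
  · rw [if_neg hP]
    simp [Expr.bool, Expr.eval, BinOp.eval, not_not.1 fun h' => hP (h.1 h')]

/-- Fill consecutive cells of an array. -/
theorem runs_fill {W i a : ℕ} {lo hi ie e : Expr} {σ : State} (L N base : ℕ) (f : ℕ → ℕ)
    (hL : lo.eval σ = L) (hLN : L ≤ N) (hNW : N ≤ W)
    (hN : ∀ τ, Frame (forTo i lo hi (.put a ie e)) σ τ → hi.eval τ = N)
    (he : ∀ k τ, L ≤ k → k < N → τ.var i = k → Frame (forTo i lo hi (.put a ie e)) σ τ →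
      τ.arr a = (fun j => if base + L ≤ j ∧ j < base + k then f (j - base) else σ.arr a j) →
      ie.eval τ = base + k ∧ e.eval τ = f k ∧ f k ≤ W)
    {Q : ℕ → State → Prop}
    (hQ : ∀ t τ, t ≤ (N - L) * (ie.cost + e.cost + hi.cost + 8) + lo.cost + hi.cost + 4 →
      Frame (forTo i lo hi (.put a ie e)) σ τ →
      τ.arr a = (fun j => if base + L ≤ j ∧ j < base + N then f (j - base) else σ.arr a j) →
      Q t τ) :
    Runs W (forTo i lo hi (.put a ie e)) σ Q := by
  refine runs_forTo L N (ie.cost + e.cost + 1) (fun k τ => τ.arr a = fun j =>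
    if base + L ≤ j ∧ j < base + k then f (j - base) else σ.arr a j) hL hLN hNW rfl hN ?_ ?_ ?_
  · simp only [State.setVar_arr]
    funext j
    rw [if_neg (by omega)]
  · intro k τ h1 h2 h3 hF hI
    obtain ⟨e1, e2, e3⟩ := he k τ h1 h2 h3 hF hI
    rw [runs_put]
    refine ⟨by omega, le_rfl, ?_⟩
    simp only [State.setVar_arr, State.setArr_arr, reduceIte, hI, e1, e2]
    funext j
    simp only [Function.update_apply]
    by_cases hj : j = base + k
    · rw [if_pos hj, if_pos (by omega), hj, Nat.add_sub_cancel_left]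
    · rw [if_neg hj]
      congr 1
      simp only [eq_iff_iff]; omega
  · intro t τ ht hF _ hI
    refine hQ t τ (ht.trans_eq ?_) hF hI
    congr 3
    ring

/-- `v` requires `w` in the class order. -/
def seqArc (e : ℕ → ℕ → ℕ) (s own : ℕ → ℕ) (v w : ℕ) : Prop :=
  (0 < v ∧ w = own v) ∨
    -- Here `v` tells its sibling `w` apart from the common pivot, so a module that contains the
    -- pivot and `w` must contain `v`.
    (0 < v ∧ 0 < w ∧ v ≠ w ∧ own v = own w ∧ e (s w) (s v) ≠ e (s (own v)) (s v))

/-- Arguments are positions of partition refinement; array 5 translates them to elements. -/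
def cellE (u x : Expr) : Expr := .get 4 (.bin .add (.bin .mul (.get 5 u) (.var 2)) (.get 5 x))

/-- Products act as conjunctions and sums as disjunctions, following `seqArc`. -/
def arcExpr (v w : Expr) : Expr :=
  .bin .add (.bin .mul (.bin .lt (.lit 0) v) (.bin .eq w (.get 9 v)))
    (.bin .mul (.bin .lt (.lit 0) v) (.bin .mul (.bin .lt (.lit 0) w)
      (.bin .mul (.not (.bin .eq v w)) (.bin .mul (.bin .eq (.get 9 v) (.get 9 w))
        (.not (.bin .eq (cellE w v) (cellE (.get 9 v) v)))))))

theorem eval_arcExpr {σ : State} {m x y : ℕ} {v w : Expr} (hm : σ.var 2 = m) (hv : v.eval σ = x)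
    (hw : w.eval σ = y) : (arcExpr v w).eval σ ≠ 0 ↔
      seqArc (fun u x => σ.arr 4 (u * m + x)) (σ.arr 5) (σ.arr 9) x y := by
  simp only [arcExpr, Expr.eval_add, Expr.eval_mul, Expr.eval_not, Expr.eval_eq, Expr.eval_lt]
  simp only [Expr.eval, BinOp.eval, cellE, hv, hw, hm, seqArc]

/-- Open a new level for the vertex in variable `23`. -/
def sccPush : Cmd :=
  .seq (.assign 21 (.bin .add (.var 21) (.lit 1)))
    (.seq (.put 10 (.var 23) (.var 21))
      (forTo 24 (.lit 0) (.var 2) (.put 11 (.bin .add (.bin .mul (.var 21) (.var 2)) (.var 24))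
        (.bool (arcExpr (.var 23) (.var 24))))))

/-- Merge the two top levels. -/
def sccMerge : Cmd :=
  .seq (forTo 24 (.lit 0) (.var 2)
      (.put 11 (.bin .add (.bin .mul (.bin .sub (.var 21) (.lit 1)) (.var 2)) (.var 24))
        (.bool (.bin .add
          (.get 11 (.bin .add (.bin .mul (.bin .sub (.var 21) (.lit 1)) (.var 2)) (.var 24)))
          (.get 11 (.bin .add (.bin .mul (.var 21) (.var 2)) (.var 24)))))))
    (.seq (forTo 24 (.lit 0) (.var 2) (.put 10 (.bin .add (.lit 0) (.var 24))
        (.bin .sub (.get 10 (.var 24)) (.bin .eq (.get 10 (.var 24)) (.var 21)))))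
      (.assign 21 (.bin .sub (.var 21) (.lit 1))))

/-- Output the top level. -/
def sccPop : Cmd :=
  .seq (forTo 24 (.lit 0) (.var 2)
      (.ite (.bin .eq (.get 10 (.var 24)) (.var 21))
        (.seq (.put 12 (.var 22) (.var 24)) (.seq (.assign 22 (.bin .add (.var 22) (.lit 1)))
          (.put 10 (.var 24) (.bin .add (.var 2) (.lit 2))))) .skip))
    (.assign 21 (.bin .sub (.var 21) (.lit 1)))

/-- Number of new vertices. -/
def newCard (m : ℕ) (lev : ℕ → ℕ) : ℕ := ((Finset.range m).filter fun v => lev v = 0).card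

theorem newCard_congr {m : ℕ} {lev lev' : ℕ → ℕ} (h : ∀ v < m, lev' v = 0 ↔ lev v = 0) :
    newCard m lev' = newCard m lev := by
  rw [newCard, newCard, Finset.filter_congr fun v hv => h v (by simpa using hv)]

/-- The memory holds the state of the algorithm, on the graph given by the refinement. -/
def HoldsScc (σ : State) (m : ℕ) (E s own lev R ord : ℕ → ℕ) (S cnt : ℕ) : Prop :=
  σ.var 2 = m ∧ σ.arr 4 = E ∧ σ.arr 5 = s ∧ σ.arr 9 = own ∧ σ.arr 10 = lev ∧ σ.arr 11 = R ∧
    σ.arr 12 = ord ∧ σ.var 21 = S ∧ σ.var 22 = cnt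

section

variable {W m : ℕ} {E s own lev R ord rank : ℕ → ℕ} {S cnt r : ℕ} {σ : State}

theorem sccPush_spec {x : ℕ} (hW : 2 * m + 5 ≤ W) (hσ : HoldsScc σ m E s own lev R ord S cnt)
    (h : SccInv m (seqArc (fun u x => E (u * m + x)) s own) lev R ord rank S cnt r) (hS : 0 < S)
    (hx : x < m) (hx0 : lev x = 0) (hRx : R (S * m + x) ≠ 0) (h23 : σ.var 23 = x) :
    Runs W sccPush σ fun t τ => t ≤ m * 100 + 50 ∧ ∃ lev' R',
      HoldsScc τ m E s own lev' R' ord (S + 1) cnt ∧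
      SccInv m (seqArc (fun u x => E (u * m + x)) s own) lev' R' ord rank (S + 1) cnt r ∧
      newCard m lev = newCard m lev' + 1 := by
  classical
  obtain ⟨h2, h4, h5, h9, h10, h11, h12, h21, h22⟩ := hσ
  have hSm := h.S_le
  rw [sccPush, runs_seq, runs_assign, runs_seq, runs_put]
  simp only [Expr.eval, BinOp.eval, Expr.cost, State.setVar_var, Nat.reduceEqDiff, reduceIte, h21,
    h23]
  refine ⟨by omega, by omega, ?_⟩
  refine runs_fill 0 m ((S + 1) * m)
    (fun w => if seqArc (fun u x => E (u * m + x)) s own x w then 1 else 0) rfl (by omega)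
    (by omega) ?_ ?_ ?_
  · intro τ hF
    simp only [Expr.eval]; rw [hF.var 2 rfl]; simpa using h2
  · intro k τ h1 h2' h3 hF _
    have g2 : τ.var 2 = m := by rw [hF.var 2 rfl]; simpa using h2
    have g21 : τ.var 21 = S + 1 := by rw [hF.var 21 rfl]; simp
    have g23 : τ.var 23 = x := by rw [hF.var 23 rfl]; simpa using h23
    refine ⟨?_, ?_, ?_⟩
    · simp only [Expr.eval, BinOp.eval, g2, g21, h3]
    · rw [Expr.eval_bool (eval_arcExpr (v := .var 23) (w := .var 24) g2 g23 h3)]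
      rw [hF.arr 4 rfl, hF.arr 5 rfl, hF.arr 9 rfl]
      simp only [State.setArr_arr, State.setVar_arr, Nat.reduceEqDiff, reduceIte, h4, h5, h9]
    · split_ifs <;> omega
  · intro t τ ht hF h11'
    refine ⟨?_, Function.update lev x (S + 1), _, ⟨?_, ?_, ?_, ?_, ?_, rfl, ?_, ?_, ?_⟩, ?_, ?_⟩
    · simp only [Expr.cost, Expr.bool, arcExpr, cellE, Expr.not] at ht
      omega
    · rw [hF.var 2 rfl]; simpa using h2
    · rw [hF.arr 4 rfl]; simpa [State.setArr_arr] using h4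
    · rw [hF.arr 5 rfl]; simpa [State.setArr_arr] using h5
    · rw [hF.arr 9 rfl]; simpa [State.setArr_arr] using h9
    · rw [hF.arr 10 rfl]; simp [State.setArr_arr, h10]
    · rw [hF.arr 12 rfl]; simpa [State.setArr_arr] using h12
    · rw [hF.var 21 rfl]; simp
    · rw [hF.var 22 rfl]; simpa using h22
    · refine h.push hS hx hx0 hRx ?_ ?_
      · intro j hj
        rw [h11']
        simp only [State.setArr_arr, State.setVar_arr, Nat.reduceEqDiff, reduceIte, h11]
        rw [if_neg (by omega)]
      · intro w hw
        rw [h11']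
        dsimp only
        rw [if_pos (by omega), Nat.add_sub_cancel_left]
        simp
    · have : ((Finset.range m).filter fun v => lev v = 0) =
          insert x ((Finset.range m).filter fun v => Function.update lev x (S + 1) v = 0) := by
        ext v
        by_cases hvx : v = x
        · subst hvx; simp [hx, hx0]
        · simp [hvx]
      rw [newCard, newCard, this, Finset.card_insert_of_notMem (by simp)]

theorem sccMerge_spec {x : ℕ} (hW : 2 * m + 5 ≤ W) (hσ : HoldsScc σ m E s own lev R ord S cnt)
    (h : SccInv m (seqArc (fun u x => E (u * m + x)) s own) lev R ord rank S cnt r)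
    (hx : x < m) (hx2 : 2 ≤ lev x) (hxS : lev x < S) (hRx : R (S * m + x) ≠ 0) :
    Runs W sccMerge σ fun t τ => t ≤ m * 100 + 50 ∧ ∃ lev' R',
      HoldsScc τ m E s own lev' R' ord (S - 1) cnt ∧
      SccInv m (seqArc (fun u x => E (u * m + x)) s own) lev' R' ord rank (S - 1) cnt r ∧
      newCard m lev' = newCard m lev := by
  classical
  obtain ⟨h2, h4, h5, h9, h10, h11, h12, h21, h22⟩ := hσ
  have hSm := h.S_le
  have hlevle : ∀ v < m, lev v ≤ m + 2 := fun v hv => by have := h.levels v hv; omega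
  have hmm : (S - 1) * m + m = S * m := by
    rw [← Nat.succ_mul]; congr 1; omega
  rw [sccMerge, runs_seq]
  refine runs_fill 0 m ((S - 1) * m)
    (fun w => if R ((S - 1) * m + w) ≠ 0 ∨ R (S * m + w) ≠ 0 then 1 else 0) rfl (by omega)
    (by omega) ?_ ?_ ?_
  · intro τ hF
    simp only [Expr.eval]; rw [hF.var 2 rfl, h2]
  · intro k τ h1 h2' h3 hF hI
    have g2 : τ.var 2 = m := by rw [hF.var 2 rfl, h2]
    have g21 : τ.var 21 = S := by rw [hF.var 21 rfl, h21]
    refine ⟨?_, ?_, ?_⟩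
    · simp only [Expr.eval, BinOp.eval, g2, g21, h3]
    · refine Expr.eval_bool ?_
      rw [Expr.eval_add]
      simp only [Expr.eval, BinOp.eval, g2, g21, h3, hI]
      rw [if_neg (by omega), if_neg (by omega), h11]
    · split_ifs <;> omega
  intro t1 τ1 ht1 hF1 h11'
  rw [runs_seq]
  refine runs_fill 0 m 0 (fun w => if lev w = S then S - 1 else lev w) rfl (by omega)
    (by omega) ?_ ?_ ?_
  · intro τ hF
    simp only [Expr.eval]; rw [hF.var 2 rfl, hF1.var 2 rfl, h2]
  · intro k τ h1 h2' h3 hF hI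
    have g21 : τ.var 21 = S := by rw [hF.var 21 rfl, hF1.var 21 rfl, h21]
    have g10 : τ.arr 10 k = lev k := by
      rw [hI]; dsimp only; rw [if_neg (by omega), hF1.arr 10 rfl, h10]
    refine ⟨?_, ?_, ?_⟩
    · simp only [Expr.eval, BinOp.eval, h3]
    · by_cases hk : lev k = S <;> simp [Expr.eval, BinOp.eval, g21, h3, g10, hk]
    · have := hlevle k h2'
      split_ifs <;> omega
  intro t2 τ2 ht2 hF2 h10'
  rw [runs_assign]
  simp only [Expr.eval, BinOp.eval, Expr.cost]
  rw [hF2.var 21 rfl, hF1.var 21 rfl, h21]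
  refine ⟨by omega, ?_, _, _, ⟨?_, ?_, ?_, ?_, rfl, rfl, ?_, ?_, ?_⟩, ?_, ?_⟩
  · simp only [Expr.cost, Expr.bool] at ht1 ht2
    omega
  · simp; rw [hF2.var 2 rfl, hF1.var 2 rfl, h2]
  · simp; rw [hF2.arr 4 rfl, hF1.arr 4 rfl, h4]
  · simp; rw [hF2.arr 5 rfl, hF1.arr 5 rfl, h5]
  · simp; rw [hF2.arr 9 rfl, hF1.arr 9 rfl, h9]
  · simp; rw [hF2.arr 12 rfl, hF1.arr 12 rfl, h12]
  · simp
  · simp; rw [hF2.var 22 rfl, hF1.var 22 rfl, h22]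
  · refine h.merge hx hx2 hxS hRx ?_ ?_ ?_
    · intro v hv
      simp only [State.setVar_arr]
      rw [h10']; dsimp only; rw [if_pos (by omega), Nat.sub_zero]
    · intro j hj
      simp only [State.setVar_arr]
      rw [hF2.arr 11 rfl, h11']; dsimp only; rw [if_neg (by omega), h11]
    · intro w hw
      simp only [State.setVar_arr]
      rw [hF2.arr 11 rfl, h11']; dsimp only
      rw [if_pos (by omega), Nat.add_sub_cancel_left]
      simp only [ne_eq, ite_eq_right_iff, one_ne_zero, imp_false, not_not]
  · refine newCard_congr fun v hv => ?_
    simp only [State.setVar_arr]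
    rw [h10']; dsimp only; rw [if_pos (by omega), Nat.sub_zero]
    split_ifs <;> omega

theorem sccPop_spec (hW : 2 * m + 5 ≤ W) (hσ : HoldsScc σ m E s own lev R ord S cnt)
    (h : SccInv m (seqArc (fun u x => E (u * m + x)) s own) lev R ord rank S cnt r) (hS : 0 < S)
    (hno : ∀ w < m, R (S * m + w) ≠ 0 → lev w = S ∨ lev w = m + 2) :
    Runs W sccPop σ fun t τ => t ≤ m * 100 + 50 ∧ ∃ lev' ord' rank' cnt',
      HoldsScc τ m E s own lev' R ord' (S - 1) cnt' ∧
      SccInv m (seqArc (fun u x => E (u * m + x)) s own) lev' R ord' rank' (S - 1) cnt' (r + 1) ∧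
      newCard m lev' = newCard m lev := by
  obtain ⟨h2, h4, h5, h9, h10, h11, h12, h21, h22⟩ := hσ
  have hSm := h.S_le
  have hcm := h.cnt_le
  rw [sccPop, runs_seq]
  refine runs_forTo 0 m 30 (fun k τ => ∃ cnt', τ.var 22 = cnt' ∧ cnt ≤ cnt' ∧ cnt' ≤ cnt + k ∧
    (∀ i < cnt, τ.arr 12 i = ord i) ∧
    (∀ i, cnt ≤ i → i < cnt' → τ.arr 12 i < k ∧ lev (τ.arr 12 i) = S) ∧
    (∀ i j, cnt ≤ i → i < j → j < cnt' → τ.arr 12 i ≠ τ.arr 12 j) ∧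
    (∀ v < k, lev v = S → ∃ i < cnt', τ.arr 12 i = v) ∧
    (∀ v, τ.arr 10 v = if v < k ∧ lev v = S then m + 2 else lev v)) rfl (by omega) (by omega) rfl
    ?_ ?_ ?_ ?_
  · intro τ hF
    simp only [Expr.eval]; rw [hF.var 2 rfl, h2]
  · refine ⟨cnt, by simpa using h22, le_rfl, le_rfl, ?_, by omega, by omega, by omega, ?_⟩
    · intro i _; simp [h12]
    · intro v; simp [h10]
  · rintro k τ h0k hkm hk hF ⟨cnt', a0, a1, a2, a3, a4, a5, a6, a7⟩
    have g2 : τ.var 2 = m := by rw [hF.var 2 rfl, h2]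
    have g21 : τ.var 21 = S := by rw [hF.var 21 rfl, h21]
    rw [runs_ite, runs_skip, runs_seq, runs_put, runs_seq, runs_assign, runs_put]
    have hev : (Expr.bin .eq (.get 10 (.var 24)) (.var 21)).eval τ ≠ 0 ↔ lev k = S := by
      rw [Expr.eval_eq]
      simp only [Expr.eval, hk, g21, a7]
      rw [if_neg (by omega)]
    constructor
    · intro hne
      rw [hev] at hne
      simp only [Expr.eval, BinOp.eval, Expr.cost, State.setArr_var, State.setVar_var,
        State.setArr_arr, State.setVar_arr, Nat.reduceEqDiff, reduceIte, hk, g2, a0]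
      refine ⟨by omega, by omega, by omega, by omega, cnt' + 1, rfl, by omega, by omega, ?_, ?_, ?_,
        ?_, ?_⟩
      · intro i hi
        rw [Function.update_of_ne (by omega)]; exact a3 i hi
      · intro i hi1 hi2
        by_cases hic : i = cnt'
        · subst hic; rw [Function.update_self]; exact ⟨by omega, hne⟩
        · rw [Function.update_of_ne hic]
          have := a4 i hi1 (by omega)
          exact ⟨by omega, this.2⟩
      · intro i j hi hij hj
        rw [Function.update_of_ne (by omega)]
        by_cases hjc : j = cnt'
        · subst hjc
          rw [Function.update_self]
          have := a4 i hi hij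
          omega
        · rw [Function.update_of_ne hjc]; exact a5 i j hi hij (by omega)
      · intro v hv hvS
        by_cases hvk : v = k
        · exact ⟨cnt', by omega, by rw [Function.update_self, hvk]⟩
        · obtain ⟨i, hi, hiv⟩ := a6 v (by omega) hvS
          exact ⟨i, by omega, by rw [Function.update_of_ne (by omega), hiv]⟩
      · intro v
        by_cases hvk : v = k
        · subst hvk; rw [Function.update_self, if_pos ⟨by omega, hne⟩]
        · rw [Function.update_of_ne hvk, a7]
          congr 1
          simp only [eq_iff_iff]; omega
    · intro h0
      have hne : lev k ≠ S := fun h => hev.2 h h0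
      simp only [Expr.cost, State.setVar_var, State.setVar_arr, Nat.reduceEqDiff, reduceIte]
      refine ⟨by omega, cnt', a0, a1, by omega, a3, ?_, a5, ?_, ?_⟩
      · intro i h1 h2
        have := a4 i h1 h2
        exact ⟨by omega, this.2⟩
      · intro v hv hvS
        have hvk : v ≠ k := by rintro rfl; exact hne hvS
        exact a6 v (by omega) hvS
      · intro v
        rw [a7]
        by_cases hvk : v = k
        · subst hvk; simp [hne]
        · congr 1
          simp only [eq_iff_iff]; omega
  · rintro t τ ht hF - ⟨cnt', a0, a1, a2, a3, a4, a5, a6, a7⟩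
    rw [runs_assign]
    simp only [Expr.eval, BinOp.eval, Expr.cost]
    rw [hF.var 21 rfl, h21]
    refine ⟨by omega, ?_, τ.arr 10, τ.arr 12, _, cnt', ⟨?_, ?_, ?_, ?_, rfl, ?_, rfl, ?_, ?_⟩,
      h.pop hS hno ?_ a1 a3 a4 a5 a6, ?_⟩
    · simp only [Expr.cost] at ht
      omega
    · simp; rw [hF.var 2 rfl, h2]
    · simp; rw [hF.arr 4 rfl, h4]
    · simp; rw [hF.arr 5 rfl, h5]
    · simp; rw [hF.arr 9 rfl, h9]
    · simp; rw [hF.arr 11 rfl, h11]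
    · simp
    · simpa using a0
    · intro v hv
      rw [a7]; simp [hv]
    · refine newCard_congr fun v hv => ?_
      rw [a7]
      by_cases hvS : lev v = S
      · simp [hv, hvS, hS.ne']
      · simp [hvS]

end

/-- One step of the path-based algorithm. -/
def sccStep : Cmd :=
  -- Vertices are searched as `vertex + 1`, because 0 signals that no successor is left.
  .seq (findFirst 23 24 (.lit 1) (.bin .add (.var 2) (.lit 1))
      (.bin .mul
        (.get 11 (.bin .add (.bin .mul (.var 21) (.var 2)) (.bin .sub (.var 24) (.lit 1))))
        (.bin .mul (.not (.bin .eq (.get 10 (.bin .sub (.var 24) (.lit 1))) (.var 21)))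
          (.not (.bin .eq (.get 10 (.bin .sub (.var 24) (.lit 1)))
            (.bin .add (.var 2) (.lit 2)))))))
    (.ite (.var 23)
      (.seq (.assign 23 (.bin .sub (.var 23) (.lit 1))) (.ite (.get 10 (.var 23)) sccMerge sccPush))
      sccPop)

/-- Order the positions by strongly connected components. -/
def sccAll : Cmd :=
  .seq (.assign 21 (.lit 1))
    (.seq (forTo 24 (.lit 0) (.var 2)
        (.put 11 (.bin .add (.bin .mul (.lit 1) (.var 2)) (.var 24)) (.lit 1)))
      (.loop (.var 21) sccStep))

/-- The potential `2 * newCard m lev + S` drops in every step: a push removes a new vertex and adds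
one level, a merge or a pop removes a level. There are at most `2 * m + 1` steps of linear cost
each. -/
theorem sccAll_spec {W m : ℕ} {E s own : ℕ → ℕ} {σ : State} (hW : 2 * m + 5 ≤ W) (hm0 : 0 < m)
    (hm : σ.var 2 = m) (hE : σ.arr 4 = E) (h5 : σ.arr 5 = s) (h9 : σ.arr 9 = own)
    (h10 : ∀ v, σ.arr 10 v = 0) (h22 : σ.var 22 = 0) :
    Runs W sccAll σ fun t τ => t ≤ 2000 * (m * m) + 1000 ∧
      ∃ rank, SccSpec m (seqArc (fun u x => E (u * m + x)) s own) (τ.arr 12) rank := by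
  rw [sccAll, runs_seq, runs_assign, runs_seq]
  refine ⟨by simp [Expr.eval]; omega, ?_⟩
  refine runs_fill 0 m (1 * m) (fun _ => 1) rfl (by omega) (by omega) ?_ ?_ ?_
  · intro τ hF
    simp only [Expr.eval]; rw [hF.var 2 rfl]; simpa using hm
  · intro k τ h1 h2 h3 hF _
    have g2 : τ.var 2 = m := by rw [hF.var 2 rfl]; simpa using hm
    simp only [Expr.eval, BinOp.eval, g2, h3]
    exact ⟨trivial, trivial, by omega⟩
  intro t0 τ0 ht0 hF0 h11
  refine runs_loop_const (160 * m + 400) (fun k τ => ∃ lev R ord rank S cnt r,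
    HoldsScc τ m E s own lev R ord S cnt ∧
    SccInv m (seqArc (fun u x => E (u * m + x)) s own) lev R ord rank S cnt r ∧
    k = 2 * newCard m lev + S) (2 * newCard m (σ.arr 10) + 1) ?_ ?_ ?_
  · refine ⟨_, _, _, fun _ => 0, 1, 0, 0, ⟨?_, ?_, ?_, ?_, rfl, rfl, rfl, ?_, ?_⟩,
      SccInv.init ?_ ?_, ?_⟩
    · rw [hF0.var 2 rfl]; simpa using hm
    · rw [hF0.arr 4 rfl]; simpa using hE
    · rw [hF0.arr 5 rfl]; simpa using h5
    · rw [hF0.arr 9 rfl]; simpa using h9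
    · rw [hF0.var 21 rfl]; simp [Expr.eval]
    · rw [hF0.var 22 rfl]; simpa using h22
    · intro w hw
      rw [h11]; dsimp only; rw [if_pos (by omega)]; omega
    · intro v
      rw [hF0.arr 10 rfl]; simpa using h10 v
    · rw [hF0.arr 10 rfl]; simp
  · rintro k τ ⟨lev, R, ord, rank, S, cnt, r, hH, hI, rfl⟩ hne _
    have hH' := hH
    obtain ⟨g2, g4, g5, g9, g10, g11, g12, g21, g22⟩ := hH'
    simp only [Expr.eval, g21] at hne
    rw [sccStep, runs_seq]
    refine runs_findFirst 1 (m + 1)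
      (fun k => R (S * m + (k - 1)) ≠ 0 ∧ lev (k - 1) ≠ S ∧ lev (k - 1) ≠ m + 2)
      (by decide) rfl (by omega) (by omega) (by omega) ?_ ?_ ?_
    · intro ρ hF
      simp only [Expr.eval, BinOp.eval]; rw [hF.var 2 rfl, g2]
    · intro ρ hF h1 h2
      simp only [Expr.eval_mul, Expr.eval_not, Expr.eval_eq]
      simp only [Expr.eval, BinOp.eval]
      rw [hF.arr 10 rfl, hF.arr 11 rfl, hF.var 21 rfl, hF.var 2 rfl, g2, g10, g11, g21]
    intro t1 τ1 ht1 hF1 hr1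
    simp only [Expr.cost, Expr.not] at ht1
    have hH1 : HoldsScc τ1 m E s own lev R ord S cnt :=
      ⟨by rw [hF1.var 2 rfl, g2], by rw [hF1.arr 4 rfl, g4], by rw [hF1.arr 5 rfl, g5],
        by rw [hF1.arr 9 rfl, g9], by rw [hF1.arr 10 rfl, g10], by rw [hF1.arr 11 rfl, g11],
        by rw [hF1.arr 12 rfl, g12], by rw [hF1.var 21 rfl, g21], by rw [hF1.var 22 rfl, g22]⟩
    have hSp : 0 < S := Nat.pos_of_ne_zero hne
    rw [runs_ite]
    constructor
    · intro h23
      simp only [Expr.eval] at h23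
      rcases hr1 with hr1 | ⟨b1, b2, ⟨b3, b4, b5⟩, -⟩
      · exact absurd hr1.1 h23
      have hx : τ1.var 23 - 1 < m := by omega
      obtain ⟨x, hxe⟩ : ∃ x, τ1.var 23 - 1 = x := ⟨_, rfl⟩
      rw [hxe] at hx b3 b4 b5
      rw [runs_seq, runs_assign]
      simp only [Expr.eval, BinOp.eval, Expr.cost, hxe]
      refine ⟨by omega, ?_⟩
      have hH2 : HoldsScc (τ1.setVar 23 x) m E s own lev R ord S cnt := by
        simpa [HoldsScc] using hH1
      have hxl := hI.levels x hx
      rw [runs_ite]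
      simp only [Expr.eval, Expr.cost, State.setVar_arr, State.setVar_var, reduceIte, hH1.2.2.2.2.1]
      constructor
      · intro hne0
        refine (sccMerge_spec (x := x) hW hH2 hI hx (by omega) (by omega) b3).mono ?_
        rintro t ρ ⟨ht, lev', R', hH', hI', hn⟩
        exact ⟨by omega, _, by omega, lev', R', ord, rank, S - 1, cnt, r, hH', hI', rfl⟩
      · intro he0
        refine (sccPush_spec (x := x) hW hH2 hI hSp hx he0 b3 (by simp)).mono ?_
        rintro t ρ ⟨ht, lev', R', hH', hI', hn⟩
        exact ⟨by omega, _, by omega, lev', R', ord, rank, S + 1, cnt, r, hH', hI', rfl⟩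
    · intro h23
      simp only [Expr.eval] at h23
      rcases hr1 with hr1 | hr1
      swap
      · omega
      refine (sccPop_spec hW hH1 hI hSp ?_).mono ?_
      · intro w hw hRw
        have := hr1.2 (w + 1) (by omega) (by omega)
        simp only [Nat.add_sub_cancel] at this
        tauto
      · rintro t ρ ⟨ht, lev', ord', rank', cnt', hH', hI', hn⟩
        simp only [Expr.cost]
        exact ⟨by omega, _, by omega, lev', R, ord', rank', S - 1, cnt', r + 1, hH', hI', rfl⟩
  · rintro t k' τ ht ⟨lev, R, ord, rank, S, cnt, r, hH, hI, rfl⟩ h0 _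
    simp only [Expr.eval, hH.2.2.2.2.2.2.2.1] at h0
    subst h0
    refine ⟨?_, rank, ?_⟩
    · have hn : newCard m (σ.arr 10) ≤ m := (Finset.card_filter_le _ _).trans (by simp)
      simp only [Expr.cost] at ht0 ht ⊢
      have : (2 * newCard m (σ.arr 10) + 1) * (160 * m + 400 + 1 + 1) ≤
          (2 * m + 1) * (160 * m + 400 + 1 + 1) := Nat.mul_le_mul_right _ (by omega)
      have h2 : (2 * m + 1) * (160 * m + 400 + 1 + 1) = 320 * (m * m) + 964 * m + 402 := by
        ring
      have h3 : m ≤ m * m := Nat.le_mul_self m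
      omega
    · rw [hH.2.2.2.2.2.2.1]
      exact hI.spec

end WordRAM


/-! ### Tabulating the colours and inserting the elements next to their pivots -/

namespace WordRAM

/-- Tabulate the relation relative to the last element. -/
def relTable : Cmd :=
  .seq (.assign 2 (.bin .sub (.var 0) (.lit 1)))
    (forTo 20 (.lit 0) (.var 2) (forTo 24 (.lit 0) (.var 2)
      (.put 4 (.bin .add (.bin .mul (.var 20) (.var 2)) (.var 24))
        (.bin .eq
          (.bin .eq (.get 0 (.bin .add (.bin .mul (.var 20) (.var 0)) (.var 24)))
            (.get 0 (.bin .add (.bin .mul (.var 20) (.var 0)) (.var 2))))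
          (.bin .eq (.get 0 (.bin .add (.bin .mul (.var 2) (.var 0)) (.var 24)))
            (.get 0 (.bin .mul (.var 2) (.var 0))))))))

/-- The entries of the table. -/
def relEntry (T : ℕ → ℕ) (n u x : ℕ) : ℕ :=
  -- The right-hand comparison depends on `x` only, so incoming homogeneity does not notice it. It
  -- cancels the way in which the last element splits a set, which is what outgoing homogeneity
  -- needs.
  if T (u * n + x) = T (u * n + (n - 1)) ↔ T ((n - 1) * n + x) = T ((n - 1) * n) then 1 else 0

theorem relTable_spec {W n : ℕ} {σ : State} (hW : n + 5 ≤ W) (hn : σ.var 0 = n) :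
    Runs W relTable σ fun t τ => t ≤ 100 * (n * n) + 100 ∧ τ.var 2 = n - 1 ∧
      ∀ u < n - 1, ∀ x < n - 1, τ.arr 4 (u * (n - 1) + x) = relEntry (σ.arr 0) n u x := by
  rw [relTable, runs_seq, runs_assign]
  simp only [Expr.eval, BinOp.eval, Expr.cost, hn]
  refine ⟨by omega, ?_⟩
  refine runs_forTo 0 (n - 1) (40 * n + 20) (fun k τ => ∀ u < k, ∀ x < n - 1,
    τ.arr 4 (u * (n - 1) + x) = relEntry (σ.arr 0) n u x) rfl (by omega) (by omega) rfl ?_ ?_ ?_ ?_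
  · intro τ hF
    simp only [Expr.eval]; rw [hF.var 2 rfl]; simp
  · simp
  · intro k τ h0 hk hkk hF hI
    have g2 : τ.var 2 = n - 1 := by rw [hF.var 2 rfl]; simp
    refine runs_fill 0 (n - 1) (k * (n - 1)) (fun x => relEntry (σ.arr 0) n k x) rfl (by omega)
      (by omega) ?_ ?_ ?_
    · intro ρ hG
      simp only [Expr.eval]; rw [hG.var 2 rfl, g2]
    · intro l ρ h1 h2 h3 hG _
      have q2 : ρ.var 2 = n - 1 := by rw [hG.var 2 rfl, g2]
      have q0 : ρ.var 0 = n := by rw [hG.var 0 rfl, hF.var 0 rfl]; simpa using hn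
      have q20 : ρ.var 20 = k := by rw [hG.var 20 rfl, hkk]
      have qT : ρ.arr 0 = σ.arr 0 := by rw [hG.arr 0 rfl, hF.arr 0 rfl]; simp
      refine ⟨?_, ?_, ?_⟩
      · simp only [Expr.eval, BinOp.eval, q2, q20, h3]
      · simp only [Expr.eval, BinOp.eval, q2, q20, h3, q0, qT, relEntry]
        by_cases hA : σ.arr 0 (k * n + l) = σ.arr 0 (k * n + (n - 1)) <;>
          by_cases hB : σ.arr 0 ((n - 1) * n + l) = σ.arr 0 ((n - 1) * n) <;>
          simp [hA, hB]
      · simp only [relEntry]; split_ifs <;> omega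
    · intro t ρ ht hG h4
      refine ⟨?_, ?_⟩
      · simp only [Expr.cost] at ht
        omega
      · intro u hu x hx
        simp only [State.setVar_arr]
        rw [h4]
        by_cases huk : u = k
        · subst huk
          simp only []
          rw [if_pos (by omega), Nat.add_sub_cancel_left]
        · have : (u + 1) * (n - 1) ≤ k * (n - 1) := Nat.mul_le_mul_right _ (by omega)
          rw [add_mul] at this
          simp only []
          rw [if_neg (by omega)]
          exact hI u (by omega) x hx
  · intro t τ ht hF _ hI
    refine ⟨?_, ?_, hI⟩
    · simp only [Expr.cost, Nat.sub_zero] at ht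
      rcases Nat.eq_zero_or_pos n with rfl | hn0
      · simp at ht; omega
      · have h1 : (n - 1) * (40 * n + 20 + 1 + 7) ≤ n * (40 * n + 20 + 1 + 7) :=
          Nat.mul_le_mul_right _ (by omega)
        have h2 : n * (40 * n + 20 + 1 + 7) = 40 * (n * n) + 28 * n := by ring
        have h3 : n ≤ n * n := Nat.le_mul_self n
        omega
    · rw [hF.var 2 rfl]; simp

/-- The positions produced by inserting every element next to its pivot. -/
structure InsSpec (m : ℕ) (e : ℕ → ℕ → ℕ) (s own ord pos : ℕ → ℕ) : Prop where
  lt : ∀ v < m, pos v < m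
  inj : ∀ v < m, ∀ w < m, pos v = pos w → v = w
  same : ∀ t < m, 0 < t → ∀ t' < t, ord t' ≠ own (ord t) →
    (pos (ord t) < pos (ord t') ↔ pos (own (ord t)) < pos (ord t'))
  side : ∀ t < m, 0 < t →
    (pos (ord t) < pos (own (ord t)) ↔ e (s (ord t)) (s (own (ord t))) = 0)

/-- The invariant of insertion. -/
structure InsInv (m : ℕ) (e : ℕ → ℕ → ℕ) (s own ord pos : ℕ → ℕ) (T : ℕ) : Prop where
  lt : ∀ v < m, pos v < T
  inj : ∀ i < T, ∀ j < T, pos (ord i) = pos (ord j) → i = j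
  same : ∀ t < T, 0 < t → ∀ t' < t, ord t' ≠ own (ord t) →
    (pos (ord t) < pos (ord t') ↔ pos (own (ord t)) < pos (ord t'))
  side : ∀ t < T, 0 < t →
    (pos (ord t) < pos (own (ord t)) ↔ e (s (ord t)) (s (own (ord t))) = 0)

/-- The new element takes the place of its pivot (`d = 0`) or the next one (`d = 1`), and everything
from there on is shifted. Earlier elements keep their relative order, and the new one compares with
them as its pivot does. -/
theorem InsInv.step {m : ℕ} {e : ℕ → ℕ → ℕ} {s own ord pos pos' : ℕ → ℕ} {T d : ℕ}
    (h : InsInv m e s own ord pos T) (hT : T < m)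
    (hlt : ∀ i < m, ord i < m) (hinj : ∀ i < m, ∀ j < m, ord i = ord j → i = j)
    (hown : ∀ t < m, 0 < t → ∃ t' < t, ord t' = own (ord t)) (hT0 : 0 < T)
    (hd1 : d ≤ 1) (hd : d = 0 ↔ e (s (ord T)) (s (own (ord T))) = 0)
    (hv : pos' (ord T) = pos (own (ord T)) + d)
    (hk : ∀ k < m, k ≠ ord T →
      pos' k = if pos k < pos (own (ord T)) + d then pos k else pos k + 1) :
    InsInv m e s own ord pos' (T + 1) := by
  obtain ⟨tp, htp, hpe⟩ := hown T hT hT0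
  rw [← hpe] at hd hv hk
  have hne : ∀ i < T, ord i ≠ ord T := fun i hi he => by
    have := hinj i (by omega) T hT he; omega
  have hk' : ∀ i < T, pos' (ord i) = if pos (ord i) < pos (ord tp) + d then pos (ord i)
      else pos (ord i) + 1 := fun i hi => hk _ (hlt i (by omega)) (hne i hi)
  have hcmp : ∀ i < T, ∀ j < T, (pos' (ord i) < pos' (ord j) ↔ pos (ord i) < pos (ord j)) := by
    intro i hi j hj
    rw [hk' i hi, hk' j hj]
    split_ifs <;> omega
  have hpT := h.lt (ord tp) (hlt tp (by omega))
  constructor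
  · intro k hkm
    by_cases hkv : k = ord T
    · rw [hkv, hv]; omega
    · rw [hk k hkm hkv]
      have := h.lt k hkm
      split_ifs <;> omega
  · intro i hi j hj hij
    by_cases hiT : i = T
    · by_cases hjT : j = T
      · omega
      · rw [hiT, hv, hk' j (by omega)] at hij
        split_ifs at hij <;> omega
    · by_cases hjT : j = T
      · rw [hjT, hv, hk' i (by omega)] at hij
        split_ifs at hij <;> omega
      · refine h.inj i (by omega) j (by omega) ?_
        rw [hk' i (by omega), hk' j (by omega)] at hij
        split_ifs at hij <;> omega
  · intro t ht ht0 t' ht' hne'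
    by_cases htT : t = T
    · subst htT
      rw [← hpe] at hne' ⊢
      have hdiff : pos (ord t') ≠ pos (ord tp) := fun he =>
        hne' (by rw [h.inj t' ht' tp htp he])
      rw [hv, hk' t' ht', hk' tp htp]
      split_ifs <;> omega
    · obtain ⟨t2, ht2, he2⟩ := hown t (by omega) ht0
      have := h.same t (by omega) ht0 t' ht' hne'
      rw [← he2] at this ⊢
      rw [hcmp t (by omega) t' (by omega), hcmp t2 (by omega) t' (by omega)]
      exact this
  · intro t ht ht0
    by_cases htT : t = T
    · subst htT
      rw [← hpe, ← hd, hv, hk' tp htp]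
      split_ifs <;> omega
    · obtain ⟨t2, ht2, he2⟩ := hown t (by omega) ht0
      have := h.side t (by omega) ht0
      rw [← he2] at this ⊢
      rw [hcmp t (by omega) t2 (by omega)]
      exact this

/-- Insert all elements, and tabulate the resulting permutation. -/
def insertAll : Cmd :=
  .seq (forTo 20 (.lit 1) (.var 2)
      (.seq (.assign 26 (.get 12 (.var 20)))
        (.seq (.assign 27 (.bin .add (.get 13 (.get 9 (.var 26)))
            (cellE (.var 26) (.get 9 (.var 26)))))
          (.seq (forTo 24 (.lit 0) (.var 2) (.put 13 (.bin .add (.lit 0) (.var 24))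
              (.bin .add (.get 13 (.var 24)) (.not (.bin .lt (.get 13 (.var 24)) (.var 27))))))
            (.put 13 (.var 26) (.var 27))))))
    (forTo 24 (.lit 0) (.var 2) (.put 14 (.get 13 (.var 24)) (.get 5 (.var 24))))

/-- There are `m - 1` insertions of linear cost. At the end array 14 lists the elements by their
final positions. -/
theorem insertAll_spec {W m : ℕ} {E s own ord : ℕ → ℕ} {σ : State} (hm0 : 0 < m)
    (hW : m + 5 ≤ W) (hm : σ.var 2 = m) (hE : σ.arr 4 = E) (h5 : σ.arr 5 = s)
    (h9 : σ.arr 9 = own) (h12 : σ.arr 12 = ord) (h13 : ∀ v, σ.arr 13 v = 0)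
    (h01 : ∀ u < m, ∀ x < m, E (u * m + x) ≤ 1) (hs : ∀ i < m, s i < m)
    (hlt : ∀ i < m, ord i < m) (hinj : ∀ i < m, ∀ j < m, ord i = ord j → i = j)
    (hsurj : ∀ v < m, ∃ i < m, ord i = v)
    (hown : ∀ t < m, 0 < t → ∃ t' < t, ord t' = own (ord t)) :
    Runs W insertAll σ fun t τ => t ≤ 1000 * (m * m) + 1000 ∧ ∃ pos,
      InsSpec m (fun u x => E (u * m + x)) s own ord pos ∧ ∀ v < m, τ.arr 14 (pos v) = s v := by
  rw [insertAll, runs_seq]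
  refine runs_forTo 1 m (50 * m + 100) (fun k τ =>
    InsInv m (fun u x => E (u * m + x)) s own ord (τ.arr 13) k) rfl hm0 (by omega) rfl ?_ ?_ ?_ ?_
  · intro τ hF
    simp only [Expr.eval]; rw [hF.var 2 rfl, hm]
  -- All positions are 0, which already places the first element. Elements not inserted yet carry
  -- meaningless positions that are overwritten later and stay below the count.
  · constructor
    · intro v hv; simp [h13]
    · intro i hi j hj _; omega
    · intro t ht ht0; omega
    · intro t ht ht0; omega
  · intro T τ hT0 hTm hTT hF hI
    have g2 : τ.var 2 = m := by rw [hF.var 2 rfl, hm]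
    have g4 : τ.arr 4 = E := by rw [hF.arr 4 rfl, hE]
    have g5 : τ.arr 5 = s := by rw [hF.arr 5 rfl, h5]
    have g9 : τ.arr 9 = own := by rw [hF.arr 9 rfl, h9]
    have g12 : τ.arr 12 = ord := by rw [hF.arr 12 rfl, h12]
    obtain ⟨tp, htp, hpe⟩ := hown T hTm hT0
    have hpm : own (ord T) < m := by rw [← hpe]; exact hlt _ (by omega)
    have hd1 := h01 _ (hs _ (hlt T hTm)) _ (hs _ hpm)
    have hpos := hI.lt _ hpm
    have hoT := hlt T hTm
    rw [runs_seq, runs_assign]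
    simp only [Expr.eval, Expr.cost, g12, hTT]
    refine ⟨by omega, ?_⟩
    rw [runs_seq, runs_assign]
    simp only [cellE, Expr.eval, BinOp.eval, Expr.cost, State.setVar_arr, State.setVar_var,
      Nat.reduceEqDiff, reduceIte, g9, g4, g5, g2]
    refine ⟨by omega, ?_⟩
    rw [runs_seq]
    obtain ⟨d, hd⟩ : ∃ d, E (s (ord T) * m + s (own (ord T))) = d := ⟨_, rfl⟩
    rw [hd] at hd1 ⊢
    refine runs_fill 0 m 0 (fun k => if τ.arr 13 k < τ.arr 13 (own (ord T)) + d then τ.arr 13 k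
      else τ.arr 13 k + 1) rfl (by omega) (by omega) ?_ ?_ ?_
    · intro ρ hG
      simp only [Expr.eval]; rw [hG.var 2 rfl]; simpa using g2
    · intro k ρ h1 h2 h3 hG hI'
      have q13 : ρ.arr 13 k = τ.arr 13 k := by
        rw [hI']; simp only []; rw [if_neg (by omega)]; simp
      have q27 : ρ.var 27 = τ.arr 13 (own (ord T)) + d := by rw [hG.var 27 rfl]; simp
      refine ⟨?_, ?_, ?_⟩
      · simp only [Expr.eval, BinOp.eval, h3]
      · by_cases hlt' : τ.arr 13 k < τ.arr 13 (own (ord T)) + d <;>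
          simp [Expr.eval, BinOp.eval, Expr.not, h3, q13, q27, hlt']
      · have := hI.lt k h2
        split_ifs <;> omega
    intro t ρ ht hG h13'
    rw [runs_put]
    have q26 : ρ.var 26 = ord T := by rw [hG.var 26 rfl]; simp
    have q27 : ρ.var 27 = τ.arr 13 (own (ord T)) + d := by rw [hG.var 27 rfl]; simp
    simp only [Expr.eval, Expr.cost, q26, q27, State.setArr_arr, reduceIte]
    refine ⟨by omega, ?_, ?_⟩
    · simp only [Expr.cost, Expr.not] at ht
      omega
    · refine hI.step hTm hlt hinj hown hT0 hd1 (by rw [← hd]) (by rw [Function.update_self]) ?_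
      intro k hkm hkv
      rw [Function.update_of_ne hkv, h13']
      simp only []
      rw [if_pos (by omega), Nat.sub_zero]
  · intro t τ ht hF _ hI
    have hinjv : ∀ v < m, ∀ w < m, τ.arr 13 v = τ.arr 13 w → v = w := by
      intro v hv w hw hvw
      obtain ⟨i, hi, rfl⟩ := hsurj v hv
      obtain ⟨j, hj, rfl⟩ := hsurj w hw
      rw [hI.inj i hi j hj hvw]
    have g2 : τ.var 2 = m := by rw [hF.var 2 rfl, hm]
    have g5 : τ.arr 5 = s := by rw [hF.arr 5 rfl, h5]
    refine runs_forTo 0 m 10 (fun k ρ => ∀ v < k, ρ.arr 14 (τ.arr 13 v) = s v) rfl (by omega)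
      (by omega) rfl ?_ ?_ ?_ ?_
    · intro ρ hG
      simp only [Expr.eval]; rw [hG.var 2 rfl, g2]
    · intro v hv; omega
    · intro k ρ h0 hk hkk hG hJ
      rw [runs_put]
      simp only [Expr.eval, Expr.cost, hkk]
      rw [hG.arr 5 rfl, g5, hG.arr 13 rfl]
      have := hs k hk
      refine ⟨by omega, by omega, ?_⟩
      intro v hv
      simp only [State.setVar_arr, State.setArr_arr, reduceIte]
      by_cases hvk : v = k
      · subst hvk; rw [Function.update_self]
      · rw [Function.update_of_ne, hJ v (by omega)]
        exact fun h => hvk (hinjv v (by omega) k hk h)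
    · intro t' ρ ht' hG _ hJ
      refine ⟨?_, τ.arr 13, ⟨hI.lt, hinjv, hI.same, hI.side⟩, hJ⟩
      simp only [Expr.cost] at ht ht'
      have h1 : (m - 1) * (50 * m + 100 + 1 + 7) ≤ m * (50 * m + 100 + 1 + 7) :=
        Nat.mul_le_mul_right _ (by omega)
      have h2 : m * (50 * m + 100 + 1 + 7) = 50 * (m * m) + 108 * m := by ring
      have h3 : m ≤ m * m := Nat.le_mul_self m
      omega

end WordRAM


/-! ### The insertion order makes every strong module an interval -/

/-- The classes of partition refinement together with the order of insertion `tm` and the resulting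
positions `pos`, in terms of the positions of partition refinement. -/
structure ClassTree (m : ℕ) (e : ℕ → ℕ → ℕ) (own q rank tm pos : ℕ → ℕ) : Prop where
  hom : ∀ U ⊆ Set.Iio m, InHom e (Set.Iio m) U → IsModuleOf e (Set.Iio m) U
  le_one : ∀ u < m, ∀ v < m, e u v ≤ 1
  qlt : ∀ i < m, i < q i ∧ q i ≤ m
  q0 : q 0 = m
  lam : ∀ i < m, ∀ k, i < k → k < q i → q k ≤ q i ∧ i ≤ own k
  own_lt : ∀ i, 0 < i → i < m → own i < i ∧ i < q (own i)
  qmod : ∀ i < m, IsModuleOf e (Set.Iio m) (Set.Ico i (q i))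
  sep : ∀ c, 0 < c → c < m → ∀ U, IsModuleOf e (Set.Iio m) U →
    U ⊆ Set.Ico (own c) (q (own c)) → own c ∉ U →
    U ⊆ Set.Ico (own c) c ∨ U ⊆ Set.Ico c (q (own c))
  arc_rank : ∀ v < m, ∀ w < m, WordRAM.seqArc e id own v w → rank w ≤ rank v
  closed : ∀ v < m, ∀ w < m, rank v = rank w → ∀ Z, ArcClosed m (WordRAM.seqArc e id own) Z →
    v ∈ Z → w ∈ Z
  tm_rank : ∀ v < m, ∀ w < m, tm v ≤ tm w → rank v ≤ rank w
  tm_inj : ∀ v < m, ∀ w < m, tm v = tm w → v = w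
  tm_own : ∀ v, 0 < v → v < m → tm (own v) < tm v
  pos_inj : ∀ v < m, ∀ w < m, pos v = pos w → v = w
  same : ∀ v, 0 < v → v < m → ∀ y < m, tm y < tm v → y ≠ own v →
    (pos v < pos y ↔ pos (own v) < pos y)
  side : ∀ v, 0 < v → v < m → (pos v < pos (own v) ↔ e v (own v) = 0)

namespace ClassTree

variable {m : ℕ} {e : ℕ → ℕ → ℕ} {own q rank tm pos : ℕ → ℕ}

/-- `v` lies in the class of the child `c` of `p`. -/
theorem exists_child (h : ClassTree m e own q rank tm pos) {p v : ℕ} (hp : p < m) (hpv : p < v)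
    (hv : v < q p) : ∃ c, own c = p ∧ p < c ∧ c ≤ v ∧ v < q c := by
  induction v using Nat.strong_induction_on with
  | _ v ih =>
    have hvm : v < m := hv.trans_le (h.qlt p hp).2
    have h1 := (h.lam p hp v hpv hv).2
    have h2 := h.own_lt v (by omega) hvm
    rcases h1.lt_or_eq with h3 | h3
    · obtain ⟨c, a1, a2, a3, a4⟩ := ih (own v) h2.1 h3 (by omega)
      refine ⟨c, a1, a2, by omega, ?_⟩
      rcases a3.lt_or_eq with a5 | a5
      · have := (h.lam c (by omega) _ a5 a4).1
        omega
      · rw [← a5] at h2; exact h2.2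
    · exact ⟨v, h3.symm, hpv, le_rfl, (h.qlt v hvm).1⟩

theorem lt_of_mem (h : ClassTree m e own q rank tm pos) {c v : ℕ} (hc : c < m)
    (hv : v ∈ Set.Ico c (q c)) : v < m := hv.2.trans_le (h.qlt c hc).2

theorem self_mem (h : ClassTree m e own q rank tm pos) {c : ℕ} (hc : c < m) :
    c ∈ Set.Ico c (q c) := ⟨le_rfl, (h.qlt c hc).1⟩

theorem seg_sub (h : ClassTree m e own q rank tm pos) {c v : ℕ} (hc : c < m)
    (hv : v ∈ Set.Ico c (q c)) : Set.Ico v (q v) ⊆ Set.Ico c (q c) := by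
  rcases hv.1.lt_or_eq with h1 | rfl
  · have := (h.lam c hc v h1 hv.2).1
    exact Set.Ico_subset_Ico h1.le this
  · exact subset_rfl

/-- Classes are closed under descendants. -/
theorem seg_down (h : ClassTree m e own q rank tm pos) {c v : ℕ} (hc : c < m) (hv0 : 0 < v)
    (hv : v < m) (ho : own v ∈ Set.Ico c (q c)) : v ∈ Set.Ico c (q c) :=
  h.seg_sub hc ho ⟨(h.own_lt v hv0 hv).1.le, (h.own_lt v hv0 hv).2⟩

theorem seg_up (h : ClassTree m e own q rank tm pos) {c v : ℕ} (hc : c < m)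
    (hv : v ∈ Set.Ico c (q c)) (hne : v ≠ c) : own v ∈ Set.Ico c (q c) := by
  have hcv : c < v := lt_of_le_of_ne hv.1 hne.symm
  have h1 := (h.lam c hc v hcv hv.2).2
  have h2 := (h.own_lt v (by omega) (h.lt_of_mem hc hv)).1
  have := hv.2
  exact ⟨h1, by omega⟩

/-- Classes of different children of the same pivot are disjoint. -/
theorem seg_disjoint (h : ClassTree m e own q rank tm pos) {c d v : ℕ} (hc : c < m) (hd : d < m)
    (hc0 : 0 < c) (hd0 : 0 < d) (ho : own c = own d) (hne : c ≠ d) (hv : v ∈ Set.Ico c (q c)) :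
    v ∉ Set.Ico d (q d) := by
  intro hv'
  rcases lt_or_gt_of_ne hne with h1 | h1
  · have := (h.lam c hc d h1 (by have := hv'.1; have := hv.2; omega)).2
    have := (h.own_lt c hc0 hc).1
    omega
  · have := (h.lam d hd c h1 (by have := hv.1; have := hv'.2; omega)).2
    have := (h.own_lt d hd0 hd).1
    omega

/-- Pivots are inserted before everything in their class, by climbing from `v` to `c`. -/
theorem tm_le (h : ClassTree m e own q rank tm pos) {c v : ℕ} (hc : c < m)
    (hv : v ∈ Set.Ico c (q c)) : tm c ≤ tm v := by
  induction v using Nat.strong_induction_on with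
  | _ v ih =>
    by_cases hvc : v = c
    · rw [hvc]
    · have h0 : 0 < v := by have := hv.1; omega
      have hvm := h.lt_of_mem hc hv
      exact (ih (own v) (h.own_lt v h0 hvm).1 (h.seg_up hc hv hvc)).trans (h.tm_own v h0 hvm).le

/-- Every class is an interval of the final order. -/
theorem pos_seg (h : ClassTree m e own q rank tm pos) {c u y : ℕ} (hc : c < m)
    (hu : u ∈ Set.Ico c (q c)) (hy : y < m) (hyc : y ∉ Set.Ico c (q c)) :
    pos u < pos y ↔ pos c < pos y := by
  -- Induction on the insertion times: the later of `u` and `y` was put directly next to its pivot,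
  -- so it can be replaced by that pivot, which lies on the same side of the class.
  obtain ⟨k, hk⟩ : ∃ k, k = tm u + tm y := ⟨_, rfl⟩
  induction k using Nat.strong_induction_on generalizing u y with
  | _ k ih =>
    by_cases huc : u = c
    · rw [huc]
    have hum := h.lt_of_mem hc hu
    have hu0 : 0 < u := by have := hu.1; omega
    have hou := h.seg_up hc hu huc
    have huy : u ≠ y := by rintro rfl; exact hyc hu
    rcases lt_or_gt_of_ne (fun he => huy (h.tm_inj u hum y hy he)) with hlt | hgt
    · have hy0 : 0 < y := by
        by_contra h0
        obtain rfl : y = 0 := by omega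
        have := h.tm_le (c := 0) (by omega) (v := u) (by rw [h.q0]; exact ⟨by omega, hum⟩)
        omega
      have hoy : own y ∉ Set.Ico c (q c) := fun ho => hyc (h.seg_down hc hy0 hy ho)
      have hoym : own y < m := (h.own_lt y hy0 hy).1.trans hy
      have hcu := h.tm_le hc hu
      have hne1 : u ≠ own y := by rintro rfl; exact hoy hu
      have hne2 : c ≠ own y := by rintro rfl; exact hoy (h.self_mem hc)
      have hne3 : c ≠ y := by rintro rfl; exact hyc (h.self_mem hc)
      have e1 := h.same y hy0 hy u hum hlt hne1
      have e2 := h.same y hy0 hy c hc (by omega) hne2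
      have e3 := ih _ (by have := h.tm_own y hy0 hy; omega) hu hoym hoy rfl
      have p1 : pos u ≠ pos y := fun he => huy (h.pos_inj u hum y hy he)
      have p2 : pos c ≠ pos y := fun he => hne3 (h.pos_inj c hc y hy he)
      have p3 : pos u ≠ pos (own y) := fun he => hne1 (h.pos_inj u hum _ hoym he)
      have p4 : pos c ≠ pos (own y) := fun he => hne2 (h.pos_inj c hc _ hoym he)
      omega
    · have hne : y ≠ own u := by rintro rfl; exact hyc hou
      rw [h.same u hu0 hum y hy hgt hne]
      exact ih _ (by have := h.tm_own u hu0 hum; omega) hou hy hyc rfl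

/-- Every module lies in the class of one of its elements. -/
theorem exists_top (h : ClassTree m e own q rank tm pos) {U : Set ℕ}
    (hU : IsModuleOf e (Set.Iio m) U) (hne : U.Nonempty) :
    ∃ p < m, p ∈ U ∧ U ⊆ Set.Ico p (q p) := by
  obtain ⟨u, hu⟩ := hne
  have hum : u < m := hU.sub hu
  -- Descent in the hierarchy: if `p` is not in `U`, then `sep` at both ends of the child class that
  -- meets `U` confines `U` to that class.
  have key : ∀ k p, p < m → m - p ≤ k → U ⊆ Set.Ico p (q p) → ∃ p < m, p ∈ U ∧ U ⊆ Set.Ico p (q p) := by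
    intro k
    induction k with
    | zero => intro p hp hk; omega
    | succ k ih =>
      intro p hp hk hsub
      by_cases hpU : p ∈ U
      · exact ⟨p, hp, hpU, hsub⟩
      have hup := hsub hu
      have hpu : p < u := lt_of_le_of_ne hup.1 (by rintro rfl; exact hpU hu)
      obtain ⟨c, c1, c2, c3, c4⟩ := h.exists_child hp hpu hup.2
      have hcm : c < m := by omega
      have hqc := (h.qlt c hcm).2
      have hqp : q c ≤ q p := (h.lam p hp c c2 (by have := hup.2; omega)).1
      refine ih c hcm (by omega) ?_
      have h1 : U ⊆ Set.Ico c (q p) := by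
        rcases h.sep c (by omega) hcm U hU (by rwa [c1]) (by rwa [c1]) with h' | h'
        · have := (h' hu).2; omega
        · rwa [c1] at h'
      rcases hqp.lt_or_eq with h2 | h2
      · have h2m : q c < m := h2.trans_le (h.qlt p hp).2
        -- The class of a child ends where the next child of the same pivot starts, unless it is the
        -- last one.
        have ho : own (q c) = p := by
          have k1 := (h.lam p hp (q c) (by omega) h2).2
          have k2 := h.own_lt (q c) (by omega) h2m
          by_contra hne
          have k3 : p < own (q c) := by omega
          rcases lt_or_ge (own (q c)) c with k4 | k4
          · have := (h.lam (own (q c)) (by omega) c k4 (by omega)).2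
            omega
          · rcases k4.lt_or_eq with k5 | k5
            · have := (h.lam c hcm (own (q c)) k5 k2.1).1
              omega
            · rw [← k5] at k2; omega
        rcases h.sep (q c) (by omega) h2m U hU (by rwa [ho]) (by rwa [ho]) with h' | h'
        · intro x hx
          exact ⟨(h1 hx).1, (h' hx).2⟩
        · have := (h' hu).1; omega
      · rwa [h2]
  exact key m 0 (by omega) (by omega) (by
    rw [h.q0]; intro x hx; exact ⟨Nat.zero_le _, hU.sub hx⟩)

/-- Siblings in the same strongly connected component lie in the same modules around their
pivot. -/
theorem mem_iff_of_rank_eq (h : ClassTree m e own q rank tm pos) {U : Set ℕ} {c d : ℕ}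
    (hU : IsModuleOf e (Set.Iio m) U) (hc0 : 0 < c) (hd0 : 0 < d) (hc : c < m) (hd : d < m)
    (ho : own d = own c) (hpU : own c ∈ U) (hr : rank c = rank d) (hdU : d ∈ U) : c ∈ U := by
  obtain ⟨p, hp⟩ : ∃ p, p = own c := ⟨_, rfl⟩
  have hpm : p < m := by have := h.own_lt c hc0 hc; omega
  by_contra hcU
  -- The positions outside the classes of siblings that belong to `U` form a closed set: a sibling
  -- that distinguishes a member of `U` from the pivot is itself in `U`. The set contains `c` but
  -- not `d`.
  have hZ : ArcClosed m (WordRAM.seqArc e id own)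
      {v | ¬ ∃ b, p < b ∧ b < m ∧ own b = p ∧ b ∈ U ∧ v ∈ Set.Ico b (q b)} := by
    rintro v hv w hw hvZ harc ⟨b, hpb, hb, hob, hbU, hwb⟩
    refine hvZ ⟨b, hpb, hb, hob, hbU, ?_⟩
    rcases harc with ⟨hv0, rfl⟩ | ⟨hv0, hw0, hne, how, harc⟩
    · exact h.seg_down hb hv0 hv hwb
    · by_cases hwb' : w = b
      · subst hwb'
        exfalso
        simp only [id] at harc
        have hvU : v ∈ U := by
          by_contra hvU
          refine harc (hU.inHom v hv hvU w hbU _ ?_)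
          rw [how, hob, hp]; exact hpU
        exact hvZ ⟨v, by have := h.own_lt v hv0 hv; omega, hv, how.trans hob, hvU, h.self_mem hv⟩
      · have := h.seg_up hb hwb hwb'
        rw [← how] at this
        exact h.seg_down hb hv0 hv this
  have hcZ : c ∈ {v | ¬ ∃ b, p < b ∧ b < m ∧ own b = p ∧ b ∈ U ∧ v ∈ Set.Ico b (q b)} := by
    rintro ⟨b, hpb, hb, hob, hbU, hcb⟩
    have hbc : b ≠ c := by rintro rfl; exact hcU hbU
    exact h.seg_disjoint hc hb hc0 (by omega) (hp.symm.trans hob.symm) hbc.symm (h.self_mem hc) hcb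
  exact h.closed c hc d hd hr _ hZ hcZ
    ⟨d, by have := h.own_lt d hd0 hd; omega, hd, ho.trans hp.symm, hdU, h.self_mem hd⟩

/-- Outsiders of a strong module are inserted before its elements. -/
theorem tm_lt_of_strong (h : ClassTree m e own q rank tm pos) {U : Set ℕ} {c b : ℕ}
    (hU : IsStrongModule e (Set.Iio m) U) (hc0 : 0 < c) (hb0 : 0 < b) (hc : c < m) (hb : b < m)
    (ho : own b = own c) (hpU : own c ∈ U) (hcU : c ∉ U) (hbU : b ∈ U) : tm c < tm b := by
  obtain ⟨p, hp⟩ : ∃ p, p = own c := ⟨_, rfl⟩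
  have hpm : p < m := by have := h.own_lt c hc0 hc; omega
  -- The pivot together with the classes of all siblings of rank at least that of `c` is a module,
  -- since no arc leads from lower rank to higher. The strong module `U` shares the pivot with it
  -- and misses `c`, hence lies inside it.
  have hV : IsModuleOf e (Set.Iio m)
      {v | v = p ∨ ∃ d, p < d ∧ d < m ∧ own d = p ∧ rank c ≤ rank d ∧ v ∈ Set.Ico d (q d)} := by
    refine h.hom _ ?_ ?_
    · rintro v (rfl | ⟨d, -, hd, -, -, hv⟩)
      · exact hpm
      · exact h.lt_of_mem hd hv
    · intro x hx hxn
      have key : ∀ u ∈ {v | v = p ∨ ∃ d, p < d ∧ d < m ∧ own d = p ∧ rank c ≤ rank d ∧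
          v ∈ Set.Ico d (q d)}, e u x = e p x := by
        rintro u (rfl | ⟨d, hpd, hd, hod, hrd, hu⟩)
        · rfl
        by_cases hxp : x ∈ Set.Ico p (q p)
        · have hxp' : p < x := lt_of_le_of_ne hxp.1 (by rintro rfl; exact hxn (.inl rfl))
          obtain ⟨g, g1, g2, g3, g4⟩ := h.exists_child hpm hxp' hxp.2
          have hgm : g < m := g3.trans_lt hx
          have hgr : ¬ rank c ≤ rank g := fun hr => hxn (.inr ⟨g, g2, hgm, g1, hr, g3, g4⟩)
          have hgd : g ≠ d := by rintro rfl; exact hgr hrd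
          have hdg : d ∉ Set.Ico g (q g) :=
            h.seg_disjoint hd hgm (by omega) (by omega) (hod.trans g1.symm) hgd.symm (h.self_mem hd)
          have hxd : x ∉ Set.Ico d (q d) :=
            h.seg_disjoint hgm hd (by omega) (by omega) (g1.trans hod.symm) hgd ⟨g3, g4⟩
          rw [(h.qmod d hd).inHom x hx hxd u hu d (h.self_mem hd),
            (h.qmod g hgm).outHom d hd hdg x ⟨g3, g4⟩ g (h.self_mem hgm),
            (h.qmod g hgm).outHom p hpm (by simp; omega) x ⟨g3, g4⟩ g (h.self_mem hgm)]
          by_contra hne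
          refine hgr (hrd.trans (h.arc_rank g hgm d hd (.inr ⟨by omega, by omega, hgd, ?_, ?_⟩)))
          · rw [g1, hod]
          · simpa only [id, g1] using hne
        · have hdp : d ∈ Set.Ico p (q p) :=
            ⟨hpd.le, by have := h.own_lt d (by omega) hd; rw [hod] at this; exact this.2⟩
          exact (h.qmod p hpm).inHom x hx hxp u (h.seg_sub hpm hdp hu) p (h.self_mem hpm)
      intro u hu v hv
      rw [key u hu, key v hv]
  have hpc : p < c := by have := h.own_lt c hc0 hc; omega
  have hcV : c ∈ {v | v = p ∨ ∃ d, p < d ∧ d < m ∧ own d = p ∧ rank c ≤ rank d ∧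
      v ∈ Set.Ico d (q d)} := .inr ⟨c, hpc, hc, hp.symm, le_rfl, h.self_mem hc⟩
  have hrle : rank c ≤ rank b := by
    rcases hU.nested hV ⟨p, by rw [hp]; exact hpU, .inl rfl⟩ with h' | h'
    · rcases h' hbU with hbp | ⟨d, hpd, hd, hod, hrd, hbd⟩
      · have := (h.own_lt b hb0 hb).1; omega
      · by_cases hdb : d = b
        · rwa [← hdb]
        · exact absurd hbd (h.seg_disjoint hb hd hb0 (by omega) (by rw [ho, ← hp, hod])
            (Ne.symm hdb) (h.self_mem hb))
    · exact absurd (h' hcV) hcU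
  have hrne : rank c ≠ rank b := fun hr => hcU
    (h.mem_iff_of_rank_eq hU.mod hc0 hb0 hc hb ho hpU hr hbU)
  by_contra hle
  have := h.tm_rank b hb c hc (by omega)
  omega

/-- Two disjoint classes are both intervals, so their heads compare like any of their elements. -/
theorem pos_lt_iff_of_children (h : ClassTree m e own q rank tm pos) {c d u w : ℕ} (hc : c < m)
    (hd : d < m) (hc0 : 0 < c) (hd0 : 0 < d) (ho : own c = own d) (hne : c ≠ d)
    (hu : u ∈ Set.Ico c (q c)) (hw : w ∈ Set.Ico d (q d)) : pos u < pos w ↔ pos c < pos d := by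
  have hum := h.lt_of_mem hc hu
  have hwm := h.lt_of_mem hd hw
  have hwc := h.seg_disjoint hd hc hd0 hc0 ho.symm hne.symm hw
  have hcd := h.seg_disjoint hc hd hc0 hd0 ho hne (h.self_mem hc)
  rw [h.pos_seg hc hu hwm hwc]
  have h1 := h.pos_seg hd hw hc hcd
  have h2 : pos c ≠ pos w := fun he => hwc ((h.pos_inj c hc w hwm he) ▸ h.self_mem hc)
  have h3 : pos c ≠ pos d := fun he => hne (h.pos_inj c hc d hd he)
  omega

/-- Strong modules are intervals. -/
theorem pos_strong (h : ClassTree m e own q rank tm pos) {U : Set ℕ}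
    (hU : IsStrongModule e (Set.Iio m) U) {u w y : ℕ} (hu : u ∈ U) (hw : w ∈ U) (hy : y < m)
    (hyU : y ∉ U) : pos u < pos y ↔ pos w < pos y := by
  obtain ⟨p, hpm, hpU, hUp⟩ := h.exists_top hU.mod hU.nonempty
  suffices key : ∀ u ∈ U, (pos u < pos y ↔ pos p < pos y) by rw [key u hu, key w hw]
  clear hu hw u w
  intro u hu
  by_cases hyp : y ∈ Set.Ico p (q p)
  swap
  · exact h.pos_seg hpm (hUp hu) hy hyp
  by_cases hup : u = p
  · rw [hup]
  have hpy : p < y := lt_of_le_of_ne hyp.1 (by rintro rfl; exact hyU hpU)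
  have hpu : p < u := lt_of_le_of_ne (hUp hu).1 (Ne.symm hup)
  obtain ⟨c, c1, c2, c3, c4⟩ := h.exists_child hpm hpy hyp.2
  obtain ⟨b, b1, b2, b3, b4⟩ := h.exists_child hpm hpu (hUp hu).2
  have hum : u < m := hU.mod.sub hu
  have hbm : b < m := by omega
  have hcm : c < m := by omega
  have hnest : ∀ g, p < g → g < m → ∀ x ∈ Set.Ico g (q g), x ∈ U → Set.Ico g (q g) ⊆ U := by
    intro g hpg hg x hx hxU
    rcases hU.nested (h.qmod g hg) ⟨x, hxU, hx⟩ with h' | h'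
    · exact absurd (h' hpU).1 (by omega)
    · exact h'
  have hbU : b ∈ U := hnest b b2 hbm u ⟨b3, b4⟩ hu (h.self_mem hbm)
  have hcU : c ∉ U := fun hc => hyU (hnest c c2 hcm c (h.self_mem hcm) hc ⟨c3, c4⟩)
  have hbc : b ≠ c := by rintro rfl; exact hcU hbU
  -- The outsider `c` is already placed when `b` is put next to the pivot, so `b` and the pivot lie
  -- on the same side of `c`.
  have hlt := h.tm_lt_of_strong hU (by omega) (by omega) hcm hbm (b1.trans c1.symm)
    (by rwa [c1]) hcU hbU
  rw [h.pos_lt_iff_of_children hbm hcm (by omega) (by omega) (b1.trans c1.symm) hbc ⟨b3, b4⟩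
    ⟨c3, c4⟩, h.same b (by omega) hbm c hcm hlt (by omega), b1]
  have hpc : p ∉ Set.Ico c (q c) := by simp; omega
  have h1 := h.pos_seg hcm ⟨c3, c4⟩ hpm hpc
  have h2 : pos p ≠ pos c := fun he => by have := h.pos_inj p hpm c hcm he; omega
  have h3 : pos p ≠ pos y := fun he => by have := h.pos_inj p hpm y hy he; omega
  omega

/-- The elements of a class of a pivot are on the correct side of the pivot. -/
theorem pos_lt_pivot (h : ClassTree m e own q rank tm pos) {p u : ℕ} (hp : p < m) (hpu : p < u)
    (hu : u < q p) : pos u < pos p ↔ e u p = 0 := by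
  obtain ⟨c, c1, c2, c3, c4⟩ := h.exists_child hp hpu hu
  have hcm : c < m := by have := (h.qlt p hp).2; omega
  have hpc : p ∉ Set.Ico c (q c) := by simp; omega
  rw [h.pos_seg hcm ⟨c3, c4⟩ hp hpc, (h.qmod c hcm).inHom p hp hpc u ⟨c3, c4⟩ c (h.self_mem hcm)]
  have := h.side c (by omega) hcm
  rwa [c1] at this

/-- The lowest common ancestor of two positions. -/
theorem exists_lca (h : ClassTree m e own q rank tm pos) {u w : ℕ} (hu : u < m) (hw : w < m)
    (hne : u ≠ w) : ∃ p < m, (u = p ∧ p < w ∧ w < q p) ∨ (w = p ∧ p < u ∧ u < q p) ∨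
      ∃ c d, own c = p ∧ own d = p ∧ p < c ∧ p < d ∧ c ≠ d ∧ u ∈ Set.Ico c (q c) ∧
        w ∈ Set.Ico d (q d) := by
  have key : ∀ k p, p < m → m - p ≤ k → u ∈ Set.Ico p (q p) → w ∈ Set.Ico p (q p) →
      ∃ p < m, (u = p ∧ p < w ∧ w < q p) ∨ (w = p ∧ p < u ∧ u < q p) ∨
      ∃ c d, own c = p ∧ own d = p ∧ p < c ∧ p < d ∧ c ≠ d ∧ u ∈ Set.Ico c (q c) ∧
        w ∈ Set.Ico d (q d) := by
    intro k
    induction k with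
    | zero => intro p hp hk; omega
    | succ k ih =>
      intro p hp hk hup hwp
      by_cases hu' : u = p
      · exact ⟨p, hp, .inl ⟨hu', by have := hwp.1; omega, hwp.2⟩⟩
      by_cases hw' : w = p
      · exact ⟨p, hp, .inr (.inl ⟨hw', by have := hup.1; omega, hup.2⟩)⟩
      obtain ⟨c, c1, c2, c3, c4⟩ := h.exists_child hp (v := u) (by have := hup.1; omega) hup.2
      obtain ⟨d, d1, d2, d3, d4⟩ := h.exists_child hp (v := w) (by have := hwp.1; omega) hwp.2
      by_cases hcd : c = d
      · subst hcd
        exact ih c (by omega) (by omega) ⟨c3, c4⟩ ⟨d3, d4⟩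
      · exact ⟨p, hp, .inr (.inr ⟨c, d, c1, d1, c2, d2, hcd, ⟨c3, c4⟩, ⟨d3, d4⟩⟩)⟩
  exact key m 0 (by omega) (by omega) (by rw [h.q0]; exact ⟨by omega, hu⟩)
    (by rw [h.q0]; exact ⟨by omega, hw⟩)

/-- The children of a linear node are ordered by position. -/
theorem pos_linear (h : ClassTree m e own q rank tm pos) {N : Set ℕ}
    (hN : IsStrongModule e (Set.Iio m) N) (hs : HasSplit e (Set.Iio m) N) {u w : ℕ} (hu : u ∈ N)
    (hw : w ∈ N) (hT : ¬ Together e (Set.Iio m) N u w) (hne : e u w ≠ e w u) :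
    pos u < pos w ↔ e u w = 0 := by
  have hlt : ∀ x ∈ N, x < m := fun x hx => hN.mod.sub hx
  have hTr : ∀ x ∈ N, ∀ y ∈ N, y ≠ x → Together e (Set.Iio m) N x x := by
    intro x hx y hy hxy
    refine ⟨{x}, .singleton (hlt x hx), ?_, rfl, rfl⟩
    refine (Set.singleton_subset_iff.2 hx).ssubset_of_ne ?_
    intro he
    exact hxy (by rwa [← he] at hy)
  obtain ⟨a, b, hab, htr⟩ := degenerate_of_hasSplit hN hs
  have hab' : a ≠ b := by
    rintro rfl
    rcases hab u hu w hw hT with ⟨h1, h2⟩ | ⟨h1, h2⟩ <;> exact hne (by rw [h1, h2])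
  have htr := htr hab'
  have htot : ∀ x ∈ N, ∀ y ∈ N, ¬ Together e (Set.Iio m) N x y → e x y ≠ e y x := by
    intro x hx y hy hxy
    rcases hab x hx y hy hxy with ⟨h1, h2⟩ | ⟨h1, h2⟩ <;> rw [h1, h2] <;> omega
  -- transitivity in both directions
  have htrans : ∀ x ∈ N, ∀ y ∈ N, ∀ z ∈ N, ¬ Together e (Set.Iio m) N x y →
      ¬ Together e (Set.Iio m) N y z → e x y = e y z → e x z = e x y := by
    intro x hx y hy z hz hxy hyz he
    rcases hab x hx y hy hxy with ⟨h1, h2⟩ | ⟨h1, h2⟩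
    · rcases hab y hy z hz hyz with ⟨h3, h4⟩ | ⟨h3, h4⟩
      · rw [(htr x hx y hy z hz hxy hyz h1 h2 h3 h4).2.1, h1]
      · omega
    · rcases hab y hy z hz hyz with ⟨h3, h4⟩ | ⟨h3, h4⟩
      · omega
      · rw [(htr z hz y hy x hx (fun t => hyz t.symm) (fun t => hxy t.symm) h3 h4 h1 h2).2.2, h2]
  have hum := hlt u hu
  have hwm := hlt w hw
  have huw : u ≠ w := by rintro rfl; exact hne rfl
  obtain ⟨p, hpm, ⟨rfl, h1, h2⟩ | ⟨rfl, h1, h2⟩ | ⟨c, d, hoc, hod, hpc, hpd, hcd, huc, hwd⟩⟩ :=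
    h.exists_lca hum hwm huw
  · have h3 := h.pos_lt_pivot hpm h1 h2
    have h4 : pos u ≠ pos w := fun he => huw (h.pos_inj u hum w hwm he)
    have h5 := h.le_one u hum w hwm
    have h6 := h.le_one w hwm u hum
    omega
  · exact h.pos_lt_pivot hpm h1 h2
  -- the two elements lie below different children of `p`
  have hcm : c < m := by have := huc.1; omega
  have hdm : d < m := by have := hwd.1; omega
  have hwc : w ∉ Set.Ico c (q c) :=
    h.seg_disjoint hdm hcm (by omega) (by omega) (hod.trans hoc.symm) hcd.symm hwd
  have hdc : d ∉ Set.Ico c (q c) :=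
    h.seg_disjoint hdm hcm (by omega) (by omega) (hod.trans hoc.symm) hcd.symm (h.self_mem hdm)
  have hud : u ∉ Set.Ico d (q d) :=
    h.seg_disjoint hcm hdm (by omega) (by omega) (hoc.trans hod.symm) hcd huc
  have hcd' : c ∉ Set.Ico d (q d) :=
    h.seg_disjoint hcm hdm (by omega) (by omega) (hoc.trans hod.symm) hcd (h.self_mem hcm)
  have hcN : Set.Ico c (q c) ⊆ N := by
    rcases hN.nested (h.qmod c hcm) ⟨u, hu, huc⟩ with h' | h'
    · exact absurd (h' hw) hwc
    · exact h'
  have hdN : Set.Ico d (q d) ⊆ N := by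
    rcases hN.nested (h.qmod d hdm) ⟨w, hw, hwd⟩ with h' | h'
    · exact absurd (h' hu) hud
    · exact h'
  have hpN : p ∈ N := by
    obtain ⟨p', hp'm, hp'N, hNp'⟩ := h.exists_top hN.mod hN.nonempty
    have hsubp : ∀ g, own g = p → p < g → g < m → Set.Ico g (q g) ⊆ Set.Ico p (q p) := by
      intro g hog hpg hg
      refine h.seg_sub hpm ⟨hpg.le, ?_⟩
      have := (h.own_lt g (by omega) hg).2
      rwa [hog] at this
    rcases hN.nested (h.qmod p hpm) ⟨u, hu, hsubp c hoc hpc hcm huc⟩ with h' | h'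
    · by_cases hpp : p' = p
      · rwa [← hpp]
      · exfalso
        have hp'p := h' hp'N
        obtain ⟨g, g1, g2, g3, g4⟩ := h.exists_child hpm (v := p') (by have := hp'p.1; omega) hp'p.2
        have hgm : g < m := by omega
        have hNg : N ⊆ Set.Ico g (q g) := hNp'.trans (h.seg_sub hgm ⟨g3, g4⟩)
        by_cases hgc : g = c
        · exact hwc (hgc ▸ hNg hw)
        · exact h.seg_disjoint hcm hgm (by omega) (by omega) (hoc.trans g1.symm) (Ne.symm hgc) huc
            (hNg hu)
    · exact h' (h.self_mem hpm)
  have hcN' := hcN (h.self_mem hcm)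
  have hdN' := hdN (h.self_mem hdm)
  have hTcd : ¬ Together e (Set.Iio m) N c d := by
    rintro ⟨C, hC, hCN, hcC, hdC⟩
    refine hT ⟨C, hC, hCN, ?_, ?_⟩
    · rcases hC.nested (h.qmod c hcm) ⟨c, hcC, h.self_mem hcm⟩ with h' | h'
      · exact absurd (h' hdC) hdc
      · exact h' huc
    · rcases hC.nested (h.qmod d hdm) ⟨d, hdC, h.self_mem hdm⟩ with h' | h'
      · exact absurd (h' hcC) hcd'
      · exact h' hwd
  have heuw : e u w = e c d := by
    rw [(h.qmod c hcm).inHom w hwm hwc u huc c (h.self_mem hcm),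
      (h.qmod d hdm).outHom c hcm hcd' w hwd d (h.self_mem hdm)]
  rw [h.pos_lt_iff_of_children hcm hdm (by omega) (by omega) (hoc.trans hod.symm) hcd huc hwd, heuw]
  -- the child inserted first
  have main : ∀ c d, own c = p → own d = p → p < c → p < d → c < m → d < m → c ∈ N → d ∈ N →
      ¬ Together e (Set.Iio m) N c d → tm c < tm d → (pos d < pos c ↔ e c d ≠ 0) := by
    intro c d hoc hod hpc hpd hcm hdm hcN hdN hTcd htm
    rw [h.same d (by omega) hdm c hcm htm (by omega), hod]
    have h1 := h.side c (by omega) hcm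
    rw [hoc] at h1
    have h2 : pos p ≠ pos c := fun he => by have := h.pos_inj p hpm c hcm he; omega
    -- The later child `d` is placed next to the pivot, so it lies on the same side of `c` as the
    -- pivot does; this side is the one given by the colour `e c p`.
    suffices hkey : e c d = e c p by rw [hkey]; omega
    have hTpc : ¬ Together e (Set.Iio m) N p c := by
      rintro ⟨C, hC, hCN, hpC, hcC⟩
      have hdC : d ∉ C := fun hdC => hTcd ⟨C, hC, hCN, hcC, hdC⟩
      have := h.tm_lt_of_strong hC (by omega) (by omega) hdm hcm (hoc.trans hod.symm)
        (by rwa [hod]) hdC hcC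
      omega
    -- A strong module with `p` and `d` but without `c` looks homogeneous from `c`.
    by_cases hTpd : Together e (Set.Iio m) N p d
    · obtain ⟨C, hC, hCN, hpC, hdC⟩ := hTpd
      have hcC : c ∉ C := fun hcC => hTcd ⟨C, hC, hCN, hcC, hdC⟩
      exact hC.mod.outHom c hcm hcC d hdC p hpC
    -- Otherwise `c` lies strictly between `p` and `d` in the linear order. Then `c` distinguishes
    -- `d` from the pivot, and with `tm c < tm d` the ranks of `c` and `d` agree.
    by_contra hcon
    have l1 := h.le_one c hcm d hdm
    have l2 := h.le_one c hcm p hpm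
    have l3 := h.le_one p hpm c hcm
    have l4 := h.le_one d hdm c hcm
    have n1 := htot p hpN c hcN hTpc
    have n2 := htot c hcN d hdN hTcd
    have hpc' : e p c = e c d := by omega
    have hpd' := htrans p hpN c hcN d hdN hTpc hTcd hpc'
    have harc : WordRAM.seqArc e id own c d :=
      .inr ⟨by omega, by omega, by rintro rfl; exact n2 rfl, by rw [hoc, hod], by
        simp only [id, hoc]; omega⟩
    have hr1 := h.arc_rank c hcm d hdm harc
    have hr2 := h.tm_rank c hcm d hdm htm.le
    -- The elements on the same side of `d` as `p` form a module containing `p` and `c` but not `d`,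
    -- which is impossible for siblings of equal rank.
    have hU : IsModuleOf e (Set.Iio m)
        {x | x ∈ N ∧ ¬ Together e (Set.Iio m) N x d ∧ e x d = e p d} := by
      refine h.hom _ (fun x hx => hlt x hx.1) ?_
      intro x hx hxn
      suffices hk : ∃ k, ∀ z ∈ {x | x ∈ N ∧ ¬ Together e (Set.Iio m) N x d ∧ e x d = e p d},
          e z x = k by
        obtain ⟨k, hk⟩ := hk
        intro z hz z' hz'
        rw [hk z hz, hk z' hz']
      by_cases hxN : x ∈ N
      · refine ⟨e p d, ?_⟩
        rintro z ⟨hzN, hzT, hzd⟩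
        by_cases hxT : Together e (Set.Iio m) N x d
        · obtain ⟨C, hC, hCN, hxC, hdC⟩ := hxT
          have hzC : z ∉ C := fun hzC => hzT ⟨C, hC, hCN, hzC, hdC⟩
          rw [hC.mod.outHom z (hlt z hzN) hzC x hxC d hdC, hzd]
        · have m1 : e x d ≠ e p d := fun he => hxn ⟨hxN, hxT, he⟩
          have m2 := htot x hxN d hdN hxT
          have m3 := h.le_one x hx d hdm
          have m4 := h.le_one d hdm x hx
          have m5 := h.le_one p hpm d hdm
          rw [htrans z hzN d hdN x hxN hzT (fun t => hxT t.symm) (by omega), hzd]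
      · refine ⟨e p x, ?_⟩
        rintro z ⟨hzN, -, -⟩
        exact hN.mod.inHom x hx hxN z hzN p hpN
    have hdU := h.mem_iff_of_rank_eq (c := d) (d := c) hU (by omega) (by omega) hdm hcm
      (hoc.trans hod.symm) (by rw [hod]; exact ⟨hpN, hTpd, rfl⟩) (by omega)
      ⟨hcN, hTcd, by omega⟩
    exact hdU.2.1 (hTr d hdN c hcN (by rintro rfl; exact n2 rfl))
  have p1 : pos c ≠ pos d := fun he => hcd (h.pos_inj c hcm d hdm he)
  rcases lt_or_gt_of_ne (fun he => hcd (h.tm_inj c hcm d hdm he)) with htm | htm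
  · have := main c d hoc hod hpc hpd hcm hdm hcN' hdN' hTcd htm
    omega
  · have := main d c hod hoc hpd hpc hdm hcm hdN' hcN' (fun t => hTcd t.symm) htm
    have n1 := htot c hcN' d hdN' hTcd
    have l1 := h.le_one c hcm d hdm
    have l2 := h.le_one d hdm c hcm
    omega

end ClassTree


/-! ### Relabelling -/

section Relabel

variable {α β : Type*}

theorem inHom_preimage (σ : α ≃ β) {e : β → β → ℕ} {Y U : Set β} :
    InHom (fun i j => e (σ i) (σ j)) (σ ⁻¹' Y) (σ ⁻¹' U) ↔ InHom e Y U := by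
  constructor
  · intro h x hx hn u hu v hv
    have := h (σ.symm x) (by simpa) (by simpa) (σ.symm u) (by simpa) (σ.symm v) (by simpa)
    simpa using this
  · intro h x hx hn u hu v hv
    exact h _ hx hn _ hu _ hv

theorem isModuleOf_preimage (σ : α ≃ β) {e : β → β → ℕ} {Y U : Set β} :
    IsModuleOf (fun i j => e (σ i) (σ j)) (σ ⁻¹' Y) (σ ⁻¹' U) ↔ IsModuleOf e Y U := by
  constructor
  · intro h
    refine ⟨fun x hx => ?_, (inHom_preimage σ).1 h.inHom, ?_⟩
    · have : σ.symm x ∈ σ ⁻¹' Y := h.sub (by simpa)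
      simpa using this
    · intro x hx hn u hu v hv
      have := h.outHom (σ.symm x) (by simpa) (by simpa) (σ.symm u) (by simpa) (σ.symm v) (by simpa)
      simpa using this
  · intro h
    exact ⟨Set.preimage_mono h.sub, (inHom_preimage σ).2 h.inHom,
      fun x hx hn u hu v hv => h.outHom _ hx hn _ hu _ hv⟩

theorem setOverlap_preimage (σ : α ≃ β) {A B : Set β} :
    SetOverlap (σ ⁻¹' A) (σ ⁻¹' B) ↔ SetOverlap A B := by
  have key : ∀ C : Set β, (σ ⁻¹' C).Nonempty ↔ C.Nonempty := fun C =>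
    ⟨fun ⟨x, hx⟩ => ⟨_, hx⟩, fun ⟨x, hx⟩ => ⟨σ.symm x, by simpa⟩⟩
  simp only [SetOverlap, ← Set.preimage_inter, ← Set.preimage_sdiff, key]

theorem exists_preimage (σ : α ≃ β) (A : Set α) : ∃ B, A = σ ⁻¹' B :=
  ⟨σ.symm ⁻¹' A, by ext; simp⟩

theorem isStrongModule_preimage (σ : α ≃ β) {e : β → β → ℕ} {Y U : Set β} :
    IsStrongModule (fun i j => e (σ i) (σ j)) (σ ⁻¹' Y) (σ ⁻¹' U) ↔ IsStrongModule e Y U := by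
  constructor
  · intro h
    refine ⟨(isModuleOf_preimage σ).1 h.mod, ?_, fun B hB ho => ?_⟩
    · obtain ⟨x, hx⟩ := h.nonempty
      exact ⟨_, hx⟩
    · exact h.strong _ ((isModuleOf_preimage σ).2 hB) ((setOverlap_preimage σ).2 ho)
  · intro h
    refine ⟨(isModuleOf_preimage σ).2 h.mod, ?_, fun B hB ho => ?_⟩
    · obtain ⟨x, hx⟩ := h.nonempty
      exact ⟨σ.symm x, by simpa⟩
    · obtain ⟨B, rfl⟩ := exists_preimage σ B
      exact h.strong _ ((isModuleOf_preimage σ).1 hB) ((setOverlap_preimage σ).1 ho)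

theorem ssubset_preimage (σ : α ≃ β) {A B : Set β} : σ ⁻¹' A ⊂ σ ⁻¹' B ↔ A ⊂ B := by
  simp only [ssubset_iff_subset_ne, σ.preimage_subset, ne_eq, σ.surjective.preimage_injective.eq_iff]

theorem together_preimage (σ : α ≃ β) {e : β → β → ℕ} {Y N : Set β} {u v : α} :
    Together (fun i j => e (σ i) (σ j)) (σ ⁻¹' Y) (σ ⁻¹' N) u v ↔ Together e Y N (σ u) (σ v) := by
  constructor
  · rintro ⟨C, h1, h2, h3, h4⟩
    obtain ⟨C, rfl⟩ := exists_preimage σ C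
    exact ⟨C, (isStrongModule_preimage σ).1 h1, (ssubset_preimage σ).1 h2, h3, h4⟩
  · rintro ⟨C, h1, h2, h3, h4⟩
    exact ⟨_, (isStrongModule_preimage σ).2 h1, (ssubset_preimage σ).2 h2, h3, h4⟩

theorem hasSplit_preimage (σ : α ≃ β) {e : β → β → ℕ} {Y N : Set β} :
    HasSplit (fun i j => e (σ i) (σ j)) (σ ⁻¹' Y) (σ ⁻¹' N) → HasSplit e Y N := by
  rintro ⟨A, h1, h2, ⟨x, hx⟩, ⟨y, hy⟩, h5⟩
  obtain ⟨A, rfl⟩ := exists_preimage σ A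
  rw [← Set.preimage_sdiff, isModuleOf_preimage] at h2
  exact ⟨A, (isModuleOf_preimage σ).1 h1, h2, ⟨_, hx⟩, ⟨_, hy⟩, (σ.preimage_subset _ _).1 h5⟩

/-- An injection of `[0, m)` into itself is a bijection there and is extended by the identity, so
that structure can be transported along a permutation of `ℕ`. -/
theorem exists_perm_of_maps {m : ℕ} {s : ℕ → ℕ} (hs : ∀ i < m, s i < m)
    (hinj : ∀ i < m, ∀ j < m, s i = s j → i = j) :
    ∃ σ : Equiv.Perm ℕ, (∀ i < m, σ i = s i) ∧ ∀ i, σ i < m ↔ i < m := by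
  let f : Fin m → Fin m := fun i => ⟨s i, hs i i.2⟩
  have hf : Function.Injective f := fun i j hij =>
    Fin.ext (hinj i i.2 j j.2 (congrArg Fin.val hij))
  have hsurj := Finite.injective_iff_surjective.1 hf
  have hbij : Function.Bijective fun i => if i < m then s i else i := by
    constructor
    · intro i j hij
      dsimp only at hij
      split_ifs at hij with h1 h2 h2
      · exact hinj i h1 j h2 hij
      · have := hs i h1; omega
      · have := hs j h2; omega
      · exact hij
    · intro j
      by_cases hj : j < m
      · obtain ⟨i, hi⟩ := hsurj ⟨j, hj⟩
        exact ⟨i, by simp only [i.2, if_true]; exact congrArg Fin.val hi⟩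
      · exact ⟨j, by simp [hj]⟩
  refine ⟨Equiv.ofBijective _ hbij, fun i hi => by simp [hi], fun i => ?_⟩
  simp only [Equiv.ofBijective_apply]
  split_ifs with h
  · simp [h, hs i h]
  · simp [h]

end Relabel

/-! ### Orders in which all strong modules are intervals -/

/-- The natural order is compatible with the module structure. -/
structure GoodOrder (m : ℕ) (e : ℕ → ℕ → ℕ) : Prop where
  hom : ∀ U ⊆ Set.Iio m, InHom e (Set.Iio m) U → IsModuleOf e (Set.Iio m) U
  le_one : ∀ u < m, ∀ v < m, e u v ≤ 1
  interval : ∀ U, IsStrongModule e (Set.Iio m) U → ∀ u ∈ U, ∀ w ∈ U, ∀ y, u < y → y < w → y ∈ U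
  linear : ∀ N, IsStrongModule e (Set.Iio m) N → HasSplit e (Set.Iio m) N → ∀ u ∈ N, ∀ w ∈ N,
    ¬ Together e (Set.Iio m) N u w → e u w ≠ e w u → (u < w ↔ e u w = 0)

namespace WordRAM

/-- The arc to the pivot gives one inequality of ranks. Equality is excluded because the complement
of the pivot's class without the pivot is closed under arcs, and it contains the pivot but not the
element. -/
theorem tm_own_lt {m : ℕ} {e : ℕ → ℕ → ℕ} {s own q ord rank : ℕ → ℕ} (hR : RefSpec m e s own q)
    (hS : SccSpec m (seqArc e s own) ord rank) {i j : ℕ} (hi : i < m) (hj : j < m)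
    (h0 : 0 < ord i) (hij : ord j = own (ord i)) : j < i := by
  have hvm := hS.lt i hi
  have hpm := hS.lt j hj
  have hlt := hR.own_lt _ h0 hvm
  rw [← hij] at hlt
  have h1 := hS.arc_rank _ hvm _ hpm (.inl ⟨h0, hij⟩)
  have hin : ∀ z, ord j < z → z < q (ord j) → ∀ x, x < m → 0 < x →
      (own x = z ∨ own x = ord j) → ord j < x ∧ x < q (ord j) := by
    intro z hz1 hz2 x hx hx0 ho
    have h2 := hR.own_lt x hx0 hx
    rcases ho with ho | ho
    · have := hR.lam _ hpm z hz1 hz2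
      rw [ho] at h2; omega
    · rw [ho] at h2; exact h2
  have hne : rank (ord j) ≠ rank (ord i) := by
    intro he
    have hZ : ArcClosed m (seqArc e s own) {z | ¬ (ord j < z ∧ z < q (ord j))} := by
      rintro x hx y hy hxZ harc ⟨hy1, hy2⟩
      apply hxZ
      rcases harc with ⟨hx0, rfl⟩ | ⟨hx0, hy0, -, how, -⟩
      · exact hin _ hy1 hy2 x hx hx0 (.inl rfl)
      · have h3 := (hR.lam _ hpm y hy1 hy2).2
        have h4 := hR.own_lt y hy0 hy
        rcases h3.lt_or_eq with h5 | h5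
        · exact hin (own y) h5 (by omega) x hx hx0 (.inl how)
        · exact hin y hy1 hy2 x hx hx0 (.inr (how.trans h5.symm))
    exact hS.closed _ hpm _ hvm he _ hZ (fun h => by omega) hlt
  by_contra hle
  have := hS.mono i j (by omega) hj
  omega

theorem ord_own {m : ℕ} {e : ℕ → ℕ → ℕ} {s own q ord rank : ℕ → ℕ} (hR : RefSpec m e s own q)
    (hS : SccSpec m (seqArc e s own) ord rank) {t : ℕ} (ht : t < m) :
    (0 < ord t ↔ 0 < t) ∧ (0 < t → ∃ t' < t, ord t' = own (ord t)) := by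
  have key : ∀ t < m, 0 < ord t → ∃ t' < t, ord t' = own (ord t) := by
    intro t ht h0
    have h1 := hR.own_lt _ h0 (hS.lt t ht)
    obtain ⟨j, hj, hje⟩ := hS.surj (own (ord t)) (h1.1.trans (hS.lt t ht))
    exact ⟨j, tm_own_lt hR hS ht hj h0 hje, hje⟩
  have h0 : ord 0 = 0 := by
    by_contra hne
    obtain ⟨t', ht', -⟩ := key 0 (by omega) (by omega)
    omega
  have h1 : 0 < ord t ↔ 0 < t := by
    constructor
    · intro h
      by_contra hn
      rw [show t = 0 by omega, h0] at h
      omega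
    · intro h
      by_contra hn
      have := hS.inj t ht 0 (by omega) (by omega)
      omega
  exact ⟨h1, fun h => key t ht (h1.2 h)⟩

/-- Refinement gives a permutation `σ` of the elements and insertion a permutation `ρ` of the
positions. The facts on `ClassTree` are transported along both. -/
theorem exists_goodOrder {m : ℕ} {e : ℕ → ℕ → ℕ} {s own q ord rank pos p : ℕ → ℕ}
    (hR : RefSpec m e s own q) (hS : SccSpec m (seqArc e s own) ord rank)
    (hP : InsSpec m e s own ord pos) (hp : ∀ v < m, p (pos v) = s v)
    (hom : ∀ U ⊆ Set.Iio m, InHom e (Set.Iio m) U → IsModuleOf e (Set.Iio m) U)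
    (h1 : ∀ u < m, ∀ v < m, e u v ≤ 1) :
    ∃ π : Equiv.Perm ℕ, (∀ i, π i < m ↔ i < m) ∧ (∀ i < m, p i = π i) ∧
      GoodOrder m fun i j => e (π i) (π j) := by
  obtain ⟨σ, hσ, hσm⟩ := exists_perm_of_maps hR.maps hR.inj
  obtain ⟨ρ, hρ, hρm⟩ := exists_perm_of_maps hP.lt hP.inj
  have hρm' : ∀ i, ρ.symm i < m ↔ i < m := fun i => by rw [← hρm, Equiv.apply_symm_apply]
  have hYσ : σ ⁻¹' Set.Iio m = Set.Iio m := by ext i; simp [hσm]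
  have hYρ : ρ.symm ⁻¹' Set.Iio m = Set.Iio m := by ext i; simp [hρm']
  choose! tm htm htme using hS.surj
  have htmo : ∀ i < m, tm (ord i) = i := fun i hi =>
    hS.inj _ (htm _ (hS.lt i hi)) i hi (htme _ (hS.lt i hi))
  have htm0 : ∀ v < m, (0 < v ↔ 0 < tm v) := fun v hv => by
    have := (ord_own hR hS (htm v hv)).1
    rwa [htme v hv] at this
  have hblk : ∀ a b, b ≤ m → Set.Ico a b = σ ⁻¹' block s a b := by
    intro a b hb
    ext i
    constructor
    · intro hi
      show σ i ∈ block s a b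
      rw [hσ i (by have := hi.2; omega)]
      exact mem_block hi.1 hi.2
    · rintro ⟨k, hk, hke⟩
      rw [← hσ k (by have := hk.2; omega)] at hke
      rwa [← σ.injective hke]
  have hmod : ∀ U, IsModuleOf (fun i j => e (σ i) (σ j)) (Set.Iio m) (σ ⁻¹' U) ↔
      IsModuleOf e (Set.Iio m) U := fun U => by
    have := isModuleOf_preimage σ (e := e) (Y := Set.Iio m) (U := U)
    rwa [hYσ] at this
  have hhom : ∀ U ⊆ Set.Iio m, InHom (fun i j => e (σ i) (σ j)) (Set.Iio m) U →
      IsModuleOf (fun i j => e (σ i) (σ j)) (Set.Iio m) U := by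
    intro U hU h
    obtain ⟨U, rfl⟩ := exists_preimage σ U
    rw [hmod]
    rw [← hYσ] at hU h
    exact hom U ((σ.preimage_subset _ _).1 hU) ((inHom_preimage σ).1 h)
  have harc : ∀ v < m, ∀ w < m,
      (seqArc (fun i j => e (σ i) (σ j)) id own v w ↔ seqArc e s own v w) := by
    intro v hv w hw
    refine or_congr_right (and_congr_right fun hv0 => ?_)
    have := (hR.own_lt v hv0 hv).1
    simp only [id, hσ v hv, hσ w hw, hσ (own v) (by omega)]
  have hCT : ClassTree m (fun i j => e (σ i) (σ j)) own q rank tm pos := by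
    constructor
    · exact hhom
    · intro u hu v hv; exact h1 _ ((hσm u).2 hu) _ ((hσm v).2 hv)
    · exact hR.qlt
    · exact hR.q0
    · exact hR.lam
    · exact hR.own_lt
    · intro i hi
      refine hhom _ (fun x hx => hx.2.trans_le (hR.qlt i hi).2) ?_
      rw [hblk _ _ (hR.qlt i hi).2]
      have := (inHom_preimage σ).2 (hR.qmod i hi)
      rwa [hYσ] at this
    · intro c h0 hc U hU
      obtain ⟨h2, h3⟩ := hR.own_lt c h0 hc
      have hqm := (hR.qlt (own c) (by omega)).2
      obtain ⟨U, rfl⟩ := exists_preimage σ U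
      rw [hblk _ _ hqm, hblk _ _ hqm, hblk _ _ hc.le, σ.preimage_subset, σ.preimage_subset,
        σ.preimage_subset, Set.mem_preimage, hσ _ (by omega)]
      exact hR.sep c h0 hc U ((hmod U).1 hU)
    · intro v hv w hw h
      exact hS.arc_rank v hv w hw ((harc v hv w hw).1 h)
    · intro v hv w hw hr Z hZ
      exact hS.closed v hv w hw hr Z fun x hx y hy hxZ h => hZ x hx y hy hxZ ((harc x hx y hy).2 h)
    · intro v hv w hw h
      have := hS.mono _ _ h (htm w hw)
      rwa [htme v hv, htme w hw] at this
    · intro v hv w hw h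
      rw [← htme v hv, h, htme w hw]
    · intro v h0 hv
      obtain ⟨t', ht', he⟩ := (ord_own hR hS (htm v hv)).2 ((htm0 v hv).1 h0)
      rw [htme v hv] at he
      rw [← he, htmo t' (by have := htm v hv; omega)]
      exact ht'
    · exact hP.inj
    · intro v h0 hv y hy hlt hne
      have := hP.same (tm v) (htm v hv) ((htm0 v hv).1 h0) (tm y) hlt
      rw [htme v hv, htme y hy] at this
      exact this hne
    · intro v h0 hv
      have := hP.side (tm v) (htm v hv) ((htm0 v hv).1 h0)
      rw [htme v hv] at this
      rw [this, hσ v hv, hσ _ ((hR.own_lt v h0 hv).1.trans hv)]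
  have hpos : ∀ i, i < m → pos (ρ.symm i) = i := fun i hi => by
    rw [← hρ _ ((hρm' i).2 hi), Equiv.apply_symm_apply]
  have hstr : ∀ U, IsStrongModule (fun i j => e (σ (ρ.symm i)) (σ (ρ.symm j))) (Set.Iio m)
      (ρ.symm ⁻¹' U) ↔ IsStrongModule (fun i j => e (σ i) (σ j)) (Set.Iio m) U := fun U => by
    have := isStrongModule_preimage ρ.symm (e := fun i j => e (σ i) (σ j)) (Y := Set.Iio m) (U := U)
    rwa [hYρ] at this
  refine ⟨ρ.symm.trans σ, fun i => ?_, fun i hi => ?_, ?_, ?_, ?_, ?_⟩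
  · simp [hσm, hρm']
  · rw [Equiv.trans_apply, hσ _ ((hρm' i).2 hi), ← hp _ ((hρm' i).2 hi), hpos i hi]
  · intro U hU h
    obtain ⟨U, rfl⟩ := exists_preimage ρ.symm U
    rw [← hYρ] at hU h ⊢
    exact (isModuleOf_preimage (e := fun i j => e (σ i) (σ j)) ρ.symm).2
      (hhom U ((ρ.symm.preimage_subset _ _).1 hU)
        ((inHom_preimage (e := fun i j => e (σ i) (σ j)) ρ.symm).1 h))
  · intro u hu v hv
    exact h1 _ (by simp [hσm, hρm', hu]) _ (by simp [hσm, hρm', hv])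
  · intro U hU u hu w hw y huy hyw
    obtain ⟨U, rfl⟩ := exists_preimage ρ.symm U
    by_contra hyU
    have hwm : w < m := hU.mod.sub hw
    have := hCT.pos_strong ((hstr U).1 hU) hu hw ((hρm' y).2 (by omega)) hyU
    rw [hpos u (by omega), hpos w hwm, hpos y (by omega)] at this
    omega
  · intro N hN hs u hu w hw hT hne
    obtain ⟨N, rfl⟩ := exists_preimage ρ.symm N
    have hum : u < m := hN.mod.sub hu
    have hwm : w < m := hN.mod.sub hw
    have hT' : ¬ Together (fun i j => e (σ i) (σ j)) (Set.Iio m) N (ρ.symm u) (ρ.symm w) := by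
      have := together_preimage (e := fun i j => e (σ i) (σ j)) (Y := Set.Iio m) (N := N) ρ.symm
        (u := u) (v := w)
      rw [hYρ] at this
      exact fun h => hT (this.2 h)
    rw [← hYρ] at hs
    have := hCT.pos_linear ((hstr N).1 hN) (hasSplit_preimage ρ.symm hs) hu hw hT' hne
    rw [hpos u hum, hpos w hwm] at this
    exact this

end WordRAM


/-! ### Scanning tables: extremal witnesses and all windows -/

namespace WordRAM

theorem Frame.mono {P P' : Cmd} {σ τ : State} (h : Frame P σ τ)
    (hv : ∀ v, P'.writesVar v = false → P.writesVar v = false)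
    (ha : ∀ a, P'.writesArr a = false → P.writesArr a = false) : Frame P' σ τ :=
  ⟨fun v hv' => h.var v (hv v hv'), fun a ha' => h.arr a (ha a ha')⟩

/-- For every `i`, the least `x` with the first property, and the greatest with the second one. -/
def extremes (cMin cMax : Expr) (oMin oMax : ℕ) : Cmd :=
  forTo 41 (.lit 0) (.var 2) (.seq (.assign 43 (.var 2)) (.seq (.assign 44 (.lit 0))
    (.seq (forTo 42 (.lit 0) (.var 2) (.seq
        (.ite cMin (.ite (.bin .lt (.var 42) (.var 43)) (.assign 43 (.var 42)) .skip) .skip)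
        (.ite cMax (.assign 44 (.var 42)) .skip)))
      (.seq (.put oMin (.var 41) (.var 43)) (.put oMax (.var 41) (.var 44))))))

/-- The results are stated by what they mean for window tests, so the defaults `m` and 0 in the
absence of a witness need no separate case. The default 0 is safe because 0 exceeds no bound `b`. -/
theorem extremes_spec {W m : ℕ} {cMin cMax : Expr} {oMin oMax : ℕ} {σ : State}
    (P P' : ℕ → ℕ → Prop) (hne : oMin ≠ oMax) (hW : m + 5 ≤ W) (hm : σ.var 2 = m) (hm0 : 0 < m)
    (hc : ∀ τ, Frame (extremes cMin cMax oMin oMax) σ τ → τ.var 41 < m → τ.var 42 < m →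
      (cMin.eval τ ≠ 0 ↔ P (τ.var 41) (τ.var 42)) ∧ (cMax.eval τ ≠ 0 ↔ P' (τ.var 41) (τ.var 42))) :
    Runs W (extremes cMin cMax oMin oMax) σ fun t τ =>
      t ≤ m * (m * (cMin.cost + cMax.cost + 30) + 40) + 10 ∧
      ∀ i < m, (τ.arr oMin i ≤ m ∧ ∀ a ≤ m, (a ≤ τ.arr oMin i ↔ ∀ x < a, ¬ P i x)) ∧
        (τ.arr oMax i ≤ m ∧ ∀ b, (τ.arr oMax i ≤ b ↔ ∀ x, b < x → x < m → ¬ P' i x)) := by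
  refine runs_forTo 0 m (m * (cMin.cost + cMax.cost + 30) + 30) (fun k τ => ∀ i < k,
    (τ.arr oMin i ≤ m ∧ ∀ a ≤ m, (a ≤ τ.arr oMin i ↔ ∀ x < a, ¬ P i x)) ∧
        (τ.arr oMax i ≤ m ∧ ∀ b, (τ.arr oMax i ≤ b ↔ ∀ x, b < x → x < m → ¬ P' i x)))
    rfl (by omega) (by omega) rfl ?_ ?_ ?_ ?_
  · intro τ hF
    simp only [Expr.eval]; rw [hF.var 2 rfl, hm]
  · intro i hi; omega
  · intro k τ h0 hk hkk hF hI
    have g2 : τ.var 2 = m := by rw [hF.var 2 rfl, hm]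
    rw [runs_seq, runs_assign]
    simp only [Expr.eval, Expr.cost, g2]
    refine ⟨by omega, ?_⟩
    rw [runs_seq, runs_assign]
    simp only [Expr.eval, Expr.cost]
    refine ⟨by omega, ?_⟩
    rw [runs_seq]
    refine runs_forTo 0 m (cMin.cost + cMax.cost + 16) (fun l ρ => ρ.var 41 = k ∧
      (ρ.var 43 ≤ m ∧ (∀ a ≤ m, (a ≤ ρ.var 43 ↔ ∀ x < a, x < l → ¬ P k x))) ∧
      ρ.var 44 ≤ m ∧ ∀ b, (ρ.var 44 ≤ b ↔ ∀ x, b < x → x < l → ¬ P' k x))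
      rfl (by omega) (by omega) rfl ?_ ?_ ?_ ?_
    · intro ρ hG
      simp only [Expr.eval]; rw [hG.var 2 rfl]; simpa using g2
    · simp only [State.setVar_var, Nat.reduceEqDiff, reduceIte]
      refine ⟨hkk, ⟨le_rfl, fun a ha => ⟨fun _ x _ hx => by omega, fun _ => ha⟩⟩, by omega, fun b =>
        ⟨fun _ x _ hx => by omega, fun _ => by omega⟩⟩
    · rintro l ρ - hl hll hG ⟨q41, ⟨q43, hmin⟩, q44, hmax⟩
      have hFρ : Frame (extremes cMin cMax oMin oMax) σ ρ := by
        refine hF.trans (Frame.mono (P := .seq (.assign 43 (.var 2)) (.seq (.assign 44 (.lit 0))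
          (forTo 42 (.lit 0) (.var 2) (.seq
          (.ite cMin (.ite (.bin .lt (.var 42) (.var 43)) (.assign 43 (.var 42)) .skip) .skip)
          (.ite cMax (.assign 44 (.var 42)) .skip))))) ?_ ?_ ?_)
        · refine ⟨fun v hv => ?_, fun a ha => ?_⟩
          · simp only [Cmd.writesVar, Bool.or_eq_false_iff] at hv
            rw [hG.var v hv.2.2]
            simp only [State.setVar_var]
            have h1 : v ≠ 43 := by rintro rfl; simp at hv
            have h2 : v ≠ 44 := by rintro rfl; simp at hv
            simp [h1, h2]
          · rw [hG.arr a rfl]; rfl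
        · intro v hv
          simp only [writesVar_forTo, Cmd.writesVar, Bool.or_eq_false_iff] at hv ⊢
          tauto
        · intro a _; rfl
      obtain ⟨c1, c2⟩ := hc ρ hFρ (by omega) (by omega)
      rw [q41, hll] at c1 c2
      have hmin' := fun a ha => hmin a ha
      have s1 : Runs W (.ite cMin (.ite (.bin .lt (.var 42) (.var 43)) (.assign 43 (.var 42)) .skip)
          .skip) ρ fun t υ => t ≤ cMin.cost + 10 ∧ (∃ x, υ = ρ.setVar 43 x ∧ x ≤ m ∧
            ∀ a ≤ m, (a ≤ x ↔ ∀ y < a, y < l + 1 → ¬ P k y)) := by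
        rw [runs_ite, runs_ite, runs_assign, runs_skip, runs_skip]
        have hself : ρ = ρ.setVar 43 (ρ.var 43) := by
          ext v
          · simp only [State.setVar_var]; split_ifs with h
            · rw [h]
            · rfl
          · rfl
        refine ⟨fun hp => ⟨fun hlt => ?_, fun hlt => ?_⟩, fun hp => ?_⟩
        · rw [Expr.eval_lt] at hlt
          simp only [Expr.eval, Expr.cost, hll] at hlt ⊢
          refine ⟨by omega, by omega, l, rfl, by omega, fun a ha => ?_⟩
          rw [c1] at hp
          constructor
          · intro hal y hy1 hy2
            exact (hmin l (by omega)).1 (by omega) y (by omega) (by omega)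
          · intro h
            by_contra hcon
            exact h l (by omega) (by omega) hp
        · have hlt' : ρ.var 43 ≤ l := by
            have := mt Expr.eval_lt.2 (not_not.2 hlt)
            simp only [Expr.eval, hll] at this
            omega
          simp only [Expr.cost]
          refine ⟨by omega, _, hself, q43, fun a ha => ?_⟩
          rw [hmin a ha]
          constructor
          · intro h y hy1 hy2
            by_cases hyl : y = l
            · exfalso
              have h' := (hmin a ha).2 h
              omega
            · exact h y hy1 (by omega)
          · intro h y hy1 hy2; exact h y hy1 (by omega)
        · have hp' : ¬ P k l := fun h => (c1.2 h) hp
          refine ⟨by omega, _, hself, q43, fun a ha => ?_⟩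
          rw [hmin a ha]
          constructor
          · intro h y hy1 hy2
            by_cases hyl : y = l
            · rw [hyl]; exact hp'
            · exact h y hy1 (by omega)
          · intro h y hy1 hy2; exact h y hy1 (by omega)
      rw [runs_seq]
      refine s1.mono ?_
      rintro t1 υ ⟨ht1, x, rfl, hxm, hx⟩
      have hFυ : Frame (extremes cMin cMax oMin oMax) σ (ρ.setVar 43 x) := by
        refine hFρ.trans ⟨fun v hv => ?_, fun a _ => rfl⟩
        have h1 : v ≠ 43 := by rintro rfl; simp [extremes, writesVar_forTo, Cmd.writesVar] at hv
        simp [h1]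
      have c3 := (hc _ hFυ (by simp; omega) (by simp; omega)).2
      simp only [State.setVar_var, Nat.reduceEqDiff, reduceIte, q41, hll] at c3
      rw [runs_ite, runs_assign, runs_skip]
      refine ⟨fun hp => ?_, fun hp => ?_⟩
      · simp only [Expr.eval, Expr.cost, State.setVar_var, Nat.reduceEqDiff, reduceIte, hll]
        refine ⟨by omega, by omega, q41, ⟨hxm, hx⟩, by omega, fun b => ?_⟩
        rw [c3] at hp
        constructor
        · intro h y hy1 hy2; omega
        · intro h
          by_contra hcon
          exact h l (by omega) (by omega) hp
      · simp only [State.setVar_var, Nat.reduceEqDiff, reduceIte]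
        have hp' : ¬ P' k l := fun h => (c3.2 h) hp
        refine ⟨by omega, q41, ⟨hxm, hx⟩, q44, fun b => ?_⟩
        rw [hmax b]
        constructor
        · intro h y hy1 hy2
          by_cases hyl : y = l
          · rw [hyl]; exact hp'
          · exact h y hy1 (by omega)
        · intro h y hy1 hy2; exact h y hy1 (by omega)
    · rintro t ρ ht hG - ⟨q41, ⟨q43, hmin⟩, q44, hmax⟩
      rw [runs_seq, runs_put, runs_put]
      simp only [Expr.eval, Expr.cost, State.setArr_var, State.setArr_arr, State.setVar_arr, q41]
      refine ⟨by omega, by omega, ?_, ?_⟩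
      · simp only [Expr.cost] at ht
        have : (m - 0) * (cMin.cost + cMax.cost + 16 + 1 + 7) + m * 6 =
          m * (cMin.cost + cMax.cost + 30) := by rw [Nat.sub_zero]; ring
        omega
      · intro i hi
        simp only [hne, hne.symm, if_true, if_false]
        have e1 : ρ.arr oMin = τ.arr oMin := by rw [hG.arr oMin rfl]; rfl
        have e2 : ρ.arr oMax = τ.arr oMax := by rw [hG.arr oMax rfl]; rfl
        by_cases hik : i = k
        · subst hik
          rw [Function.update_self, Function.update_self]
          refine ⟨⟨q43, fun a ha => ?_⟩, q44, fun b => hmax b⟩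
          rw [hmin a ha]
          exact ⟨fun h x hx => h x hx (by omega), fun h x hx _ => h x hx⟩
        · rw [Function.update_of_ne hik, Function.update_of_ne hik, e1, e2]
          exact hI i (by omega)
  · intro t τ ht hF _ hI
    refine ⟨?_, hI⟩
    simp only [Expr.cost] at ht
    have : (m - 0) * (m * (cMin.cost + cMax.cost + 30) + 30 + 1 + 7) + m * 2 =
      m * (m * (cMin.cost + cMax.cost + 30) + 40) := by rw [Nat.sub_zero]; ring
    omega

/-- For every interval `[a, b]`, test the guard and that the values of `mn` and `mx` on `[a, b)` are
at least `a` and at most `b`. -/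
def windowAll (g : Expr) (mn mx out : ℕ) : Cmd :=
  forTo 41 (.lit 0) (.var 2) (.seq (.assign 43 (.var 2)) (.seq (.assign 44 (.lit 0))
    (forTo 42 (.var 41) (.var 2) (.seq
      -- The entry is written before position `b` joins the running extremes: a window `[a, b]`
      -- involves only the indices `i` with `a ≤ i < b`.
      (.put out (.bin .add (.bin .mul (.var 41) (.var 2)) (.var 42))
        (.bool (.bin .mul g (.bin .mul (.not (.bin .lt (.var 43) (.var 41)))
          (.not (.bin .lt (.var 42) (.var 44)))))))
      (.seq (.ite (.bin .lt (.get mn (.var 42)) (.var 43)) (.assign 43 (.get mn (.var 42))) .skip)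
        (.ite (.bin .lt (.var 44) (.get mx (.var 42))) (.assign 44 (.get mx (.var 42))) .skip))))))

/-- For fixed `a` the minimum and the maximum are updated as `b` grows, so each of the quadratically
many entries takes constant time. -/
theorem windowAll_spec {W m : ℕ} {g : Expr} {mn mx out : ℕ} {σ : State} (G : ℕ → ℕ → Prop)
    (h1 : mn ≠ out) (h2 : mx ≠ out) (hW : m + 5 ≤ W) (hm : σ.var 2 = m)
    (hmn : ∀ i < m, σ.arr mn i ≤ m) (hmx : ∀ i < m, σ.arr mx i ≤ m)
    (hout : ∀ i, σ.arr out i = 0)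
    (hg : ∀ τ, Frame (windowAll g mn mx out) σ τ → τ.var 41 ≤ τ.var 42 → τ.var 42 < m →
      (g.eval τ ≠ 0 ↔ G (τ.var 41) (τ.var 42))) :
    Runs W (windowAll g mn mx out) σ fun t τ =>
      t ≤ m * (m * (g.cost + 60) + 40) + 10 ∧
      ∀ a < m, ∀ b < m, (τ.arr out (a * m + b) ≠ 0 ↔
        a ≤ b ∧ G a b ∧ ∀ i, a ≤ i → i < b → a ≤ σ.arr mn i ∧ σ.arr mx i ≤ b) := by
  have hinj : ∀ a b a' b', b < m → b' < m → a * m + b = a' * m + b' → a = a' ∧ b = b' := by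
    intro a b a' b' hb hb' he
    have k1 : (a * m + b) / m = a := by
      rw [Nat.mul_comm, Nat.mul_add_div (by omega), Nat.div_eq_of_lt hb, add_zero]
    have k2 : (a' * m + b') / m = a' := by
      rw [Nat.mul_comm, Nat.mul_add_div (by omega), Nat.div_eq_of_lt hb', add_zero]
    have : a = a' := by rw [← k1, he, k2]
    subst this
    omega
  have hFin : ∀ τ ρ, Frame (windowAll g mn mx out) σ τ →
      Frame (forTo 42 (.var 41) (.var 2) (.seq
      (.put out (.bin .add (.bin .mul (.var 41) (.var 2)) (.var 42))
        (.bool (.bin .mul g (.bin .mul (.not (.bin .lt (.var 43) (.var 41)))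
          (.not (.bin .lt (.var 42) (.var 44)))))))
      (.seq (.ite (.bin .lt (.get mn (.var 42)) (.var 43)) (.assign 43 (.get mn (.var 42))) .skip)
        (.ite (.bin .lt (.var 44) (.get mx (.var 42))) (.assign 44 (.get mx (.var 42))) .skip))))
        ((τ.setVar 43 m).setVar 44 0) ρ → Frame (windowAll g mn mx out) σ ρ := by
    intro τ ρ hF hG
    refine hF.trans ⟨fun v hv => ?_, fun a ha => ?_⟩
    · have e1 : v ≠ 43 := by rintro rfl; simp [windowAll, writesVar_forTo, Cmd.writesVar] at hv
      have e2 : v ≠ 44 := by rintro rfl; simp [windowAll, writesVar_forTo, Cmd.writesVar] at hv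
      rw [hG.var v]
      · simp [e1, e2]
      · simp only [windowAll, writesVar_forTo, Cmd.writesVar, Bool.or_eq_false_iff] at hv ⊢
        tauto
    · rw [hG.arr a]
      · rfl
      · rw [windowAll, writesArr_forTo] at ha
        exact ha
  refine runs_forTo 0 m (m * (g.cost + 60) + 20) (fun k τ => ∀ a < m, ∀ b < m,
    (τ.arr out (a * m + b) ≠ 0 ↔
      a < k ∧ a ≤ b ∧ G a b ∧ ∀ i, a ≤ i → i < b → a ≤ σ.arr mn i ∧ σ.arr mx i ≤ b))
    rfl (by omega) (by omega) rfl ?_ ?_ ?_ ?_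
  · intro τ hF
    simp only [Expr.eval]; rw [hF.var 2 rfl, hm]
  · intro a _ b _; simp [hout]
  · intro k τ h0 hk hkk hF hI
    have g2 : τ.var 2 = m := by rw [hF.var 2 rfl, hm]
    rw [runs_seq, runs_assign]
    simp only [Expr.eval, Expr.cost, g2]
    refine ⟨by omega, ?_⟩
    rw [runs_seq, runs_assign]
    simp only [Expr.eval, Expr.cost]
    refine ⟨by omega, ?_⟩
    refine runs_forTo k m (g.cost + 45) (fun l ρ =>
      (∀ c, (c ≤ m → (c ≤ ρ.var 43 ↔ ∀ i, k ≤ i → i < l → c ≤ σ.arr mn i))) ∧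
      (∀ c, (ρ.var 44 ≤ c ↔ ∀ i, k ≤ i → i < l → σ.arr mx i ≤ c)) ∧
      ∀ a < m, ∀ b < m, (ρ.arr out (a * m + b) ≠ 0 ↔
      (a < k ∨ (a = k ∧ b < l)) ∧ a ≤ b ∧ G a b ∧
        ∀ i, a ≤ i → i < b → a ≤ σ.arr mn i ∧ σ.arr mx i ≤ b))
      ?_ (by omega) (by omega) rfl ?_ ?_ ?_ ?_
    · simpa [Expr.eval] using hkk
    · intro ρ hG
      simp only [Expr.eval]; rw [hG.var 2 rfl]; simpa using g2
    · refine ⟨fun c hc => ?_, fun c => ?_, fun a ha b hb => ?_⟩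
      · simp only [State.setVar_var, Nat.reduceEqDiff, reduceIte]
        exact ⟨fun _ i _ _ => by omega, fun _ => hc⟩
      · simp only [State.setVar_var, Nat.reduceEqDiff, reduceIte]
        exact ⟨fun _ i _ _ => by omega, fun _ => by omega⟩
      · simp only [State.setVar_arr]
        rw [hI a ha b hb]
        constructor
        · rintro ⟨h1, h2⟩; exact ⟨.inl h1, h2⟩
        · rintro ⟨h1, h2⟩; exact ⟨by omega, h2⟩
    · rintro l ρ hkl hl hll hG ⟨H1, H2, H3⟩
      have hFρ := hFin τ ρ hF hG
      have q41 : ρ.var 41 = k := by rw [hG.var 41 rfl]; simpa using hkk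
      have q2 : ρ.var 2 = m := by rw [hFρ.var 2 rfl, hm]
      have hgρ := hg ρ hFρ (by omega) (by omega)
      rw [q41, hll] at hgρ
      have emn : ρ.arr mn = σ.arr mn := hFρ.arr mn (by
        simp [windowAll, writesArr_forTo, Cmd.writesArr, h1.symm])
      have emx : ρ.arr mx = σ.arr mx := hFρ.arr mx (by
        simp [windowAll, writesArr_forTo, Cmd.writesArr, h2.symm])
      have hval : (Expr.bin .mul g (.bin .mul (.not (.bin .lt (.var 43) (.var 41)))
          (.not (.bin .lt (.var 42) (.var 44))))).eval ρ ≠ 0 ↔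
          (G k l ∧ ∀ i, k ≤ i → i < l → k ≤ σ.arr mn i ∧ σ.arr mx i ≤ l) := by
        simp only [Expr.eval_mul, Expr.eval_not, Expr.eval_lt]
        simp only [Expr.eval, hgρ, q41, hll, not_lt]
        rw [H1 k (by omega), H2 l]
        constructor
        · rintro ⟨k1, k2, k3⟩; exact ⟨k1, fun i i1 i2 => ⟨k2 i i1 i2, k3 i i1 i2⟩⟩
        · rintro ⟨k1, k2⟩; exact ⟨k1, fun i i1 i2 => (k2 i i1 i2).1, fun i i1 i2 => (k2 i i1 i2).2⟩
      classical
      rw [runs_seq, runs_put, Expr.eval_bool hval]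
      simp only [Expr.cost, Expr.bool, Expr.not]
      have hidx : (Expr.bin .add (.bin .mul (.var 41) (.var 2)) (.var 42)).eval ρ = k * m + l := by
        simp only [Expr.eval, BinOp.eval, q41, q2, hll]
      rw [hidx]
      refine ⟨by split_ifs <;> omega, ?_⟩
      obtain ⟨υ, hυ⟩ : ∃ υ, υ = ρ.setArr out (k * m + l)
        (if G k l ∧ ∀ i, k ≤ i → i < l → k ≤ σ.arr mn i ∧ σ.arr mx i ≤ l then 1 else 0) := ⟨_, rfl⟩
      rw [← hυ]
      have uvar : υ.var = ρ.var := by rw [hυ]; rfl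
      have umn : υ.arr mn = σ.arr mn := by rw [hυ, State.setArr_arr, if_neg h1, emn]
      have umx : υ.arr mx = σ.arr mx := by rw [hυ, State.setArr_arr, if_neg h2, emx]
      have uout : ∀ a < m, ∀ b < m, (υ.arr out (a * m + b) ≠ 0 ↔
          (a < k ∨ (a = k ∧ b < l + 1)) ∧ a ≤ b ∧ G a b ∧
          ∀ i, a ≤ i → i < b → a ≤ σ.arr mn i ∧ σ.arr mx i ≤ b) := by
        intro a ha b hb
        rw [hυ, State.setArr_arr, if_pos rfl, Function.update_apply]
        by_cases hab : a = k ∧ b = l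
        · obtain ⟨rfl, rfl⟩ := hab
          rw [if_pos rfl]
          simp [hkl]
        · rw [if_neg (fun he => hab (hinj _ _ _ _ hb hl he)), H3 a ha b hb]
          have : (a < k ∨ (a = k ∧ b < l)) ↔ (a < k ∨ (a = k ∧ b < l + 1)) := by omega
          rw [this]
      have s1 : Runs W (.ite (.bin .lt (.get mn (.var 42)) (.var 43))
          (.assign 43 (.get mn (.var 42))) .skip) υ fun t w => t ≤ 8 ∧ w = υ.setVar 43 (w.var 43) ∧
          ∀ c, (c ≤ m → (c ≤ w.var 43 ↔ ∀ i, k ≤ i → i < l + 1 → c ≤ σ.arr mn i)) := by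
        rw [runs_ite, runs_assign, runs_skip]
        have hself : υ = υ.setVar 43 (υ.var 43) := by
          ext v
          · simp only [State.setVar_var]; split_ifs with h
            · rw [h]
            · rfl
          · rfl
        have hsplit : ∀ c, (∀ i, k ≤ i → i < l + 1 → c ≤ σ.arr mn i) ↔
            (∀ i, k ≤ i → i < l → c ≤ σ.arr mn i) ∧ c ≤ σ.arr mn l := by
          intro c
          constructor
          · intro h; exact ⟨fun i i1 i2 => h i i1 (by omega), h l hkl (by omega)⟩
          · rintro ⟨h, h'⟩ i i1 i2
            by_cases hil : i = l
            · rw [hil]; exact h'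
            · exact h i i1 (by omega)
        have hmnl := hmn l hl
        refine ⟨fun hlt => ?_, fun hlt => ?_⟩
        · rw [Expr.eval_lt] at hlt
          simp only [Expr.eval, Expr.cost, umn, uvar, hll, State.setVar_var, reduceIte] at hlt ⊢
          refine ⟨by omega, by omega, trivial, fun c hc => ?_⟩
          rw [hsplit, ← H1 c hc]
          omega
        · have hlt' := mt Expr.eval_lt.2 (not_not.2 hlt)
          simp only [Expr.eval, umn, uvar, hll] at hlt'
          simp only [Expr.cost]
          refine ⟨by omega, hself, fun c hc => ?_⟩
          rw [hsplit, ← H1 c hc, uvar]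
          omega
      rw [runs_seq]
      refine s1.mono ?_
      rintro t1 w ⟨ht1, hw, hw43⟩
      have wvar : ∀ v, v ≠ 43 → w.var v = ρ.var v := fun v hv => by
        rw [hw]; simp [hv, uvar]
      have warr : w.arr = υ.arr := by rw [hw]; rfl
      have hsplit : ∀ c, (∀ i, k ≤ i → i < l + 1 → σ.arr mx i ≤ c) ↔
          (∀ i, k ≤ i → i < l → σ.arr mx i ≤ c) ∧ σ.arr mx l ≤ c := by
        intro c
        constructor
        · intro h; exact ⟨fun i i1 i2 => h i i1 (by omega), h l hkl (by omega)⟩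
        · rintro ⟨h, h'⟩ i i1 i2
          by_cases hil : i = l
          · rw [hil]; exact h'
          · exact h i i1 (by omega)
      have hmxl := hmx l hl
      rw [runs_ite, runs_assign, runs_skip]
      refine ⟨fun hlt => ?_, fun hlt => ?_⟩
      · rw [Expr.eval_lt] at hlt
        simp only [Expr.eval, Expr.cost, warr, umx, wvar 42 (by decide), wvar 44 (by decide), hll]
          at hlt ⊢
        refine ⟨by omega, by omega, ?_, ?_, ?_⟩
        · simpa using hw43
        · intro c
          simp only [State.setVar_var, Nat.reduceEqDiff, reduceIte]
          rw [hsplit, ← H2 c]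
          omega
        · simpa [warr] using uout
      · have hlt' := mt Expr.eval_lt.2 (not_not.2 hlt)
        simp only [Expr.eval, warr, umx, wvar 42 (by decide), wvar 44 (by decide), hll] at hlt'
        simp only [Expr.cost]
        refine ⟨by omega, ?_, ?_, ?_⟩
        · simpa using hw43
        · intro c
          simp only [State.setVar_var, Nat.reduceEqDiff, reduceIte]
          rw [hsplit, ← H2 c, wvar 44 (by decide)]
          omega
        · simpa [warr] using uout
    · rintro t ρ ht hG - ⟨-, -, H3⟩
      refine ⟨?_, fun a ha b hb => ?_⟩
      · simp only [Expr.cost] at ht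
        have q1 : (m - k) * (g.cost + 45 + 1 + 7) ≤ m * (g.cost + 60) :=
          Nat.mul_le_mul (by omega) (by omega)
        omega
      · simp only [State.setVar_arr]
        rw [H3 a ha b hb]
        constructor
        · rintro ⟨k1, k2⟩; exact ⟨by omega, k2⟩
        · rintro ⟨k1, k2⟩; exact ⟨by omega, k2⟩
  · intro t τ ht hF _ hI
    refine ⟨?_, fun a ha b hb => ?_⟩
    · simp only [Expr.cost] at ht
      have : (m - 0) * (m * (g.cost + 60) + 20 + 1 + 7) ≤ m * (m * (g.cost + 60) + 40) :=
        Nat.mul_le_mul (by omega) (by omega)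
      omega
    · rw [hI a ha b hb]
      simp [ha]

end WordRAM


/-! ### The tree of a laminar family of intervals -/

/-- The intervals `[A w, B w]` of the list elements are consecutive and fill `[a, e)`. -/
def Tiles (A B : ℕ → ℕ) : ℕ → ℕ → List ℕ → Prop
  | a, e, [] => a = e
  | a, e, w :: l => A w = a ∧ a ≤ B w ∧ Tiles A B (B w + 1) e l

section Tiles

variable {A B : ℕ → ℕ}

theorem Tiles.le {a e : ℕ} {l : List ℕ} (h : Tiles A B a e l) : a ≤ e := by
  induction l generalizing a with
  | nil => exact le_of_eq h
  | cons w l ih => obtain ⟨-, h2, h3⟩ := h; have := ih h3; omega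

theorem Tiles.snoc {a e w : ℕ} {l : List ℕ} (h : Tiles A B a e l) (hA : A w = e) (hB : e ≤ B w) :
    Tiles A B a (B w + 1) (l ++ [w]) := by
  induction l generalizing a with
  | nil => obtain rfl : a = e := h; exact ⟨hA, hB, rfl⟩
  | cons x l ih => exact ⟨h.1, h.2.1, ih h.2.2⟩

theorem Tiles.mem {a e w : ℕ} {l : List ℕ} (h : Tiles A B a e l) (hw : w ∈ l) :
    a ≤ A w ∧ A w ≤ B w ∧ B w < e := by
  induction l generalizing a with
  | nil => simp at hw
  | cons x l ih =>
    obtain ⟨h1, h2, h3⟩ := h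
    rcases List.mem_cons.1 hw with rfl | hw
    · have := h3.le; omega
    · have := ih h3 hw; omega

theorem Tiles.exists_mem {a e x : ℕ} {l : List ℕ} (h : Tiles A B a e l) (h1 : a ≤ x) (h2 : x < e) :
    ∃ w ∈ l, A w ≤ x ∧ x ≤ B w := by
  induction l generalizing a with
  | nil => have : a = e := h; omega
  | cons y l ih =>
    obtain ⟨k1, k2, k3⟩ := h
    by_cases hx : x ≤ B y
    · exact ⟨y, by simp, by omega, hx⟩
    · obtain ⟨w, hw, h'⟩ := ih k3 (by omega)
      exact ⟨w, by simp [hw], h'⟩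

theorem Tiles.congr {A' B' : ℕ → ℕ} {a e : ℕ} {l : List ℕ} (h : Tiles A B a e l)
    (hA : ∀ w ∈ l, A' w = A w ∧ B' w = B w) : Tiles A' B' a e l := by
  induction l generalizing a with
  | nil => exact h
  | cons x l ih =>
    obtain ⟨k1, k2, k3⟩ := h
    obtain ⟨e1, e2⟩ := hA x (by simp)
    refine ⟨by rw [e1, k1], by rw [e2]; exact k2, ?_⟩
    rw [e2]
    exact ih k3 fun w hw => hA w (by simp [hw])

theorem Tiles.nodup {a e : ℕ} {l : List ℕ} (h : Tiles A B a e l) : l.Nodup := by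
  induction l generalizing a with
  | nil => simp
  | cons x l ih =>
    obtain ⟨k1, k2, k3⟩ := h
    refine List.nodup_cons.2 ⟨fun hx => ?_, ih k3⟩
    have := k3.mem hx
    omega

end Tiles

/-- A laminar family of intervals of `[0, m)` that contains the singletons and `[0, m)`. -/
structure Laminar (m : ℕ) (S : ℕ → ℕ → Prop) : Prop where
  lt : ∀ c d, S c d → c ≤ d ∧ d < m
  self : ∀ c < m, S c c
  top : S 0 (m - 1)
  lam : ∀ c d c' d', S c d → S c' d' → c < c' → c' ≤ d → d' ≤ d

/-- The nodes below `N` form the forest of the members of the family `D`. Node `v` stands for the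
interval from `A v` to `B v`, its children are listed in `cs v`, and `cid c` is the node of the
longest interval of `D` from `c`, which ends at `big c`. -/
structure TreeInv (m : ℕ) (S D : ℕ → ℕ → Prop) (K : ℕ → ℕ → ℕ → ℕ) (π : ℕ → ℕ) (N p2 : ℕ)
    (st l2 kd big cid par A B : ℕ → ℕ) (cs : ℕ → List ℕ) : Prop where
  node : ∀ v < N, v ≠ m → D (A v) (B v)
  inj : ∀ v < N, ∀ w < N, v ≠ m → w ≠ m → A v = A w → B v = B w → v = w
  surj : ∀ c d, D c d → ∃ v < N, v ≠ m ∧ A v = c ∧ B v = d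
  leaf : ∀ v < N, v ≠ m → (v < m ↔ A v = B v)
  leafA : ∀ i < m, π i < m ∧ A (π i) = i ∧ B (π i) = i
  gt : m < N
  big : ∀ c < m, D c (big c) ∧ (∀ d, D c d → d ≤ big c) ∧ cid c < N ∧ cid c ≠ m ∧
    A (cid c) = c ∧ B (cid c) = big c
  nil : ∀ v ≤ m, cs v = []
  tiles : ∀ v < N, m < v → Tiles A B (A v) (B v + 1) (cs v)
  -- The last clause is maximality of the child: a member of `S` that starts with `w` ends within
  -- `w` or reaches the end of `v`.
  child : ∀ v < N, ∀ w ∈ cs v, w < v ∧ w ≠ m ∧ par w = v ∧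
    ∀ d, S (A w) d → d ≤ B w ∨ (A w = A v ∧ B v ≤ d)
  st0 : ∀ v ≤ m, st v = v
  stS : ∀ v < N, st (v + 1) = st v + 1 + (cs v).length
  pos : st N = p2
  -- The first slot of each list, at `st v`, is left free for the parent.
  slots : ∀ v < N, ∀ i (h : i < (cs v).length), l2 (st v + 1 + i) = (cs v)[i]
  kind : ∀ v < N, m < v → ∃ x y l, cs v = x :: y :: l ∧ kd v = K (A v) (A y) (B y)
  kind0 : ∀ v ≤ m, kd v = 0

namespace TreeInv

variable {m : ℕ} {S D : ℕ → ℕ → Prop} {K : ℕ → ℕ → ℕ → ℕ} {π : ℕ → ℕ} {N p2 : ℕ}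
  {st l2 kd big cid par A B : ℕ → ℕ} {cs : ℕ → List ℕ}

theorem st_lt (h : TreeInv m S D K π N p2 st l2 kd big cid par A B cs) {v w : ℕ} (hvw : v < w)
    (hw : w ≤ N) : st v + 1 + (cs v).length ≤ st w := by
  induction w with
  | zero => omega
  | succ w ih =>
    have h1 := h.stS w (by omega)
    rcases (Nat.lt_succ_iff.1 hvw).lt_or_eq with h2 | rfl
    · have := ih h2 (by omega); omega
    · omega

theorem two_tiles (h : TreeInv m S D K π N p2 st l2 kd big cid par A B cs) {v : ℕ} (hv : v < N)
    (hmv : m < v) : ∃ x y l, cs v = x :: y :: l ∧ A x = A v ∧ B x + 1 = A y ∧ A v ≤ B x ∧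
      A y ≤ B y ∧ B y ≤ B v ∧ kd v = K (A v) (A y) (B y) := by
  obtain ⟨x, y, l, h1, h2⟩ := h.kind v hv hmv
  have h3 := h.tiles v hv hmv
  rw [h1] at h3
  obtain ⟨k1, k2, k3, k4, k5⟩ := h3
  have := k5.le
  exact ⟨x, y, l, h1, k1, k3.symm, k2, by omega, by omega, h2⟩

/-- The number of nodes is linear. -/
theorem card_le (h : TreeInv m S D K π N p2 st l2 kd big cid par A B cs) (hL : Laminar m S)
    (hD : ∀ c d, D c d → S c d) : N ≤ 2 * m + 1 := by
  -- An inner node is charged to the start of its second child, a position below `m`; this charging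
  -- is injective.
  let f : ℕ → ℕ := fun v => A (((cs v)[1]?).getD 0)
  have hf : ∀ v < N, m < v → ∃ x y l, cs v = x :: y :: l ∧ A x = A v ∧ B x + 1 = A y ∧ A v ≤ B x ∧
      A y ≤ B y ∧ B y ≤ B v ∧ f v = A y := by
    intro v hv hmv
    obtain ⟨x, y, l, h1, h2, h3, h4, h5, h6, -⟩ := h.two_tiles hv hmv
    exact ⟨x, y, l, h1, h2, h3, h4, h5, h6, by simp [f, h1]⟩
  have hmaps : ∀ v ∈ Finset.Ico (m + 1) N, f v ∈ Finset.range m := by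
    intro v hv
    rw [Finset.mem_Ico] at hv
    obtain ⟨x, y, l, h1, h2, h3, h4, h5, h6, h7⟩ := hf v hv.2 (by omega)
    have := (hL.lt _ _ (hD _ _ (h.node v hv.2 (by omega)))).2
    rw [Finset.mem_range, h7]
    omega
  have hkey : ∀ v < N, ∀ w < N, m < v → m < w → f v = f w → A v ≤ A w →
      (A v = A w → B v ≤ B w) → v = w := by
    intro v hv w hw hmv hmw hvw hA hB
    obtain ⟨x, y, l, h1, h2, h3, h4, h5, h6, h7⟩ := hf v hv hmv
    obtain ⟨x', y', l', h1', h2', h3', h4', h5', h6', h7'⟩ := hf w hw hmw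
    have sv := hD _ _ (h.node v hv (by omega))
    have sw := hD _ _ (h.node w hw (by omega))
    have hx := h.child v hv x (by simp [h1])
    have hx' := h.child w hw x' (by simp [h1'])
    have sx := hD _ _ (h.node x (by omega) hx.2.1)
    -- If `v` starts before `w`, then `w` starts inside the first child of `v` and leaves it. If
    -- both start together, maximality of the first child of the longer one fails unless they
    -- coincide.
    rcases hA.lt_or_eq with hlt | heq
    · have := hL.lam _ _ _ _ sx sw (by omega) (by omega)
      omega
    · have hBle := hB heq
      have h8 := hx'.2.2.2 (B v) (by rw [h2', ← heq]; exact sv)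
      exact h.inj v hv w hw (by omega) (by omega) heq (by omega)
  have := Finset.card_le_card_of_injOn f hmaps (by
    intro v hv w hw hvw
    simp only [Finset.coe_Ico, Set.mem_Ico] at hv hw
    rcases lt_trichotomy (A v) (A w) with h1 | h1 | h1
    · exact hkey v hv.2 w hw.2 (by omega) (by omega) hvw h1.le (by omega)
    · rcases le_total (B v) (B w) with h2 | h2
      · exact hkey v hv.2 w hw.2 (by omega) (by omega) hvw h1.le fun _ => h2
      · exact (hkey w hw.2 v hv.2 (by omega) (by omega) hvw.symm h1.ge fun _ => h2).symm
    · exact (hkey w hw.2 v hv.2 (by omega) (by omega) hvw.symm h1.le (by omega)).symm)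
  simp only [Nat.card_Ico, Finset.card_range] at this
  omega

end TreeInv

/-- The members of `S` that precede `[a, b]`, and the singletons. -/
def DoneBefore (S : ℕ → ℕ → Prop) (a b c d : ℕ) : Prop :=
  S c d ∧ (c = d ∨ a < c ∨ (c = a ∧ d < b))

/-- The children of `[a, b]` found so far are listed in `l`, and they fill `[a, nx)`. -/
structure ChildInv (S : ℕ → ℕ → Prop) (m a b N p2 : ℕ) (big A B : ℕ → ℕ) (cs : ℕ → List ℕ)
    (st : ℕ → ℕ) (c nx p : ℕ) (l2 par : ℕ → ℕ) (l : List ℕ) : Prop where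
  le : c ≤ nx
  nx_le : nx ≤ b + 1
  tiles : Tiles A B a nx l
  mem : ∀ w ∈ l, w < N ∧ w ≠ m ∧ B w = big (A w) ∧ par w = N
  closed : ∀ x, a ≤ x → x < nx → ∀ d, DoneBefore S a b x d → d < nx
  old_par : ∀ v < N, ∀ w ∈ cs v, par w = v
  pos : p = p2 + 1 + l.length
  old : ∀ v < N, ∀ i (h : i < (cs v).length), l2 (st v + 1 + i) = (cs v)[i]
  new : ∀ i (h : i < l.length), l2 (p2 + 1 + i) = l[i]

section

variable {m : ℕ} {S : ℕ → ℕ → Prop} {K : ℕ → ℕ → ℕ → ℕ} {π : ℕ → ℕ} {N p2 a b : ℕ}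
  {st l2 kd big cid par A B : ℕ → ℕ} {cs : ℕ → List ℕ}

/-- By laminarity, finished intervals that start inside `[a, b]` stay inside it, and those from `a`
are shorter. -/
theorem TreeInv.big_le
    (h : TreeInv m S (DoneBefore S a b) K π N p2 st l2 kd big cid par A B cs) (hL : Laminar m S)
    (hS : S a b) (hab : a < b) {c : ℕ} (hac : a ≤ c) (hcb : c ≤ b) :
    c ≤ big c ∧ big c ≤ b ∧ (c = a → big c < b) := by
  have hb := (hL.lt _ _ hS).2
  obtain ⟨⟨h1, h2⟩, -⟩ := h.big c (by omega)
  have h3 := (hL.lt _ _ h1).1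
  rcases hac.lt_or_eq with h4 | h4
  · have := hL.lam _ _ _ _ hS h1 h4 hcb
    omega
  · omega

/-- The longest finished interval from the first uncovered position is the next child; laminarity
makes the covered range closed under finished intervals. -/
theorem ChildInv.step {c nx p : ℕ} {l2' par' : ℕ → ℕ} {l : List ℕ}
    (h : TreeInv m S (DoneBefore S a b) K π N p2 st l2 kd big cid par A B cs) (hL : Laminar m S)
    (hS : S a b) (hab : a < b) (hac : a ≤ c) (hcb : c ≤ b)
    (hC : ChildInv S m a b N p2 big A B cs st c nx p l2' par' l) (hnx : c = nx) :
    ChildInv S m a b N p2 big A B cs st (c + 1) (big c + 1) (p + 1)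
      (Function.update l2' p (cid c)) (Function.update par' (cid c) N) (l ++ [cid c]) := by
  have hb := (hL.lt _ _ hS).2
  obtain ⟨g1, g2, g3, g4, g5, g6⟩ := h.big c (by omega)
  obtain ⟨b1, b2, -⟩ := h.big_le hL hS hab hac hcb
  have hst : ∀ v < N, st v + 1 + (cs v).length ≤ p2 := fun v hv => by
    have := h.st_lt hv le_rfl; rwa [h.pos] at this
  constructor
  · omega
  · omega
  · rw [← g6]
    exact hC.tiles.snoc (by omega) (by omega)
  · intro w hw
    rw [List.mem_append, List.mem_singleton] at hw
    by_cases hwc : w = cid c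
    · subst hwc
      exact ⟨g3, g4, by rw [g5, g6], by simp⟩
    · rw [Function.update_of_ne hwc]
      exact hC.mem w (by tauto)
  · intro x hx1 hx2 d hd
    rcases lt_or_ge x nx with h1 | h1
    · have := hC.closed x hx1 h1 d hd
      omega
    · rcases h1.lt_or_eq with h2 | h2
      · have := hL.lam _ _ _ _ g1.1 hd.1 (by omega) (by omega)
        omega
      · have := g2 d (by rw [hnx, h2]; exact hd)
        omega
  · intro v hv w hw
    rw [Function.update_of_ne]
    · exact hC.old_par v hv w hw
    -- The new child has no parent yet: a finished node around it would start before `c` and end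
    -- before it, or start at `c` and be no longer than the longest one.
    rintro rfl
    obtain ⟨k1, k2, -, -⟩ := h.child v hv _ hw
    have hmv : m < v := by
      by_contra hle
      rw [h.nil v (by omega)] at hw
      simp at hw
    have hmem := (h.tiles v hv hmv).mem hw
    have hnl : A v ≠ B v := fun he => by
      have := (h.leaf v hv (by omega)).2 he; omega
    have hDv := h.node v hv (by omega)
    have hav : a ≤ A v := by
      rcases hDv.2 with h' | h' | h' <;> omega
    rcases lt_or_ge (A v) c with h1 | h1
    · have := hC.closed (A v) hav (by omega) _ hDv
      omega
    · have hAv : A v = c := by omega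
      have := g2 (B v) (hAv ▸ hDv)
      have := h.inj v hv (cid c) g3 (by omega) g4 (by omega) (by omega)
      omega
  · rw [List.length_append, hC.pos]; simp; omega
  · intro v hv i hi
    rw [Function.update_of_ne]
    · exact hC.old v hv i hi
    · have := hst v hv
      have := hC.pos
      omega
  · intro i hi
    by_cases hil : i = l.length
    · subst hil
      rw [← hC.pos]; simp
    · have hi' : i < l.length := by simp at hi; omega
      rw [Function.update_of_ne (by have := hC.pos; omega), hC.new i hi', List.getElem_append_left hi']

theorem TreeInv.step {p nx : ℕ} {st' l2' kd' big' cid' par' : ℕ → ℕ} {l : List ℕ}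
    (h : TreeInv m S (DoneBefore S a b) K π N p2 st l2 kd big cid par A B cs) (hL : Laminar m S)
    (hS : S a b) (hab : a < b) (hC : ChildInv S m a b N p2 big A B cs st (b + 1) nx p l2' par' l)
    (hbig : big' = Function.update big a b) (hcid : cid' = Function.update cid a N)
    (hst : st' = Function.update st (N + 1) p)
    (hkd : kd' = Function.update kd N (K a (big a + 1) (big (big a + 1)))) :
    TreeInv m S (DoneBefore S a (b + 1)) K π (N + 1) p st' l2' kd' big' cid' par'
      (Function.update A N a) (Function.update B N b) (Function.update cs N l) := by
  have hb := (hL.lt _ _ hS).2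
  have hgt := h.gt
  have hnx : nx = b + 1 := by have := hC.le; have := hC.nx_le; omega
  subst hnx
  have hDD : ∀ c d, DoneBefore S a (b + 1) c d ↔ DoneBefore S a b c d ∨ (c = a ∧ d = b) := by
    intro c d
    constructor
    · rintro ⟨h1, h2⟩
      by_cases hcd : c = a ∧ d = b
      · exact .inr hcd
      · exact .inl ⟨h1, by omega⟩
    · rintro (⟨h1, h2⟩ | ⟨rfl, rfl⟩)
      · exact ⟨h1, by omega⟩
      · exact ⟨hS, by omega⟩
  have hnD : ¬ DoneBefore S a b a b := by rintro ⟨-, h2⟩; omega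
  have hA : ∀ v < N, Function.update A N a v = A v := fun v hv => by
    rw [Function.update_of_ne (by omega)]
  have hB : ∀ v < N, Function.update B N b v = B v := fun v hv => by
    rw [Function.update_of_ne (by omega)]
  have hcs : ∀ v < N, Function.update cs N l v = cs v := fun v hv => by
    rw [Function.update_of_ne (by omega)]
  have hst' : ∀ v ≤ N, st' v = st v := fun v hv => by
    rw [hst, Function.update_of_ne (by omega)]
  constructor
  · intro v hv hvm
    rw [hDD]
    by_cases hvN : v = N
    · subst hvN; simp
    · rw [hA v (by omega), hB v (by omega)]; exact .inl (h.node v (by omega) hvm)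
  · have key : ∀ v < N, v ≠ m → A v = a → B v = b → False := fun v hv hvm h1 h2 => by
      have := h.node v hv hvm
      rw [h1, h2] at this
      exact hnD this
    intro v hv w hw hvm hwm h1 h2
    by_cases hvN : v = N
    · subst hvN
      by_contra hne
      rw [hA w (by omega), Function.update_self] at h1
      rw [hB w (by omega), Function.update_self] at h2
      exact key w (by omega) hwm h1.symm h2.symm
    · by_cases hwN : w = N
      · subst hwN
        rw [hA v (by omega), Function.update_self] at h1
        rw [hB v (by omega), Function.update_self] at h2
        exact (key v (by omega) hvm h1 h2).elim
      · rw [hA v (by omega), hA w (by omega)] at h1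
        rw [hB v (by omega), hB w (by omega)] at h2
        exact h.inj v (by omega) w (by omega) hvm hwm h1 h2
  · intro c d hcd
    rw [hDD] at hcd
    rcases hcd with hcd | ⟨rfl, rfl⟩
    · obtain ⟨v, hv, hvm, h1, h2⟩ := h.surj c d hcd
      exact ⟨v, by omega, hvm, by rw [hA v hv, h1], by rw [hB v hv, h2]⟩
    · exact ⟨N, by omega, by omega, by simp, by simp⟩
  · intro v hv hvm
    by_cases hvN : v = N
    · subst hvN; simp; omega
    · rw [hA v (by omega), hB v (by omega)]; exact h.leaf v (by omega) hvm
  · intro i hi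
    obtain ⟨h1, h2, h3⟩ := h.leafA i hi
    exact ⟨h1, by rw [hA _ (by omega), h2], by rw [hB _ (by omega), h3]⟩
  · omega
  · intro c hc
    subst hbig hcid
    simp only [hDD]
    by_cases hca : c = a
    · subst hca
      simp only [Function.update_self]
      refine ⟨.inr ⟨trivial, trivial⟩, ?_, by omega, by omega, trivial, trivial⟩
      rintro d (⟨-, h2⟩ | ⟨-, rfl⟩)
      · omega
      · exact le_rfl
    · rw [Function.update_of_ne hca, Function.update_of_ne hca]
      obtain ⟨g1, g2, g3, g4, g5, g6⟩ := h.big c hc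
      refine ⟨.inl g1, ?_, by omega, g4, by rw [hA _ g3, g5], by rw [hB _ g3, g6]⟩
      rintro d (hd | ⟨rfl, -⟩)
      · exact g2 d hd
      · exact absurd rfl hca
  · intro v hv
    rw [hcs v (by omega)]; exact h.nil v hv
  · intro v hv hmv
    by_cases hvN : v = N
    · subst hvN
      simp only [Function.update_self]
      refine hC.tiles.congr fun w hw => ?_
      have := (hC.mem w hw).1
      exact ⟨hA w this, hB w this⟩
    · rw [hA v (by omega), hB v (by omega), hcs v (by omega)]
      refine (h.tiles v (by omega) hmv).congr fun w hw => ?_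
      have := (h.child v (by omega) w hw).1
      exact ⟨hA w (by omega), hB w (by omega)⟩
  · intro v hv w hw
    by_cases hvN : v = N
    · subst hvN
      simp only [Function.update_self] at hw ⊢
      obtain ⟨k1, k2, k3, k4⟩ := hC.mem w hw
      refine ⟨k1, k2, k4, fun d hd => ?_⟩
      rw [hA w k1] at hd ⊢
      rw [hB w k1, k3]
      have hm := hC.tiles.mem hw
      by_cases hlast : A w = a ∧ b ≤ d
      · exact .inr hlast
      · exact .inl ((h.big (A w) (by omega)).2.1 d ⟨hd, by omega⟩)
    · rw [hcs v (by omega)] at hw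
      obtain ⟨k1, k2, k3, k4⟩ := h.child v (by omega) w hw
      rw [hA w (by omega), hB w (by omega), hA v (by omega), hB v (by omega)]
      exact ⟨k1, k2, hC.old_par v (by omega) w hw, k4⟩
  · intro v hv
    rw [hst' v (by omega)]; exact h.st0 v hv
  · intro v hv
    by_cases hvN : v = N
    · subst hvN
      rw [hst' v le_rfl, hst]
      simp only [Function.update_self]
      rw [hC.pos, h.pos]
    · rw [hst' v (by omega), hst' (v + 1) (by omega), hcs v (by omega)]
      exact h.stS v (by omega)
  · rw [hst]; simp
  · intro v hv i hi
    by_cases hvN : v = N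
    · subst hvN
      simp only [Function.update_self] at hi ⊢
      rw [hst' v le_rfl, h.pos]
      exact hC.new i hi
    · simp only [hcs v (show v < N by omega)] at hi ⊢
      rw [hst' v (by omega)]
      exact hC.old v (by omega) i hi
  · intro v hv hmv
    by_cases hvN : v = N
    · subst hvN
      simp only [Function.update_self]
      obtain ⟨b1, b2, b3⟩ := h.big_le hL hS hab le_rfl hab.le
      have b3 := b3 rfl
      obtain ⟨b4, b5, -⟩ := h.big_le hL hS hab (c := big a + 1) (by omega) (by omega)
      have ht := hC.tiles
      have hmem := hC.mem
      rcases l with _ | ⟨x, _ | ⟨y, l⟩⟩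
      · have : a = b + 1 := ht
        omega
      · obtain ⟨t1, t2, t3⟩ := ht
        have := (hmem x (by simp)).2.2.1
        have t3 : B x + 1 = b + 1 := t3
        rw [t1] at this
        omega
      · obtain ⟨t1, t2, t3, t4, t5⟩ := ht
        have e1 := (hmem x (by simp)).2.2.1
        have e2 := hmem y (by simp)
        refine ⟨x, y, l, rfl, ?_⟩
        rw [hkd, Function.update_self, hA y e2.1, hB y e2.1, e2.2.2.1, t3, e1, t1]
    · rw [hcs v (by omega), hA v (by omega), hkd, Function.update_of_ne (by omega)]
      obtain ⟨x, y, l', h1, h2⟩ := h.kind v (by omega) hmv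
      have := (h.child v (by omega) y (by simp [h1])).1
      exact ⟨x, y, l', h1, by rw [hA y (by omega), hB y (by omega), h2]⟩
  · intro v hv
    rw [hkd, Function.update_of_ne (by omega)]; exact h.kind0 v hv

end


theorem Tiles.length_le {A B : ℕ → ℕ} {a e : ℕ} {l : List ℕ} (h : Tiles A B a e l) :
    a + l.length ≤ e := by
  induction l generalizing a with
  | nil => exact le_of_eq h
  | cons w l ih => obtain ⟨-, h2, h3⟩ := h; have := ih h3; simp only [List.length_cons]; omega

/-- A crude bound, needed only to show that list positions fit into a word. -/
theorem TreeInv.st_le {m : ℕ} {S D : ℕ → ℕ → Prop} {K : ℕ → ℕ → ℕ → ℕ} {π : ℕ → ℕ} {N p2 : ℕ}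
    {st l2 kd big cid par A B : ℕ → ℕ} {cs : ℕ → List ℕ}
    (h : TreeInv m S D K π N p2 st l2 kd big cid par A B cs) (hL : Laminar m S)
    (hD : ∀ c d, D c d → S c d) {v : ℕ} (hv : v ≤ N) : st v ≤ v * (m + 1) := by
  induction v with
  | zero => rw [h.st0 0 (by omega)]; omega
  | succ v ih =>
    have h1 : (cs v).length ≤ m := by
      rcases Nat.lt_or_ge m v with h1 | h1
      · have := (h.tiles v (by omega) h1).length_le
        have := (hL.lt _ _ (hD _ _ (h.node v (by omega) (by omega)))).2
        omega
      · rw [h.nil v h1]; simp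
    have := h.stS v (by omega)
    have := ih (by omega)
    rw [add_mul]
    omega

/-! ### The program that builds the tree from its intervals -/

namespace WordRAM

/-- Append the maximal done intervals inside `[a, b]` to the adjacency list of node `N`. -/
def childLoop : Cmd :=
  forTo 34 (.var 30) (.bin .add (.var 31) (.lit 1))
    (.ite (.bin .eq (.var 34) (.var 35))
      (.seq (.put 2 (.var 33) (.get 22 (.var 34)))
        (.seq (.put 23 (.get 22 (.var 34)) (.var 32))
          (.seq (.assign 33 (.bin .add (.var 33) (.lit 1)))
            (.assign 35 (.bin .add (.get 21 (.var 34)) (.lit 1)))))) .skip)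

/-- Make a node for the interval `[a, b]`. -/
def buildNode (kindE : Expr) : Cmd :=
  .seq (.assign 36 (.bin .add (.get 21 (.var 30)) (.lit 1)))
    (.seq (.assign 37 (.get 21 (.var 36)))
      (.seq (.put 3 (.var 32) kindE)
        (.seq (.assign 33 (.bin .add (.var 33) (.lit 1)))
          (.seq (.assign 35 (.var 30))
            (.seq childLoop
              (.seq (.put 21 (.var 30) (.var 31))
                (.seq (.put 22 (.var 30) (.var 32))
                  (.seq (.assign 32 (.bin .add (.var 32) (.lit 1)))
                    (.put 1 (.var 32) (.var 33))))))))))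

/-- The memory holds a part of the tree. -/
def HoldsTree (τ : State) (m : ℕ) (S D : ℕ → ℕ → Prop) (K : ℕ → ℕ → ℕ → ℕ) (π : ℕ → ℕ) (N : ℕ) :
    Prop :=
  ∃ p2 A B cs, τ.var 32 = N ∧ τ.var 33 = p2 ∧
    TreeInv m S D K π N p2 (τ.arr 1) (τ.arr 2) (τ.arr 3) (τ.arr 21) (τ.arr 22) (τ.arr 23) A B cs

theorem childLoop_spec {W m a b N p2 : ℕ} {S : ℕ → ℕ → Prop} {K : ℕ → ℕ → ℕ → ℕ} {π : ℕ → ℕ}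
    {st l2 kd A B : ℕ → ℕ} {cs : ℕ → List ℕ} {σ : State} {par : ℕ → ℕ}
    (h : TreeInv m S (DoneBefore S a b) K π N p2 st l2 kd (σ.arr 21) (σ.arr 22) par A B cs)
    (hL : Laminar m S) (hS : S a b) (hab : a < b) (hW : (2 * m + 5) * (m + 5) ≤ W)
    (h30 : σ.var 30 = a) (h31 : σ.var 31 = b) (h32 : σ.var 32 = N)
    (hC : ChildInv S m a b N p2 (σ.arr 21) A B cs st a (σ.var 35) (σ.var 33) (σ.arr 2)
      (σ.arr 23) []) :
    Runs W childLoop σ fun t τ => t ≤ 40 * m + 10 ∧ τ.var 33 ≤ W ∧ ∃ l nx,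
      ChildInv S m a b N p2 (σ.arr 21) A B cs st (b + 1) nx (τ.var 33) (τ.arr 2) (τ.arr 23) l := by
  have hb := (hL.lt _ _ hS).2
  have hN := h.card_le hL fun c d hd => hd.1
  have hp2 : p2 ≤ (2 * m + 1) * (m + 1) := by
    rw [← h.pos]
    exact (h.st_le hL (fun c d hd => hd.1) le_rfl).trans (Nat.mul_le_mul_right _ hN)
  have hWb : p2 + 1 + (m + 2) ≤ W ∧ 2 * m + 5 ≤ W := by
    have : (2 * m + 5) * (m + 5) = (2 * m + 1) * (m + 1) + 12 * m + 24 := by ring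
    omega
  refine runs_forTo a (b + 1) 25 (fun c τ => ∃ l, ChildInv S m a b N p2 (σ.arr 21) A B cs st c
    (τ.var 35) (τ.var 33) (τ.arr 2) (τ.arr 23) l) (by simpa [Expr.eval] using h30) (by omega)
    (by omega) rfl ?_ ?_ ?_ ?_
  · intro τ hF
    simp only [Expr.eval, BinOp.eval, hF.var 31 rfl, h31]
  · exact ⟨[], by simpa using hC⟩
  · rintro c τ hac hcb hci hF ⟨l, hI⟩
    have g21 : τ.arr 21 = σ.arr 21 := hF.arr 21 rfl
    have g22 : τ.arr 22 = σ.arr 22 := hF.arr 22 rfl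
    have g32 : τ.var 32 = N := by rw [hF.var 32 rfl, h32]
    have hlen := hI.tiles.length_le
    have hnx := hI.nx_le
    have hpp := hI.pos
    have hcid := (h.big c (by omega)).2.2.1
    have hbc := (h.big_le hL hS hab hac (by omega)).2.1
    rw [runs_ite, runs_skip]
    refine ⟨fun he => ?_, fun he => ?_⟩
    · rw [Expr.eval_eq] at he
      simp only [Expr.eval, hci] at he
      rw [runs_seq, runs_put, runs_seq, runs_put, runs_seq, runs_assign, runs_assign]
      simp only [Expr.eval, BinOp.eval, Expr.cost, State.setArr_arr, State.setArr_var,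
        State.setVar_arr, State.setVar_var, Nat.reduceEqDiff, reduceIte, hci, g21, g22, g32]
      exact ⟨by omega, by omega, by omega, by omega, by omega, _,
        hI.step h hL hS hab hac (by omega) he⟩
    · have he' : c ≠ τ.var 35 := fun he' => by
        have := mt Expr.eval_eq.2 (not_not.2 he)
        simp only [Expr.eval, hci] at this
        exact this he'
      simp only [Expr.cost, State.setVar_arr, State.setVar_var, Nat.reduceEqDiff, reduceIte]
      have := hI.le
      exact ⟨by omega, l, by omega, hI.nx_le, hI.tiles, hI.mem, hI.closed, hI.old_par, hI.pos,
        hI.old, hI.new⟩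
  · rintro t τ ht hF - ⟨l, hI⟩
    have hlen := hI.tiles.length_le
    have hnx := hI.nx_le
    have hpp := hI.pos
    refine ⟨?_, by omega, l, _, hI⟩
    simp only [Expr.cost] at ht
    omega

theorem buildNode_spec {W m a b N : ℕ} {S : ℕ → ℕ → Prop} {K : ℕ → ℕ → ℕ → ℕ} {π : ℕ → ℕ}
    {kindE : Expr} {σ : State} (hL : Laminar m S)
    (h : HoldsTree σ m S (DoneBefore S a b) K π N) (hS : S a b) (hab : a < b)
    (hW : (2 * m + 5) * (m + 5) ≤ W) (h30 : σ.var 30 = a) (h31 : σ.var 31 = b)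
    (hK : ∀ x y, (kindE.eval ((σ.setVar 36 x).setVar 37 y) = K a x y ∧ K a x y ≤ W)) :
    Runs W (buildNode kindE) σ fun t τ => t ≤ 40 * m + kindE.cost + 60 ∧
      HoldsTree τ m S (DoneBefore S a (b + 1)) K π (N + 1) := by
  obtain ⟨p2, A, B, cs, h32, h33, h⟩ := h
  have hb := (hL.lt _ _ hS).2
  have hN := h.card_le hL fun c d hd => hd.1
  have hp2 : p2 ≤ (2 * m + 1) * (m + 1) := by
    rw [← h.pos]
    exact (h.st_le hL (fun c d hd => hd.1) le_rfl).trans (Nat.mul_le_mul_right _ hN)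
  have hWb : p2 + 1 + (m + 2) ≤ W ∧ 2 * m + 5 ≤ W := by
    have : (2 * m + 5) * (m + 5) = (2 * m + 1) * (m + 1) + 12 * m + 24 := by ring
    omega
  obtain ⟨b1, b2, b3⟩ := h.big_le hL hS hab le_rfl hab.le
  have b3 := b3 rfl
  obtain ⟨b4, b5, -⟩ := h.big_le hL hS hab (c := σ.arr 21 a + 1) (by omega) (by omega)
  rw [buildNode, runs_seq, runs_assign, runs_seq, runs_assign, runs_seq, runs_put, runs_seq,
    runs_assign, runs_seq, runs_assign]
  simp only [Expr.eval, BinOp.eval, Expr.cost, State.setArr_var, hK,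
    State.setVar_arr, State.setVar_var, Nat.reduceEqDiff, reduceIte, h30, h32, h33]
  refine ⟨by omega, by omega, trivial, by omega, by omega, ?_⟩
  rw [runs_seq]
  refine (childLoop_spec (K := K) (π := π) (a := a) (b := b) (N := N) (p2 := p2) (st := σ.arr 1) (l2 := σ.arr 2)
    (kd := σ.arr 3) (par := σ.arr 23) (A := A) (B := B) (cs := cs) ?_ hL hS hab hW
    ?_ ?_ ?_ ?_).frame.mono ?_
  · simpa using h
  · simpa using h30
  · simpa using h31
  · simpa using h32
  · simp only [State.setArr_arr, State.setArr_var, State.setVar_arr, State.setVar_var,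
      Nat.reduceEqDiff, reduceIte]
    refine ⟨le_rfl, by omega, rfl, by simp, fun x h1 h2 => by omega, fun v hv w hw =>
      (h.child v hv w hw).2.2.1, by simp, h.slots, by simp⟩
  rintro t τ ⟨⟨ht, h33W, l, nx, hC⟩, hF⟩
  have g : ∀ v, childLoop.writesVar v = false → v ≠ 35 → v ≠ 33 → v ≠ 37 → v ≠ 36 →
      τ.var v = σ.var v := by
    intro v hv h1 h2 h3 h4
    rw [hF.var v hv]; simp [h1, h2, h3, h4]
  have ga : ∀ a, childLoop.writesArr a = false → a ≠ 3 → τ.arr a = σ.arr a := by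
    intro a ha h1
    rw [hF.arr a ha]; simp [h1]
  have g30 : τ.var 30 = a := by
    rw [g 30 rfl (by decide) (by decide) (by decide) (by decide), h30]
  have g31 : τ.var 31 = b := by
    rw [g 31 rfl (by decide) (by decide) (by decide) (by decide), h31]
  have g32 : τ.var 32 = N := by
    rw [g 32 rfl (by decide) (by decide) (by decide) (by decide), h32]
  rw [runs_seq, runs_put, runs_seq, runs_put, runs_seq, runs_assign, runs_put]
  simp only [Expr.eval, BinOp.eval, Expr.cost, State.setArr_arr, State.setArr_var,
    State.setVar_arr, State.setVar_var, Nat.reduceEqDiff, reduceIte, g30, g31, g32]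
  refine ⟨by omega, by omega, by omega, h33W, by omega, τ.var 33, Function.update A N a,
    Function.update B N b, Function.update cs N l, ?_, ?_, ?_⟩
  · simp
  · simp
  · simp only [State.setArr_arr, State.setArr_var,
      State.setVar_arr, State.setVar_var, Nat.reduceEqDiff, reduceIte]
    refine h.step hL hS hab (by simpa using hC) ?_ ?_ ?_ ?_
    · rw [ga 21 rfl (by decide)]
    · rw [ga 22 rfl (by decide)]
    · rw [ga 1 rfl (by decide)]
    · rw [hF.arr 3 rfl]
      simp

/-- Build the nodes of the tree from the leaves upwards. -/
def buildNodes (gS kindE : Expr) : Cmd :=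
  forTo 38 (.lit 0) (.var 2)
    -- Left ends decrease and right ends increase, so an interval is reached after all members of
    -- the family inside it.
    (.seq (.assign 30 (.bin .sub (.bin .sub (.var 2) (.lit 1)) (.var 38)))
      (forTo 31 (.bin .add (.var 30) (.lit 1)) (.var 2) (.ite gS (buildNode kindE) .skip)))

/-- The node count pays for the child loops: at most `m` inner nodes, each of linear cost. Testing
all pairs for membership costs another quadratic term. -/
theorem buildNodes_spec {W m : ℕ} {S : ℕ → ℕ → Prop} {K : ℕ → ℕ → ℕ → ℕ} {π : ℕ → ℕ}
    {gS kindE : Expr} {σ : State} (hL : Laminar m S) (hm : σ.var 2 = m)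
    (hW : (2 * m + 5) * (m + 5) ≤ W)
    (h : HoldsTree σ m S (fun c d => S c d ∧ c = d) K π (m + 1))
    (hg : ∀ τ, Frame (buildNodes gS kindE) σ τ → τ.var 30 < m → τ.var 31 < m →
      (gS.eval τ ≠ 0 ↔ S (τ.var 30) (τ.var 31)))
    (hK : ∀ τ, Frame (buildNodes gS kindE) σ τ → kindE.eval τ = K (τ.var 30) (τ.var 36) (τ.var 37) ∧
      kindE.eval τ ≤ W) :
    Runs W (buildNodes gS kindE) σ fun t τ =>
      t ≤ m * (40 * m + kindE.cost + 60) + m * (m * (gS.cost + 20) + 40) + 10 ∧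
      ∃ N, HoldsTree τ m S S K π N := by
  have hWb : 2 * m + 5 ≤ W := by
    have : (2 * m + 5) * (m + 5) = (2 * m + 5) * (m + 4) + (2 * m + 5) := by ring
    omega
  set C := 40 * m + kindE.cost + 60 with hC
  refine runs_forTo_time 0 m (fun k T τ => ∃ N, m + 1 ≤ N ∧
      T ≤ (N - (m + 1)) * C + k * (m * (gS.cost + 20) + 25) ∧
      HoldsTree τ m S (fun c d => S c d ∧ (c = d ∨ m ≤ c + k)) K π N)
    rfl (by omega) (by omega) rfl ?_ ?_ ?_ ?_
  · intro τ hF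
    simp only [Expr.eval]; rw [hF.var 2 rfl, hm]
  · refine ⟨m + 1, le_rfl, by omega, ?_⟩
    have : (fun c d => S c d ∧ (c = d ∨ m ≤ c + 0)) = fun c d => S c d ∧ c = d := by
      funext c d
      refine propext (and_congr_right fun hs => ?_)
      have := hL.lt _ _ hs
      omega
    rw [this]
    obtain ⟨p2, A, B, cs, h1, h2, h3⟩ := h
    exact ⟨p2, A, B, cs, by simpa using h1, by simpa using h2, h3⟩
  · rintro k T τ - hkm hki hF ⟨N, hN, hT, hI⟩
    have g2 : τ.var 2 = m := by rw [hF.var 2 rfl, hm]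
    rw [runs_seq, runs_assign]
    simp only [Expr.eval, BinOp.eval, Expr.cost, g2, hki]
    refine ⟨by omega, ?_⟩
    obtain ⟨a, ha⟩ : ∃ a, m - 1 - k = a := ⟨_, rfl⟩
    rw [ha]
    refine runs_forTo_time (a + 1) m (fun b T' ρ => ∃ N, m + 1 ≤ N ∧ T + T' ≤ (N - (m + 1)) * C +
        k * (m * (gS.cost + 20) + 25) + (b - a) * (gS.cost + 5) ∧
        HoldsTree ρ m S (DoneBefore S a b) K π N) ?_ (by omega) (by omega) rfl ?_ ?_ ?_ ?_
    · simp [Expr.eval, BinOp.eval]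
    · intro ρ hG
      simp only [Expr.eval]; rw [hG.var 2 rfl]; simpa using g2
    · refine ⟨N, hN, by omega, ?_⟩
      have : DoneBefore S a (a + 1) = fun c d => S c d ∧ (c = d ∨ m ≤ c + k) := by
        funext c d
        refine propext (and_congr_right fun hs => ?_)
        have := hL.lt _ _ hs
        omega
      rw [this]
      obtain ⟨p2, A, B, cs, h1, h2, h3⟩ := hI
      exact ⟨p2, A, B, cs, by simpa using h1, by simpa using h2, h3⟩
    · rintro b T' ρ hab hbm hbi hG ⟨N', hN', hT', hI'⟩
      have q30 : ρ.var 30 = a := by rw [hG.var 30 rfl]; simp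
      have hFρ : Frame (buildNodes gS kindE) σ ρ := by
        refine hF.trans ⟨fun v hv => ?_, fun x hx => ?_⟩
        · have h1 : v ≠ 30 := by rintro rfl; simp [writesVar_forTo, Cmd.writesVar] at hv
          rw [hG.var v]
          · simp [h1]
          · simp only [writesVar_forTo, Cmd.writesVar, Bool.or_eq_false_iff] at hv ⊢
            tauto
        · rw [hG.arr x]
          · rfl
          · simpa [buildNodes, writesArr_forTo, Cmd.writesArr] using hx
      have hgρ := hg ρ hFρ (by omega) (by omega)
      rw [q30, hbi] at hgρ
      have hmulb : (b + 1 - a) * (gS.cost + 5) = (b - a) * (gS.cost + 5) + (gS.cost + 5) := by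
        rw [Nat.sub_add_comm (by omega), add_mul, one_mul]
      rw [runs_ite, runs_skip]
      refine ⟨fun he => ?_, fun he => ?_⟩
      · have hK' : ∀ x y, kindE.eval ((ρ.setVar 36 x).setVar 37 y) = K a x y ∧ K a x y ≤ W := by
          intro x y
          have hk := hK ((ρ.setVar 36 x).setVar 37 y) (hFρ.trans ⟨fun v hv => ?_, fun _ _ => rfl⟩)
          · simp only [State.setVar_var, Nat.reduceEqDiff, reduceIte, q30] at hk
            exact ⟨hk.1, hk.1 ▸ hk.2⟩
          · have h1 : v ≠ 36 := by
              rintro rfl; simp [buildNodes, buildNode, writesVar_forTo, Cmd.writesVar] at hv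
            have h2 : v ≠ 37 := by
              rintro rfl; simp [buildNodes, buildNode, writesVar_forTo, Cmd.writesVar] at hv
            simp [h1, h2]
        refine (buildNode_spec hL hI' (hgρ.1 he) (by omega) hW q30 hbi hK').mono ?_
        rintro t υ ⟨ht, p2, A, B, cs, h1, h2, h3⟩
        refine ⟨N' + 1, by omega, ?_, p2, A, B, cs, by simpa using h1, by simpa using h2, h3⟩
        rw [Nat.sub_add_comm hN', add_mul]
        omega
      · refine ⟨N', hN', by omega, ?_⟩
        have : DoneBefore S a (b + 1) = DoneBefore S a b := by
          funext c d
          refine propext (and_congr_right fun hs => ?_)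
          have : ¬ (c = a ∧ d = b) := by rintro ⟨rfl, rfl⟩; exact hgρ.2 hs he
          omega
        rw [this]
        obtain ⟨p2, A, B, cs, h1, h2, h3⟩ := hI'
        exact ⟨p2, A, B, cs, by simpa using h1, by simpa using h2, h3⟩
    · rintro t T' ρ ht hG - ⟨N', hN', hT', hI'⟩
      refine ⟨N', hN', ?_, ?_⟩
      · simp only [Expr.cost] at ht
        have e1 : (m - (a + 1)) * (1 + 7) ≤ m * 8 := by omega
        have e2 : (m - a) * (gS.cost + 5) ≤ m * (gS.cost + 5) := Nat.mul_le_mul_right _ (by omega)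
        have e3 : m * (gS.cost + 20) = m * (gS.cost + 5) + m * 15 := by ring
        have e4 : (k + 1) * (m * (gS.cost + 20) + 25) =
          k * (m * (gS.cost + 20) + 25) + m * (gS.cost + 20) + 25 := by ring
        rw [e4]
        omega
      · have : DoneBefore S a m = fun c d => S c d ∧ (c = d ∨ m ≤ c + (k + 1)) := by
          funext c d
          refine propext (and_congr_right fun hs => ?_)
          have := hL.lt _ _ hs
          omega
        rw [← this]
        obtain ⟨p2, A, B, cs, h1, h2, h3⟩ := hI'
        exact ⟨p2, A, B, cs, by simpa using h1, by simpa using h2, h3⟩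
  · rintro t T τ ht hF - ⟨N, hN, hT, hI⟩
    have : (fun c d => S c d ∧ (c = d ∨ m ≤ c + m)) = S := by
      funext c d
      exact propext ⟨fun h => h.1, fun h => ⟨h, .inr (by omega)⟩⟩
    rw [this] at hI
    refine ⟨?_, N, hI⟩
    obtain ⟨p2, A, B, cs, h1, h2, h3⟩ := hI
    have hN2 := h3.card_le hL fun c d hd => hd
    simp only [Expr.cost, Nat.sub_zero] at ht
    have e1 : (N - (m + 1)) * C ≤ m * C := Nat.mul_le_mul_right _ (by omega)
    have e2 : m * (m * (gS.cost + 20) + 40) = m * (m * (gS.cost + 20) + 25) + m * 15 := by ring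
    omega

end WordRAM


/-! ### The finished tree: parents, root, initial and final stage -/

namespace TreeInv

variable {m : ℕ} {S : ℕ → ℕ → Prop} {K : ℕ → ℕ → ℕ → ℕ} {π : ℕ → ℕ} {N p2 : ℕ}
  {st l2 kd big cid par A B : ℕ → ℕ} {cs : ℕ → List ℕ}

theorem root (h : TreeInv m S S K π N p2 st l2 kd big cid par A B cs) (hL : Laminar m S)
    (hm0 : 0 < m) : cid 0 < N ∧ cid 0 ≠ m ∧ A (cid 0) = 0 ∧ B (cid 0) = m - 1 := by
  obtain ⟨g1, g2, g3, g4, g5, g6⟩ := h.big 0 hm0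
  have := g2 _ hL.top
  have := (hL.lt _ _ g1).2
  exact ⟨g3, g4, g5, by omega⟩

theorem lt_of_mem (h : TreeInv m S S K π N p2 st l2 kd big cid par A B cs) {v w : ℕ}
    (hw : w ∈ cs v) : m < v := by
  by_contra hle
  rw [h.nil v (by omega)] at hw
  simp at hw

theorem root_notMem (h : TreeInv m S S K π N p2 st l2 kd big cid par A B cs) (hL : Laminar m S)
    (hm0 : 0 < m) {v : ℕ} (hv : v < N) : cid 0 ∉ cs v := fun hw => by
  have hmv := h.lt_of_mem hw
  obtain ⟨r1, r2, r3, r4⟩ := h.root hL hm0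
  have := (h.tiles v hv hmv).mem hw
  have := (hL.lt _ _ (h.node v hv (by omega))).2
  have := h.inj v hv (cid 0) r1 (by omega) r2 (by omega) (by omega)
  have := (h.child v hv _ hw).1
  omega

/-- Every node except the root is a child. -/
theorem exists_parent (h : TreeInv m S S K π N p2 st l2 kd big cid par A B cs) (hL : Laminar m S)
    (hm0 : 0 < m) {w : ℕ} (hw : w < N) (hwm : w ≠ m) (hw0 : w ≠ cid 0) :
    ∃ v < N, w ∈ cs v ∧ par w = v := by
  classical
  obtain ⟨r1, r2, r3, r4⟩ := h.root hL hm0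
  have sw := h.node w hw hwm
  have lw := hL.lt _ _ sw
  -- The parent is the node with the shortest interval around that of `w`; the child of it that
  -- meets `w` must then be `w` itself.
  have hex : ∃ k v, v < N ∧ v ≠ m ∧ v ≠ w ∧ A v ≤ A w ∧ B w ≤ B v ∧ B v - A v = k :=
    ⟨_, cid 0, r1, r2, hw0.symm, by omega, by omega, rfl⟩
  obtain ⟨v, hv, hvm, hvw, hA, hB, hk⟩ := Nat.find_spec hex
  have hmin : ∀ u < N, u ≠ m → u ≠ w → A u ≤ A w → B w ≤ B u → B v - A v ≤ B u - A u := by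
    intro u hu hum huw h1 h2
    rw [hk]
    exact Nat.find_min' hex ⟨u, hu, hum, huw, h1, h2, rfl⟩
  have hmv : m < v := by
    by_contra hle
    have := (h.leaf v hv hvm).1 (by omega)
    exact hvw (h.inj v hv w hw hvm hwm (by omega) (by omega))
  have hT := h.tiles v hv hmv
  obtain ⟨u, hu, hu1, hu2⟩ := hT.exists_mem hA (by omega)
  obtain ⟨c1, c2, c3, c4⟩ := h.child v hv u hu
  have hum := hT.mem hu
  have su := h.node u (by omega) c2
  by_cases huw : u = w
  · subst huw; exact ⟨v, hv, hu, c3⟩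
  exfalso
  rcases Nat.lt_or_ge (B u) (B w) with hlt | hge
  · rcases hu1.lt_or_eq with h1 | h1
    · have := hL.lam _ _ _ _ su sw h1 hu2; omega
    · rcases c4 (B w) (h1 ▸ sw) with h2 | h2
      · omega
      · exact hvw (h.inj v hv w hw hvm hwm (by omega) (by omega))
  · have := hmin u (by omega) c2 huw hu1 hge
    have := h.inj u (by omega) v hv c2 hvm (by omega) (by omega)
    omega

theorem par_lt (h : TreeInv m S S K π N p2 st l2 kd big cid par A B cs) (hL : Laminar m S)
    (hm0 : 0 < m) {w : ℕ} (hw : w < N) (hwm : w ≠ m) (hw0 : w ≠ cid 0) : par w < N := by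
  obtain ⟨v, hv, -, h'⟩ := h.exists_parent hL hm0 hw hwm hw0
  omega

/-- The forest of the singletons. -/
theorem init (hL : Laminar m S) (ρ : Equiv.Perm ℕ) (hρ : ∀ i, ρ i < m ↔ i < m)
    (hst : ∀ v < m + 2, st v = v) (hkd : ∀ v ≤ m, kd v = 0)
    (hbig : ∀ c < m, big c = c ∧ cid c = ρ c) :
    TreeInv m S (fun c d => S c d ∧ c = d) K ρ (m + 1) (m + 1) st l2 kd big cid par ρ.symm ρ.symm
      fun _ => [] := by
  have hsymm : ∀ i, ρ.symm i < m ↔ i < m := fun i => by rw [← hρ]; simp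
  constructor
  · intro v hv hvm
    exact ⟨hL.self _ ((hsymm v).2 (by omega)), rfl⟩
  · intro v _ w _ _ _ h _
    exact ρ.symm.injective h
  · rintro c d ⟨h1, rfl⟩
    have := hL.lt _ _ h1
    have := (hρ c).2 (by omega)
    exact ⟨ρ c, by omega, by omega, by simp, by simp⟩
  · intro v hv hvm; simp; omega
  · intro i hi; exact ⟨(hρ i).2 hi, by simp, by simp⟩
  · omega
  · intro c hc
    obtain ⟨h1, h2⟩ := hbig c hc
    have := (hρ c).2 hc
    rw [h1, h2]
    exact ⟨⟨hL.self c hc, rfl⟩, fun d hd => hd.2.ge, by omega, by omega, by simp, by simp⟩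
  · intros; rfl
  · intro v hv hmv; omega
  · intro v hv w hw; simp at hw
  · intro v hv; exact hst v (by omega)
  · intro v hv; rw [hst v (by omega), hst (v + 1) (by omega)]; rfl
  · exact hst _ (by omega)
  · intro v hv i hi; simp at hi
  · intro v hv hmv; omega
  · exact hkd

/-- The root becomes adjacent to the leaf `m`. -/
theorem join (h : TreeInv m S S K π N p2 st l2 kd big cid par A B cs) (hL : Laminar m S)
    (hm0 : 0 < m) : TreeInv m S S K π N p2 st l2 kd big cid
      (Function.update (Function.update par (cid 0) m) m (cid 0)) A B cs := by
  refine ⟨h.node, h.inj, h.surj, h.leaf, h.leafA, h.gt, h.big, h.nil, h.tiles, ?_, h.st0, h.stS,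
    h.pos, h.slots, h.kind, h.kind0⟩
  intro v hv w hw
  obtain ⟨h1, h2, h3, h4⟩ := h.child v hv w hw
  rw [Function.update_of_ne h2, Function.update_of_ne]
  · exact ⟨h1, h2, h3, h4⟩
  · rintro rfl; exact h.root_notMem hL hm0 hv hw

end TreeInv

namespace WordRAM

/-- Start with the leaves. -/
def initTree : Cmd :=
  .seq (.assign 32 (.bin .add (.var 2) (.lit 1)))
    (.seq (.assign 33 (.var 32))
      -- The leaves `0, …, m` have one slot each, so `m + 2` starts are known: those of the leaves
      -- and that of the first inner node.
      (.seq (forTo 34 (.lit 0) (.bin .add (.var 2) (.lit 2))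
          (.put 1 (.bin .add (.lit 0) (.var 34)) (.var 34)))
        (forTo 34 (.lit 0) (.var 2)
          (.seq (.put 21 (.var 34) (.var 34)) (.put 22 (.var 34) (.get 14 (.var 34)))))))

theorem initTree_spec {W m : ℕ} {S : ℕ → ℕ → Prop} {K : ℕ → ℕ → ℕ → ℕ} {σ : State}
    (hL : Laminar m S) (ρ : Equiv.Perm ℕ) (hρ : ∀ i, ρ i < m ↔ i < m) (hm : σ.var 2 = m)
    (hW : m + 5 ≤ W) (h3 : ∀ v, σ.arr 3 v = 0) (h14 : ∀ i < m, σ.arr 14 i = ρ i) :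
    Runs W initTree σ fun t τ => t ≤ 50 * m + 100 ∧
      HoldsTree τ m S (fun c d => S c d ∧ c = d) K ρ (m + 1) := by
  rw [initTree, runs_seq, runs_assign, runs_seq, runs_assign, runs_seq]
  simp only [Expr.eval, BinOp.eval, Expr.cost, State.setVar_var, hm, reduceIte]
  refine ⟨by omega, by omega, ?_⟩
  refine runs_fill 0 (m + 2) 0 (fun v => v) rfl (by omega) (by omega) ?_ ?_ ?_
  · intro τ hF
    simp only [Expr.eval, BinOp.eval]; rw [hF.var 2 rfl]; simp [hm]
  · intro k τ _ hk hki hF _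
    simp only [Expr.eval, BinOp.eval, hki]
    exact ⟨trivial, trivial, by omega⟩
  intro t τ ht hF h1
  have g2 : τ.var 2 = m := by rw [hF.var 2 rfl]; simpa using hm
  have g14 : τ.arr 14 = σ.arr 14 := by rw [hF.arr 14 rfl]; rfl
  refine runs_forTo 0 m 10 (fun k υ => ∀ c < k, υ.arr 21 c = c ∧ υ.arr 22 c = ρ c) rfl (by omega)
    (by omega) rfl ?_ (by simp) ?_ ?_
  · intro υ hG
    simp only [Expr.eval]; rw [hG.var 2 rfl, g2]
  · intro k υ _ hk hki hG hI
    have q14 : υ.arr 14 = σ.arr 14 := by rw [hG.arr 14 rfl, g14]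
    rw [runs_seq, runs_put, runs_put]
    simp only [Expr.eval, Expr.cost, State.setArr_arr, State.setArr_var, State.setVar_arr, hki,
      Nat.reduceEqDiff, reduceIte, q14, h14 k hk]
    have := (hρ k).2 hk
    refine ⟨by omega, by omega, by omega, fun c hc => ?_⟩
    by_cases hck : c = k
    · subst hck; simp
    · rw [Function.update_of_ne hck, Function.update_of_ne hck]; exact hI c (by omega)
  · intro t' υ ht' hG _ hI
    simp only [Expr.cost] at ht ht'
    refine ⟨by omega, m + 1, ρ.symm, ρ.symm, fun _ => [], ?_, ?_, ?_⟩
    · rw [hG.var 32 rfl, hF.var 32 rfl]; simp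
    · rw [hG.var 33 rfl, hF.var 33 rfl]; simp
    · refine TreeInv.init hL ρ hρ ?_ ?_ hI
      · intro v hv
        rw [hG.arr 1 rfl, h1]
        simp only []
        rw [if_pos (by omega)]
        omega
      · intro v hv
        rw [hG.arr 3 rfl, hF.arr 3 rfl]; simpa using h3 v

/-- Write the parents into the adjacency lists. -/
def finishTree : Cmd :=
  .seq (.put 23 (.get 22 (.lit 0)) (.var 2))
    (.seq (.put 23 (.var 2) (.get 22 (.lit 0)))
      -- The node of `[0, m - 1]` and leaf `m` have become parents of each other, so this loop
      -- enters their common edge in both lists.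
      (.seq (forTo 34 (.lit 0) (.var 32) (.put 2 (.get 1 (.var 34)) (.get 23 (.var 34))))
        (.assign 1 (.var 32))))

theorem finishTree_spec {W m N : ℕ} {S : ℕ → ℕ → Prop} {K : ℕ → ℕ → ℕ → ℕ} {π : ℕ → ℕ} {σ : State}
    (hL : Laminar m S) (hm0 : 0 < m) (hm : σ.var 2 = m) (hW : 2 * m + 5 ≤ W)
    (h : HoldsTree σ m S S K π N) :
    Runs W finishTree σ fun t τ => t ≤ 50 * m + 100 ∧ τ.var 1 = N ∧
      ∃ p2 l2 big cid par A B cs,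
        TreeInv m S S K π N p2 (τ.arr 1) l2 (τ.arr 3) big cid par A B cs ∧
        par (cid 0) = m ∧ par m = cid 0 ∧
        ∀ v < N, ∀ i (hi : i < (par v :: cs v).length),
          τ.arr 2 (τ.arr 1 v + i) = (par v :: cs v)[i] := by
  obtain ⟨p2, A, B, cs, h32, h33, h⟩ := h
  have hN := h.card_le hL fun c d hd => hd
  obtain ⟨r1, r2, r3, r4⟩ := h.root hL hm0
  have hJ := h.join hL hm0
  rw [finishTree, runs_seq, runs_put, runs_seq, runs_put, runs_seq]
  simp only [Expr.eval, Expr.cost, State.setArr_arr, State.setArr_var, Nat.reduceEqDiff, reduceIte,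
    hm]
  refine ⟨by omega, by omega, ?_⟩
  obtain ⟨par, hpar⟩ : ∃ par, par = Function.update (Function.update (σ.arr 23) (σ.arr 22 0) m) m
    (σ.arr 22 0) := ⟨_, rfl⟩
  rw [← hpar] at hJ
  have hpW : ∀ v < N, par v ≤ W := by
    intro v hv
    by_cases hvm : v = m
    · rw [hpar, hvm, Function.update_self]; omega
    by_cases hv0 : v = σ.arr 22 0
    · rw [hpar, hv0, Function.update_of_ne r2, Function.update_self]; omega
    · have := hJ.par_lt hL hm0 hv hvm hv0; omega
  refine runs_forTo 0 N 10 (fun k τ => (∀ v < k, τ.arr 2 (σ.arr 1 v) = par v) ∧ ∀ v < N, ∀ i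
    (hi : i < (cs v).length), τ.arr 2 (σ.arr 1 v + 1 + i) = (cs v)[i]) rfl (by omega) (by omega) rfl
    ?_ ?_ ?_ ?_
  · intro τ hF
    simp only [Expr.eval]; rw [hF.var 32 rfl]; simpa using h32
  · refine ⟨fun v hv => by omega, ?_⟩
    simpa using h.slots
  · rintro k τ - hk hki hF ⟨hI, hI'⟩
    have g1 : τ.arr 1 = σ.arr 1 := by rw [hF.arr 1 rfl]; simp
    have g23 : τ.arr 23 = par := by rw [hF.arr 23 rfl, hpar]; simp
    rw [runs_put]
    simp only [Expr.eval, Expr.cost, State.setArr_arr, State.setVar_arr, hki, reduceIte, g1, g23]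
    refine ⟨hpW k hk, by omega, fun v hv => ?_, fun v hv i hi => ?_⟩
    · by_cases hvk : v = k
      · subst hvk; simp
      · have := h.st_lt (v := v) (w := k) (by omega) (by omega)
        rw [Function.update_of_ne (by omega)]
        exact hI v (by omega)
    · rw [Function.update_of_ne]
      · exact hI' v hv i hi
      · rcases lt_trichotomy v k with hvk | rfl | hvk
        · have := h.st_lt hvk (by omega); omega
        · omega
        · have := h.st_lt hvk (by omega); omega
  · rintro t τ ht hF - ⟨hI, hI'⟩
    have g1 : τ.arr 1 = σ.arr 1 := by rw [hF.arr 1 rfl]; simp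
    have g3 : τ.arr 3 = σ.arr 3 := by rw [hF.arr 3 rfl]; simp
    have g32 : τ.var 32 = N := by rw [hF.var 32 rfl]; simpa using h32
    rw [runs_assign]
    simp only [Expr.eval, Expr.cost, State.setVar_arr, State.setVar_var, reduceIte, g1, g3, g32]
    simp only [Expr.cost] at ht
    refine ⟨by omega, by omega, trivial, p2, _, _, _, par, A, B, cs, hJ, ?_, ?_, ?_⟩
    · rw [hpar, Function.update_of_ne r2, Function.update_self]
    · rw [hpar, Function.update_self]
    · intro v hv i hi
      rcases i with _ | i
      · exact hI v hv
      · have hi' : i < (cs v).length := by simpa using hi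
        rw [List.getElem_cons_succ, ← hI' v hv i hi']
        congr 1
        omega

end WordRAM


/-! ### Modules of a good order -/

/-- The interval `[a, b]` is a module. -/
def IntervalModule (m : ℕ) (e : ℕ → ℕ → ℕ) (a b : ℕ) : Prop :=
  a ≤ b ∧ b < m ∧ IsModuleOf e (Set.Iio m) (Set.Icc a b)

/-- The interval `[a, b]` is a strong module. -/
def StrongInterval (m : ℕ) (e : ℕ → ℕ → ℕ) (a b : ℕ) : Prop :=
  a ≤ b ∧ b < m ∧ IsStrongModule e (Set.Iio m) (Set.Icc a b)

section

variable {m : ℕ} {e : ℕ → ℕ → ℕ}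

theorem strongInterval_laminar (hm : 0 < m) : Laminar m (StrongInterval m e) := by
  refine ⟨fun c d h => ⟨h.1, h.2.1⟩, fun c hc => ⟨le_rfl, hc, ?_⟩, ⟨by omega, by omega, ?_⟩, ?_⟩
  · rw [Set.Icc_self]; exact .singleton hc
  · have : Set.Icc 0 (m - 1) = Set.Iio m := by ext; simp; omega
    rw [this]
    exact .univ ⟨0, hm⟩
  · intro c d c' d' h h' h1 h2
    by_contra hcon
    rcases h.2.2.nested h'.2.2.mod ⟨c', ⟨h1.le, h2⟩, le_rfl, h'.1⟩ with h3 | h3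
    · have := h3 ⟨le_rfl, h.1⟩
      have := this.1
      omega
    · have := (h3 ⟨h'.1, le_rfl⟩).2
      omega

namespace GoodOrder

/-- Strong modules are intervals. -/
theorem exists_interval (hG : GoodOrder m e) {U : Set ℕ} (hU : IsStrongModule e (Set.Iio m) U) :
    ∃ a b, StrongInterval m e a b ∧ U = Set.Icc a b := by
  have hfin : U.Finite := (Set.finite_Iio m).subset hU.mod.sub
  obtain ⟨a, ha, ha'⟩ := Set.exists_min_image U id hfin hU.nonempty
  obtain ⟨b, hb, hb'⟩ := Set.exists_max_image U id hfin hU.nonempty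
  have : U = Set.Icc a b := by
    ext y
    refine ⟨fun hy => ⟨ha' y hy, hb' y hy⟩, fun ⟨h1, h2⟩ => ?_⟩
    rcases h1.eq_or_lt with rfl | h1
    · exact ha
    rcases h2.eq_or_lt with rfl | h2
    · exact hb
    exact hG.interval U hU a ha b hb y h1 h2
  exact ⟨a, b, ⟨ha' b hb, hU.mod.sub hb, this ▸ hU⟩, this⟩

/-- In a degenerate node, all pairs of elements of different children are symmetric, or none. -/
theorem isModuleOf_of_symmetric (hG : GoodOrder m e) {N U : Set ℕ}
    (hN : IsStrongModule e (Set.Iio m) N) (hs : HasSplit e (Set.Iio m) N) (hUN : U ⊆ N)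
    (hsat : ∀ u ∈ U, ∀ v, Together e (Set.Iio m) N u v → v ∈ U) {u₀ v₀ : ℕ} (hu₀ : u₀ ∈ N)
    (hv₀ : v₀ ∈ N) (hT : ¬ Together e (Set.Iio m) N u₀ v₀) (he : e u₀ v₀ = e v₀ u₀) :
    IsModuleOf e (Set.Iio m) U := by
  refine hG.hom U (hUN.trans hN.mod.sub) fun x hx hxU u hu v hv => ?_
  by_cases hxN : x ∈ N
  · obtain ⟨c, d, h1, -⟩ := degenerate_of_hasSplit hN hs
    have hcd : c = d := by rcases h1 _ hu₀ _ hv₀ hT with h | h <;> omega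
    have k1 := h1 u (hUN hu) x hxN fun h => hxU (hsat u hu x h)
    have k2 := h1 v (hUN hv) x hxN fun h => hxU (hsat v hv x h)
    omega
  · exact hN.mod.inHom x hx hxN u (hUN hu) v (hUN hv)

/-- If some pair of different children is symmetric, all are, and every union of children is a
module. Otherwise an outsider of a convex set lies on one side of it, and in a linear node the side
fixes the colour. -/
theorem isModuleOf_of_convex (hG : GoodOrder m e) {N U : Set ℕ}
    (hN : IsStrongModule e (Set.Iio m) N) (hs : HasSplit e (Set.Iio m) N) (hUN : U ⊆ N)
    (hsat : ∀ u ∈ U, ∀ v, Together e (Set.Iio m) N u v → v ∈ U)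
    (hconv : ∀ u ∈ U, ∀ w ∈ U, ∀ y, u < y → y < w → y ∈ U) : IsModuleOf e (Set.Iio m) U := by
  by_cases hsym : ∃ u ∈ N, ∃ v ∈ N, ¬ Together e (Set.Iio m) N u v ∧ e u v = e v u
  · obtain ⟨u, hu, v, hv, hT, he⟩ := hsym
    exact hG.isModuleOf_of_symmetric hN hs hUN hsat hu hv hT he
  push Not at hsym
  refine hG.hom U (hUN.trans hN.mod.sub) fun x hx hxU u hu v hv => ?_
  by_cases hxN : x ∈ N
  · have k1 : ¬ Together e (Set.Iio m) N u x := fun h => hxU (hsat u hu x h)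
    have k2 : ¬ Together e (Set.Iio m) N v x := fun h => hxU (hsat v hv x h)
    have l1 := hG.linear N hN hs u (hUN hu) x hxN k1 (hsym u (hUN hu) x hxN k1)
    have l2 := hG.linear N hN hs v (hUN hv) x hxN k2 (hsym v (hUN hv) x hxN k2)
    have o1 := hG.le_one u (hN.mod.sub (hUN hu)) x hx
    have o2 := hG.le_one v (hN.mod.sub (hUN hv)) x hx
    have n1 : u ≠ x := by rintro rfl; exact hxU hu
    have n2 : v ≠ x := by rintro rfl; exact hxU hv
    have huv : u < x ↔ v < x := by
      constructor
      · intro h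
        by_contra h'
        exact hxU (hconv u hu v hv x h (by omega))
      · intro h
        by_contra h'
        exact hxU (hconv v hv u hu x h (by omega))
    omega
  · exact hN.mod.inHom x hx hxN u (hUN hu) v (hUN hv)

/-- The modules of a linear node are convex. -/
theorem convex_of_isModuleOf (hG : GoodOrder m e) {N U : Set ℕ}
    (hN : IsStrongModule e (Set.Iio m) N) (hs : HasSplit e (Set.Iio m) N) (hUN : U ⊆ N)
    (hU : IsModuleOf e (Set.Iio m) U)
    (hsat : ∀ u ∈ U, ∀ v, Together e (Set.Iio m) N u v → v ∈ U) {u₀ v₀ : ℕ} (hu₀ : u₀ ∈ N)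
    (hv₀ : v₀ ∈ N) (hT : ¬ Together e (Set.Iio m) N u₀ v₀) (he : e u₀ v₀ ≠ e v₀ u₀) :
    ∀ u ∈ U, ∀ w ∈ U, ∀ y, u < y → y < w → y ∈ U := by
  intro u hu w hw y huy hyw
  by_contra hy
  have hyN := hG.interval N hN u (hUN hu) w (hUN hw) y huy hyw
  have k1 : ¬ Together e (Set.Iio m) N u y := fun h => hy (hsat u hu y h)
  have k2 : ¬ Together e (Set.Iio m) N w y := fun h => hy (hsat w hw y h)
  obtain ⟨c, d, h1, -⟩ := degenerate_of_hasSplit hN hs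
  have h0 := h1 u₀ hu₀ v₀ hv₀ hT
  have e1 := h1 u (hUN hu) y hyN k1
  have e2 := h1 w (hUN hw) y hyN k2
  have l1 := hG.linear N hN hs u (hUN hu) y hyN k1 (by omega)
  have l2 := hG.linear N hN hs w (hUN hw) y hyN k2 (by omega)
  have := hU.inHom y (hN.mod.sub hyN) hy u hu w hw
  omega

/-- Every module is strong, or a union of children of a degenerate node. -/
theorem exists_node (hm : 0 < m) {U : Set ℕ} (hU : IsModuleOf e (Set.Iio m) U)
    (hne : U.Nonempty) : IsStrongModule e (Set.Iio m) U ∨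
      ∃ N, IsStrongModule e (Set.Iio m) N ∧ HasSplit e (Set.Iio m) N ∧ U ⊂ N ∧
        (∀ u ∈ U, ∀ v, Together e (Set.Iio m) N u v → v ∈ U) := by
  have hfin : {M | IsStrongModule e (Set.Iio m) M ∧ U ⊆ M}.Finite :=
    (Set.finite_Iio m).finite_subsets.subset fun M hM => hM.1.mod.sub
  -- The least strong module around `U`. If it is larger than `U`, no child of it contains `U`,
  -- which forces it to split.
  obtain ⟨N, hN⟩ := hfin.exists_minimal ⟨Set.Iio m, .univ ⟨0, hm⟩, hU.sub⟩
  by_cases hUN : U = N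
  · exact .inl (hUN ▸ hN.prop.1)
  have hss := hN.prop.2.ssubset_of_ne hUN
  have hnot : ¬ ∃ C, IsStrongModule e (Set.Iio m) C ∧ C ⊂ N ∧ U ⊆ C := by
    rintro ⟨C, h1, h2, h3⟩
    exact h2.2 (hN.le_of_le ⟨h1, h3⟩ h2.1)
  refine .inr ⟨N, hN.prop.1, ?_, hss, fun u hu v h => hU.saturated hnot hu h⟩
  by_contra hs
  exact hnot (exists_strong_of_not_hasSplit (Set.finite_Iio m) hN.prop.1 hs hU hss hne)

/-- The union of two consecutive children of a degenerate node. -/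
theorem exists_adjacent (hG : GoodOrder m e) {N : Set ℕ} (hN : IsStrongModule e (Set.Iio m) N)
    (hs : HasSplit e (Set.Iio m) N) {u : ℕ} (hu : u ∈ N) (hu' : u + 1 ∈ N)
    (hT : ¬ Together e (Set.Iio m) N u (u + 1)) : ∃ c d, c ≤ u ∧ u + 1 ≤ d ∧
      IntervalModule m e c d ∧ IsStrongModule e (Set.Iio m) (Set.Icc c u) ∧ Set.Icc c u ⊂ N ∧
      IsStrongModule e (Set.Iio m) (Set.Icc (u + 1) d) ∧ Set.Icc (u + 1) d ⊂ N := by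
  obtain ⟨C, hC, hCN, huC, hCT⟩ := exists_child (Set.finite_Iio m) hN hu (by
    rintro rfl; simp at hu')
  obtain ⟨D, hD, hDN, huD, hDT⟩ := exists_child (Set.finite_Iio m) hN hu' (by
    rintro rfl; simp at hu)
  have hC' : u + 1 ∉ C := fun h => hT ⟨C, hC, hCN, huC, h⟩
  have hD' : u ∉ D := fun h => hT ⟨D, hD, hDN, h, huD⟩
  obtain ⟨c, c', ⟨h1, h2, h3⟩, rfl⟩ := hG.exists_interval hC
  obtain ⟨d', d, ⟨k1, k2, k3⟩, rfl⟩ := hG.exists_interval hD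
  simp only [Set.mem_Icc] at huC huD hC' hD'
  obtain rfl : c' = u := by omega
  obtain rfl : d' = c' + 1 := by omega
  have huni : Set.Icc c c' ∪ Set.Icc (c' + 1) d = Set.Icc c d := by ext; simp; omega
  refine ⟨c, d, by omega, by omega, ⟨by omega, k2, ?_⟩, hC, hCN, hD, hDN⟩
  rw [← huni]
  refine hG.isModuleOf_of_convex hN hs (Set.union_subset hCN.1 hDN.1) ?_ ?_
  · rintro w (hw | hw) v hv
    · exact .inl (hCT v (Together.trans ⟨_, hC, hCN, huC, hw⟩ hv))
    · exact .inr (hDT v (Together.trans ⟨_, hD, hDN, huD, hw⟩ hv))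
  · rw [huni]
    intro x hx w hw y h1 h2
    exact ⟨hx.1.trans h1.le, h2.le.trans hw.2⟩

/-- An interval is a strong module if it is a module and overlaps no module that is an interval. -/
theorem strongInterval_iff (hG : GoodOrder m e) {a b : ℕ} : StrongInterval m e a b ↔
    IntervalModule m e a b ∧ ∀ c d, IntervalModule m e c d →
      ¬ (c < a ∧ a ≤ d ∧ d < b) ∧ ¬ (a < c ∧ c ≤ b ∧ b < d) := by
  constructor
  · rintro ⟨h1, h2, h3⟩
    refine ⟨⟨h1, h2, h3.mod⟩, fun c d ⟨k1, k2, k3⟩ => ⟨fun hcon => ?_, fun hcon => ?_⟩⟩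
    · exact h3.strong _ k3 ⟨⟨a, by simp; omega⟩, ⟨b, by simp; omega⟩, ⟨c, by simp; omega⟩⟩
    · exact h3.strong _ k3 ⟨⟨b, by simp; omega⟩, ⟨a, by simp; omega⟩, ⟨d, by simp; omega⟩⟩
  · rintro ⟨⟨h1, h2, h3⟩, hno⟩
    refine ⟨h1, h2, ?_⟩
    rcases exists_node (by omega) h3 ⟨a, le_rfl, h1⟩ with h | ⟨N, hN, hs, hss, hsat⟩
    · exact h
    by_contra hnS
    obtain ⟨p, q, -, rfl⟩ := hG.exists_interval hN
    have hpa := hss.1 ⟨le_rfl, h1⟩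
    have hbq := hss.1 ⟨h1, le_rfl⟩
    have hpq : p < a ∨ b < q := by
      by_contra hcon
      push Not at hcon
      exact hss.2 (Set.Icc_subset_Icc hcon.1 hcon.2)
    -- A non-strong module `[a, b]` is a union of children of `[p, q]`. At an end where it stops
    -- short, the two consecutive children meeting there form an interval module that overlaps it,
    -- since `[a, b]` is not a single child.
    rcases hpq with hp | hq
    · obtain ⟨a', rfl⟩ : ∃ a', a = a' + 1 := ⟨a - 1, by omega⟩
      have hT : ¬ Together e (Set.Iio m) (Set.Icc p q) a' (a' + 1) := fun h => by
        have := (hsat _ ⟨le_rfl, h1⟩ a' h.symm).1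
        omega
      obtain ⟨c, d, k1, k2, k3, -, -, k4, k5⟩ := hG.exists_adjacent hN hs
        ⟨by omega, by have := hpa.2; omega⟩ hpa hT
      have hdb : d ≤ b := (hsat (a' + 1) ⟨le_rfl, h1⟩ d
        ⟨_, k4, k5, ⟨le_rfl, k2⟩, ⟨k2, le_rfl⟩⟩).2
      have hne : d ≠ b := by rintro rfl; exact hnS k4
      exact (hno c d k3).1 ⟨by omega, k2, by omega⟩
    · have hT : ¬ Together e (Set.Iio m) (Set.Icc p q) b (b + 1) := fun h => by
        have := (hsat b ⟨h1, le_rfl⟩ _ h).2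
        omega
      obtain ⟨c, d, k1, k2, k3, k4, k5, -, -⟩ := hG.exists_adjacent hN hs hbq
        ⟨by have := hbq.1; omega, by omega⟩ hT
      have hca : a ≤ c := (hsat b ⟨h1, le_rfl⟩ c ⟨_, k4, k5, ⟨k1, le_rfl⟩, ⟨le_rfl, k1⟩⟩).1
      have hne : a ≠ c := by rintro rfl; exact hnS k4
      exact (hno c d k3).2 ⟨by omega, by omega, by omega⟩

end GoodOrder

end


/-! ### Unions of children and the types of nodes -/

theorem Tiles.append {A B : ℕ → ℕ} {a e : ℕ} {l l' : List ℕ} :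
    Tiles A B a e (l ++ l') ↔ ∃ c, Tiles A B a c l ∧ Tiles A B c e l' := by
  induction l generalizing a with
  | nil => simp [Tiles]
  | cons w l ih =>
    simp only [List.cons_append, Tiles, ih]
    constructor
    · rintro ⟨h1, h2, c, h3, h4⟩; exact ⟨c, ⟨h1, h2, h3⟩, h4⟩
    · rintro ⟨c, ⟨h1, h2, h3⟩, h4⟩; exact ⟨h1, h2, c, h3, h4⟩

theorem Tiles.eq_of_mem {A B : ℕ → ℕ} {a e i w u : ℕ} {l : List ℕ} (h : Tiles A B a e l)
    (hw : w ∈ l) (hu : u ∈ l) (hw1 : A w ≤ i) (hw2 : i ≤ B w) (hu1 : A u ≤ i) (hu2 : i ≤ B u) :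
    w = u := by
  induction l generalizing a with
  | nil => simp at hw
  | cons x l ih =>
    obtain ⟨-, -, h3⟩ := h
    rcases List.mem_cons.1 hw with rfl | hw'
    · rcases List.mem_cons.1 hu with rfl | hu'
      · rfl
      · have := h3.mem hu'; omega
    · rcases List.mem_cons.1 hu with rfl | hu'
      · have := h3.mem hw'; omega
      · exact ih h3 hw' hu'

/-- The union of the intervals of the nodes in `Q`. -/
def nodeUnion (A B : ℕ → ℕ) (Q : Set ℕ) : Set ℕ := {i | ∃ w ∈ Q, A w ≤ i ∧ i ≤ B w}

theorem Tiles.nodeUnion_eq {A B : ℕ → ℕ} {a e : ℕ} {l : List ℕ} (h : Tiles A B a e l) :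
    nodeUnion A B {w | w ∈ l} = Set.Ico a e := by
  ext i
  constructor
  · rintro ⟨w, hw, h1, h2⟩
    have := h.mem hw
    exact ⟨by omega, by omega⟩
  · rintro ⟨h1, h2⟩
    exact h.exists_mem h1 h2

/-- A convex union of consecutive intervals is the union of a segment of the list. -/
theorem Tiles.exists_segment {A B : ℕ → ℕ} {a e : ℕ} {l : List ℕ} (h : Tiles A B a e l) {U : Set ℕ}
    (hU : ∀ u ∈ U, ∀ w ∈ U, ∀ y, u < y → y < w → y ∈ U) :
    ∃ s q t, l = s ++ q ++ t ∧ ∀ w ∈ l, (A w ∈ U ↔ w ∈ q) := by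
  have hn := h.nodup
  induction l generalizing a with
  | nil => exact ⟨[], [], [], rfl, by simp⟩
  | cons x l ih =>
    obtain ⟨h1, h2, h3⟩ := h
    obtain ⟨hx, hn'⟩ := List.nodup_cons.1 hn
    obtain ⟨s, q, t, rfl, hq⟩ := ih h3 hn'
    by_cases hxU : A x ∈ U
    · rcases q with _ | ⟨y, q⟩
      · refine ⟨[], [x], s ++ t, by simp, fun w hw => ?_⟩
        rcases List.mem_cons.1 hw with rfl | hw'
        · simp [hxU]
        · have := hq w hw'
          have hwx : w ≠ x := by rintro rfl; exact hx hw'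
          simp only [List.mem_singleton, hwx]
          simpa using this
      · rcases s with _ | ⟨z, s⟩
        · refine ⟨[], x :: y :: q, t, by simp, fun w hw => ?_⟩
          rcases List.mem_cons.1 hw with rfl | hw'
          · simp [hxU]
          · have hwx : w ≠ x := by rintro rfl; exact hx hw'
            rw [hq w hw', List.mem_cons (b := x), or_iff_right hwx]
        · exfalso
          obtain ⟨k1, k2, k3⟩ := h3
          have hy : A y ∈ U := (hq y (by simp)).2 (by simp)
          have hmy := k3.mem (w := y) (by simp)
          have hz := hU _ hxU _ hy (A z) (by omega) (by omega)
          rw [hq z (by simp)] at hz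
          have hn2 : (z :: (s ++ (y :: q ++ t))).Nodup := by simpa using hn'
          rw [List.nodup_cons] at hn2
          exact hn2.1 (List.mem_append_right _ (List.mem_append_left _ hz))
    · refine ⟨x :: s, q, t, by simp, fun w hw => ?_⟩
      rcases List.mem_cons.1 hw with rfl | hw
      · simp only [hxU, false_iff]
        intro hwq
        exact hx (by simp [hwq])
      · exact hq w hw

/-- The numerical type of the node `[a, b]` whose first two children fill `[a, y]`, where the second
one starts at `x`. -/
noncomputable def intervalKind (m : ℕ) (e : ℕ → ℕ → ℕ) (a x y : ℕ) : ℕ :=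
  open Classical in if IntervalModule m e a y then (if e a x = e x a then 1 else 2) else 0

namespace TreeInv

variable {m : ℕ} {S : ℕ → ℕ → Prop} {K : ℕ → ℕ → ℕ → ℕ} {π : ℕ → ℕ} {N p2 : ℕ}
  {st l2 kd big cid par A B : ℕ → ℕ} {cs : ℕ → List ℕ}

/-- The children of a node are maximal. -/
theorem child_max (h : TreeInv m S S K π N p2 st l2 kd big cid par A B cs) (hL : Laminar m S)
    {u v c d : ℕ} (hv : v < N) (hu : u ∈ cs v) (hcd : S c d) (hc : c ≤ A u) (hd : B u ≤ d) :
    (c = A u ∧ d = B u) ∨ (c ≤ A v ∧ B v ≤ d) := by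
  have hmv := h.lt_of_mem hu
  have hT := h.tiles v hv hmv
  have hmu := hT.mem hu
  have cu := h.child v hv u hu
  have sv := h.node v hv (by omega)
  rcases hc.lt_or_eq with h1 | rfl
  · rcases Nat.lt_or_ge c (A v) with h2 | h2
    · have := hL.lam _ _ _ _ hcd sv h2 (by omega)
      exact .inr ⟨h2.le, this⟩
    · obtain ⟨w, hw, w1, w2⟩ := hT.exists_mem h2 (by omega)
      have cw := h.child v hv w hw
      have sw := h.node w (by omega) cw.2.1
      have hwu : B w < A u := by
        by_contra hcon
        have su := h.node u (by omega) cu.2.1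
        have hne : w ≠ u := by rintro rfl; omega
        have := cw.2.2.2 (B u)
        rcases Nat.lt_or_ge (A w) (A u) with k | k
        · have k2 := hL.lam _ _ _ _ sw su k (by omega)
          exact hne (hT.eq_of_mem hw hu (i := A u) (by omega) (by omega) le_rfl (by omega))
        · omega
      rcases w1.lt_or_eq with k | k
      · have := hL.lam _ _ _ _ sw hcd k w2
        omega
      · have := cw.2.2.2 d (k ▸ hcd)
        omega
  · rcases cu.2.2.2 d hcd with h2 | h2
    · exact .inl ⟨rfl, by omega⟩
    · exact .inr ⟨h2.1.le, h2.2⟩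

end TreeInv

namespace TreeInv

variable {m : ℕ} {e : ℕ → ℕ → ℕ} {π : ℕ → ℕ} {N p2 : ℕ}
  {st l2 kd big cid par A B : ℕ → ℕ} {cs : ℕ → List ℕ}

section

variable (h : TreeInv m (StrongInterval m e) (StrongInterval m e) (intervalKind m e) π N p2 st l2 kd
  big cid par A B cs) {v : ℕ} (hv : v < N) (hmv : m < v)

include h hv hmv

theorem child_ssubset {w : ℕ} (hw : w ∈ cs v) :
    Set.Icc (A w) (B w) ⊂ Set.Icc (A v) (B v) := by
  have hT := (h.tiles v hv hmv).mem hw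
  have hc := h.child v hv w hw
  refine (Set.Icc_subset_Icc hT.1 (by omega)).ssubset_of_ne fun he => ?_
  have h1 : A v ∈ Set.Icc (A w) (B w) := by rw [he]; exact ⟨le_rfl, by omega⟩
  have h2 : B v ∈ Set.Icc (A w) (B w) := by rw [he]; exact ⟨by omega, le_rfl⟩
  have := h.inj v hv w (by omega) (by omega) hc.2.1 (by have := h1.1; omega)
    (by have := h2.2; omega)
  omega

theorem together_of_child {w i j : ℕ} (hw : w ∈ cs v) (hi : i ∈ Set.Icc (A w) (B w))
    (hj : j ∈ Set.Icc (A w) (B w)) : Together e (Set.Iio m) (Set.Icc (A v) (B v)) i j := by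
  have hc := h.child v hv w hw
  exact ⟨_, (h.node w (by omega) hc.2.1).2.2, h.child_ssubset hv hmv hw, hi, hj⟩

-- A strong proper submodule that meets a child is inside it or contains it; in the second case
-- maximality of children makes them equal.
omit hmv in
theorem child_of_together (hG : GoodOrder m e) {w i j : ℕ} (hw : w ∈ cs v)
    (hi : i ∈ Set.Icc (A w) (B w))
    (hT : Together e (Set.Iio m) (Set.Icc (A v) (B v)) i j) : j ∈ Set.Icc (A w) (B w) := by
  obtain ⟨C, hC, hCv, hiC, hjC⟩ := hT
  have hc := h.child v hv w hw
  have sw := h.node w (by omega) hc.2.1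
  rcases hC.nested sw.2.2.mod ⟨i, hiC, hi⟩ with h1 | h1
  · exact h1 hjC
  obtain ⟨c, d, hcd, rfl⟩ := hG.exists_interval hC
  have hm0 : 0 < m := by have := hcd.2.1; omega
  have k1 := h1 ⟨le_rfl, sw.1⟩
  have k2 := h1 ⟨sw.1, le_rfl⟩
  rcases h.child_max (strongInterval_laminar hm0) hv hw hcd k1.1 k2.2 with ⟨rfl, rfl⟩ | ⟨k3, k4⟩
  · exact hjC
  · exact absurd (Set.Icc_subset_Icc k3 k4) hCv.2

omit hmv in
theorem nodeUnion_sat (hG : GoodOrder m e) {Q : Set ℕ} (hQ : ∀ w ∈ Q, w ∈ cs v) :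
    ∀ u ∈ nodeUnion A B Q, ∀ x, Together e (Set.Iio m) (Set.Icc (A v) (B v)) u x →
      x ∈ nodeUnion A B Q := by
  rintro u ⟨w, hw, hu⟩ x hx
  exact ⟨w, hw, h.child_of_together hv hG (hQ w hw) hu hx⟩

theorem nodeUnion_subset {Q : Set ℕ} (hQ : ∀ w ∈ Q, w ∈ cs v) :
    nodeUnion A B Q ⊆ Set.Icc (A v) (B v) := by
  rintro u ⟨w, hw, hu⟩
  exact (h.child_ssubset hv hmv (hQ w hw)).1 hu

/-- The first two children decide whether a node is degenerate. -/
theorem hasSplit_iff (hG : GoodOrder m e) {x y : ℕ} {l : List ℕ} (hcs : cs v = x :: y :: l) :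
    HasSplit e (Set.Iio m) (Set.Icc (A v) (B v)) ↔ IntervalModule m e (A v) (B y) := by
  have sv := h.node v hv (by omega)
  have hm0 : 0 < m := by have := sv.2.1; omega
  have hT := h.tiles v hv hmv
  have hT' := hT
  rw [hcs] at hT
  obtain ⟨t1, t2, t3, t4, t5⟩ := hT
  have hle := t5.le
  have hxm : x ∈ cs v := by simp [hcs]
  have hym : y ∈ cs v := by simp [hcs]
  have cx := h.child v hv x hxm
  have cy := h.child v hv y hym
  have sx := h.node x (by omega) cx.2.1
  have sy := h.node y (by omega) cy.2.1
  have hlt := sv.2.1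
  constructor
  · intro hs
    refine ⟨by omega, by omega, ?_⟩
    have hU : nodeUnion A B {w | w ∈ [x, y]} = Set.Icc (A v) (B y) := by
      rw [Tiles.nodeUnion_eq (show Tiles A B (A v) (B y + 1) [x, y] from ⟨t1, t2, t3, t4, rfl⟩)]
      ext; simp
    have hsub : ∀ w ∈ ({w | w ∈ [x, y]} : Set ℕ), w ∈ cs v := by
      intro w hw
      rw [hcs]
      simp only [Set.mem_ofPred_eq, List.mem_cons] at hw ⊢
      tauto
    rw [← hU]
    refine hG.isModuleOf_of_convex sv.2.2 hs (h.nodeUnion_subset hv hmv hsub)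
      (h.nodeUnion_sat hv hG hsub) ?_
    rw [hU]
    intro u hu w hw z h1 h2
    exact ⟨hu.1.trans h1.le, h2.le.trans hw.2⟩
  · rintro ⟨-, -, hmod⟩
    -- With exactly two children the node always splits. With more, and no split, the union of the
    -- first two lies in a proper strong module, against the maximality of the first child.
    rcases l with _ | ⟨z, l⟩
    · have hBy : B y = B v := by have : B y + 1 = B v + 1 := t5; omega
      have hd : Set.Icc (A v) (B v) \ Set.Icc (A x) (B x) = Set.Icc (A y) (B y) := by
        ext; simp; omega
      refine ⟨Set.Icc (A x) (B x), sx.2.2.mod, ?_, ⟨A x, by simp; omega⟩, ?_,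
        Set.Icc_subset_Icc (by omega) (by omega)⟩
      · rw [hd]; exact sy.2.2.mod
      · rw [hd]; exact ⟨A y, by simp; omega⟩
    · have hBy : B y < B v := by
        obtain ⟨t6, t7, t8⟩ := t5
        have := t8.le
        omega
      by_contra hs
      obtain ⟨C, hC, hCv, hUC⟩ := exists_strong_of_not_hasSplit (Set.finite_Iio m) sv.2.2 hs hmod
        ((Set.Icc_subset_Icc le_rfl hBy.le).ssubset_of_ne fun he => by
          have : B v ∈ Set.Icc (A v) (B y) := by rw [he]; exact ⟨by omega, le_rfl⟩
          have := this.2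
          omega) ⟨A v, by simp; omega⟩
      obtain ⟨c, d, hcd, rfl⟩ := hG.exists_interval hC
      have k1 := hUC ⟨le_rfl, by omega⟩
      have k2 := hUC (show B y ∈ _ from ⟨by omega, le_rfl⟩)
      have k1' := k1.1
      have k2' := k2.2
      rcases h.child_max (strongInterval_laminar hm0) hv hxm hcd (by omega) (by omega) with
        ⟨rfl, rfl⟩ | ⟨k3, k4⟩
      · omega
      · exact hCv.2 (Set.Icc_subset_Icc k3 k4)

/-- The stored type reflects the structure of the node. The starts of the first two children serve
as the pair that decides between symmetric and linear. -/
theorem kind_cases (hG : GoodOrder m e) :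
    (¬ HasSplit e (Set.Iio m) (Set.Icc (A v) (B v)) ∧ kd v = 0) ∨
    (HasSplit e (Set.Iio m) (Set.Icc (A v) (B v)) ∧ ∃ i ∈ Set.Icc (A v) (B v),
      ∃ j ∈ Set.Icc (A v) (B v), ¬ Together e (Set.Iio m) (Set.Icc (A v) (B v)) i j ∧
      ((kd v = 1 ∧ e i j = e j i) ∨ (kd v = 2 ∧ e i j ≠ e j i))) := by
  obtain ⟨x, y, l, hcs, h1, h2, h3, h4, h5, hk⟩ := h.two_tiles hv hmv
  have hsp := h.hasSplit_iff hv hmv hG hcs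
  by_cases hs : HasSplit e (Set.Iio m) (Set.Icc (A v) (B v))
  · refine .inr ⟨hs, A v, ⟨le_rfl, by omega⟩, A y, ⟨by omega, by omega⟩, fun hT => ?_, ?_⟩
    · have := (h.child_of_together hv hG (w := x) (by simp [hcs]) ⟨by omega, by omega⟩ hT).2
      omega
    · rw [hk, intervalKind, if_pos (hsp.1 hs)]
      by_cases he : e (A v) (A y) = e (A y) (A v) <;> simp [he]
  · refine .inl ⟨hs, ?_⟩
    rw [hk, intervalKind, if_neg (fun h' => hs (hsp.2 h'))]

/-- The unions of children of a complete node are modules. -/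
theorem isModuleOf_complete (hG : GoodOrder m e) (hk : kd v = 1) {Q : Set ℕ}
    (hQ : ∀ w ∈ Q, w ∈ cs v) : IsModuleOf e (Set.Iio m) (nodeUnion A B Q) := by
  have sv := h.node v hv (by omega)
  rcases h.kind_cases hv hmv hG with ⟨-, h0⟩ | ⟨hs, i, hi, j, hj, hT, h0⟩
  · omega
  · exact hG.isModuleOf_of_symmetric sv.2.2 hs (h.nodeUnion_subset hv hmv hQ)
      (h.nodeUnion_sat hv hG hQ) hi hj hT (by omega)

/-- The unions of consecutive children of a circular node are modules. -/
theorem isModuleOf_circular (hG : GoodOrder m e) (hk : kd v = 2) {s q t : List ℕ}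
    (hq : cs v = s ++ q ++ t) : IsModuleOf e (Set.Iio m) (nodeUnion A B {w | w ∈ q}) := by
  have sv := h.node v hv (by omega)
  have hQ : ∀ w ∈ ({w | w ∈ q} : Set ℕ), w ∈ cs v := by
    intro w hw
    have hw : w ∈ q := hw
    simp [hq, hw]
  have hT := h.tiles v hv hmv
  rw [hq, Tiles.append] at hT
  obtain ⟨c, hT, -⟩ := hT
  rw [Tiles.append] at hT
  obtain ⟨d, -, hT⟩ := hT
  rcases h.kind_cases hv hmv hG with ⟨-, h0⟩ | ⟨hs, -⟩
  · omega
  · refine hG.isModuleOf_of_convex sv.2.2 hs (h.nodeUnion_subset hv hmv hQ)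
      (h.nodeUnion_sat hv hG hQ) ?_
    rw [hT.nodeUnion_eq]
    intro u hu w hw z h1 h2
    exact ⟨hu.1.trans h1.le, h2.trans hw.2⟩

end

/-- Every module is described by a node. -/
theorem exists_node
    (h : TreeInv m (StrongInterval m e) (StrongInterval m e) (intervalKind m e) π N p2 st l2 kd
      big cid par A B cs) (hG : GoodOrder m e) (hm0 : 0 < m) {U : Set ℕ}
    (hU : IsModuleOf e (Set.Iio m) U) (hne : U.Nonempty) :
    (∃ w < N, w ≠ m ∧ U = Set.Icc (A w) (B w)) ∨ ∃ v < N, m < v ∧ ∃ Q : Set ℕ,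
      (∀ w ∈ Q, w ∈ cs v) ∧ Q.Nonempty ∧ U = nodeUnion A B Q ∧
      (kd v = 1 ∨ (kd v = 2 ∧ ∃ s q t, cs v = s ++ q ++ t ∧ Q = {w | w ∈ q})) := by
  rcases GoodOrder.exists_node hm0 hU hne with hS | ⟨M, hM, hs, hss, hsat⟩
  · obtain ⟨a, b, hab, rfl⟩ := hG.exists_interval hS
    obtain ⟨w, hw, hwm, rfl, rfl⟩ := h.surj a b hab
    exact .inl ⟨w, hw, hwm, rfl⟩
  right
  obtain ⟨a, b, hab, rfl⟩ := hG.exists_interval hM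
  obtain ⟨v, hv, hvm, rfl, rfl⟩ := h.surj a b hab
  obtain ⟨i, hi⟩ := hne
  have hiv := hss.1 hi
  have hmv : m < v := by
    by_contra hle
    have he := (h.leaf v hv hvm).1 (by omega)
    refine hss.2 fun j hj => ?_
    obtain rfl : j = i := by have := hj.1; have := hj.2; have := hiv.1; have := hiv.2; omega
    exact hi
  have hT := h.tiles v hv hmv
  have key : ∀ w ∈ cs v, ∀ j, A w ≤ j → j ≤ B w → (j ∈ U ↔ A w ∈ U) := by
    intro w hw j h1 h2
    constructor
    · intro hj
      exact hsat j hj _ (h.together_of_child hv hmv hw ⟨h1, h2⟩ ⟨le_rfl, h1.trans h2⟩)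
    · intro hj
      exact hsat _ hj _ (h.together_of_child hv hmv hw ⟨le_rfl, h1.trans h2⟩ ⟨h1, h2⟩)
  have hUQ : U = nodeUnion A B {w | w ∈ cs v ∧ A w ∈ U} := by
    ext j
    constructor
    · intro hj
      have hjv := hss.1 hj
      obtain ⟨w, hw, h1, h2⟩ := hT.exists_mem hjv.1 (Nat.lt_succ_of_le hjv.2)
      exact ⟨w, ⟨hw, (key w hw j h1 h2).1 hj⟩, h1, h2⟩
    · rintro ⟨w, ⟨hw, hwU⟩, h1, h2⟩
      exact (key w hw j h1 h2).2 hwU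
  refine ⟨v, hv, hmv, {w | w ∈ cs v ∧ A w ∈ U}, fun w hw => hw.1, ?_, hUQ, ?_⟩
  · rw [hUQ] at hi
    obtain ⟨w, hw, -⟩ := hi
    exact ⟨w, hw⟩
  · rcases h.kind_cases hv hmv hG with ⟨h0, -⟩ | ⟨-, i', hi', j', hj', hT', ⟨h0, -⟩ | ⟨h0, he⟩⟩
    · exact absurd hs h0
    · exact .inl h0
    · right
      have hconv := hG.convex_of_isModuleOf hM hs hss.1 hU hsat hi' hj' hT' he
      obtain ⟨s, q, t, hq, hq'⟩ := hT.exists_segment hconv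
      refine ⟨h0, s, q, t, hq, ?_⟩
      ext w
      constructor
      · rintro ⟨h1, h2⟩; exact (hq' w h1).1 h2
      · intro hw
        have hw : w ∈ q := hw
        have hwc : w ∈ cs v := by rw [hq]; simp [hw]
        exact ⟨hwc, (hq' w hwc).2 hw⟩

end TreeInv


/-! ### Circular intervals, and bipartitions as sets of leaves -/

/-- Here `p` plays the parent. A circular interval without `p` is a segment of the children, and one
with `p` is the complement of a segment. -/
theorem exists_of_prefix_rotate {α : Type*} {p : α} {l l' : List α} {k : ℕ}
    (hn : (p :: l).Nodup) (h : l' <+: (p :: l).rotate k) : ∃ s q t, l = s ++ q ++ t ∧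
      ((∀ w, w ∈ l' ↔ w ∈ q) ∨ ∀ w, w ∈ l' ↔ w ∈ p :: l ∧ w ∉ q) := by
  rw [List.rotate_eq_drop_append_take_mod] at h
  obtain ⟨X, hX⟩ : ∃ X, (p :: l).take (k % (p :: l).length) = X := ⟨_, rfl⟩
  obtain ⟨Z, hZ⟩ : ∃ Z, (p :: l).drop (k % (p :: l).length) = Z := ⟨_, rfl⟩
  have hXZ : p :: l = X ++ Z := by rw [← hX, ← hZ, List.take_append_drop]
  rw [hX, hZ] at h
  obtain ⟨t', ht⟩ := h
  have hcompl : ∀ s q t : List α, l = s ++ q ++ t → (∀ w, w ∈ l' ↔ w = p ∨ w ∈ s ∨ w ∈ t) →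
      ∃ s q t, l = s ++ q ++ t ∧
      ((∀ w, w ∈ l' ↔ w ∈ q) ∨ ∀ w, w ∈ l' ↔ w ∈ p :: l ∧ w ∉ q) := by
    rintro s q t rfl hw
    refine ⟨s, q, t, rfl, .inr fun w => ?_⟩
    rw [hw w]
    simp only [List.nodup_cons, List.nodup_append, List.mem_append] at hn
    simp only [List.mem_cons, List.mem_append]
    constructor
    · rintro (rfl | h | h)
      · exact ⟨.inl rfl, fun h' => hn.1 (.inl (.inr h'))⟩
      · exact ⟨by tauto, fun h' => hn.2.1.2.2 w h w h' rfl⟩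
      · exact ⟨by tauto, fun h' => hn.2.2.2 w (.inr h') w h rfl⟩
    · tauto
  rcases X with _ | ⟨x, X⟩
  · rw [List.append_nil] at ht
    rw [List.nil_append] at hXZ
    rw [← hXZ] at ht
    rcases l' with _ | ⟨y, l'⟩
    · exact ⟨l, [], [], by simp, .inl (by simp)⟩
    · obtain ⟨rfl, rfl⟩ := List.cons.inj ht
      exact hcompl l' t' [] (by simp) (by simp)
  · obtain ⟨rfl, rfl⟩ := List.cons.inj hXZ
    rcases List.append_eq_append_iff.1 ht with ⟨a, rfl, h2⟩ | ⟨c, rfl, h2⟩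
    · exact ⟨X, l', a, by simp, .inl fun w => Iff.rfl⟩
    · rcases c with _ | ⟨y, c⟩
      · exact ⟨X, Z, [], by simp, .inl (by simp)⟩
      · obtain ⟨rfl, rfl⟩ := List.cons.inj h2
        refine hcompl c t' Z rfl fun w => ?_
        simp only [List.mem_append, List.mem_cons]
        tauto

/-! ### Sets of leaves -/

/-- The leaves at the positions in `U`. -/
def leafSet {m : ℕ} (π : Equiv.Perm ℕ) (U : Set ℕ) : Set (Fin (m + 1)) := {x | π.symm x ∈ U}

section LeafSet

variable {m : ℕ} {π : Equiv.Perm ℕ} (hπ : ∀ i, π i < m ↔ i < m) {U U' : Set ℕ}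

include hπ

theorem last_notMem_leafSet (hU : U ⊆ Set.Iio m) : Fin.last m ∉ leafSet π U := fun h => by
  have h1 : π.symm m < m := hU h
  rw [← hπ] at h1
  simp at h1

theorem exists_leafSet {A : Set (Fin (m + 1))} (hA : Fin.last m ∉ A) :
    ∃ U ⊆ Set.Iio m, A = leafSet π U := by
  refine ⟨{i | ∃ x ∈ A, π.symm (x : Fin (m + 1)) = i}, ?_, ?_⟩
  · rintro i ⟨x, hx, rfl⟩
    have : x ≠ Fin.last m := by rintro rfl; exact hA hx
    have := Fin.val_lt_last this
    change π.symm x < m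
    rw [← hπ]
    simpa
  · ext x
    refine ⟨fun hx => ⟨x, hx, rfl⟩, ?_⟩
    rintro ⟨y, hy, h⟩
    rwa [← Fin.ext (π.symm.injective h)]

theorem leafSet_nonempty (hU : U ⊆ Set.Iio m) :
    (leafSet π U : Set (Fin (m + 1))).Nonempty ↔ U.Nonempty := by
  constructor
  · rintro ⟨x, hx⟩; exact ⟨_, hx⟩
  · rintro ⟨i, hi⟩
    have := (hπ i).2 (hU hi)
    exact ⟨⟨π i, by omega⟩, by simpa [leafSet] using hi⟩

theorem leafSet_subset (hU : U ⊆ Set.Iio m) :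
    (leafSet π U : Set (Fin (m + 1))) ⊆ leafSet π U' ↔ U ⊆ U' := by
  constructor
  · intro h i hi
    have := (hπ i).2 (hU hi)
    have := h (show (⟨π i, by omega⟩ : Fin (m + 1)) ∈ leafSet π U by simpa [leafSet] using hi)
    simpa [leafSet] using this
  · intro h x hx; exact h hx

/-- The last element lies outside both sets, so the fourth of the intersections is never empty. -/
theorem bipOverlap_leafSet (hU : U ⊆ Set.Iio m) (hU' : U' ⊆ Set.Iio m) :
    BipOverlap (leafSet π U : Set (Fin (m + 1))) (leafSet π U') ↔ SetOverlap U U' := by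
  have h1 : (leafSet π U ∩ leafSet π U' : Set (Fin (m + 1))) = leafSet π (U ∩ U') := rfl
  have h2 : (leafSet π U ∩ (leafSet π U')ᶜ : Set (Fin (m + 1))) = leafSet π (U \ U') := rfl
  have h3 : ((leafSet π U)ᶜ ∩ leafSet π U' : Set (Fin (m + 1))) = leafSet π (U' \ U) := by
    rw [Set.inter_comm]; rfl
  rw [BipOverlap, h1, h2, h3, leafSet_nonempty hπ (Set.inter_subset_left.trans hU),
    leafSet_nonempty hπ (Set.sdiff_subset.trans hU), leafSet_nonempty hπ (Set.sdiff_subset.trans hU')]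
  refine ⟨fun h => ⟨h.1, h.2.1, h.2.2.1⟩, fun h => ⟨h.1, h.2.1, h.2.2, Fin.last m,
    last_notMem_leafSet hπ hU, last_notMem_leafSet hπ hU'⟩⟩

variable {e : ℕ → ℕ → ℕ} {F : Set (Set (Fin (m + 1)))} (hcompl : ∀ A ∈ F, Aᶜ ∈ F)
  (hF : ∀ U ⊆ Set.Iio m, U.Nonempty → (leafSet π U ∈ F ↔ IsModuleOf e (Set.Iio m) U))

omit hπ in
include hcompl in
theorem IsPart.compl {A : Set (Fin (m + 1))} (h : IsPart F A) : IsPart F Aᶜ :=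
  ⟨hcompl _ h.1, h.2.2, by rw [compl_compl]; exact h.2.1⟩

include hF

theorem isPart_leafSet (hU : U ⊆ Set.Iio m) :
    IsPart F (leafSet π U) ↔ IsModuleOf e (Set.Iio m) U ∧ U.Nonempty := by
  rw [IsPart, leafSet_nonempty hπ hU]
  constructor
  · rintro ⟨h1, h2, -⟩; exact ⟨(hF U hU h2).1 h1, h2⟩
  · rintro ⟨h1, h2⟩
    exact ⟨(hF U hU h2).2 h1, h2, Fin.last m, last_notMem_leafSet hπ hU⟩

include hcompl

/-- Every competing bipartition can be represented by its part that avoids the last element, as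
overlapping does not change under complementation. -/
theorem isStrongPart_leafSet (hU : U ⊆ Set.Iio m) :
    IsStrongPart F (leafSet π U) ↔ IsStrongModule e (Set.Iio m) U := by
  rw [IsStrongPart, isPart_leafSet hπ hF hU]
  constructor
  · rintro ⟨⟨h1, h2⟩, h3⟩
    refine ⟨h1, h2, fun B hB ho => ?_⟩
    exact h3 _ ((isPart_leafSet hπ hF hB.sub).2 ⟨hB, ho.1.mono Set.inter_subset_right⟩)
      ((bipOverlap_leafSet hπ hU hB.sub).2 ho)
  · rintro ⟨h1, h2, h3⟩
    refine ⟨⟨h1, h2⟩, ?_⟩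
    have key : ∀ B, Fin.last m ∉ B → IsPart F B → ¬ BipOverlap (leafSet π U) B := by
      intro B hB hP ho
      obtain ⟨V, hV, rfl⟩ := exists_leafSet hπ hB
      exact h3 V ((isPart_leafSet hπ hF hV).1 hP).1 ((bipOverlap_leafSet hπ hU hV).1 ho)
    intro B hB ho
    by_cases hl : Fin.last m ∈ B
    · refine key Bᶜ (fun h => h hl) (hB.compl hcompl) ⟨ho.2.1, ?_, ho.2.2.2, ?_⟩
      · rw [compl_compl]; exact ho.1
      · rw [compl_compl]; exact ho.2.2.1
    · exact key B hl hB ho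

omit hπ hF in
theorem IsStrongPart.compl {A : Set (Fin (m + 1))} (h : IsStrongPart F A) : IsStrongPart F Aᶜ := by
  refine ⟨h.1.compl hcompl, fun B hB ho => h.2 B hB ?_⟩
  obtain ⟨h1, h2, h3, h4⟩ := ho
  rw [compl_compl] at h3 h4
  exact ⟨h3, h4, h1, h2⟩

end LeafSet


/-! ### The decomposition tree of a rooted tree of strong intervals -/

namespace TreeInv

variable {m : ℕ} {e : ℕ → ℕ → ℕ} {π : Equiv.Perm ℕ} {N p2 : ℕ}
  {st l2 kd big cid par A B : ℕ → ℕ} {cs : ℕ → List ℕ}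

section

variable (h : TreeInv m (StrongInterval m e) (StrongInterval m e) (intervalKind m e) π N p2 st l2 kd
  big cid par A B cs) (hm0 : 0 < m) (hroot : par (cid 0) = m) (hlast : par m = cid 0)

include h hm0 hroot hlast

theorem par_lt' {v : ℕ} (hv : v < N) : par v < N := by
  have hL := strongInterval_laminar (e := e) hm0
  have hr := h.root hL hm0
  have hgt := h.gt
  by_cases h1 : v = m
  · rw [h1, hlast]; exact hr.1
  by_cases h2 : v = cid 0
  · rw [h2, hroot]; omega
  · exact h.par_lt hL hm0 hv h1 h2

-- Parents among the inner nodes have larger numbers than their children. The tree is rooted at the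
-- leaf `m`, which therefore gets height 0.
omit hlast in
theorem height_par {v : ℕ} (hv : v < N) (hvm : v ≠ m) :
    (if par v = m then 0 else N - par v) < if v = m then 0 else N - v := by
  have hL := strongInterval_laminar (e := e) hm0
  rw [if_neg hvm]
  by_cases h2 : v = cid 0
  · rw [h2, hroot, if_pos rfl, ← h2]; omega
  · obtain ⟨u, hu, hvu, hp⟩ := h.exists_parent hL hm0 hv hvm h2
    have := (h.child u hu v hvu).1
    split_ifs <;> omega

variable {P : Fin N → Fin N} (hP : ∀ v, (P v).val = par v) {ρ : Fin N} (hρ : ρ.val = m)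

include hP hρ

omit hlast in
theorem height_lt (v : Fin N) (hv : v ≠ ρ) :
    (if (P v).val = m then 0 else N - (P v).val) < if v.val = m then 0 else N - v.val := by
  rw [hP]
  exact h.height_par hm0 hroot v.2 fun h' => hv (Fin.ext (h'.trans hρ.symm))

/-- Descent in the tree is containment of intervals. A node inside `w` other than `w` has its parent
inside `w` too, by maximality of children. -/
theorem below_iff {w u : Fin N} (hw : w ≠ ρ) :
    Below P ρ w u ↔ u.val ≠ m ∧ A w ≤ A u ∧ B u ≤ B w := by
  have hL := strongInterval_laminar (e := e) hm0
  have hwm : w.val ≠ m := fun h' => hw (Fin.ext (h'.trans hρ.symm))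
  obtain ⟨r1, r2, r3, r4⟩ := h.root hL hm0
  constructor
  · intro hb
    induction hb using Relation.ReflTransGen.head_induction_on with
    | refl => exact ⟨hwm, le_rfl, le_rfl⟩
    | @head a c hac _ ih =>
      obtain ⟨ha, rfl⟩ := hac
      rw [hP] at ih
      have ham : a.val ≠ m := fun h' => ha (Fin.ext (h'.trans hρ.symm))
      have ha0 : a.val ≠ cid 0 := fun h' => ih.1 (by rw [h', hroot])
      obtain ⟨v, hv, hav, hp⟩ := h.exists_parent hL hm0 a.2 ham ha0
      have := (h.tiles v hv (h.lt_of_mem hav)).mem hav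
      rw [hp] at ih
      exact ⟨ham, by omega, by omega⟩
  · induction hn : (if u.val = m then 0 else N - u.val) using Nat.strong_induction_on generalizing u
      with
    | _ n ih =>
      rintro ⟨hum, h1, h2⟩
      by_cases huw : u = w
      · subst huw; exact Relation.ReflTransGen.refl
      have huw' : u.val ≠ w.val := fun h' => huw (Fin.ext h')
      have huρ : u ≠ ρ := fun h' => hum (by rw [h', hρ])
      have sw := h.node w w.2 hwm
      have hu0 : u.val ≠ cid 0 := fun h' => by
        have := (hL.lt _ _ sw).2
        rw [h'] at h1 h2
        exact huw' (h.inj u u.2 w w.2 hum hwm (by rw [h']; omega) (by rw [h']; omega))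
      obtain ⟨v, hv, huv, hp⟩ := h.exists_parent hL hm0 u.2 hum hu0
      have hmv := h.lt_of_mem huv
      rcases h.child_max hL hv huv sw h1 h2 with h3 | h3
      · exact absurd (h.inj w w.2 u u.2 hwm hum h3.1 h3.2).symm huw'
      · refine Below.step huρ (ih _ (hn ▸ h.height_lt hm0 hroot hP hρ u huρ) rfl ?_)
        rw [hP, hp]
        exact ⟨by omega, h3.1, h3.2⟩

omit hm0 hroot hlast hP hρ in
/-- The interval of a leaf. -/
theorem leaf_pos (hπ : ∀ i, π i < m ↔ i < m) {x : ℕ} (hx : x < m) :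
    A x = π.symm x ∧ B x = π.symm x := by
  have h1 : π.symm x < m := by rw [← hπ]; simpa
  have := h.leafA _ h1
  simpa using this.2

/-- An edge separates the leaves whose positions lie in the interval of its lower end from all
others, leaf `m` among them. -/
theorem branch_eq (hπ : ∀ i, π i < m ↔ i < m) (hmN : m + 1 ≤ N) {w : Fin N} (hw : w ≠ ρ) :
    branch (parentGraph P ρ) (Fin.castLE hmN) (P w) w = leafSet π (Set.Icc (A w) (B w)) ∧
    branch (parentGraph P ρ) (Fin.castLE hmN) w (P w) = (leafSet π (Set.Icc (A w) (B w)))ᶜ := by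
  have hwm : w.val ≠ m := fun h' => hw (Fin.ext (h'.trans hρ.symm))
  have hset : {x | Below P ρ w (Fin.castLE hmN x)} = leafSet π (Set.Icc (A w) (B w)) := by
    ext x
    simp only [Set.mem_ofPred_eq]
    rw [h.below_iff hm0 hroot hlast hP hρ hw]
    have hB := (h.node w w.2 hwm).2.1
    by_cases hx : x.val = m
    · have : ¬ π.symm m < m := by rw [← hπ]; simp
      simp only [Fin.val_castLE, leafSet, Set.mem_Icc, hx, Set.mem_ofPred_eq]
      omega
    · obtain ⟨h1, h2⟩ := h.leaf_pos hπ (x := x) (by omega)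
      simp only [Fin.val_castLE, h1, h2, leafSet, Set.mem_Icc, Set.mem_ofPred_eq]
      omega
  have hh := h.height_lt hm0 hroot hP hρ
  exact ⟨by rw [branch_child (ht := fun v => if v.val = m then 0 else N - v.val) hh _ hw, hset],
    by rw [branch_par (ht := fun v => if v.val = m then 0 else N - v.val) hh _ hw, hset]⟩

theorem adj_iff {v w : Fin N} :
    (parentGraph P ρ).Adj v w ↔ (v ≠ ρ ∧ P v = w) ∨ (w ≠ ρ ∧ P w = v) :=
  parentGraph_adj (ht := fun v => if v.val = m then 0 else N - v.val)
    (h.height_lt hm0 hroot hP hρ)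

variable {C : Fin N → List (Fin N)} (hC : ∀ v, (C v).map Fin.val = cs v)

include hC

omit h hm0 hroot hlast hP hρ in
theorem mem_children {v w : Fin N} : w ∈ C v ↔ w.val ∈ cs v := by
  rw [← hC, List.mem_map_of_injective Fin.val_injective]

theorem mem_order_iff {v w : Fin N} : w ∈ P v :: C v ↔ (parentGraph P ρ).Adj v w := by
  have hL := strongInterval_laminar (e := e) hm0
  rw [h.adj_iff hm0 hroot hlast hP hρ, List.mem_cons, mem_children hC]
  have hval : ∀ u : Fin N, u = ρ ↔ u.val = m := fun u =>
    ⟨fun h' => by rw [h', hρ], fun h' => Fin.ext (h'.trans hρ.symm)⟩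
  obtain ⟨r1, r2, r3, r4⟩ := h.root hL hm0
  constructor
  · rintro (rfl | hw)
    · by_cases hv : v = ρ
      · right
        have hPv : (P v).val = cid 0 := by rw [hP, hv, hρ, hlast]
        refine ⟨fun h' => r2 (by rw [← hPv, h', hρ]), Fin.ext ?_⟩
        rw [hP, hPv, hroot, hv, hρ]
      · exact .inl ⟨hv, rfl⟩
    · obtain ⟨c1, c2, c3, -⟩ := h.child v v.2 w hw
      exact .inr ⟨fun h' => c2 (by rw [h', hρ]), Fin.ext (by rw [hP, c3])⟩
  · rintro (⟨hv, rfl⟩ | ⟨hw, rfl⟩)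
    · exact .inl rfl
    · rw [ne_eq, hval] at hw
      by_cases hw0 : w.val = cid 0
      · left
        refine Fin.ext ?_
        rw [hP, hP, hw0, hroot, hlast]
      · obtain ⟨u, hu, hwu, hp⟩ := h.exists_parent hL hm0 w.2 hw hw0
        right
        rw [hP, hp]
        exact hwu

omit hρ hlast in
theorem order_nodup' (v : Fin N) : (P v :: C v).Nodup := by
  have hL := strongInterval_laminar (e := e) hm0
  refine List.nodup_cons.2 ⟨fun hp => ?_, ?_⟩
  · rw [mem_children hC, hP] at hp
    have hmv := h.lt_of_mem hp
    obtain ⟨c1, c2, c3, -⟩ := h.child v v.2 _ hp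
    by_cases hv0 : v.val = cid 0
    · rw [hv0, hroot] at c2; exact c2 rfl
    · obtain ⟨u, hu, hvu, hpu⟩ := h.exists_parent hL hm0 v.2 (by omega) hv0
      have := (h.child u hu _ hvu).1
      omega
  · have : ((C v).map Fin.val).Nodup := by
      rw [hC]
      by_cases hmv : m < v.val
      · exact (h.tiles v v.2 hmv).nodup
      · rw [h.nil v (by omega)]; exact List.nodup_nil
    exact this.of_map _

/-- The leaves below some of the children of a node, and the other leaves. -/
theorem iUnion_branch (hπ : ∀ i, π i < m ↔ i < m) (hmN : m + 1 ≤ N)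
    {v : Fin N} (hmv : m < v.val) {Q : Set (Fin N)} (hQ : ∀ w ∈ Q, w ∈ C v) :
    (⋃ w ∈ Q, branch (parentGraph P ρ) (Fin.castLE hmN) v w) =
        leafSet π (nodeUnion A B (Fin.val '' Q)) ∧
      (⋃ w ∈ {w | w ∈ P v :: C v ∧ w ∉ Q}, branch (parentGraph P ρ) (Fin.castLE hmN) v w) =
        (leafSet π (nodeUnion A B (Fin.val '' Q)))ᶜ := by
  have hT := h.tiles v v.2 hmv
  have hvρ : v ≠ ρ := fun h' => by rw [h', hρ] at hmv; omega
  have hchild : ∀ w ∈ C v, branch (parentGraph P ρ) (Fin.castLE hmN) v w =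
      leafSet π (Set.Icc (A w) (B w)) := by
    intro w hw
    rw [mem_children hC] at hw
    obtain ⟨c1, c2, c3, -⟩ := h.child v v.2 w hw
    have hPw : P w = v := Fin.ext (by rw [hP, c3])
    have := (h.branch_eq hm0 hroot hlast hP hρ hπ hmN (w := w)
      fun h' => c2 (by rw [h', hρ])).1
    rwa [hPw] at this
  have hparent := (h.branch_eq hm0 hroot hlast hP hρ hπ hmN hvρ).2
  have hmem : ∀ x : Fin (m + 1), x ∈ leafSet π (nodeUnion A B (Fin.val '' Q)) ↔
      ∃ w ∈ Q, x ∈ leafSet π (Set.Icc (A w) (B w)) := by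
    intro x
    constructor
    · rintro ⟨_, ⟨w, hw, rfl⟩, h1⟩; exact ⟨w, hw, h1⟩
    · rintro ⟨w, hw, h1⟩; exact ⟨_, ⟨w, hw, rfl⟩, h1⟩
  constructor
  · ext x
    rw [hmem]
    simp only [Set.mem_iUnion]
    constructor
    · rintro ⟨w, hw, hx⟩; rw [hchild w (hQ w hw)] at hx; exact ⟨w, hw, hx⟩
    · rintro ⟨w, hw, hx⟩; refine ⟨w, hw, ?_⟩; rw [hchild w (hQ w hw)]; exact hx
  · ext x
    rw [Set.mem_compl_iff, hmem]
    simp only [Set.mem_iUnion]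
    constructor
    · rintro ⟨w, ⟨hw, hwQ⟩, hx⟩ ⟨u, hu, hxu⟩
      have huC := (mem_children hC).1 (hQ u hu)
      rcases List.mem_cons.1 hw with rfl | hw
      · rw [hparent] at hx
        have := hT.mem huC
        exact hx ⟨by have := hxu.1; omega, by have := hxu.2; omega⟩
      · rw [hchild w hw] at hx
        have := hT.eq_of_mem ((mem_children hC).1 hw) huC hx.1 hx.2 hxu.1 hxu.2
        rw [Fin.ext this] at hwQ
        exact hwQ hu
    · intro hx
      by_cases hxv : x ∈ (leafSet π (Set.Icc (A v) (B v)) : Set (Fin (m + 1)))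
      · obtain ⟨w, hw, h1, h2⟩ := hT.exists_mem hxv.1 (Nat.lt_succ_of_le hxv.2)
        have hwN := (h.child v v.2 w hw).1
        obtain ⟨w', rfl⟩ : ∃ w' : Fin N, w'.val = w := ⟨⟨w, by omega⟩, rfl⟩
        have hwC := (mem_children hC).2 hw
        refine ⟨w', ⟨List.mem_cons_of_mem _ hwC, fun hwQ => hx ⟨w', hwQ, h1, h2⟩⟩, ?_⟩
        rw [hchild w' hwC]
        exact ⟨h1, h2⟩
      · have hno : P v ∉ C v :=
          (List.nodup_cons.1 (h.order_nodup' hm0 hroot hP hC v)).1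
        refine ⟨P v, ⟨List.mem_cons_self, fun h' => hno (hQ _ h')⟩, ?_⟩
        rw [hparent]
        exact hxv

end

end TreeInv


namespace TreeInv

variable {m : ℕ} {e : ℕ → ℕ → ℕ} {π : Equiv.Perm ℕ} {N p2 : ℕ}
  {st l2 kd big cid par A B : ℕ → ℕ} {cs : ℕ → List ℕ}

section

variable (h : TreeInv m (StrongInterval m e) (StrongInterval m e) (intervalKind m e) π N p2 st l2 kd
  big cid par A B cs) (hm0 : 0 < m) (hroot : par (cid 0) = m) (hlast : par m = cid 0)
  {P : Fin N → Fin N} (hP : ∀ v, (P v).val = par v) {ρ : Fin N} (hρ : ρ.val = m)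
  {C : Fin N → List (Fin N)} (hC : ∀ v, (C v).map Fin.val = cs v)
  (hG : GoodOrder m e) (hπ : ∀ i, π i < m ↔ i < m) (hmN : m + 1 ≤ N)
  {F : Set (Set (Fin (m + 1)))} (hcompl : ∀ A ∈ F, Aᶜ ∈ F)
  (hF : ∀ U ⊆ Set.Iio m, U.Nonempty → (leafSet π U ∈ F ↔ IsModuleOf e (Set.Iio m) U))

include h hm0 hroot hlast hP hρ hπ hcompl hF

theorem isStrongPart_branch {v w : Fin N} (hvw : (parentGraph P ρ).Adj v w) :
    IsStrongPart F (branch (parentGraph P ρ) (Fin.castLE hmN) v w) := by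
  have key : ∀ u : Fin N, u ≠ ρ → IsStrongPart F (leafSet π (Set.Icc (A u) (B u))) := by
    intro u hu
    have su := h.node u u.2 fun h' => hu (Fin.ext (h'.trans hρ.symm))
    exact (isStrongPart_leafSet hπ hcompl hF su.2.2.mod.sub).2 su.2.2
  rcases (h.adj_iff hm0 hroot hlast hP hρ).1 hvw with ⟨hv, rfl⟩ | ⟨hw, rfl⟩
  · rw [(h.branch_eq hm0 hroot hlast hP hρ hπ hmN hv).2]
    exact (key v hv).compl hcompl
  · rw [(h.branch_eq hm0 hroot hlast hP hρ hπ hmN hw).1]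
    exact key w hw

-- Downward branches avoid the last leaf and upward ones contain it, so directions cannot be
-- confused; the interval then identifies the node.
omit hcompl hF in
theorem branch_injective {v w v' w' : Fin N} (hvw : (parentGraph P ρ).Adj v w)
    (hvw' : (parentGraph P ρ).Adj v' w')
    (he : branch (parentGraph P ρ) (Fin.castLE hmN) v w =
      branch (parentGraph P ρ) (Fin.castLE hmN) v' w') : v = v' ∧ w = w' := by
  have hvm : ∀ u : Fin N, u ≠ ρ → u.val ≠ m := fun u hu h' => hu (Fin.ext (h'.trans hρ.symm))
  have hsub : ∀ u : Fin N, u ≠ ρ → Set.Icc (A u) (B u) ⊆ Set.Iio m := fun u hu =>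
    (h.node u u.2 (hvm u hu)).2.2.mod.sub
  have hin : ∀ u : Fin N, u ≠ ρ → Fin.last m ∉ leafSet π (Set.Icc (A u) (B u)) := fun u hu =>
    last_notMem_leafSet hπ (hsub u hu)
  have hinj : ∀ u u' : Fin N, u ≠ ρ → u' ≠ ρ →
      (leafSet π (Set.Icc (A u) (B u)) : Set (Fin (m + 1))) = leafSet π (Set.Icc (A u') (B u')) →
      u = u' := by
    intro u u' hu hu' he
    have s := h.node u u.2 (hvm u hu)
    have s' := h.node u' u'.2 (hvm u' hu')
    have h1 := (leafSet_subset hπ (hsub u hu)).1 he.le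
    have h2 := (leafSet_subset hπ (hsub u' hu')).1 he.ge
    rw [Set.Icc_subset_Icc_iff s.1] at h1
    rw [Set.Icc_subset_Icc_iff s'.1] at h2
    exact Fin.ext (h.inj u u.2 u' u'.2 (hvm u hu) (hvm u' hu') (by omega) (by omega))
  have hb := fun u (hu : u ≠ ρ) => h.branch_eq hm0 hroot hlast hP hρ hπ hmN hu
  rcases (h.adj_iff hm0 hroot hlast hP hρ).1 hvw with ⟨hv, rfl⟩ | ⟨hw, rfl⟩ <;>
    rcases (h.adj_iff hm0 hroot hlast hP hρ).1 hvw' with ⟨hv', rfl⟩ | ⟨hw', rfl⟩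
  · rw [(hb v hv).2, (hb v' hv').2, compl_inj_iff] at he
    obtain rfl := hinj v v' hv hv' he
    exact ⟨rfl, rfl⟩
  · rw [(hb v hv).2, (hb w' hw').1] at he
    exact absurd (he ▸ hin v hv : Fin.last m ∈ _) (hin w' hw')
  · rw [(hb w hw).1, (hb v' hv').2] at he
    exact absurd (he ▸ hin v' hv' : Fin.last m ∈ _) (hin w hw)
  · rw [(hb w hw).1, (hb w' hw').1] at he
    obtain rfl := hinj w w' hw hw' he
    exact ⟨rfl, rfl⟩

include hC hG

omit hC in
theorem exists_branch_of_isStrongPart {D : Set (Fin (m + 1))} (hD : IsStrongPart F D) :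
    ∃ v w, (parentGraph P ρ).Adj v w ∧
      branch (parentGraph P ρ) (Fin.castLE hmN) v w = D := by
  have key : ∀ D : Set (Fin (m + 1)), IsStrongPart F D → Fin.last m ∉ D → ∃ w : Fin N, w ≠ ρ ∧
      D = leafSet π (Set.Icc (A w) (B w)) := by
    intro D hD hl
    obtain ⟨U, hU, rfl⟩ := exists_leafSet hπ hl
    obtain ⟨a, b, hab, rfl⟩ := hG.exists_interval ((isStrongPart_leafSet hπ hcompl hF hU).1 hD)
    obtain ⟨w, hw, hwm, rfl, rfl⟩ := h.surj a b hab
    exact ⟨⟨w, hw⟩, fun h' => hwm (by rw [← hρ, ← h']), rfl⟩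
  by_cases hl : Fin.last m ∈ D
  · obtain ⟨w, hw, he⟩ := key Dᶜ (hD.compl hcompl) fun h' => h' hl
    refine ⟨w, P w, (h.adj_iff hm0 hroot hlast hP hρ).2 (.inl ⟨hw, rfl⟩), ?_⟩
    rw [(h.branch_eq hm0 hroot hlast hP hρ hπ hmN hw).2, ← he, compl_compl]
  · obtain ⟨w, hw, rfl⟩ := key D hD hl
    exact ⟨P w, w, (h.adj_iff hm0 hroot hlast hP hρ).2 (.inr ⟨hw, rfl⟩),
      (h.branch_eq hm0 hroot hlast hP hρ hπ hmN hw).1⟩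

omit hG in
theorem isPart_iUnion (hG : GoodOrder m e) {v : Fin N} (hmv : m < v.val) {Q : Set (Fin N)}
    (hQ : ∀ w ∈ Q, w ∈ C v) (hne : Q.Nonempty)
    (hmod : IsModuleOf e (Set.Iio m) (nodeUnion A B (Fin.val '' Q))) :
    IsPart F (⋃ w ∈ Q, branch (parentGraph P ρ) (Fin.castLE hmN) v w) ∧
    IsPart F (⋃ w ∈ {w | w ∈ P v :: C v ∧ w ∉ Q},
      branch (parentGraph P ρ) (Fin.castLE hmN) v w) := by
  obtain ⟨h1, h2⟩ := h.iUnion_branch hm0 hroot hlast hP hρ hC hπ hmN hmv hQ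
  rw [h1, h2]
  have := (isPart_leafSet hπ hF hmod.sub).2 ⟨hmod, by
    obtain ⟨w, hw⟩ := hne
    have hwc := (mem_children hC).1 (hQ w hw)
    have := (h.tiles v v.2 hmv).mem hwc
    exact ⟨A w, w, ⟨w, hw, rfl⟩, le_rfl, by omega⟩⟩
  exact ⟨this, this.compl hcompl⟩

/-- If the selected neighbours include the parent, their complement consists of children. The
bipartition is the same. -/
theorem isPart_of_admissible {kind : Fin N → NodeKind} (hk : ∀ v : Fin N, kd v = WordRAM.kindCode (kind v))
    {v : Fin N} {I : Set (Fin N)} (hI : Admissible (kind v) (P v :: C v) I) :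
    IsPart F (⋃ w ∈ I, branch (parentGraph P ρ) (Fin.castLE hmN) v w) := by
  have hmv : kind v ≠ .prime → m < v.val := fun hkv => by
    by_contra hle
    have := h.kind0 v (by omega)
    rw [hk] at this
    cases hkk : kind v <;> simp_all [WordRAM.kindCode]
  rcases hI with ⟨w, hw, rfl⟩ | ⟨hkv, hne, hss⟩ | ⟨hkv, hne, hss, r, l', hl', rfl⟩
  · have := (h.isStrongPart_branch hm0 hroot hlast hP hρ hπ hmN hcompl hF
      ((h.mem_order_iff hm0 hroot hlast hP hρ hC).1 hw)).1
    simpa using this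
  · have hmv := hmv (by rw [hkv]; simp)
    have hk1 : kd v = 1 := by rw [hk, hkv]; rfl
    have hmod : ∀ Q : Set (Fin N), (∀ w ∈ Q, w ∈ C v) →
        IsModuleOf e (Set.Iio m) (nodeUnion A B (Fin.val '' Q)) := by
      intro Q hQ
      refine h.isModuleOf_complete v.2 hmv hG hk1 ?_
      rintro _ ⟨w, hw, rfl⟩
      exact (mem_children hC).1 (hQ w hw)
    by_cases hp : P v ∈ I
    · have hQ : ∀ w ∈ {w | w ∈ P v :: C v ∧ w ∉ I}, w ∈ C v := by
        rintro w ⟨h1, h2⟩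
        rcases List.mem_cons.1 h1 with rfl | h1
        · exact absurd hp h2
        · exact h1
      have := (h.isPart_iUnion hm0 hroot hlast hP hρ hC hπ hmN hcompl hF hG hmv hQ
        (Set.nonempty_of_ssubset hss) (hmod _ hQ)).2
      have hII : {w | w ∈ P v :: C v ∧ w ∉ {w | w ∈ P v :: C v ∧ w ∉ I}} = I := by
        ext w
        have := @hss.1 w
        simp only [Set.mem_ofPred_eq] at this ⊢
        tauto
      rwa [hII] at this
    · have hQ : ∀ w ∈ I, w ∈ C v := by
        intro w hw
        rcases List.mem_cons.1 (hss.1 hw) with rfl | h1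
        · exact absurd hw hp
        · exact h1
      exact (h.isPart_iUnion hm0 hroot hlast hP hρ hC hπ hmN hcompl hF hG hmv hQ hne (hmod _ hQ)).1
  · have hmv := hmv (by rw [hkv]; simp)
    have hk2 : kd v = 2 := by rw [hk, hkv]; rfl
    obtain ⟨s, q, t, hq, hor⟩ :=
      exists_of_prefix_rotate (h.order_nodup' hm0 hroot hP hC v) hl'
    have hQ : ∀ w ∈ ({w | w ∈ q} : Set (Fin N)), w ∈ C v := by
      intro w hw
      have hw : w ∈ q := hw
      rw [hq]; simp [hw]
    have hmod : IsModuleOf e (Set.Iio m) (nodeUnion A B (Fin.val '' {w | w ∈ q})) := by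
      have himg : Fin.val '' ({w | w ∈ q} : Set (Fin N)) = {w | w ∈ q.map Fin.val} := by
        ext; simp
      rw [himg]
      refine h.isModuleOf_circular (s := s.map Fin.val) (t := t.map Fin.val) v.2 hmv hG hk2 ?_
      rw [← hC, hq, List.map_append, List.map_append]
    rcases hor with hor | hor
    · have he : ({w | w ∈ l'} : Set (Fin N)) = {w | w ∈ q} := by ext w; exact hor w
      rw [he] at hne ⊢
      exact (h.isPart_iUnion hm0 hroot hlast hP hρ hC hπ hmN hcompl hF hG hmv hQ hne hmod).1
    · have he : ({w | w ∈ l'} : Set (Fin N)) = {w | w ∈ P v :: C v ∧ w ∉ {w | w ∈ q}} := by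
        ext w; exact hor w
      rw [he] at hss ⊢
      refine (h.isPart_iUnion hm0 hroot hlast hP hρ hC hπ hmN hcompl hF hG hmv hQ ?_ hmod).2
      obtain ⟨w, hw, hw'⟩ := Set.exists_of_ssubset hss
      exact ⟨w, by_contra fun h' => hw' ⟨hw, h'⟩⟩

-- Both parts of each bipartition must occur: a union of children gives one, and the remaining
-- neighbours with the parent give the other.
omit hcompl hF in
theorem exists_admissible {kind : Fin N → NodeKind} (hk : ∀ v : Fin N, kd v = WordRAM.kindCode (kind v))
    {U : Set ℕ} (hU : IsModuleOf e (Set.Iio m) U) (hne : U.Nonempty) :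
    (∃ v I, Admissible (kind v) (P v :: C v) I ∧
      leafSet π U = ⋃ w ∈ I, branch (parentGraph P ρ) (Fin.castLE hmN) v w) ∧
    ∃ v I, Admissible (kind v) (P v :: C v) I ∧
      (leafSet π U)ᶜ = ⋃ w ∈ I, branch (parentGraph P ρ) (Fin.castLE hmN) v w := by
  rcases h.exists_node hG hm0 hU hne with ⟨w, hw, hwm, rfl⟩ | ⟨v, hv, hmv, Q', hQ', hQne, rfl, hkv⟩
  · obtain ⟨w, rfl⟩ : ∃ w' : Fin N, w'.val = w := ⟨⟨w, hw⟩, rfl⟩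
    have hwρ : w ≠ ρ := fun h' => hwm (by rw [h', hρ])
    have hb := h.branch_eq hm0 hroot hlast hP hρ hπ hmN hwρ
    refine ⟨⟨P w, {w}, .inl ⟨w, ?_, rfl⟩, by simp [hb.1]⟩,
      ⟨w, {P w}, .inl ⟨P w, by simp, rfl⟩, by simp [hb.2]⟩⟩
    exact (h.mem_order_iff hm0 hroot hlast hP hρ hC).2
      ((h.adj_iff hm0 hroot hlast hP hρ).2 (.inr ⟨hwρ, rfl⟩))
  obtain ⟨v, rfl⟩ : ∃ v' : Fin N, v'.val = v := ⟨⟨v, hv⟩, rfl⟩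
  obtain ⟨Q, rfl⟩ : ∃ Q : Set (Fin N), Q' = Fin.val '' Q := by
    refine ⟨Fin.val ⁻¹' Q', (Set.image_preimage_eq_of_subset fun w hw => ?_).symm⟩
    have := (h.child v v.2 w (hQ' w hw)).1
    exact ⟨⟨w, by omega⟩, rfl⟩
  have hQ : ∀ w ∈ Q, w ∈ C v := fun w hw => (mem_children hC).2 (hQ' _ ⟨w, hw, rfl⟩)
  have hQne : Q.Nonempty := Set.image_nonempty.1 hQne
  obtain ⟨h1, h2⟩ := h.iUnion_branch hm0 hroot hlast hP hρ hC hπ hmN hmv hQ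
  have hnd := h.order_nodup' hm0 hroot hP hC v
  have hpQ : P v ∉ Q := fun h' => (List.nodup_cons.1 hnd).1 (hQ _ h')
  have hsub1 : Q ⊂ {w | w ∈ P v :: C v} := by
    refine ⟨fun w hw => List.mem_cons_of_mem _ (hQ w hw), fun h' => ?_⟩
    exact hpQ (h' (show P v ∈ P v :: C v by simp))
  have hsub2 : {w | w ∈ P v :: C v ∧ w ∉ Q} ⊂ {w | w ∈ P v :: C v} := by
    refine ⟨fun w hw => hw.1, fun h' => ?_⟩
    obtain ⟨w, hw⟩ := hQne
    exact (h' (hsub1.1 hw)).2 hw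
  have hne2 : {w | w ∈ P v :: C v ∧ w ∉ Q}.Nonempty := ⟨P v, by simp, hpQ⟩
  suffices hsuff : Admissible (kind v) (P v :: C v) Q ∧
      Admissible (kind v) (P v :: C v) {w | w ∈ P v :: C v ∧ w ∉ Q} from
    ⟨⟨v, Q, hsuff.1, h1.symm⟩, ⟨v, _, hsuff.2, h2.symm⟩⟩
  rcases hkv with hkv | ⟨hkv, s, q, t, hq, hQq⟩
  · have hkk : kind v = .complete := by
      rw [hk] at hkv
      cases hkk : kind v <;> simp_all [WordRAM.kindCode]
    exact ⟨.inr (.inl ⟨hkk, hQne, hsub1⟩), .inr (.inl ⟨hkk, hne2, hsub2⟩)⟩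
  · have hkk : kind v = .circular := by
      rw [hk] at hkv
      cases hkk : kind v <;> simp_all [WordRAM.kindCode]
    rw [← hC, List.map_eq_append_iff] at hq
    obtain ⟨sq, t, hq, hq1, rfl⟩ := hq
    rw [List.map_eq_append_iff] at hq1
    obtain ⟨s, q, rfl, rfl, rfl⟩ := hq1
    have hQq : Q = {w | w ∈ q} := by
      ext w
      have : w.val ∈ Fin.val '' Q ↔ w.val ∈ q.map Fin.val := by rw [hQq]; rfl
      rwa [Fin.val_injective.mem_set_image, List.mem_map_of_injective Fin.val_injective] at this
    -- The parent heads the list, so skipping it and `s` brings `q` to the front; skipping `q` too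
    -- brings `t`, the parent and `s`, which is the complementary circular interval.
    refine ⟨.inr (.inr ⟨hkk, hQne, hsub1, s.length + 1, q, ?_, hQq⟩),
      .inr (.inr ⟨hkk, hne2, hsub2, s.length + 1 + q.length, t ++ P v :: s, ?_, ?_⟩)⟩
    · have : P v :: C v = (P v :: s) ++ (q ++ t) := by rw [hq]; simp
      rw [this, ← List.length_cons (a := P v), List.rotate_append_length_eq, List.append_assoc]
      exact List.prefix_append _ _
    · have : P v :: C v = (P v :: s ++ q) ++ t := by rw [hq]; simp
      have hlen : s.length + 1 + q.length = (P v :: s ++ q).length := by simp; omega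
      rw [this, hlen, List.rotate_append_length_eq]
      exact ⟨q, by simp⟩
    · ext w
      rw [hq] at hnd
      simp only [List.nodup_cons, List.nodup_append, List.mem_append] at hnd
      simp only [Set.mem_ofPred_eq, List.mem_cons, List.mem_append, hq, hQq]
      constructor
      · tauto
      · rintro (h' | rfl | h')
        · exact ⟨by tauto, fun h'' => hnd.2.2.2 w (.inr h'') w h' rfl⟩
        · exact ⟨by tauto, fun h'' => hnd.1 (.inl (.inr h''))⟩
        · exact ⟨by tauto, fun h'' => hnd.2.1.2.2 w h' w h'' rfl⟩

theorem isDecompositionTree_parentGraph {kind : Fin N → NodeKind}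
    (hk : ∀ v : Fin N, kd v = WordRAM.kindCode (kind v)) :
    IsDecompositionTree F (parentGraph P ρ) (Fin.castLE hmN) kind fun v => P v :: C v := by
  have hmem : ∀ v w, w ∈ P v :: C v ↔ (parentGraph P ρ).Adj v w := fun v w =>
    h.mem_order_iff hm0 hroot hlast hP hρ hC
  constructor
  · exact parentGraph_isTree (ht := fun v => if v.val = m then 0 else N - v.val)
      (h.height_lt hm0 hroot hP hρ)
  · exact Fin.castLE_injective hmN
  · intro v
    have hnb : (parentGraph P ρ).neighborSet v = {w | w ∈ P v :: C v} := by
      ext w; exact (hmem v w).symm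
    rw [hnb]
    have hrange : v ∈ Set.range (Fin.castLE hmN) ↔ v.val ≤ m :=
      ⟨by rintro ⟨x, rfl⟩; simp; omega, fun hv => ⟨⟨v, by omega⟩, rfl⟩⟩
    rw [hrange]
    constructor
    · intro hv
      have : C v = [] := by
        have := hC v
        rw [h.nil v hv] at this
        simpa using this
      rw [this]
      intro x hx y hy
      simp at hx hy
      rw [hx, hy]
    · intro hs
      -- An inner node has two distinct neighbours, its parent and its first child.
      by_contra hle
      obtain ⟨x, y, l, hxy, -⟩ := h.kind v v.2 (by omega)
      have hx := h.child v v.2 x (by simp [hxy])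
      have hxC : (⟨x, by omega⟩ : Fin N) ∈ C v := (mem_children hC).2 (by simp [hxy])
      have hnd := (List.nodup_cons.1 (h.order_nodup' hm0 hroot hP hC v)).1
      have := hs (show P v ∈ P v :: C v by simp) (List.mem_cons_of_mem _ hxC)
      rw [this] at hnd
      exact hnd hxC
  · intro D
    constructor
    · exact h.exists_branch_of_isStrongPart hm0 hroot hlast hP hρ hG hπ hmN hcompl hF
    · rintro ⟨v, w, hvw, rfl⟩
      exact h.isStrongPart_branch hm0 hroot hlast hP hρ hπ hmN hcompl hF hvw
  · intro v w v' w' hvw hvw' he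
    exact h.branch_injective hm0 hroot hlast hP hρ hπ hmN hvw hvw' he
  · exact h.order_nodup' hm0 hroot hP hC
  · exact hmem
  · intro D
    constructor
    · intro hD
      by_cases hl : Fin.last m ∈ D
      · have hD' := hD.compl hcompl
        obtain ⟨U, hU, he⟩ := exists_leafSet hπ (show Fin.last m ∉ Dᶜ from fun h' => h' hl)
        rw [he] at hD'
        obtain ⟨h1, h2⟩ := (isPart_leafSet hπ hF hU).1 hD'
        have := (h.exists_admissible hm0 hroot hlast hP hρ hC hG hπ hmN hk h1 h2).2
        rwa [← he, compl_compl] at this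
      · obtain ⟨U, hU, rfl⟩ := exists_leafSet hπ hl
        obtain ⟨h1, h2⟩ := (isPart_leafSet hπ hF hU).1 hD
        exact (h.exists_admissible hm0 hroot hlast hP hρ hC hG hπ hmN hk h1 h2).1
    · rintro ⟨v, I, hI, rfl⟩
      exact h.isPart_of_admissible hm0 hroot hlast hP hρ hC hG hπ hmN hcompl hF hk hI

end

/-- The output of the algorithm is the decomposition tree. -/
theorem exists_isDecompositionTree
    (h : TreeInv m (StrongInterval m e) (StrongInterval m e) (intervalKind m e) π N p2 st l2 kd
      big cid par A B cs) (hm0 : 0 < m) (hroot : par (cid 0) = m) (hlast : par m = cid 0)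
    (hG : GoodOrder m e) (hπ : ∀ i, π i < m ↔ i < m) {F : Set (Set (Fin (m + 1)))}
    (hcompl : ∀ A ∈ F, Aᶜ ∈ F)
    (hF : ∀ U ⊆ Set.Iio m, U.Nonempty → (leafSet π U ∈ F ↔ IsModuleOf e (Set.Iio m) U)) :
    ∃ (hmN : m + 1 ≤ N) (G : SimpleGraph (Fin N)) (kind : Fin N → NodeKind)
      (order : Fin N → List (Fin N)),
      IsDecompositionTree F G (Fin.castLE hmN) kind order ∧
      (∀ v, (order v).map Fin.val = par v :: cs v) ∧
      ∀ v : Fin N, kd v = WordRAM.kindCode (kind v) := by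
  have hgt := h.gt
  have hlt : ∀ v : Fin N, ∀ w ∈ cs v, w < N := fun v w hw => by
    have := (h.child v v.2 w hw).1; omega
  have hkind : ∀ v : Fin N, ∃ k, kd v = WordRAM.kindCode k := by
    intro v
    have : kd v = 0 ∨ kd v = 1 ∨ kd v = 2 := by
      by_cases hmv : m < v.val
      · rcases h.kind_cases v.2 hmv hG with h' | ⟨-, i, hi, j, hj, hT, h' | h'⟩
        · exact .inl h'.2
        · exact .inr (.inl h'.1)
        · exact .inr (.inr h'.1)
      · exact .inl (h.kind0 v (by omega))
    rcases this with h' | h' | h'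
    · exact ⟨.prime, h'⟩
    · exact ⟨.complete, h'⟩
    · exact ⟨.circular, h'⟩
  choose kind hk using hkind
  have hC : ∀ v : Fin N, ((cs v).pmap (fun w hw => (⟨w, hw⟩ : Fin N)) (hlt v)).map Fin.val =
      cs v := by
    intro v
    rw [List.map_pmap]
    simp
  refine ⟨by omega, _, kind, _, h.isDecompositionTree_parentGraph
    (P := fun v => ⟨par v, h.par_lt' hm0 hroot hlast v.2⟩) (ρ := ⟨m, hgt⟩) hm0 hroot hlast
    (fun _ => rfl) rfl hC hG hπ (by omega) hcompl hF hk, fun v => ?_, hk⟩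
  rw [List.map_cons, hC]

end TreeInv


/-! ### Umodules that avoid an element -/

namespace HomogeneousRelation

/-- Pigeonhole: three elements and at most two classes. -/
theorem PresentedBy.eq_or {X : Type*} [Fintype X] {H : HomogeneousRelation X} {C : X → X → ℕ}
    (hC : H.PresentedBy C) (hc : H.localCongruence ≤ 2) {x a b c : X} (ha : a ≠ x) (hb : b ≠ x)
    (hc' : c ≠ x) : C x a = C x b ∨ C x a = C x c ∨ C x b = C x c := by
  classical
  have h1 : Nat.card (Quotient (H x)) ≤ 2 :=
    (Finset.le_sup (f := H.congruence) (Finset.mem_univ x)).trans hc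
  have : Fintype (Quotient (H x)) := Fintype.ofFinite _
  rw [Nat.card_eq_fintype_card] at h1
  by_contra! hcon
  have key : ∀ (y z : X) (hy : y ≠ x) (hz : z ≠ x), C x y ≠ C x z →
      (Quotient.mk (H x) ⟨y, hy⟩) ≠ Quotient.mk (H x) ⟨z, hz⟩ := by
    intro y z hy hz hne he
    exact hne ((hC x y z hy hz).1 ⟨hy, hz, Quotient.exact he⟩)
  exact absurd (Fintype.two_lt_card_iff.2 ⟨_, _, _, key a b ha hb hcon.1, key a c ha hc' hcon.2.1,
    key b c hb hc' hcon.2.2⟩) (by omega)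

section

variable {m : ℕ} {H : HomogeneousRelation (Fin (m + 1))} {C : Fin (m + 1) → Fin (m + 1) → ℕ}
  {e : ℕ → ℕ → ℕ} (hC : H.PresentedBy C) (hc : H.localCongruence ≤ 2)
  (he : ∀ u x : Fin (m + 1), u ≠ Fin.last m → x ≠ Fin.last m → e u x =
    if (C u x = C u (Fin.last m) ↔ C (Fin.last m) x = C (Fin.last m) 0) then 1 else 0)

include hC in
theorem mem_umodules_iff {U : Set (Fin (m + 1))} : U ∈ H.umodules ↔
    ∀ u ∈ U, ∀ u' ∈ U, ∀ x ∉ U, ∀ x' ∉ U, (C u x = C u x' ↔ C u' x = C u' x') := by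
  have hne : ∀ u ∈ U, ∀ x ∉ U, x ≠ u := by rintro u hu x hx rfl; exact hx hu
  constructor
  · intro h u hu u' hu' x hx x' hx'
    rw [← hC u x x' (hne u hu x hx) (hne u hu x' hx'),
      ← hC u' x x' (hne u' hu' x hx) (hne u' hu' x' hx')]
    exact h u hu u' hu' x hx x' hx'
  · intro h u hu u' hu' x hx x' hx'
    rw [hC u x x' (hne u hu x hx) (hne u hu x' hx'),
      hC u' x x' (hne u' hu' x hx) (hne u' hu' x' hx')]
    exact h u hu u' hu' x hx x' hx'

theorem notMem_image {U : Set (Fin (m + 1))} (hU : Fin.last m ∉ U) :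
    Fin.val '' U ⊆ Set.Iio m := by
  rintro _ ⟨x, hx, rfl⟩
  exact Fin.val_lt_last (by rintro rfl; exact hU hx)

include hC hc he

/-- With two classes, whether `x` and `x'` are equivalent at `u` follows from comparing each of them
with the last element, so the pairs of outsiders reduce to single outsiders. -/
theorem mem_umodules_iff_inHom {U : Set (Fin (m + 1))} (hU : Fin.last m ∉ U) :
    U ∈ H.umodules ↔ InHom e (Set.Iio m) (Fin.val '' U) := by
  have hne : ∀ u ∈ U, ∀ x ∉ U, x ≠ u := by rintro u hu x hx rfl; exact hx hu
  have hl : ∀ u ∈ U, u ≠ Fin.last m := by rintro u hu rfl; exact hU hu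
  rw [mem_umodules_iff hC]
  constructor
  · rintro h x hx hxU _ ⟨u, hu, rfl⟩ _ ⟨v, hv, rfl⟩
    obtain ⟨x, rfl⟩ : ∃ x' : Fin (m + 1), x'.val = x := ⟨⟨x, Nat.lt_succ_of_lt hx⟩, rfl⟩
    have hxU' : x ∉ U := fun h' => hxU ⟨x, h', rfl⟩
    have hxl : x ≠ Fin.last m := by rintro rfl; exact lt_irrefl m hx
    rw [he u x (hl u hu) hxl, he v x (hl v hv) hxl]
    have := h u hu v hv x hxU' _ hU
    simp only [this]
  · intro h
    have key : ∀ u ∈ U, ∀ v ∈ U, ∀ x ∉ U,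
        (C u x = C u (Fin.last m) ↔ C v x = C v (Fin.last m)) := by
      intro u hu v hv x hx
      by_cases hxl : x = Fin.last m
      · simp [hxl]
      have h1 := h x (Fin.val_lt_last hxl) (by
        rintro ⟨y, hy, hyx⟩; rw [Fin.ext hyx] at hy; exact hx hy) u ⟨u, hu, rfl⟩ v ⟨v, hv, rfl⟩
      rw [he u x (hl u hu) hxl, he v x (hl v hv) hxl] at h1
      split_ifs at h1 <;> tauto
    intro u hu v hv x hx x' hx'
    have k1 := key u hu v hv x hx
    have k2 := key u hu v hv x' hx'
    have k3 := hC.eq_or hc (hne u hu x hx) (hne u hu x' hx') (hne u hu _ hU)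
    have k4 := hC.eq_or hc (hne v hv x hx) (hne v hv x' hx') (hne v hv _ hU)
    omega

/-- By self-complementation, homogeneity towards a set implies that it is a module. -/
theorem isModuleOf_of_inHom (hs : H.SelfComplemented) :
    ∀ U ⊆ Set.Iio m, InHom e (Set.Iio m) U → IsModuleOf e (Set.Iio m) U := by
  intro U hU hin
  obtain ⟨V, rfl⟩ : ∃ V : Set (Fin (m + 1)), U = Fin.val '' V := by
    refine ⟨Fin.val ⁻¹' U, (Set.image_preimage_eq_of_subset fun w hw => ?_).symm⟩
    have : w < m := hU hw
    exact ⟨⟨w, by omega⟩, rfl⟩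
  have hV : Fin.last m ∉ V := fun h' => lt_irrefl m (hU ⟨_, h', rfl⟩)
  refine ⟨hU, hin, ?_⟩
  rintro x hx hxV _ ⟨u, hu, rfl⟩ _ ⟨v, hv, rfl⟩
  have hcomp := hs _ ((mem_umodules_iff_inHom hC hc he hV).2 hin)
  rw [mem_umodules_iff hC] at hcomp
  obtain ⟨x, rfl⟩ : ∃ x' : Fin (m + 1), x'.val = x := ⟨⟨x, Nat.lt_succ_of_lt hx⟩, rfl⟩
  have hxV' : x ∉ V := fun h' => hxV ⟨x, h', rfl⟩
  have hxl : x ≠ Fin.last m := by rintro rfl; exact lt_irrefl m hx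
  have hul : u ≠ Fin.last m := by rintro rfl; exact hV hu
  have hvl : v ≠ Fin.last m := by rintro rfl; exact hV hv
  -- Both `x` and the last element lie in the complement, which is a umodule; hence they split `V`
  -- in the same way.
  have h1 := hcomp x hxV' _ hV u (fun h' => h' hu) v (fun h' => h' hv)
  have hux : u ≠ x := by rintro rfl; exact hxV' hu
  have hvx : v ≠ x := by rintro rfl; exact hxV' hv
  have h2 := hC.eq_or hc hux hvx hxl.symm
  have h0 : (0 : Fin (m + 1)) ≠ Fin.last m := by
    intro h'
    have h3 : (0 : ℕ) = m := congrArg Fin.val h'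
    have : x.val < m := hx
    omega
  have h4 := hC.eq_or hc hul hvl h0
  rw [he x u hxl hul, he x v hxl hvl]
  split_ifs <;> omega

theorem leafSet_mem_umodules (hs : H.SelfComplemented) {π : Equiv.Perm ℕ}
    (hπ : ∀ i, π i < m ↔ i < m) {U : Set ℕ} (hU : U ⊆ Set.Iio m) :
    (leafSet π U : Set (Fin (m + 1))) ∈ H.umodules ↔
      IsModuleOf (fun i j => e (π i) (π j)) (Set.Iio m) U := by
  rw [mem_umodules_iff_inHom hC hc he (last_notMem_leafSet hπ hU)]
  have h1 : Set.Iio m = π ⁻¹' Set.Iio m := by ext i; simp [hπ]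
  have h2 : U = π ⁻¹' (Fin.val '' (leafSet π U : Set (Fin (m + 1)))) := by
    ext i
    constructor
    · intro hi
      have := (hπ i).2 (hU hi)
      exact ⟨⟨π i, by omega⟩, by simpa [leafSet] using hi, rfl⟩
    · rintro ⟨x, hx, hxi⟩
      have hx : π.symm x ∈ U := hx
      rw [hxi] at hx
      simpa using hx
  have h3 : IsModuleOf (fun i j => e (π i) (π j)) (Set.Iio m) U ↔
      IsModuleOf e (Set.Iio m) (Fin.val '' (leafSet π U : Set (Fin (m + 1)))) := by
    conv_lhs => rw [h1, h2]
    exact isModuleOf_preimage π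
  rw [h3]
  exact ⟨isModuleOf_of_inHom hC hc he hs _ (notMem_image (last_notMem_leafSet hπ hU)),
    fun h => h.inHom⟩

end

end HomogeneousRelation

/-! ### Tournaments -/

namespace IsTournament

open HomogeneousRelation

variable {X : Type*} {A : X → X → Bool} (hA : IsTournament A)

include hA

/-- Between distinct vertices the arc in one direction is the negation of the other, so the outgoing
status alone presents the relation. -/
theorem arcColour_eq_iff {x y z : X} (hy : y ≠ x) (hz : z ≠ x) :
    (arcColour A x y = arcColour A x z ↔ arcColour A y x = arcColour A z x) ∧
      (arcColour A x y = arcColour A x z ↔ A x y = A x z) := by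
  have h1 := hA.2 x y hy.symm
  have h2 := hA.2 x z hz.symm
  simp only [arcColour, h1, h2]
  cases A y x <;> cases A z x <;> simp

theorem presentedBy : (standard (arcColour A)).PresentedBy (arcColour A) := by
  intro x y z hy hz
  constructor
  · rintro ⟨_, _, h⟩; exact h.1
  · intro h; exact ⟨hy, hz, h, (hA.arcColour_eq_iff hy hz).1.1 h⟩

theorem localCongruence_le [Fintype X] : (standard (arcColour A)).localCongruence ≤ 2 := by
  refine Finset.sup_le fun x _ => ?_
  have : Function.Injective (Quotient.lift (s := standard (arcColour A) x) (fun y => A x y.1)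
      fun y z h => (hA.arcColour_eq_iff y.2 z.2).2.1 h.1) := by
    intro p q
    induction p using Quotient.inductionOn with | _ y =>
    induction q using Quotient.inductionOn with | _ z =>
    intro h
    have h1 := (hA.arcColour_eq_iff y.2 z.2).2.2 h
    exact Quotient.sound ⟨h1, (hA.arcColour_eq_iff y.2 z.2).1.1 h1⟩
  simpa [congruence] using Nat.card_le_card_of_injective _ this

/-- For two elements inside and two outside, the condition says that an even number of the four arcs
point outwards. Reversing all four arcs preserves this parity, so it also holds from the side of the
complement. -/
theorem selfComplemented : (standard (arcColour A)).SelfComplemented := by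
  intro U hU u hu u' hu' x hx x' hx'
  have hx : x ∈ U := not_not.1 hx
  have hx' : x' ∈ U := not_not.1 hx'
  have hne : ∀ y ∉ U, ∀ z ∈ U, z ≠ y := by rintro y hy z hz rfl; exact hy hz
  have h := hU x hx x' hx' u hu u' hu'
  have hP := hA.presentedBy
  rw [hP x u u' (hne u hu x hx).symm (hne u' hu' x hx).symm,
    hP x' u u' (hne u hu x' hx').symm (hne u' hu' x' hx').symm,
    (hA.arcColour_eq_iff (hne u hu x hx).symm (hne u' hu' x hx).symm).2,
    (hA.arcColour_eq_iff (hne u hu x' hx').symm (hne u' hu' x' hx').symm).2,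
    hA.2 x u (hne u hu x hx), hA.2 x u' (hne u' hu' x hx), hA.2 x' u (hne u hu x' hx'),
    hA.2 x' u' (hne u' hu' x' hx')] at h
  rw [hP u x x' (hne u hu x hx) (hne u hu x' hx'), hP u' x x' (hne u' hu' x hx) (hne u' hu' x' hx'),
    (hA.arcColour_eq_iff (hne u hu x hx) (hne u hu x' hx')).2,
    (hA.arcColour_eq_iff (hne u' hu' x hx) (hne u' hu' x' hx')).2]
  revert h
  cases A u x <;> cases A u x' <;> cases A u' x <;> cases A u' x' <;> simp

end IsTournament


/-! ### Assembling the algorithm -/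

/-- An interval is a module if consecutive elements of it agree outside. -/
theorem GoodOrder.intervalModule_iff {m : ℕ} {e : ℕ → ℕ → ℕ} (hG : GoodOrder m e) {a b : ℕ}
    (hb : b < m) : IntervalModule m e a b ↔ a ≤ b ∧ ∀ i, a ≤ i → i < b →
      (∀ x < a, ¬ e i x ≠ e (i + 1) x) ∧ ∀ x, b < x → x < m → ¬ e i x ≠ e (i + 1) x := by
  constructor
  · rintro ⟨h1, h2, h3⟩
    refine ⟨h1, fun i hai hib => ⟨fun x hx => ?_, fun x hx hxm => ?_⟩⟩
    · exact not_not.2 (h3.inHom x (show x < m by omega) (by simp; omega) i (by simp; omega)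
        (i + 1) (by simp; omega))
    · exact not_not.2 (h3.inHom x hxm (by simp; omega) i (by simp; omega) (i + 1) (by simp; omega))
  · rintro ⟨h1, h2⟩
    refine ⟨h1, hb, hG.hom _ (fun i hi => lt_of_le_of_lt hi.2 hb) fun x hx hxn => ?_⟩
    have key : ∀ k, a + k ≤ b → e (a + k) x = e a x := by
      intro k
      induction k with
      | zero => intro _; rfl
      | succ k ih =>
        intro hk
        rw [← ih (by omega)]
        have := h2 (a + k) (by omega) (by omega)
        rcases Nat.lt_or_ge x a with h3 | h3
        · exact (not_not.1 (this.1 x h3)).symm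
        · exact (not_not.1 (this.2 x (by
            by_contra h4; exact hxn ⟨h3, by omega⟩) hx)).symm
    intro u hu v hv
    have h3 := key (u - a) (by have := hu.2; have := hu.1; omega)
    have h4 := key (v - a) (by have := hv.2; have := hv.1; omega)
    rw [show a + (u - a) = u by have := hu.1; omega] at h3
    rw [show a + (v - a) = v by have := hv.1; omega] at h4
    rw [h3, h4]

/-- Types are evaluated only at positions below `m`, so the type read from tables and the true one
need to agree only there. -/
theorem TreeInv.congr_kind {m : ℕ} {S D : ℕ → ℕ → Prop} {K K' : ℕ → ℕ → ℕ → ℕ} {π : ℕ → ℕ}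
    {N p2 : ℕ} {st l2 kd big cid par A B : ℕ → ℕ} {cs : ℕ → List ℕ}
    (h : TreeInv m S D K π N p2 st l2 kd big cid par A B cs) (hD : ∀ c d, D c d → c < m ∧ d < m)
    (hK : ∀ a < m, ∀ x < m, ∀ y < m, K a x y = K' a x y) :
    TreeInv m S D K' π N p2 st l2 kd big cid par A B cs := by
  refine ⟨h.node, h.inj, h.surj, h.leaf, h.leafA, h.gt, h.big, h.nil, h.tiles, h.child, h.st0,
    h.stS, h.pos, h.slots, ?_, h.kind0⟩
  intro v hv hmv
  obtain ⟨x, y, l, h1, h2, h3, h4, h5, h6, h7⟩ := h.two_tiles hv hmv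
  have := hD _ _ (h.node v hv (by omega))
  exact ⟨x, y, l, h1, by rw [h7, hK _ (by omega) _ (by omega) _ (by omega)]⟩

namespace WordRAM

/-- Compute a good order of the elements. -/
def orderAll : Cmd := .seq refineAll (.seq sccAll insertAll)

theorem orderAll_spec {W m : ℕ} {E : ℕ → ℕ} {σ : State} (hm0 : 0 < m) (hW : 2 * m + 5 ≤ W)
    (hm : σ.var 2 = m) (hE : σ.arr 4 = E) (h01 : ∀ u < m, ∀ x < m, E (u * m + x) ≤ 1)
    (hz : ∀ a, 6 ≤ a → σ.arr a = fun _ => 0) (h22 : σ.var 22 = 0)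
    (hom : ∀ U ⊆ Set.Iio m, InHom (fun u x => E (u * m + x)) (Set.Iio m) U →
      IsModuleOf (fun u x => E (u * m + x)) (Set.Iio m) U) :
    Runs W orderAll σ fun t τ => t ≤ 4000 * (m * m) + 4000 ∧
      ∃ π : Equiv.Perm ℕ, (∀ i, π i < m ↔ i < m) ∧ (∀ i < m, τ.arr 14 i = π i) ∧
        GoodOrder m fun i j => E (π i * m + π j) := by
  rw [orderAll, runs_seq]
  refine (refineAll_spec hm0 (by omega) hm hE h01 (by
    intro a ha; exact hz a (by fin_cases ha <;> simp))).frame.mono ?_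
  rintro t1 σ1 ⟨⟨ht1, q, hR⟩, hF1⟩
  have m1 : σ1.var 2 = m := by rw [hF1.var 2 rfl, hm]
  have E1 : σ1.arr 4 = E := by rw [hF1.arr 4 rfl, hE]
  rw [runs_seq]
  refine (sccAll_spec hW hm0 m1 E1 rfl rfl ?_ ?_).frame.mono ?_
  · intro v; rw [hF1.arr 10 rfl, hz 10 (by omega)]
  · rw [hF1.var 22 rfl, h22]
  rintro t2 σ2 ⟨⟨ht2, rank, hS⟩, hF2⟩
  have hmap := hR.maps
  refine (insertAll_spec hm0 (by omega) (by rw [hF2.var 2 rfl, m1]) (by rw [hF2.arr 4 rfl, E1])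
    (hF2.arr 5 rfl) (hF2.arr 9 rfl) rfl ?_ h01 hmap hS.lt hS.inj hS.surj
    fun t ht ht0 => (ord_own hR hS ht).2 ht0).mono ?_
  · intro v; rw [hF2.arr 13 rfl, hF1.arr 13 rfl, hz 13 (by omega)]
  rintro t3 σ3 ⟨ht3, pos, hP, h14⟩
  exact ⟨by omega, exists_goodOrder hR hS hP h14 hom h01⟩

/-- The entry of the relation at two positions of the order. -/
def permE (i x : Expr) : Expr :=
  .get 4 (.bin .add (.bin .mul (.get 14 i) (.var 2)) (.get 14 x))

/-- The entry of an array at two positions. -/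
def cellAt (a : ℕ) (i x : Expr) : Expr := .get a (.bin .add (.bin .mul i (.var 2)) x)

/-- Find the intervals that are modules, and those that are strong modules. -/
def windows : Cmd :=
  .seq (extremes
      -- For each `i`, the least and the greatest `x` that distinguish the positions `i` and `i +
      -- 1`. At `i = m - 1` the read beyond the end is harmless, since windows use only `i < b`.
      (.not (.bin .eq (permE (.var 41) (.var 42)) (permE (.bin .add (.var 41) (.lit 1)) (.var 42))))
      (.not (.bin .eq (permE (.var 41) (.var 42)) (permE (.bin .add (.var 41) (.lit 1)) (.var 42))))
      15 16)
    (.seq (windowAll (.lit 1) 15 16 17)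
      -- For each `i`, the least start of an interval module ending at `i` and the greatest end of
      -- one starting at `i + 1`. An interval module overlapping `[a, b]` reveals itself at such an
      -- `i`.
      (.seq (extremes (cellAt 17 (.var 42) (.var 41))
          (cellAt 17 (.bin .add (.var 41) (.lit 1)) (.var 42)) 18 19)
        (windowAll (cellAt 17 (.var 41) (.var 42)) 18 19 20)))

theorem windows_spec {W m : ℕ} {E p : ℕ → ℕ} {e : ℕ → ℕ → ℕ} {σ : State} (hm0 : 0 < m)
    (hW : m + 5 ≤ W) (hm : σ.var 2 = m) (hE : σ.arr 4 = E) (hp : σ.arr 14 = p)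
    (h17 : σ.arr 17 = fun _ => 0) (h20 : σ.arr 20 = fun _ => 0) (hG : GoodOrder m e)
    (he : ∀ i < m, ∀ x < m, E (p i * m + p x) = e i x) :
    Runs W windows σ fun t τ => t ≤ 1000 * (m * m) + 1000 ∧
      (∀ a < m, ∀ b < m, (τ.arr 17 (a * m + b) ≠ 0 ↔ IntervalModule m e a b)) ∧
      ∀ a < m, ∀ b < m, (τ.arr 20 (a * m + b) ≠ 0 ↔ StrongInterval m e a b) := by
  have hmm : m ≤ m * m := Nat.le_mul_self m
  rw [windows, runs_seq]
  refine (extremes_spec (fun i x => E (p i * m + p x) ≠ E (p (i + 1) * m + p x))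
    (fun i x => E (p i * m + p x) ≠ E (p (i + 1) * m + p x)) (by decide) hW hm hm0 ?_).frame.mono ?_
  · intro τ hF _ _
    have q : (Expr.not (.bin .eq (permE (.var 41) (.var 42))
        (permE (.bin .add (.var 41) (.lit 1)) (.var 42)))).eval τ ≠ 0 ↔
        E (p (τ.var 41) * m + p (τ.var 42)) ≠ E (p (τ.var 41 + 1) * m + p (τ.var 42)) := by
      rw [Expr.eval_not, Expr.eval_eq]
      simp only [permE, Expr.eval, BinOp.eval, hF.var 2 rfl, hF.arr 4 rfl, hF.arr 14 rfl, hm, hE, hp]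
    exact ⟨q, q⟩
  rintro t1 σ1 ⟨⟨ht1, h1⟩, hF1⟩
  have m1 : σ1.var 2 = m := by rw [hF1.var 2 rfl, hm]
  rw [runs_seq]
  refine (windowAll_spec (fun _ _ => True) (by decide) (by decide) hW m1 (fun i hi => (h1 i hi).1.1)
    (fun i hi => (h1 i hi).2.1) (fun i => by rw [hF1.arr 17 rfl, h17]) ?_).frame.mono ?_
  · intro τ _ _ _; simp [Expr.eval]
  rintro t2 σ2 ⟨⟨ht2, h2⟩, hF2⟩
  have m2 : σ2.var 2 = m := by rw [hF2.var 2 rfl, m1]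
  have hT : ∀ a < m, ∀ b < m, (σ2.arr 17 (a * m + b) ≠ 0 ↔ IntervalModule m e a b) := by
    intro a ha b hb
    rw [h2 a ha b hb, hG.intervalModule_iff hb, true_and]
    refine and_congr_right fun hab => forall_congr' fun i => forall_congr' fun hai =>
      forall_congr' fun hib => ?_
    rw [(h1 i (by omega)).1.2 a (by omega), (h1 i (by omega)).2.2 b]
    have hP : ∀ x < m, (E (p i * m + p x) ≠ E (p (i + 1) * m + p x) ↔ e i x ≠ e (i + 1) x) := by
      intro x hx
      rw [he i (by omega) x hx, he (i + 1) (by omega) x hx]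
    constructor
    · rintro ⟨k1, k2⟩
      exact ⟨fun x hx => by rw [← hP x (by omega)]; exact k1 x hx,
        fun x hx hxm => by rw [← hP x hxm]; exact k2 x hx hxm⟩
    · rintro ⟨k1, k2⟩
      exact ⟨fun x hx => by rw [hP x (by omega)]; exact k1 x hx,
        fun x hx hxm => by rw [hP x hxm]; exact k2 x hx hxm⟩
  rw [runs_seq]
  refine (extremes_spec (fun i x => σ2.arr 17 (x * m + i) ≠ 0)
    (fun i x => σ2.arr 17 ((i + 1) * m + x) ≠ 0) (by decide) hW m2 hm0 ?_).frame.mono ?_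
  · intro τ hF _ _
    constructor <;> simp only [cellAt, Expr.eval, BinOp.eval, hF.var 2 rfl, hF.arr 17 rfl, m2]
  rintro t3 σ3 ⟨⟨ht3, h3⟩, hF3⟩
  have m3 : σ3.var 2 = m := by rw [hF3.var 2 rfl, m2]
  refine (windowAll_spec (fun a b => σ2.arr 17 (a * m + b) ≠ 0) (by decide) (by decide) hW m3
    (fun i hi => (h3 i hi).1.1) (fun i hi => (h3 i hi).2.1)
    (fun i => by rw [hF3.arr 20 rfl, hF2.arr 20 rfl, hF1.arr 20 rfl, h20]) ?_).frame.mono ?_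
  · intro τ hF _ _
    simp only [cellAt, Expr.eval, BinOp.eval, hF.var 2 rfl, hF.arr 17 rfl, m3, hF3.arr 17 rfl]
  rintro t4 σ4 ⟨⟨ht4, h4⟩, hF4⟩
  refine ⟨?_, ?_, ?_⟩
  · simp only [Expr.cost, Expr.not, permE, cellAt] at ht1 ht2 ht3 ht4
    ring_nf at ht1 ht2 ht3 ht4
    rw [pow_two] at ht1 ht2 ht3 ht4
    omega
  · intro a ha b hb
    rw [hF4.arr 17 rfl, hF3.arr 17 rfl]
    exact hT a ha b hb
  · intro a ha b hb
    rw [h4 a ha b hb, hG.strongInterval_iff, hT a ha b hb]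
    constructor
    · rintro ⟨hab, hM, hi⟩
      refine ⟨hM, fun c d hcd => ⟨fun hc => ?_, fun hc => ?_⟩⟩
      · have hd := (h3 d (by omega)).1.2 a (by omega)
        have := hd.1 (hi d hc.2.1 hc.2.2).1 c hc.1
        exact this ((hT c (by omega) d (by omega)).2 hcd)
      · have hd := (h3 (c - 1) (by omega)).2.2 b
        have hdm := hcd.2.1
        have := hd.1 (hi (c - 1) (by omega) (by omega)).2 d hc.2.2 hdm
        rw [show c - 1 + 1 = c by omega] at this
        exact this ((hT c (by omega) d hdm).2 hcd)
    · rintro ⟨hM, hno⟩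
      refine ⟨hM.1, hM, fun i hai hib => ⟨?_, ?_⟩⟩
      · rw [(h3 i (by omega)).1.2 a (by omega)]
        intro x hx hxi
        exact (hno x i ((hT x (by omega) i (by omega)).1 hxi)).1 ⟨hx, hai, hib⟩
      · rw [(h3 i (by omega)).2.2 b]
        intro x hx hxm hxi
        exact (hno (i + 1) x ((hT (i + 1) (by omega) x hxm).1 hxi)).2 ⟨by omega, by omega, hx⟩

end WordRAM


namespace WordRAM

/-- The type of the node under construction. -/
def kindExpr : Expr :=
  .bin .mul (.bool (cellAt 17 (.var 30) (.var 37))) (.bin .add (.lit 1)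
    (.not (.bin .eq (permE (.var 30) (.var 36)) (permE (.var 36) (.var 30)))))

/-- Build the tree from the tables of intervals. -/
def treeAll : Cmd :=
  .seq initTree (.seq (buildNodes (cellAt 20 (.var 30) (.var 31)) kindExpr) finishTree)

theorem treeAll_spec {W m : ℕ} {e : ℕ → ℕ → ℕ} {σ : State} (hm0 : 0 < m)
    (hW : (2 * m + 5) * (m + 5) ≤ W) (hm : σ.var 2 = m) (h3 : ∀ v, σ.arr 3 v = 0)
    (π : Equiv.Perm ℕ) (hπ : ∀ i, π i < m ↔ i < m) (h14 : ∀ i < m, σ.arr 14 i = π i)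
    (he : ∀ i < m, ∀ x < m, σ.arr 4 (σ.arr 14 i * m + σ.arr 14 x) = e i x)
    (h17 : ∀ a < m, ∀ b < m, (σ.arr 17 (a * m + b) ≠ 0 ↔ IntervalModule m e a b))
    (h20 : ∀ a < m, ∀ b < m, (σ.arr 20 (a * m + b) ≠ 0 ↔ StrongInterval m e a b)) :
    Runs W treeAll σ fun t τ => t ≤ 2000 * (m * m) + 2000 ∧ ∃ p2 l2 big cid par A B cs,
      TreeInv m (StrongInterval m e) (StrongInterval m e) (intervalKind m e) π (τ.var 1) p2
        (τ.arr 1) l2 (τ.arr 3) big cid par A B cs ∧ par (cid 0) = m ∧ par m = cid 0 ∧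
        ∀ v < τ.var 1, ∀ i (hi : i < (par v :: cs v).length),
          τ.arr 2 (τ.arr 1 v + i) = (par v :: cs v)[i] := by
  have hL := strongInterval_laminar (e := e) hm0
  have hWb : 2 * m + 5 ≤ W := by
    have : (2 * m + 5) * (m + 5) = (2 * m + 5) * (m + 4) + (2 * m + 5) := by ring
    omega
  have hmm : m ≤ m * m := Nat.le_mul_self m
  obtain ⟨K, hK⟩ : ∃ K : ℕ → ℕ → ℕ → ℕ, K = fun a x y => if σ.arr 17 (a * m + y) ≠ 0 then
      if σ.arr 4 (σ.arr 14 a * m + σ.arr 14 x) = σ.arr 4 (σ.arr 14 x * m + σ.arr 14 a) then 1 else 2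
      else 0 := ⟨_, rfl⟩
  rw [treeAll, runs_seq]
  refine (initTree_spec (K := K) hL π hπ hm (by omega) h3 h14).frame.mono ?_
  rintro t1 σ1 ⟨⟨ht1, h1⟩, hF1⟩
  have m1 : σ1.var 2 = m := by rw [hF1.var 2 rfl, hm]
  rw [runs_seq]
  refine (buildNodes_spec hL m1 hW h1 ?_ ?_).frame.mono ?_
  · intro τ hF ha hb
    rw [← h20 _ ha _ hb]
    simp only [cellAt, Expr.eval, BinOp.eval, hF.var 2 rfl, hF.arr 20 rfl, hF1.arr 20 rfl, m1]
  · intro τ hF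
    have hv : kindExpr.eval τ = K (τ.var 30) (τ.var 36) (τ.var 37) := by
      simp only [kindExpr, cellAt, permE, Expr.bool, Expr.not, Expr.eval, BinOp.eval,
        hF.var 2 rfl, hF.arr 17 rfl, hF.arr 4 rfl, hF.arr 14 rfl, hF1.arr 17 rfl, hF1.arr 4 rfl,
        hF1.arr 14 rfl, m1, hK, Nat.pos_iff_ne_zero]
      split_ifs <;> simp_all
    refine ⟨hv, ?_⟩
    rw [hv, hK]
    simp only []
    split_ifs <;> omega
  rintro t2 σ2 ⟨⟨ht2, N, h2⟩, hF2⟩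
  refine (finishTree_spec hL hm0 (by rw [hF2.var 2 rfl, m1]) hWb h2).mono ?_
  rintro t3 σ3 ⟨ht3, hN, p2, l2, big, cid, par, A, B, cs, hI, hrest⟩
  refine ⟨?_, p2, l2, big, cid, par, A, B, cs, ?_, ?_⟩
  · simp only [cellAt, kindExpr, permE, Expr.bool, Expr.not, Expr.cost] at ht2
    ring_nf at ht1 ht2 ht3
    rw [pow_two] at ht2
    omega
  · rw [hN]
    refine hI.congr_kind (fun c d hcd => ⟨lt_of_le_of_lt hcd.1 hcd.2.1, hcd.2.1⟩) ?_
    intro a ha x hx y hy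
    rw [hK, intervalKind]
    simp only [he a ha x hx, he x hx a ha]
    by_cases hT : IntervalModule m e a y
    · rw [if_pos ((h17 a ha y hy).2 hT), if_pos hT]
    · rw [if_neg (mt (h17 a ha y hy).1 hT), if_neg hT]
  · rw [hN]; exact hrest

/-- Compute the decomposition tree. -/
def decompose : Cmd :=
  -- For a single element `m = 0`; the zeros in memory already describe the one-node tree, and only
  -- the number of nodes has to be set.
  .seq relTable (.ite (.var 2) (.seq orderAll (.seq windows treeAll)) (.assign 1 (.lit 1)))

theorem inputState_arr {m : ℕ} (C : Fin (m + 1) → Fin (m + 1) → ℕ) (u x : Fin (m + 1)) :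
    (inputState (m + 1) C).arr 0 (u * (m + 1) + x) = C u x := by
  have hlt : u.val * (m + 1) + x.val < (m + 1) * (m + 1) := by
    have : (u.val + 1) * (m + 1) ≤ (m + 1) * (m + 1) := Nat.mul_le_mul_right _ u.2
    rw [add_mul] at this
    omega
  have h1 : (u.val * (m + 1) + x.val) / (m + 1) = u.val := by
    rw [Nat.mul_comm, Nat.mul_add_div (by omega), Nat.div_eq_of_lt x.2, add_zero]
  have h2 : (u.val * (m + 1) + x.val) % (m + 1) = x.val := by
    rw [Nat.mul_comm, Nat.mul_add_mod, Nat.mod_eq_of_lt x.2]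
  simp only [inputState]
  rw [dif_pos ⟨trivial, hlt⟩]
  congr 1
  · exact Fin.ext h1
  · exact Fin.ext h2

/-- The decomposition tree of a family on one element. -/
theorem isDecompositionTree_one (F : Set (Set (Fin 1))) :
    IsDecompositionTree F (⊥ : SimpleGraph (Fin 1)) (Fin.castLE le_rfl) (fun _ => .prime)
      fun _ => [] := by
  have hno : ∀ A, ¬ IsPart F A := by
    rintro A ⟨-, ⟨x, hx⟩, ⟨y, hy⟩⟩
    rw [Subsingleton.elim y x] at hy
    exact hy hx
  constructor
  · refine ⟨⟨fun u v => ?_⟩, fun v c hc => ?_⟩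
    · rw [Subsingleton.elim u v]
    · cases c with
      | nil => exact hc.ne_nil rfl
      | cons h _ => exact h
  · exact Fin.castLE_injective _
  · intro v
    refine ⟨fun _ => Set.subsingleton_of_subsingleton, fun _ => ⟨v, rfl⟩⟩
  · intro A
    refine ⟨fun h => absurd h.1 (hno A), ?_⟩
    rintro ⟨v, w, h, -⟩; exact absurd h (by simp)
  · intro v w v' w' h; exact absurd h (by simp)
  · intro v; exact List.nodup_nil
  · intro v w; simp
  · intro A
    refine ⟨fun h => absurd h (hno A), ?_⟩
    rintro ⟨v, I, hI, -⟩
    rcases hI with ⟨w, hw, -⟩ | ⟨h, -⟩ | ⟨h, -⟩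
    · simp at hw
    · cases h
    · cases h

theorem outputsTree_of_treeInv {m : ℕ} {e : ℕ → ℕ → ℕ} {π : Equiv.Perm ℕ} {p2 : ℕ} {τ : State}
    {l2 big cid par A B : ℕ → ℕ} {cs : ℕ → List ℕ} (hm0 : 0 < m)
    (h : TreeInv m (StrongInterval m e) (StrongInterval m e) (intervalKind m e) π (τ.var 1) p2
        (τ.arr 1) l2 (τ.arr 3) big cid par A B cs)
    (hroot : par (cid 0) = m) (hlast : par m = cid 0)
    (hlist : ∀ v < τ.var 1, ∀ i (hi : i < (par v :: cs v).length),
      τ.arr 2 (τ.arr 1 v + i) = (par v :: cs v)[i])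
    (hG : GoodOrder m e) (hπ : ∀ i, π i < m ↔ i < m) {F : Set (Set (Fin (m + 1)))}
    (hcompl : ∀ A ∈ F, Aᶜ ∈ F)
    (hF : ∀ U ⊆ Set.Iio m, U.Nonempty → (leafSet π U ∈ F ↔ IsModuleOf e (Set.Iio m) U)) :
    OutputsTree F τ := by
  obtain ⟨hmN, G, kind, order, hT, ho, hk⟩ :=
    h.exists_isDecompositionTree hm0 hroot hlast hG hπ hcompl hF
  have hlen : ∀ v, (order v).length = 1 + (cs v).length := fun v => by
    rw [← List.length_map (f := Fin.val), ho, List.length_cons, add_comm]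
  refine ⟨τ.var 1, hmN, G, kind, order, hT, rfl, h.st0 0 (by omega), fun v => ?_, fun v i => ?_, hk⟩
  · rw [h.stS v v.2, hlen]; omega
  · rw [hlist v v.2 i (by have := i.2; have := hlen v; simp; omega)]
    simp only [← ho, List.getElem_map, List.get_eq_getElem]

/-- The stages add up to at most `8000 * n ^ 2 + 8000` steps, which `20000 * n ^ 2` covers for `n ≥
1`. -/
theorem computesTree_decompose {c n : ℕ} (hc : 20000 ≤ c) (hn : 0 < n)
    {H : HomogeneousRelation (Fin n)} (hloc : H.localCongruence ≤ 2) (hs : H.SelfComplemented)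
    {C : Fin n → Fin n → ℕ} (hC : H.PresentedBy C) : ComputesTree decompose c C H.umodules := by
  obtain ⟨m, rfl⟩ : ∃ m, n = m + 1 := ⟨n - 1, by omega⟩
  obtain ⟨W, hWdef⟩ : ∃ W, (m + 1 + 2) ^ c = W := ⟨_, rfl⟩
  -- Of the word size only the cube of `n + 2` is used; it exceeds all values stored, list positions
  -- included.
  have hW3 : (m + 3) * (m + 3) * (m + 3) ≤ W := by
    have : (m + 3) ^ 3 ≤ (m + 1 + 2) ^ c := Nat.pow_le_pow_right (by omega) (by omega)
    rw [← hWdef]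
    calc _ = (m + 3) ^ 3 := by ring
      _ ≤ _ := this
  have hW2 : (2 * m + 5) * (m + 5) + 2 ≤ W := by
    refine le_trans ?_ hW3
    have : (m + 3) * (m + 3) * (m + 3) =
        (2 * m + 5) * (m + 5) + 2 + (m * m * m + 7 * (m * m) + 12 * m) := by ring
    omega
  have hW1 : 2 * m + 7 ≤ W := by
    have : (2 * m + 5) * (m + 5) = (2 * m + 5) * (m + 4) + (2 * m + 5) := by ring
    omega
  rw [ComputesTree, hWdef]
  suffices hmain : Runs W decompose (inputState (m + 1) C) fun t τ =>
      t ≤ 8000 * ((m + 1) * (m + 1)) + 8000 ∧ OutputsTree H.umodules τ by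
    obtain ⟨t, τ, hE, ht, ho⟩ := hmain
    refine ⟨t, τ, hE, ht.trans ?_, ho⟩
    have h1 : 20000 * (m + 1) ^ 2 ≤ c * (m + 1) ^ 2 := Nat.mul_le_mul_right _ hc
    have h2 : (m + 1) ^ 2 = (m + 1) * (m + 1) := by ring
    have h3 : 1 ≤ (m + 1) * (m + 1) := Nat.mul_pos (by omega) (by omega)
    rw [h2] at h1 ⊢
    omega
  rw [decompose, runs_seq]
  refine (relTable_spec (n := m + 1) (by omega) rfl).frame.mono ?_
  rintro t1 σ1 ⟨⟨ht1, m1, h4⟩, hF1⟩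
  rw [Nat.add_sub_cancel] at m1 h4
  have hz : ∀ a, a ≠ 0 → a ≠ 4 → σ1.arr a = fun _ => 0 := by
    intro a ha ha4
    rw [hF1.arr a (by simp [relTable, Cmd.writesArr, writesArr_forTo]; omega)]
    funext i
    simp [inputState, ha]
  rw [runs_ite, runs_assign]
  simp only [Expr.eval, Expr.cost, m1]
  refine ⟨fun hm0 => ?_, fun hm0 => ?_⟩
  · have hm0 : 0 < m := Nat.pos_of_ne_zero hm0
    have he : ∀ u x : Fin (m + 1), u ≠ Fin.last m → x ≠ Fin.last m →
        σ1.arr 4 (u * m + x) = if (C u x = C u (Fin.last m) ↔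
          C (Fin.last m) x = C (Fin.last m) 0) then 1 else 0 := by
      intro u x hu hx
      rw [h4 u (Fin.val_lt_last hu) x (Fin.val_lt_last hx), relEntry]
      have k1 := inputState_arr C u (Fin.last m)
      have k2 := inputState_arr C (Fin.last m) x
      have k3 := inputState_arr C (Fin.last m) 0
      simp only [Fin.val_last, Fin.val_zero, add_zero] at k1 k2 k3
      rw [Nat.add_sub_cancel, inputState_arr C u x, k1, k2, k3]
    have h01 : ∀ u < m, ∀ x < m, σ1.arr 4 (u * m + x) ≤ 1 := by
      intro u hu x hx
      rw [h4 u hu x hx, relEntry]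
      split_ifs <;> omega
    rw [runs_seq]
    refine (orderAll_spec hm0 (by omega) m1 rfl h01 (fun a ha => hz a (by omega) (by omega)) ?_
      (HomogeneousRelation.isModuleOf_of_inHom (e := fun u x => σ1.arr 4 (u * m + x)) hC hloc he
        hs)).frame.mono ?_
    · rw [hF1.var 22 rfl]; rfl
    rintro t2 σ2 ⟨⟨ht2, π, hπ, h14, hG⟩, hF2⟩
    have hE : ∀ i < m, ∀ x < m, σ1.arr 4 (σ2.arr 14 i * m + σ2.arr 14 x) =
        σ1.arr 4 (π i * m + π x) := by
      intro i hi x hx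
      rw [h14 i hi, h14 x hx]
    rw [runs_seq]
    refine (windows_spec hm0 (by omega) (by rw [hF2.var 2 rfl, m1]) (hF2.arr 4 rfl) rfl
      (by rw [hF2.arr 17 rfl, hz 17 (by decide) (by decide)])
      (by rw [hF2.arr 20 rfl, hz 20 (by decide) (by decide)]) hG hE).frame.mono ?_
    rintro t3 σ3 ⟨⟨ht3, h17, h20⟩, hF3⟩
    refine (treeAll_spec hm0 (by omega) (by rw [hF3.var 2 rfl, hF2.var 2 rfl, m1]) ?_ π hπ ?_ ?_ h17
      h20).mono ?_
    · intro v; rw [hF3.arr 3 rfl, hF2.arr 3 rfl, hz 3 (by decide) (by decide)]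
    · intro i hi; rw [hF3.arr 14 rfl, h14 i hi]
    · intro i hi x hx
      rw [hF3.arr 14 rfl, hF3.arr 4 rfl, hF2.arr 4 rfl]
      exact hE i hi x hx
    rintro t4 σ4 ⟨ht4, p2, l2, big, cid, par, A, B, cs, hI, hroot, hlast, hlist⟩
    refine ⟨?_, outputsTree_of_treeInv hm0 hI hroot hlast hlist hG hπ hs fun U hU _ => ?_⟩
    · have : (m + 1) * (m + 1) = m * m + 2 * m + 1 := by ring
      omega
    · exact HomogeneousRelation.leafSet_mem_umodules
        (e := fun u x => σ1.arr 4 (u * m + x)) hC hloc he hs hπ hU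
  · subst hm0
    refine ⟨by omega, by omega, 1, le_rfl, ⊥, fun _ => .prime, fun _ => [],
      isDecompositionTree_one _, ?_, ?_, ?_, ?_, ?_⟩
    · simp
    · simp [hz 1 (by decide) (by decide)]
    · intro v; simp [hz 1 (by decide) (by decide)]
    · intro v i; exact i.elim0
    · intro v; simp [hz 3 (by decide) (by decide), kindCode]

end WordRAM

theorem mainTheorem11 :
    (∃ (P : WordRAM.Cmd) (c : ℕ), ∀ (n : ℕ) (_ : 0 < n) (H : HomogeneousRelation (Fin n))
        (_ : H.localCongruence ≤ 2) (_ : H.SelfComplemented)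
        (C : Fin n → Fin n → ℕ) (_ : ∀ x y, C x y ≤ n) (_ : H.PresentedBy C),
        WordRAM.ComputesTree P c C H.umodules) ∧
    (∃ (P : WordRAM.Cmd) (c : ℕ), ∀ (n : ℕ) (_ : 0 < n) (A : Fin n → Fin n → Bool)
        (_ : IsTournament A),
        WordRAM.ComputesTree P c (arcColour A) (bijoins A)) := by
  refine ⟨⟨WordRAM.decompose, 20000, fun n hn H hc hs C _ hC =>
    WordRAM.computesTree_decompose le_rfl hn hc hs hC⟩, WordRAM.decompose, 20000,
    fun n hn A hA => ?_⟩
  exact WordRAM.computesTree_decompose le_rfl hn hA.localCongruence_le hA.selfComplemented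
    hA.presentedBy
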